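/- **Notation.** On \(\mathbb R^7\) with dual basis \(v_0,\dots,v_6\) let \(\phi(\theta)=(v_{12}+v_{34}+v_{56})\wedge v_0+\cos\theta\,(v_{246}-v_{235}-v_{145}-v_{136})+\sin\theta\,(v_{135}-v_{146}-v_{236}-v_{245})\). A \(G_2\)-structure on a 7-manifold \(M\) is a three-form \(\phi\) such that at each point \(\phi=\phi(\theta)\) for some \(\theta\) in some basis of the tangent space; that basis is declared orthonormal, with \(v_{0123456}>0\), which determines the metric \(g\) and the Hodge star of \(\phi\). The structure is cosymplectic if \(d{*}\phi=0\). An action of \(Sp(2)\) preserving \(\phi\) is of cohomogeneity one if its largest orbits have dimension \(6\). Let \(K=Sp(1)\times U(1)\subset Sp(2)\) be the subgroup of matrices \(\mathrm{diag}(q,z)\), \(q\in Sp(1)\), \(z\in U(1)=\{e^{is}\}\). Let \(e_1,\dots,e_6\) be the linear forms on \(\mathfrak{sp}(2)\) vanishing on the Lie algebra of \(K\) and dual to \[E_1=\tfrac12\begin{pmatrix}0&0\\0&j\end{pmatrix},\ E_2=\tfrac12\begin{pmatrix}0&0\\0&-k\end{pmatrix},\ E_3=\tfrac1{2\sqrt2}\begin{pmatrix}0&-1\\1&0\end{pmatrix},\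 E_4=\tfrac1{2\sqrt2}\begin{pmatrix}0&i\\i&0\end{pmatrix},\ E_5=\tfrac1{2\sqrt2}\begin{pmatrix}0&j\\j&0\end{pmatrix},\ E_6=\tfrac1{2\sqrt2}\begin{pmatrix}0&k\\k&0\end{pmatrix}.\] Put \(g_1=e_1^2+e_2^2\), \(g_2=e_3^2+e_4^2+e_5^2+e_6^2\), \(\omega_1=e_{12}\), \(\omega_2=e_{34}+e_{56}\), \(\alpha=e_{246}-e_{235}-e_{145}-e_{136}\), \(\beta=e_{135}-e_{146}-e_{236}-e_{245}\). For an open interval \(I\) and a smooth curve \(\gamma\colon I\to M\), an invariant \(G_2\)-structure is *in normal form along \(\gamma\)*, with functions \(f_1,f_2,\theta\) on \(I\), where \(f_1,f_2\) have no zeros, if its pull-back under \((t,aK)\mapsto a\cdot\gamma(t)\) is \[g=dt^2+f_1^2g_1+f_2^2g_2,\qquad \phi=(f_1^2\omega_1+f_2^2\omega_2)\wedge dt+f_1f_2^2(\cos\theta\,\alpha+\sin\theta\,\beta).\] **Theorem.** Let \(M\) be a smooth 7-manifold with a smooth action of \(Sp(2)\). (A) Let \(\phi\) be a smooth cosymplectic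 \(G_2\)-structure on \(M\) preserved by the action, and let the action be of cohomogeneity one. Through every point of a six-dimensional orbit there is a smooth unit-speed curve, defined on an open interval, which meets only six-dimensional orbits and is orthogonal to them. For each such curve \(\gamma\colon I\to M\) there are \(b\in Sp(2)\) and smooth \(f_1,f_2,\theta\) such that \(\phi\) is in normal form along \(b\cdot\gamma\) with these functions. Whenever \(\phi\) is in normal form along a curve on an open interval \(I\) with smooth functions \(f_1,f_2,\theta\), the sign of \(f_1^2-f_2^2\) is constant on \(I\), and the following hold. (1) If \(f_1^2\leqslant f_2^2\) on \(I\), then for some constant \(\nu\geqslant0\) \[2f_2^2=f_1^2+\sqrt{f_1^4+4\nu^2}\quad\text{and}\quad |f_1'|\leqslant\frac{\sqrt{f_1^4+4\nu^2}}{f_1^2+\sqrt{f_1^4+4\nu^2}}.\] (2) If \(f_1^2\geqslant f_2^2\) on \(I\), then for some constant \(\nu\geqslant0\) \[f_1^2=f_2^2+\nu^2f_2^{-2}\quad\text{and}\quad |f_2'|\leqslant\frac{\sqrt{f_2^4+\nu^2}}{2f_2^2}.\] (B) Conversely, let \(I\) be an open interval, \(\nu\geqslant0\), and let \(f_1,f_2\colon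 I\to\mathbb R\setminus\{0\}\) be smooth functions satisfying the two relations of (1) or the two relations of (2). Suppose that \(\gamma\colon I\to M\) is a smooth curve such that \((t,aK)\mapsto a\cdot\gamma(t)\) is a well-defined diffeomorphism \(I\times Sp(2)/K\to M\). Then \(M\) carries an \(Sp(2)\)-invariant cosymplectic \(G_2\)-structure of class \(C^1\) which is in normal form along \(\gamma\) with functions \(f_1,f_2\) and some \(\theta\) of class \(C^1\). The structure and \(\theta\) can be chosen smooth if the difference of the squares of the two sides of the differential inequality, right-hand side squared minus left-hand side squared, is the square of a smooth function on \(I\) (for example, if the inequality is strict). -/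

import Mathlib

open Set Manifold
open scoped ContDiff Quaternion

noncomputable section

namespace G2Coho

/-! ### Linear algebra of `G₂`-forms -/

/-- The model space `ℝ⁷`, with coordinates numbered `0, …, 6`. -/
abbrev V7 : Type := EuclideanSpace ℝ (Fin 7)

/-- The determinant, as a continuous alternating `k`-form on `ℝᵏ`. -/
def detForm (k : ℕ) : (Fin k → ℝ) [⋀^Fin k]→L[ℝ] ℝ :=
  { (Matrix.detRowAlternating : (Fin k → ℝ) [⋀^Fin k]→ₗ[ℝ] ℝ) with
    cont := by
      change Continuous fun v : Fin k → Fin k → ℝ => Matrix.det (Matrix.of v)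
      exact Continuous.matrix_det continuous_id }

section Forms

variable {E : Type*} [AddCommGroup E] [Module ℝ E] [TopologicalSpace E]

/-- The decomposable form `ℓ₁ ∧ ⋯ ∧ ℓₖ`, that is, `(w₁, …, wₖ) ↦ det (ℓₐ (w_b))`. -/
def wedge {k : ℕ} (ℓ : Fin k → E →L[ℝ] ℝ) : E [⋀^Fin k]→L[ℝ] ℝ :=
  (detForm k).compContinuousLinearMap (ContinuousLinearMap.pi ℓ)

/-- `e₁₂ ∧ e₀`. -/
def omegaOneForm (e : Fin 7 → E →L[ℝ] ℝ) : E [⋀^Fin 3]→L[ℝ] ℝ :=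
  wedge ![e 1, e 2, e 0]

/-- `(e₃₄ + e₅₆) ∧ e₀`. -/
def omegaTwoForm (e : Fin 7 → E →L[ℝ] ℝ) : E [⋀^Fin 3]→L[ℝ] ℝ :=
  wedge ![e 3, e 4, e 0] + wedge ![e 5, e 6, e 0]

/-- `α = e₂₄₆ - e₂₃₅ - e₁₄₅ - e₁₃₆`. -/
def alphaForm (e : Fin 7 → E →L[ℝ] ℝ) : E [⋀^Fin 3]→L[ℝ] ℝ :=
  wedge ![e 2, e 4, e 6] - wedge ![e 2, e 3, e 5] - wedge ![e 1, e 4, e 5] - wedge ![e 1, e 3, e 6]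

/-- `β = e₁₃₅ - e₁₄₆ - e₂₃₆ - e₂₄₅`. -/
def betaForm (e : Fin 7 → E →L[ℝ] ℝ) : E [⋀^Fin 3]→L[ℝ] ℝ :=
  wedge ![e 1, e 3, e 5] - wedge ![e 1, e 4, e 6] - wedge ![e 2, e 3, e 6] - wedge ![e 2, e 4, e 5]

/-- The three-form `φ(θ) = (v₁₂ + v₃₄ + v₅₆) ∧ v₀ + cos θ α + sin θ β` on `ℝ⁷`. -/
def modelForm (θ : ℝ) : V7 [⋀^Fin 3]→L[ℝ] ℝ :=
  let v : Fin 7 → V7 →L[ℝ] ℝ := fun i => EuclideanSpace.proj i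
  omegaOneForm v + omegaTwoForm v + Real.cos θ • alphaForm v + Real.sin θ • betaForm v

/-- `u` identifies `φ` with one of the model forms `φ(θ)`. -/
def IsAdapted (φ : E [⋀^Fin 3]→L[ℝ] ℝ) (u : E ≃L[ℝ] V7) : Prop :=
  ∃ θ : ℝ, φ = (modelForm θ).compContinuousLinearMap (u : E →L[ℝ] V7)

/-- `φ` is a `G₂`-form: in some basis it is `φ(θ)` for some `θ`. -/
def IsG2Form (φ : E [⋀^Fin 3]→L[ℝ] ℝ) : Prop := ∃ u : E ≃L[ℝ] V7, IsAdapted φ u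

open Classical in
/-- The inner product determined by a `G₂`-form `φ`: it makes the adapted identifications with
Euclidean space `ℝ⁷` isometric (and does not depend on which of them is used). -/
def g2Metric (φ : E [⋀^Fin 3]→L[ℝ] ℝ) (v w : E) : ℝ :=
  if h : ∃ u : E ≃L[ℝ] V7, IsAdapted φ u then inner ℝ (h.choose v) (h.choose w) else 0

/-- `ψ = ∗η` on Euclidean `ℝ⁷`, oriented by `v₁₂₃₄₅₆ ∧ v₀ = v₀₁₂₃₄₅₆`. -/
def IsHodgeDual (η : V7 [⋀^Fin 3]→L[ℝ] ℝ) (ψ : V7 [⋀^Fin 4]→L[ℝ] ℝ) : Prop :=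
  let b : Fin 7 → V7 := fun i => EuclideanSpace.single i 1
  ∀ σ : Equiv.Perm (Fin 7),
    ψ ![b (σ 3), b (σ 4), b (σ 5), b (σ 6)] =
      ((Equiv.Perm.sign σ : ℤ) : ℝ) * η ![b (σ 0), b (σ 1), b (σ 2)]

/-- `ψ = ∗φ` for the metric and the orientation determined by the `G₂`-form `φ`. -/
def IsG2Dual (φ : E [⋀^Fin 3]→L[ℝ] ℝ) (ψ : E [⋀^Fin 4]→L[ℝ] ℝ) : Prop :=
  ∃ u : E ≃L[ℝ] V7, IsAdapted φ u ∧
    IsHodgeDual (φ.compContinuousLinearMap (u.symm : V7 →L[ℝ] E))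
      (ψ.compContinuousLinearMap (u.symm : V7 →L[ℝ] E))

end Forms

/-! ### The group `Sp(2)` -/

/-- `Sp(2)`: the quaternionic unitary `2 × 2` matrices. -/
abbrev Sp2 : Type := unitary (Matrix (Fin 2) (Fin 2) ℍ[ℝ])

/-- The Lie algebra `sp(2)`: the quaternionic skew-Hermitian `2 × 2` matrices. -/
def sp2Submodule : Submodule ℝ (Matrix (Fin 2) (Fin 2) ℍ[ℝ]) where
  carrier := {X | star X = -X}
  add_mem' := fun {X Y} (hX : star X = -X) (hY : star Y = -Y) => by
    change star (X + Y) = -(X + Y)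
    rw [star_add, hX, hY, neg_add]
  zero_mem' := by simp
  smul_mem' := fun r X (hX : star X = -X) => by
    change star (r • X) = -(r • X)
    rw [← smul_neg, ← hX]
    ext i j <;> simp [Matrix.star_apply]

/-- The Lie algebra `sp(2)`, as a type. -/
def sp2 : Type := sp2Submodule

section Norm

attribute [local instance] Matrix.normedAddCommGroup Matrix.normedSpace

/-- `sp(2)` as a normed space; the norm (the largest norm of an entry) only serves to define
smoothness, for which the choice is immaterial. -/
instance : NormedAddCommGroup sp2 := inferInstanceAs (NormedAddCommGroup sp2Submodule)

instance : NormedSpace ℝ sp2 := inferInstanceAs (NormedSpace ℝ sp2Submodule)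

end Norm

instance : FiniteDimensional ℝ sp2 := inferInstanceAs (FiniteDimensional ℝ sp2Submodule)

/-- The inclusion of `sp(2)` in the quaternionic matrices. -/
def toMat : sp2 →ₗ[ℝ] Matrix (Fin 2) (Fin 2) ℍ[ℝ] := sp2Submodule.subtype

/-- The exponential map `sp(2) → Sp(2)`. -/
def expSp (X : sp2) : Sp2 :=
  ⟨NormedSpace.exp (toMat X), by
    let _ : NormedAlgebra ℚ ℍ[ℝ] := NormedAlgebra.restrictScalars ℚ ℝ ℍ[ℝ]
    have hX : star (toMat X) = -toMat X := X.2
    have h : star (NormedSpace.exp (toMat X)) = NormedSpace.exp (-toMat X) := by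
      rw [← hX]
      exact (Matrix.exp_conjTranspose _).symm
    rw [Unitary.mem_iff, h]
    constructor
    · rw [← Matrix.exp_add_of_commute _ _ ((Commute.refl (toMat X)).neg_left), neg_add_cancel,
        NormedSpace.exp_zero]
    · rw [← Matrix.exp_add_of_commute _ _ ((Commute.refl (toMat X)).neg_right), add_neg_cancel,
        NormedSpace.exp_zero]⟩

/-- The subgroup `K = Sp(1) × U(1)` of `Sp(2)`: the matrices `diag(q, z)` with `z ∈ ℂ = ⟨1, i⟩`. -/
def IsInK (a : Sp2) : Prop :=
  (a : Matrix (Fin 2) (Fin 2) ℍ[ℝ]) 0 1 = 0 ∧ (a : Matrix (Fin 2) (Fin 2) ℍ[ℝ]) 1 0 = 0 ∧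
    ((a : Matrix (Fin 2) (Fin 2) ℍ[ℝ]) 1 1).imJ = 0 ∧
    ((a : Matrix (Fin 2) (Fin 2) ℍ[ℝ]) 1 1).imK = 0

/-- The linear function `X ↦ c · p (X₁ᵢ)` of the lower row (row number `1`) of `X ∈ sp(2)`. -/
def entry (i : Fin 2) (c : ℝ) (p : ℍ[ℝ] →ₗ[ℝ] ℝ) : sp2 →L[ℝ] ℝ :=
  LinearMap.toContinuousLinearMap
    { toFun := fun X => c * p (toMat X 1 i)
      map_add' := fun X Y => by simp [mul_add]
      map_smul' := fun r X => by
        simp only [map_smul, Matrix.smul_apply, smul_eq_mul, RingHom.id_apply]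
        ring }

/-- The coframe `e₀ = dt, e₁, …, e₆` on `ℝ ⊕ sp(2)`.  Here `e₁, …, e₆` vanish on the Lie algebra
of `K` and are dual to
`E₁ = ½ diag(0, j)`, `E₂ = ½ diag(0, -k)`, `E₃ = (8)^(-1/2) (0, -1; 1, 0)`,
`E₄ = (8)^(-1/2) (0, i; i, 0)`, `E₅ = (8)^(-1/2) (0, j; j, 0)`, `E₆ = (8)^(-1/2) (0, k; k, 0)`. -/
def coframe : Fin 7 → (ℝ × sp2) →L[ℝ] ℝ :=
  ![ContinuousLinearMap.fst ℝ ℝ sp2,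
    (entry 1 2 (QuaternionAlgebra.imJₗ _ _ _)).comp (ContinuousLinearMap.snd ℝ ℝ sp2),
    (entry 1 (-2) (QuaternionAlgebra.imKₗ _ _ _)).comp (ContinuousLinearMap.snd ℝ ℝ sp2),
    (entry 0 (2 * √2) (QuaternionAlgebra.reₗ _ _ _)).comp (ContinuousLinearMap.snd ℝ ℝ sp2),
    (entry 0 (2 * √2) (QuaternionAlgebra.imIₗ _ _ _)).comp (ContinuousLinearMap.snd ℝ ℝ sp2),
    (entry 0 (2 * √2) (QuaternionAlgebra.imJₗ _ _ _)).comp (ContinuousLinearMap.snd ℝ ℝ sp2),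
    (entry 0 (2 * √2) (QuaternionAlgebra.imKₗ _ _ _)).comp (ContinuousLinearMap.snd ℝ ℝ sp2)]

/-! ### Forms, actions and curves on a seven-manifold -/

section Manifold

variable {M : Type*} [TopologicalSpace M] [ChartedSpace V7 M]

variable (M) in
/-- Fields of `k`-forms on the seven-manifold `M`. -/
abbrev FormField (k : ℕ) : Type _ :=
  ∀ x : M, TangentSpace 𝓘(ℝ, V7) x [⋀^Fin k]→L[ℝ] ℝ

/-- The expression of a field of forms in the chart `e`: its pull-back under `e.symm`. -/
def FormField.inChart {k : ℕ} (η : FormField M k) (e : OpenPartialHomeomorph M V7) (y : V7) :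
    V7 [⋀^Fin k]→L[ℝ] ℝ :=
  (η (e.symm y)).compContinuousLinearMap (mfderiv 𝓘(ℝ, V7) 𝓘(ℝ, V7) e.symm y)

/-- The field of forms is of class `C^r`. -/
def FormField.IsOfClass {k : ℕ} (r : WithTop ℕ∞) (η : FormField M k) : Prop :=
  ∀ e ∈ atlas V7 M, ContDiffOn ℝ r (η.inChart e) e.target

/-- The field of forms is of class `C¹` and its exterior derivative vanishes. -/
def FormField.IsClosed {k : ℕ} (η : FormField M k) : Prop :=
  η.IsOfClass 1 ∧ ∀ e ∈ atlas V7 M, ∀ y ∈ e.target, extDeriv (η.inChart e) y = 0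

/-- The three-form `φ` is a `G₂`-structure of class `C^r`. -/
def IsG2Structure (r : WithTop ℕ∞) (φ : FormField M 3) : Prop :=
  φ.IsOfClass r ∧ ∀ x, IsG2Form (φ x)

/-- The `G₂`-structure `φ` is cosymplectic: `d ∗φ = 0`. -/
def IsCosymplectic (φ : FormField M 3) : Prop :=
  ∃ ψ : FormField M 4, (∀ x, IsG2Dual (φ x) (ψ x)) ∧ ψ.IsClosed

variable [MulAction Sp2 M]

variable (M) in
/-- The action map `Sp(2) × M → M` is smooth, where `Sp(2)` is given its exponential coordinates
`X ↦ a exp X` around each of its points `a`. -/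
def IsSmoothAction : Prop :=
  ∀ a : Sp2, ContMDiff (𝓘(ℝ, sp2).prod 𝓘(ℝ, V7)) 𝓘(ℝ, V7) ∞
    fun p : sp2 × M => (a * expSp p.1) • p.2

/-- The action of `Sp(2)` preserves `φ`. -/
def IsInvariant (φ : FormField M 3) : Prop :=
  ∀ (a : Sp2) (x : M),
    (φ (a • x)).compContinuousLinearMap
      (mfderiv 𝓘(ℝ, V7) 𝓘(ℝ, V7) (fun y : M => a • y) x) = φ x

/-- The infinitesimal action at `x`: the derivative at `0` of `X ↦ exp X • x`. -/
def infAction (x : M) : sp2 →L[ℝ] TangentSpace 𝓘(ℝ, V7) x :=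
  (mfderiv 𝓘(ℝ, sp2) 𝓘(ℝ, V7) (fun X : sp2 => expSp X • x) 0 :)

/-- The dimension of the orbit through `x`; its tangent space at `x` is the range of the
infinitesimal action. -/
def orbitDim (x : M) : ℕ :=
  Module.finrank ℝ (LinearMap.range (infAction x : sp2 →ₗ[ℝ] TangentSpace 𝓘(ℝ, V7) x))

variable (M) in
/-- The largest orbits have dimension six. -/
def IsCohomogeneityOne : Prop :=
  (∀ x : M, orbitDim x ≤ 6) ∧ ∃ x : M, orbitDim x = 6

/-- The velocity vector `γ'(t)`. -/
def velocity (γ : ℝ → M) (t : ℝ) : TangentSpace 𝓘(ℝ, V7) (γ t) :=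
  mfderiv 𝓘(ℝ, ℝ) 𝓘(ℝ, V7) γ t (1 : ℝ)

/-- `γ : I → M` is a smooth curve through six-dimensional orbits, orthogonal to them and
parameterized by arc length, for the metric determined by `φ`. -/
def IsNormalCurve (φ : FormField M 3) (I : Set ℝ) (γ : ℝ → M) : Prop :=
  ContMDiffOn 𝓘(ℝ, ℝ) 𝓘(ℝ, V7) ∞ γ I ∧
    ∀ t ∈ I, orbitDim (γ t) = 6 ∧ g2Metric (φ (γ t)) (velocity γ t) (velocity γ t) = 1 ∧
      ∀ X : sp2, g2Metric (φ (γ t)) (velocity γ t) (infAction (γ t) X) = 0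

/-- The derivative at `(t, 0) ∈ ℝ × sp(2)` of the map `(s, X) ↦ exp X • γ(s)`. -/
def tubeDeriv (γ : ℝ → M) (t : ℝ) : (ℝ × sp2) →L[ℝ] TangentSpace 𝓘(ℝ, V7) (γ t) :=
  (mfderiv 𝓘(ℝ, ℝ × sp2) 𝓘(ℝ, V7) (fun p : ℝ × sp2 => expSp p.2 • γ p.1) (t, 0) :)

/-- Along the union of the orbits through the curve `γ : I → M`, i.e. after pulling back by
`(t, aK) ↦ a • γ(t)`, the metric of the `Sp(2)`-invariant structure `φ` is
`dt² + f₁² g₁ + f₂² g₂` with `g₁ = e₁² + e₂²`, `g₂ = e₃² + e₄² + e₅² + e₆²`, and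
`φ = (f₁² ω₁ + f₂² ω₂) ∧ dt + f₁ f₂² (cos θ α + sin θ β)`
with `ω₁ = e₁₂`, `ω₂ = e₃₄ + e₅₆`, where `f₁, f₂, θ` are functions of class `C^r` on `I` and
`f₁, f₂` have no zeros. -/
structure IsNormalForm (r : WithTop ℕ∞) (φ : FormField M 3) (I : Set ℝ) (γ : ℝ → M)
    (f₁ f₂ θ : ℝ → ℝ) : Prop where
  curve : ContMDiffOn 𝓘(ℝ, ℝ) 𝓘(ℝ, V7) ∞ γ I
  class_f₁ : ContDiffOn ℝ r f₁ I
  class_f₂ : ContDiffOn ℝ r f₂ I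
  class_θ : ContDiffOn ℝ r θ I
  f₁_ne : ∀ t ∈ I, f₁ t ≠ 0
  f₂_ne : ∀ t ∈ I, f₂ t ≠ 0
  metric : ∀ t ∈ I, ∀ v w : ℝ × sp2,
    g2Metric (φ (γ t)) (tubeDeriv γ t v) (tubeDeriv γ t w) =
      coframe 0 v * coframe 0 w +
        f₁ t ^ 2 * (coframe 1 v * coframe 1 w + coframe 2 v * coframe 2 w) +
        f₂ t ^ 2 * (coframe 3 v * coframe 3 w + coframe 4 v * coframe 4 w +
          coframe 5 v * coframe 5 w + coframe 6 v * coframe 6 w)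
  form : ∀ t ∈ I,
    (φ (γ t)).compContinuousLinearMap (tubeDeriv γ t) =
      f₁ t ^ 2 • omegaOneForm coframe + f₂ t ^ 2 • omegaTwoForm coframe +
        (f₁ t * f₂ t ^ 2) • (Real.cos (θ t) • alphaForm coframe + Real.sin (θ t) • betaForm coframe)

/-- `(t, aK) ↦ a • γ(t)` is a well-defined diffeomorphism from `I × Sp(2)/K` onto `M`: it is a
bijection, and a local diffeomorphism since its derivative is onto (both sides have dimension
seven). -/
structure IsTube (I : Set ℝ) (γ : ℝ → M) : Prop where
  curve : ContMDiffOn 𝓘(ℝ, ℝ) 𝓘(ℝ, V7) ∞ γ I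
  stabilizer : ∀ t ∈ I, ∀ a : Sp2, a • γ t = γ t ↔ IsInK a
  injective : ∀ t ∈ I, ∀ t' ∈ I, ∀ a : Sp2, a • γ t = γ t' → t = t'
  surjective : ∀ x : M, ∃ t ∈ I, ∃ a : Sp2, a • γ t = x
  submersion : ∀ t ∈ I, Function.Surjective (tubeDeriv γ t)

end Manifold

/-! ### The two families of relations -/

/-- The right-hand side of the differential inequality for `f₁` in the case `f₁² ≤ f₂²`. -/
def bound₁ (ν x : ℝ) : ℝ := √(x ^ 4 + 4 * ν ^ 2) / (x ^ 2 + √(x ^ 4 + 4 * ν ^ 2))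

/-- The right-hand side of the differential inequality for `f₂` in the case `f₁² ≥ f₂²`. -/
def bound₂ (ν x : ℝ) : ℝ := √(x ^ 4 + ν ^ 2) / (2 * x ^ 2)

/-- The relations between `f₁` and `f₂` in the case `f₁² ≤ f₂²`. -/
def Relations₁ (ν : ℝ) (I : Set ℝ) (f₁ f₂ : ℝ → ℝ) : Prop :=
  ∀ t ∈ I, 2 * f₂ t ^ 2 = f₁ t ^ 2 + √(f₁ t ^ 4 + 4 * ν ^ 2) ∧ |deriv f₁ t| ≤ bound₁ ν (f₁ t)

/-- The relations between `f₁` and `f₂` in the case `f₁² ≥ f₂²`. -/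
def Relations₂ (ν : ℝ) (I : Set ℝ) (f₁ f₂ : ℝ → ℝ) : Prop :=
  ∀ t ∈ I, f₁ t ^ 2 = f₂ t ^ 2 + ν ^ 2 * (f₂ t ^ 2)⁻¹ ∧ |deriv f₂ t| ≤ bound₂ ν (f₂ t)

end G2Coho

end

set_option linter.all false

noncomputable section

namespace G2Coho

/-! ### Explicit formulas for the model forms -/

section Wedge

variable {E : Type*} [AddCommGroup E] [Module ℝ E] [TopologicalSpace E]

/-! Linear algebra. For the model form, the cross product given by ⟨x × y, z⟩ = φ(x, y, z) satisfies
⟨x × y, z × w⟩ = ⟨x, z⟩⟨y, w⟩ - ⟨x, w⟩⟨y, z⟩ + ∗φ(x, y, z, w) (`inner_cross_cross`). Hence the slice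
φ(w, ·, ·) is a skew matrix with square w wᵀ - |w|², and the determinant of a slice bordered by its
kernel vector recovers the length of that vector from the form, up to a factor (`bordered_sq`) that
a second determinant removes. So the metric and the dual do not depend on the adapted frame, and the
metric depends smoothly on the form.

Normal curves. Near a six-dimensional orbit the unit normal is, up to sign, a smooth vector field,
and normal curves are its integral curves. Uniqueness for ordinary differential equations shows that
the isotropy algebra is constant along such a curve and fixes its velocity
(`IsNormalCurve.isotropy`). Its dimension is 10 - 6 = 4. A four-dimensional subalgebra of sp(2)
contains two independent commuting elements, hence, up to conjugation, the standard torus, to which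
it adds one root plane. For a long root it is conjugate to the Lie algebra of K. For a short root it
contains an H with (ad H)² = -1 modulo the subalgebra (`exists_map_eq_subK`). Then H acts on the
tangent space of the orbit as a complex structure that annihilates φ as a derivation, so φ vanishes
on the orbit (`trilinear_eq_zero_of_derivation`), which no G₂-form does on a hyperplane. Thus the
isotropy algebra is that of K, up to conjugation (`IsNormalCurve.exists_isoAlg_eq`).

The three-forms invariant under it are a ω₁ ∧ dt + c ω₂ ∧ dt + p α + q β (`isotropic_components`).
If a > 0, then being a G₂-form with dt of unit length forces c > 0 and a c² = p² + q²
(`isotropicForm_conditions`). This is the normal form, with f₁² = a, f₂² = c and θ the angle of (p,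
q); the sign of a is corrected by the element diag(1, j), which normalizes the Lie algebra of K.

Differential equations. In the coordinates (t, exp(p₁E₁) ⋯ exp(p₆E₆)) the equation d∗φ = 0 reduces
to (f₁²f₂²)' = (f₂⁴)' = 2 f₁f₂² cos θ. So f₂⁴ - f₁²f₂² is a constant, equal to ν² or -ν². This gives
the algebraic relations and the constant sign of f₁² - f₂². Solving for the derivatives, f₁' in case
(1) and, up to sign, f₂' in case (2) is cos θ times the bound, and |cos θ| ≤ 1 is the inequality
(`relations_of_conserved`).

Converse. The relations determine cos θ as a smooth function c, and a root of 1 - c² is needed as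
sin θ. A nonnegative C² function is the square of a C¹ function (`exists_contDiffOn_one_sq`): the
root changes sign at each zero with nonvanishing second derivative, and Glaeser's inequality
controls the other zeros. The form so obtained along γ is invariant under K, hence extends to the
tube, and the same computation shows that its dual is closed (`IsTube.exists_structure`). -/

theorem wedge_three_apply (a b c : E →L[ℝ] ℝ) (x y z : E) :
    wedge ![a, b, c] ![x, y, z] = a x * b y * c z - a x * c y * b z - b x * a y * c z
      + b x * c y * a z + c x * a y * b z - c x * b y * a z := by
  change Matrix.det (Matrix.of fun (j i : Fin 3) => (![a, b, c] i) (![x, y, z] j)) = _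
  rw [Matrix.det_fin_three]
  simp

theorem wedge_four_apply (a b c d : E →L[ℝ] ℝ) (x y z w : E) :
    wedge ![a, b, c, d] ![x, y, z, w] =
      (a x * b y - b x * a y) * (c z * d w - d z * c w)
      - (a x * c y - c x * a y) * (b z * d w - d z * b w)
      + (a x * d y - d x * a y) * (b z * c w - c z * b w)
      + (b x * c y - c x * b y) * (a z * d w - d z * a w)
      - (b x * d y - d x * b y) * (a z * c w - c z * a w)
      + (c x * d y - d x * c y) * (a z * b w - b z * a w) := by
  change Matrix.det (Matrix.of fun (j i : Fin 4) => (![a, b, c, d] i) (![x, y, z, w] j)) = _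
  simp [Matrix.det_succ_row_zero, Fin.sum_univ_succ, Fin.succAbove]
  ring

end Wedge

theorem modelForm_apply (θ : ℝ) (x y z : V7) :
    modelForm θ ![x, y, z] =
      ((x 1 * y 2 - x 2 * y 1) + (x 3 * y 4 - x 4 * y 3) + (x 5 * y 6 - x 6 * y 5)) * z 0
      + ((x 2 * y 0 - x 0 * y 2)
          - Real.cos θ * ((x 4 * y 5 - x 5 * y 4) + (x 3 * y 6 - x 6 * y 3))
          + Real.sin θ * ((x 3 * y 5 - x 5 * y 3) - (x 4 * y 6 - x 6 * y 4))) * z 1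
      + ((x 0 * y 1 - x 1 * y 0)
          + Real.cos θ * ((x 4 * y 6 - x 6 * y 4) - (x 3 * y 5 - x 5 * y 3))
          - Real.sin θ * ((x 3 * y 6 - x 6 * y 3) + (x 4 * y 5 - x 5 * y 4))) * z 2
      + ((x 4 * y 0 - x 0 * y 4)
          + Real.cos θ * ((x 2 * y 5 - x 5 * y 2) + (x 1 * y 6 - x 6 * y 1))
          - Real.sin θ * ((x 1 * y 5 - x 5 * y 1) - (x 2 * y 6 - x 6 * y 2))) * z 3
      + ((x 0 * y 3 - x 3 * y 0)
          - Real.cos θ * ((x 2 * y 6 - x 6 * y 2) - (x 1 * y 5 - x 5 * y 1))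
          + Real.sin θ * ((x 1 * y 6 - x 6 * y 1) + (x 2 * y 5 - x 5 * y 2))) * z 4
      + ((x 6 * y 0 - x 0 * y 6)
          - Real.cos θ * ((x 2 * y 3 - x 3 * y 2) + (x 1 * y 4 - x 4 * y 1))
          + Real.sin θ * ((x 1 * y 3 - x 3 * y 1) - (x 2 * y 4 - x 4 * y 2))) * z 5
      + ((x 0 * y 5 - x 5 * y 0)
          + Real.cos θ * ((x 2 * y 4 - x 4 * y 2) - (x 1 * y 3 - x 3 * y 1))
          - Real.sin θ * ((x 1 * y 4 - x 4 * y 1) + (x 2 * y 3 - x 3 * y 2))) * z 6 := by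
  simp only [modelForm, omegaOneForm, omegaTwoForm, alphaForm, betaForm,
    ContinuousAlternatingMap.add_apply, ContinuousAlternatingMap.sub_apply,
    ContinuousAlternatingMap.smul_apply, wedge_three_apply, PiLp.proj_apply, smul_eq_mul]
  ring

/-- The cross product of the model form. -/
def cross (θ : ℝ) (x y : V7) : V7 :=
  WithLp.toLp 2 ![
    (x 1 * y 2 - x 2 * y 1) + (x 3 * y 4 - x 4 * y 3) + (x 5 * y 6 - x 6 * y 5),
    (x 2 * y 0 - x 0 * y 2)
          - Real.cos θ * ((x 4 * y 5 - x 5 * y 4) + (x 3 * y 6 - x 6 * y 3))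
          + Real.sin θ * ((x 3 * y 5 - x 5 * y 3) - (x 4 * y 6 - x 6 * y 4)),
    (x 0 * y 1 - x 1 * y 0)
          + Real.cos θ * ((x 4 * y 6 - x 6 * y 4) - (x 3 * y 5 - x 5 * y 3))
          - Real.sin θ * ((x 3 * y 6 - x 6 * y 3) + (x 4 * y 5 - x 5 * y 4)),
    (x 4 * y 0 - x 0 * y 4)
          + Real.cos θ * ((x 2 * y 5 - x 5 * y 2) + (x 1 * y 6 - x 6 * y 1))
          - Real.sin θ * ((x 1 * y 5 - x 5 * y 1) - (x 2 * y 6 - x 6 * y 2)),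
    (x 0 * y 3 - x 3 * y 0)
          - Real.cos θ * ((x 2 * y 6 - x 6 * y 2) - (x 1 * y 5 - x 5 * y 1))
          + Real.sin θ * ((x 1 * y 6 - x 6 * y 1) + (x 2 * y 5 - x 5 * y 2)),
    (x 6 * y 0 - x 0 * y 6)
          - Real.cos θ * ((x 2 * y 3 - x 3 * y 2) + (x 1 * y 4 - x 4 * y 1))
          + Real.sin θ * ((x 1 * y 3 - x 3 * y 1) - (x 2 * y 4 - x 4 * y 2)),
    (x 0 * y 5 - x 5 * y 0)
          + Real.cos θ * ((x 2 * y 4 - x 4 * y 2) - (x 1 * y 3 - x 3 * y 1))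
          - Real.sin θ * ((x 1 * y 4 - x 4 * y 1) + (x 2 * y 3 - x 3 * y 2))]

theorem inner_eq_sum7 (x y : V7) : inner ℝ x y = x 0 * y 0 + x 1 * y 1 + x 2 * y 2 + x 3 * y 3
    + x 4 * y 4 + x 5 * y 5 + x 6 * y 6 := by
  rw [PiLp.inner_apply, Fin.sum_univ_seven]
  simp only [RCLike.inner_apply, conj_trivial]
  ring

theorem inner_cross (θ : ℝ) (x y z : V7) : inner ℝ (cross θ x y) z = modelForm θ ![x, y, z] := by
  rw [modelForm_apply, inner_eq_sum7]
  simp [cross]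

/-- The Hodge dual of the model form. -/
def starForm (θ : ℝ) : V7 [⋀^Fin 4]→L[ℝ] ℝ :=
  let v : Fin 7 → V7 →L[ℝ] ℝ := fun i => EuclideanSpace.proj i
  wedge ![v 1, v 2, v 3, v 4] + wedge ![v 1, v 2, v 5, v 6] + wedge ![v 3, v 4, v 5, v 6]
    + Real.sin θ • (wedge ![v 0, v 2, v 4, v 6] - wedge ![v 0, v 2, v 3, v 5]
        - wedge ![v 0, v 1, v 4, v 5] - wedge ![v 0, v 1, v 3, v 6])
    - Real.cos θ • (wedge ![v 0, v 1, v 3, v 5] - wedge ![v 0, v 1, v 4, v 6]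
        - wedge ![v 0, v 2, v 3, v 6] - wedge ![v 0, v 2, v 4, v 5])

set_option maxRecDepth 4000 in
-- This identity expresses the dual form through the metric and the cross product, and is the source
-- of every uniqueness statement about adapted frames. For z = x the dual term drops out, which
-- gives |x × y|² = |x|²|y|² - ⟨x, y⟩² and the square of a slice matrix.
theorem inner_cross_cross (θ : ℝ) (x y z w : V7) :
    inner ℝ (cross θ x y) (cross θ z w) = starForm θ ![x, y, z, w]
      + inner ℝ x z * inner ℝ y w - inner ℝ x w * inner ℝ y z := by
  have h : Real.sin θ ^ 2 = 1 - Real.cos θ ^ 2 := by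
    have := Real.sin_sq_add_cos_sq θ; linarith
  -- The Binet–Cauchy identity. After it both sides are bilinear in the 2 × 2 minors of (x, y) and
  -- of (z, w), which are then replaced by 21 + 21 free variables.
  have key : inner ℝ x z * inner ℝ y w - inner ℝ x w * inner ℝ y z =
     (x 0 * y 1 - x 1 * y 0) * (z 0 * w 1 - z 1 * w 0)
     + (x 0 * y 2 - x 2 * y 0) * (z 0 * w 2 - z 2 * w 0)
     + (x 0 * y 3 - x 3 * y 0) * (z 0 * w 3 - z 3 * w 0)
     + (x 0 * y 4 - x 4 * y 0) * (z 0 * w 4 - z 4 * w 0)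
     + (x 0 * y 5 - x 5 * y 0) * (z 0 * w 5 - z 5 * w 0)
     + (x 0 * y 6 - x 6 * y 0) * (z 0 * w 6 - z 6 * w 0)
     + (x 1 * y 2 - x 2 * y 1) * (z 1 * w 2 - z 2 * w 1)
     + (x 1 * y 3 - x 3 * y 1) * (z 1 * w 3 - z 3 * w 1)
     + (x 1 * y 4 - x 4 * y 1) * (z 1 * w 4 - z 4 * w 1)
     + (x 1 * y 5 - x 5 * y 1) * (z 1 * w 5 - z 5 * w 1)
     + (x 1 * y 6 - x 6 * y 1) * (z 1 * w 6 - z 6 * w 1)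
     + (x 2 * y 3 - x 3 * y 2) * (z 2 * w 3 - z 3 * w 2)
     + (x 2 * y 4 - x 4 * y 2) * (z 2 * w 4 - z 4 * w 2)
     + (x 2 * y 5 - x 5 * y 2) * (z 2 * w 5 - z 5 * w 2)
     + (x 2 * y 6 - x 6 * y 2) * (z 2 * w 6 - z 6 * w 2)
     + (x 3 * y 4 - x 4 * y 3) * (z 3 * w 4 - z 4 * w 3)
     + (x 3 * y 5 - x 5 * y 3) * (z 3 * w 5 - z 5 * w 3)
     + (x 3 * y 6 - x 6 * y 3) * (z 3 * w 6 - z 6 * w 3)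
     + (x 4 * y 5 - x 5 * y 4) * (z 4 * w 5 - z 5 * w 4)
     + (x 4 * y 6 - x 6 * y 4) * (z 4 * w 6 - z 6 * w 4)
     + (x 5 * y 6 - x 6 * y 5) * (z 5 * w 6 - z 6 * w 5) := by
    simp only [inner_eq_sum7]; ring
  rw [add_sub_assoc, key, inner_eq_sum7]
  simp only [starForm, ContinuousAlternatingMap.add_apply, ContinuousAlternatingMap.sub_apply,
    ContinuousAlternatingMap.smul_apply, wedge_four_apply, PiLp.proj_apply, smul_eq_mul,
    cross, Matrix.cons_val]
  -- `cross` contains some minors with reversed indices; they are normalized so that the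
  -- generalizations below catch all of them.
  have e1 (i j) : x j * y i - x i * y j = - (x i * y j - x j * y i) := by ring
  have e2 (i j) : z j * w i - z i * w j = - (z i * w j - z j * w i) := by ring
  rw [e1 0 2, e1 0 4, e1 0 6, e2 0 2, e2 0 4, e2 0 6]
  generalize Real.cos θ = c at *
  generalize Real.sin θ = s at *
  generalize x 0 * y 1 - x 1 * y 0 = p01
  generalize x 0 * y 2 - x 2 * y 0 = p02
  generalize x 0 * y 3 - x 3 * y 0 = p03
  generalize x 0 * y 4 - x 4 * y 0 = p04
  generalize x 0 * y 5 - x 5 * y 0 = p05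
  generalize x 0 * y 6 - x 6 * y 0 = p06
  generalize x 1 * y 2 - x 2 * y 1 = p12
  generalize x 1 * y 3 - x 3 * y 1 = p13
  generalize x 1 * y 4 - x 4 * y 1 = p14
  generalize x 1 * y 5 - x 5 * y 1 = p15
  generalize x 1 * y 6 - x 6 * y 1 = p16
  generalize x 2 * y 3 - x 3 * y 2 = p23
  generalize x 2 * y 4 - x 4 * y 2 = p24
  generalize x 2 * y 5 - x 5 * y 2 = p25
  generalize x 2 * y 6 - x 6 * y 2 = p26
  generalize x 3 * y 4 - x 4 * y 3 = p34
  generalize x 3 * y 5 - x 5 * y 3 = p35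
  generalize x 3 * y 6 - x 6 * y 3 = p36
  generalize x 4 * y 5 - x 5 * y 4 = p45
  generalize x 4 * y 6 - x 6 * y 4 = p46
  generalize x 5 * y 6 - x 6 * y 5 = p56
  generalize z 0 * w 1 - z 1 * w 0 = q01
  generalize z 0 * w 2 - z 2 * w 0 = q02
  generalize z 0 * w 3 - z 3 * w 0 = q03
  generalize z 0 * w 4 - z 4 * w 0 = q04
  generalize z 0 * w 5 - z 5 * w 0 = q05
  generalize z 0 * w 6 - z 6 * w 0 = q06
  generalize z 1 * w 2 - z 2 * w 1 = q12
  generalize z 1 * w 3 - z 3 * w 1 = q13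
  generalize z 1 * w 4 - z 4 * w 1 = q14
  generalize z 1 * w 5 - z 5 * w 1 = q15
  generalize z 1 * w 6 - z 6 * w 1 = q16
  generalize z 2 * w 3 - z 3 * w 2 = q23
  generalize z 2 * w 4 - z 4 * w 2 = q24
  generalize z 2 * w 5 - z 5 * w 2 = q25
  generalize z 2 * w 6 - z 6 * w 2 = q26
  generalize z 3 * w 4 - z 4 * w 3 = q34
  generalize z 3 * w 5 - z 5 * w 3 = q35
  generalize z 3 * w 6 - z 6 * w 3 = q36
  generalize z 4 * w 5 - z 5 * w 4 = q45
  generalize z 4 * w 6 - z 6 * w 4 = q46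
  generalize z 5 * w 6 - z 6 * w 5 = q56
  -- Only sin² θ = 1 - cos² θ remains to be used; its multiplier collects the products of the terms
  -- that carry sin θ in the two cross products.
  linear_combination ((p45 + p36) * (q45 + q36) + (p46 - p35) * (q46 - q35)
    + (p25 + p16) * (q25 + q16) + (p26 - p15) * (q26 - q15) + (p23 + p14) * (q23 + q14)
    + (p24 - p13) * (q24 - q13)) * h

/-! ### Trilinear and quadrilinear calculus -/

section Multilinear

variable {E : Type*} [AddCommGroup E] [Module ℝ E] [TopologicalSpace E]

theorem update_three_zero (x y z w : E) : Function.update ![x, y, z] 0 w = ![w, y, z] := by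
  ext i; fin_cases i <;> rfl

theorem update_three_one (x y z w : E) : Function.update ![x, y, z] 1 w = ![x, w, z] := by
  ext i; fin_cases i <;> rfl

theorem update_three_two (x y z w : E) : Function.update ![x, y, z] 2 w = ![x, y, w] := by
  ext i; fin_cases i <;> rfl

/-- A three-form as an iterated linear map. -/
def curryThree (φ : E [⋀^Fin 3]→L[ℝ] ℝ) : E →ₗ[ℝ] E →ₗ[ℝ] E →ₗ[ℝ] ℝ where
  toFun x :=
    { toFun := fun y =>
        { toFun := fun z => φ ![x, y, z]
          map_add' := fun z z' => by
            simpa only [update_three_two] using φ.map_update_add ![x, y, 0] 2 z z'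
          map_smul' := fun c z => by
            simpa only [update_three_two, RingHom.id_apply] using
              φ.map_update_smul ![x, y, 0] 2 c z }
      map_add' := fun y y' => by
        ext z
        change φ ![x, y + y', z] = φ ![x, y, z] + φ ![x, y', z]
        simpa only [update_three_one] using φ.map_update_add ![x, 0, z] 1 y y'
      map_smul' := fun c y => by
        ext z
        change φ ![x, c • y, z] = c • φ ![x, y, z]
        simpa only [update_three_one] using φ.map_update_smul ![x, 0, z] 1 c y }
  map_add' := fun x x' => by
    ext y z
    change φ ![x + x', y, z] = φ ![x, y, z] + φ ![x', y, z]
    simpa only [update_three_zero] using φ.map_update_add ![0, y, z] 0 x x'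
  map_smul' := fun c x => by
    ext y z
    change φ ![c • x, y, z] = c • φ ![x, y, z]
    simpa only [update_three_zero] using φ.map_update_smul ![0, y, z] 0 c x

theorem curryThree_apply (φ : E [⋀^Fin 3]→L[ℝ] ℝ) (x y z : E) :
    curryThree φ x y z = φ ![x, y, z] := rfl

theorem comp_vec_three {E' : Type*} (f : E → E') (x y z : E) :
    (f ∘ ![x, y, z]) = ![f x, f y, f z] := by
  ext i; fin_cases i <;> rfl

theorem comp_vec_four {E' : Type*} (f : E → E') (x y z w : E) :
    (f ∘ ![x, y, z, w]) = ![f x, f y, f z, f w] := by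
  ext i; fin_cases i <;> rfl

theorem three_swap_left (φ : E [⋀^Fin 3]→L[ℝ] ℝ) (x y z : E) :
    φ ![y, x, z] = -φ ![x, y, z] := by
  have := φ.toAlternatingMap.map_swap ![x, y, z] (i := 0) (j := 1) (by decide)
  rw [← ContinuousAlternatingMap.coe_toAlternatingMap, ← this]
  congr 1
  ext i; fin_cases i <;> rfl

theorem three_swap_right (φ : E [⋀^Fin 3]→L[ℝ] ℝ) (x y z : E) :
    φ ![x, z, y] = -φ ![x, y, z] := by
  have := φ.toAlternatingMap.map_swap ![x, y, z] (i := 1) (j := 2) (by decide)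
  rw [← ContinuousAlternatingMap.coe_toAlternatingMap, ← this]
  congr 1
  ext i; fin_cases i <;> rfl

theorem three_self_left (φ : E [⋀^Fin 3]→L[ℝ] ℝ) (x z : E) : φ ![x, x, z] = 0 := by
  have := three_swap_left φ x x z
  linarith

theorem three_self_right (φ : E [⋀^Fin 3]→L[ℝ] ℝ) (x z : E) : φ ![x, z, z] = 0 := by
  have := three_swap_right φ x z z
  linarith

theorem three_self_outer (φ : E [⋀^Fin 3]→L[ℝ] ℝ) (x z : E) : φ ![x, z, x] = 0 := by
  rw [three_swap_right, three_self_left, neg_zero]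

theorem ext_three {φ ψ : E [⋀^Fin 3]→L[ℝ] ℝ} (h : ∀ x y z, φ ![x, y, z] = ψ ![x, y, z]) :
    φ = ψ := by
  ext v
  have : v = ![v 0, v 1, v 2] := by ext i; fin_cases i <;> rfl
  rw [this]; exact h _ _ _

theorem ext_four {φ ψ : E [⋀^Fin 4]→L[ℝ] ℝ} (h : ∀ x y z w, φ ![x, y, z, w] = ψ ![x, y, z, w]) :
    φ = ψ := by
  ext v
  have : v = ![v 0, v 1, v 2, v 3] := by ext i; fin_cases i <;> rfl
  rw [this]; exact h _ _ _ _

variable {E' : Type*} [AddCommGroup E'] [Module ℝ E'] [TopologicalSpace E']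

theorem comp_three_apply (φ : E' [⋀^Fin 3]→L[ℝ] ℝ) (L : E →L[ℝ] E') (x y z : E) :
    φ.compContinuousLinearMap L ![x, y, z] = φ ![L x, L y, L z] := by
  rw [ContinuousAlternatingMap.compContinuousLinearMap_apply, comp_vec_three]

theorem comp_four_apply (φ : E' [⋀^Fin 4]→L[ℝ] ℝ) (L : E →L[ℝ] E') (x y z w : E) :
    φ.compContinuousLinearMap L ![x, y, z, w] = φ ![L x, L y, L z, L w] := by
  rw [ContinuousAlternatingMap.compContinuousLinearMap_apply, comp_vec_four]

end Multilinear

/-! ### The metric of a `G₂`-form -/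

open Matrix in
/-- The determinant of a skew matrix `A` with `A² = w wᵀ - |w|²` and `A w = 0`, bordered by `η`. -/
theorem det_skew_add_vecMulVec_sq (A : Matrix (Fin 7) (Fin 7) ℝ) (w η : Fin 7 → ℝ)
    (hskew : Aᵀ = -A) (hw : A *ᵥ w = 0) (hsq : A * A = vecMulVec w w - (w ⬝ᵥ w) • 1)
    (hpos : 0 < w ⬝ᵥ w) :
    (A + vecMulVec η η).det ^ 2 = (w ⬝ᵥ w) ^ 4 * (η ⬝ᵥ w) ^ 4 := by
  -- With a fourth root r of |w|² all coefficients below are powers of r.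
  obtain ⟨r, hr, hrr⟩ : ∃ r : ℝ, 0 < r ∧ w ⬝ᵥ w = r ^ 4 :=
    ⟨√√(w ⬝ᵥ w), by positivity, by
      rw [show 4 = 2 * 2 from rfl, pow_mul, Real.sq_sqrt (by positivity), Real.sq_sqrt hpos.le]⟩
  have hw' : w ᵥ* A = 0 := by
    rw [← mulVec_transpose, hskew, neg_mulVec, hw, neg_zero]
  -- Filling the kernel of A makes M a multiple of an orthogonal matrix: M Mᵀ = r⁴, so det M² = r²⁸.
  set M : Matrix (Fin 7) (Fin 7) ℝ := A + (r ^ 2)⁻¹ • vecMulVec w w with hM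
  have hMM : M * Mᵀ = (r ^ 4) • 1 := by
    rw [hM, transpose_add, transpose_smul, transpose_vecMulVec, hskew]
    simp only [add_mul, mul_add, mul_neg, smul_mul_assoc, mul_smul_comm, hsq, mul_vecMulVec,
      vecMulVec_mul, vecMulVec_mulVec, hw, hw', zero_vecMulVec, vecMulVec_zero, smul_zero,
      zero_add, op_smul_eq_smul, hrr, smul_vecMulVec, smul_smul]
    rw [show (r ^ 2)⁻¹ * ((r ^ 2)⁻¹ * r ^ 4) = 1 by field_simp, one_smul]
    abel
  have hdetM : M.det ^ 2 = r ^ 28 := by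
    have := congrArg det hMM
    rw [det_mul, det_transpose, det_smul, det_one, Fintype.card_fin] at this
    rw [sq, this]; ring
  set y : Fin 7 → ℝ := (r ^ 4)⁻¹ • (r • η - w) with hy
  have hη : r • η = w + r ^ 4 • y := by
    rw [hy, smul_smul, mul_inv_cancel₀ (by positivity), one_smul]; abel
  have hyw : 1 + w ⬝ᵥ y = (r ^ 3)⁻¹ * (η ⬝ᵥ w) := by
    rw [hy, dotProduct_smul, dotProduct_sub, dotProduct_smul, hrr, dotProduct_comm w η]
    simp only [smul_eq_mul]
    field_simp
    ring
  -- A + η ηᵀ is congruent to M: since wᵀM = r² wᵀ, the product L M Lᵀ equals A + r⁻² (w + r⁴y)(w +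
  -- r⁴y)ᵀ, and w + r⁴y = r η. The factor L is a rank one perturbation of the identity, so its
  -- determinant is 1 + w · y.
  set L : Matrix (Fin 7) (Fin 7) ℝ := 1 + vecMulVec y w with hL
  have hdetL : L.det = (r ^ 3)⁻¹ * (η ⬝ᵥ w) := by
    rw [hL, vecMulVec_eq Unit, det_one_add_replicateCol_mul_replicateRow, hyw]
  have hLM : A + vecMulVec η η = L * M * Lᵀ := by
    have h1 : vecMulVec η η = (r ^ 2)⁻¹ • vecMulVec (r • η) (r • η) := by
      rw [smul_vecMulVec, vecMulVec_smul, smul_smul, smul_smul]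
      rw [show (r ^ 2)⁻¹ * r * r = 1 by field_simp, one_smul]
    rw [h1, hη, hL, hM, transpose_add, transpose_one, transpose_vecMulVec]
    simp only [add_mul, mul_add, one_mul, mul_one, smul_mul_assoc, mul_smul_comm, mul_vecMulVec,
      vecMulVec_mul, vecMulVec_mul_vecMulVec, hw, hw', zero_vecMulVec, vecMulVec_zero,
      add_zero, zero_add, hrr, add_vecMulVec, vecMulVec_add, vecMulVec_smul, smul_vecMulVec,
      smul_add, vecMul_smul, smul_zero, zero_mul, vecMulVec_mulVec, smul_mulVec]
    simp only [hrr, smul_smul, op_smul_eq_smul, smul_vecMulVec, vecMulVec_smul]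
    module
  rw [hLM, det_mul, det_mul, det_transpose, hdetL]
  calc _ = ((r ^ 3)⁻¹ * (η ⬝ᵥ w)) ^ 4 * M.det ^ 2 := by ring
    _ = _ := by rw [hdetM, hrr]; field_simp

/-- The standard basis of `ℝ⁷`. -/
abbrev bas (i : Fin 7) : V7 := EuclideanSpace.single i 1

theorem bas_apply (i j : Fin 7) : bas i j = if j = i then 1 else 0 := by
  simp [bas]

theorem sum_smul_bas (x : V7) : ∑ i, x i • bas i = x := by
  ext j
  simp [bas, Pi.single_apply]

/-- The matrix of `(x, y) ↦ φ (v, x, y)`. -/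
def sliceMatrix (φ : V7 [⋀^Fin 3]→L[ℝ] ℝ) (v : V7) : Matrix (Fin 7) (Fin 7) ℝ :=
  Matrix.of fun i j => φ ![v, bas i, bas j]

theorem three_eq_sum (φ : V7 [⋀^Fin 3]→L[ℝ] ℝ) (v x y : V7) :
    φ ![v, x, y] = ∑ i, ∑ j, x i * y j * sliceMatrix φ v i j := by
  rw [← curryThree_apply]
  conv_lhs => rw [← sum_smul_bas x, ← sum_smul_bas y]
  simp only [map_sum, map_smul, LinearMap.sum_apply, LinearMap.smul_apply, smul_eq_mul,
    Finset.mul_sum]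
  rw [Finset.sum_comm]
  refine Finset.sum_congr rfl fun i _ => Finset.sum_congr rfl fun j _ => ?_
  rw [curryThree_apply]
  simp only [sliceMatrix, Matrix.of_apply]
  ring

theorem three_eq_sum_right (φ : V7 [⋀^Fin 3]→L[ℝ] ℝ) (v x y : V7) :
    φ ![v, x, y] = ∑ j, y j * φ ![v, x, bas j] := by
  rw [← curryThree_apply]
  conv_lhs => rw [← sum_smul_bas y]
  simp only [map_sum, map_smul, smul_eq_mul, curryThree_apply]

theorem starForm_repeat (θ : ℝ) (x y z : V7) : starForm θ ![x, y, x, z] = 0 :=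
  (starForm θ).map_eq_zero_of_eq _ (i := 0) (j := 2) rfl (by decide)

open Matrix in
-- The case z = x of `inner_cross_cross`; the sign comes from the skewness of the slice.
theorem sliceMatrix_model_sq (θ : ℝ) (w : V7) :
    sliceMatrix (modelForm θ) w * sliceMatrix (modelForm θ) w =
      vecMulVec (fun i => w i) (fun i => w i) - ((fun i => w i) ⬝ᵥ (fun i => w i)) • 1 := by
  ext i j
  have h := inner_cross_cross θ w (bas i) w (bas j)
  rw [starForm_repeat, zero_add] at h
  have h1 : (sliceMatrix (modelForm θ) w * sliceMatrix (modelForm θ) w) i j =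
      -inner ℝ (cross θ w (bas i)) (cross θ w (bas j)) := by
    rw [Matrix.mul_apply, PiLp.inner_apply, ← Finset.sum_neg_distrib]
    refine Finset.sum_congr rfl fun k _ => ?_
    have e (l : Fin 7) : modelForm θ ![w, bas l, bas k] = cross θ w (bas l) k := by
      rw [← inner_cross, bas, EuclideanSpace.inner_single_right]; simp
    simp only [sliceMatrix, Matrix.of_apply]
    rw [three_swap_right (modelForm θ) w (bas j) (bas k), e, e]
    simp [mul_comm]
  rw [h1, h]
  simp only [bas, EuclideanSpace.inner_single_right, EuclideanSpace.inner_single_left,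
    Matrix.sub_apply, vecMulVec_apply, Matrix.smul_apply, Matrix.one_apply, PiLp.inner_apply,
    dotProduct]
  by_cases hij : i = j
  · subst hij; simp; ring_nf
  · simp [hij]; rw [mul_comm]

theorem sliceMatrix_transpose (φ : V7 [⋀^Fin 3]→L[ℝ] ℝ) (w : V7) :
    (sliceMatrix φ w).transpose = -sliceMatrix φ w := by
  ext i j
  simp only [sliceMatrix, Matrix.transpose_apply, Matrix.of_apply, Matrix.neg_apply]
  rw [three_swap_right]

open Matrix in
theorem sliceMatrix_mulVec (φ : V7 [⋀^Fin 3]→L[ℝ] ℝ) (w : V7) :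
    sliceMatrix φ w *ᵥ (fun i => w i) = 0 := by
  ext i
  have := three_eq_sum_right φ w (bas i) w
  rw [three_self_outer] at this
  rw [Pi.zero_apply, this]
  simp only [mulVec, dotProduct, sliceMatrix, Matrix.of_apply]
  exact Finset.sum_congr rfl fun j _ => mul_comm _ _

/-- The matrix of a linear map of `ℝ⁷`. -/
def matrixOf (U : V7 →L[ℝ] V7) : Matrix (Fin 7) (Fin 7) ℝ := Matrix.of fun k i => U (bas i) k

open Matrix in
theorem matrixOf_mulVec (U : V7 →L[ℝ] V7) (x : V7) :
    matrixOf U *ᵥ (fun i => x i) = fun i => U x i := by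
  ext i
  conv_rhs => rw [← sum_smul_bas x]
  simp [matrixOf, mulVec, dotProduct, mul_comm]

open Matrix in
theorem det_matrixOf_ne_zero (U : V7 ≃L[ℝ] V7) : (matrixOf (U : V7 →L[ℝ] V7)).det ≠ 0 := by
  intro h
  obtain ⟨v, hv, hv0⟩ := exists_mulVec_eq_zero_iff.2 h
  have := matrixOf_mulVec (U : V7 →L[ℝ] V7) (WithLp.toLp 2 v)
  change matrixOf (U : V7 →L[ℝ] V7) *ᵥ v = _ at this
  rw [hv0] at this
  have h2 : U (WithLp.toLp 2 v) = 0 := by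
    ext i; exact (congrFun this i).symm
  rw [map_eq_zero_iff _ U.injective] at h2
  exact hv (congrArg WithLp.ofLp h2)

/-- The slice of a three-form, bordered by the vector. -/
def bordered (φ : V7 [⋀^Fin 3]→L[ℝ] ℝ) (v : V7) : ℝ :=
  (Matrix.of fun i j => φ ![v, bas i, bas j] + v i * v j).det

open Matrix in
-- The left side is computed from the form alone, while the right side contains the length of U v:
-- this is how a G₂-form remembers its metric. The slice at v has v in its kernel, whence the
-- bordering. With P the matrix of U and Pᵀη = v, the bordered slice is Pᵀ (A + η ηᵀ) P, where A is
-- the slice of the model form at U v, and η · U v = ⟨v, v⟩.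
theorem bordered_sq (θ : ℝ) (U : V7 ≃L[ℝ] V7) (v : V7) (hv : v ≠ 0) :
    bordered ((modelForm θ).compContinuousLinearMap (U : V7 →L[ℝ] V7)) v ^ 2 =
      (|(matrixOf (U : V7 →L[ℝ] V7)).det| * inner ℝ (U v) (U v) * inner ℝ v v) ^ 4 := by
  set P := matrixOf (U : V7 →L[ℝ] V7) with hP
  have hdet : P.det ≠ 0 := det_matrixOf_ne_zero U
  have hunit : IsUnit Pᵀ.det := by rw [det_transpose]; exact hdet.isUnit
  set w := U v with hw
  set η : Fin 7 → ℝ := Pᵀ⁻¹ *ᵥ (fun i => v i) with hη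
  have hPη : Pᵀ *ᵥ η = fun i => v i := by
    rw [hη, mulVec_mulVec, Matrix.mul_nonsing_inv _ hunit, one_mulVec]
  have hPv : P *ᵥ (fun i => v i) = fun i => w i := matrixOf_mulVec _ v
  have hηw : η ⬝ᵥ (fun i => w i) = inner ℝ v v := by
    rw [← hPv, dotProduct_mulVec, ← mulVec_transpose, hPη, PiLp.inner_apply, dotProduct]
    simp [pow_two]
  have hww : (fun i => w i) ⬝ᵥ (fun i => w i) = inner ℝ w w := by
    rw [PiLp.inner_apply, dotProduct]; simp [pow_two]
  have hw0 : w ≠ 0 := by rw [hw, Ne, map_eq_zero_iff _ U.injective]; exact hv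
  have hM : (Matrix.of fun i j =>
      ((modelForm θ).compContinuousLinearMap (U : V7 →L[ℝ] V7)) ![v, bas i, bas j] + v i * v j) =
      Pᵀ * (sliceMatrix (modelForm θ) w + vecMulVec η η) * P := by
    rw [mul_add, add_mul, mul_vecMulVec, hPη, vecMulVec_mul, ← mulVec_transpose, hPη]
    ext i j
    rw [of_apply, Matrix.add_apply, vecMulVec_apply, comp_three_apply]
    congr 1
    rw [three_eq_sum, Matrix.mul_apply]
    simp only [Matrix.mul_apply, Finset.sum_mul]
    rw [Finset.sum_comm]
    refine Finset.sum_congr rfl fun k _ => Finset.sum_congr rfl fun l _ => ?_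
    simp only [hP, matrixOf, transpose_apply, of_apply]
    change U (bas i) l * U (bas j) k * sliceMatrix (modelForm θ) (U v) l k = _
    simp only [ContinuousLinearEquiv.coe_coe]
    ring
  rw [bordered, hM, det_mul, det_mul, det_transpose]
  have key := det_skew_add_vecMulVec_sq (sliceMatrix (modelForm θ) w) (fun i => w i) η
    (sliceMatrix_transpose _ _) (sliceMatrix_mulVec _ _) (sliceMatrix_model_sq _ _)
    (by rw [hww]; exact real_inner_self_pos.2 hw0)
  rw [hηw, hww] at key
  calc _ = P.det ^ 4 * (sliceMatrix (modelForm θ) w + vecMulVec η η).det ^ 2 := by ring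
    _ = _ := by
      rw [key, mul_pow, mul_pow, show |P.det| ^ 4 = P.det ^ 4 from (by
        rw [show 4 = 2 * 2 from rfl, pow_mul, sq_abs, ← pow_mul])]
      ring

theorem polarization_of_smul_inner {E F : Type*} [NormedAddCommGroup E] [InnerProductSpace ℝ E]
    [NormedAddCommGroup F] [InnerProductSpace ℝ F] (T : E →ₗ[ℝ] F) (c : ℝ)
    (h : ∀ v, c * inner ℝ (T v) (T v) = inner ℝ v v) (x y : E) :
    c * inner ℝ (T x) (T y) = inner ℝ x y := by
  have h1 := h (x + y)
  rw [map_add, inner_add_add_self (𝕜 := ℝ), inner_add_add_self (𝕜 := ℝ),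
    real_inner_comm (T x) (T y), real_inner_comm x y] at h1
  have := h x
  have := h y
  linarith

open Matrix in
theorem matrixOf_gram (U : V7 →L[ℝ] V7) (i j : Fin 7) :
    ((matrixOf U)ᵀ * matrixOf U) i j = inner ℝ (U (bas i)) (U (bas j)) := by
  rw [Matrix.mul_apply, PiLp.inner_apply]
  exact Finset.sum_congr rfl fun k _ => by simp [matrixOf, mul_comm]

/-- A linear map carrying model forms to model forms is an isometry. -/
theorem inner_map_of_model_comp {θ θ' : ℝ} (T : V7 ≃L[ℝ] V7)
    (hT : modelForm θ = (modelForm θ').compContinuousLinearMap (T : V7 →L[ℝ] V7)) (x y : V7) :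
    inner ℝ (T x) (T y) = inner ℝ x y := by
  set δ := |(matrixOf (T : V7 →L[ℝ] V7)).det| with hδ
  have hδ0 : 0 < δ := abs_pos.2 (det_matrixOf_ne_zero T)
  have h1 (v : V7) : δ * inner ℝ (T v) (T v) = inner ℝ v v := by
    by_cases hv : v = 0
    · simp [hv]
    have hv' := real_inner_self_pos.2 hv
    -- The bordered determinant of the same form is computed through T and through the identity;
    -- taking fourth roots gives δ |T v|² = |v|².
    have e1 := bordered_sq θ' T v hv
    have e2 := bordered_sq θ (ContinuousLinearEquiv.refl ℝ V7) v hv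
    have e3 : matrixOf ((ContinuousLinearEquiv.refl ℝ V7 : V7 ≃L[ℝ] V7) : V7 →L[ℝ] V7) = 1 := by
      ext i j; simp [matrixOf, Matrix.one_apply, bas_apply, Pi.single_apply]
    have e4 : (modelForm θ).compContinuousLinearMap
        ((ContinuousLinearEquiv.refl ℝ V7 : V7 ≃L[ℝ] V7) : V7 →L[ℝ] V7) = modelForm θ := by
      ext v; rfl
    rw [e4, e3, Matrix.det_one, abs_one, one_mul, hT, e1, ← hδ] at e2
    have e5 := (pow_left_inj₀ (mul_nonneg (mul_nonneg hδ0.le real_inner_self_nonneg) hv'.le)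
      (mul_nonneg hv'.le hv'.le) (by norm_num)).1 e2
    exact mul_right_cancel₀ hv'.ne' e5
  have h2 := polarization_of_smul_inner (T : V7 →ₗ[ℝ] V7) δ h1
  have h3 : δ • ((matrixOf (T : V7 →L[ℝ] V7)).transpose * matrixOf (T : V7 →L[ℝ] V7)) = 1 := by
    ext i j
    rw [Matrix.smul_apply, matrixOf_gram, smul_eq_mul]
    refine (h2 (bas i) (bas j)).trans ?_
    simp [bas, Matrix.one_apply, EuclideanSpace.inner_single_left, Pi.single_apply]
  -- The determinant of the Gram relation reads δ⁷ δ² = 1, so that δ = 1.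
  have h4 := congrArg Matrix.det h3
  rw [Matrix.det_smul, Matrix.det_mul, Matrix.det_transpose, Matrix.det_one, Fintype.card_fin,
    ← sq, ← sq_abs, ← hδ, ← pow_add] at h4
  have h5 : δ = 1 := (pow_eq_one_iff_of_nonneg hδ0.le (by norm_num)).1 h4
  have := h2 x y
  rwa [h5, one_mul] at this

theorem cross_map_of_model_comp {θ θ' : ℝ} (T : V7 ≃L[ℝ] V7)
    (hT : modelForm θ = (modelForm θ').compContinuousLinearMap (T : V7 →L[ℝ] V7)) (x y : V7) :
    T (cross θ x y) = cross θ' (T x) (T y) := by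
  refine ext_inner_right ℝ fun z => ?_
  obtain ⟨z, rfl⟩ := T.surjective z
  rw [inner_map_of_model_comp T hT, inner_cross, inner_cross, hT, comp_three_apply]
  rfl

/-- By `inner_cross_cross` the dual is built from the inner and cross products, and T respects both.
-/
theorem starForm_of_model_comp {θ θ' : ℝ} (T : V7 ≃L[ℝ] V7)
    (hT : modelForm θ = (modelForm θ').compContinuousLinearMap (T : V7 →L[ℝ] V7)) :
    starForm θ = (starForm θ').compContinuousLinearMap (T : V7 →L[ℝ] V7) := by
  refine ext_four fun x y z w => ?_
  have h1 := inner_cross_cross θ x y z w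
  have h2 := inner_cross_cross θ' (T x) (T y) (T z) (T w)
  simp only [← cross_map_of_model_comp T hT, inner_map_of_model_comp T hT] at h2
  rw [comp_four_apply]
  change _ = starForm θ' ![T x, T y, T z, T w]
  linarith

section Forms

variable {E : Type*} [AddCommGroup E] [Module ℝ E] [TopologicalSpace E]

theorem model_comp_of_adapted {φ : E [⋀^Fin 3]→L[ℝ] ℝ} {u u' : E ≃L[ℝ] V7} {θ θ' : ℝ}
    (h : φ = (modelForm θ).compContinuousLinearMap (u : E →L[ℝ] V7))
    (h' : φ = (modelForm θ').compContinuousLinearMap (u' : E →L[ℝ] V7)) :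
    modelForm θ = (modelForm θ').compContinuousLinearMap
      ((u.symm.trans u' : V7 ≃L[ℝ] V7) : V7 →L[ℝ] V7) := by
  refine ext_three fun x y z => ?_
  have e := congrArg (fun f => f ![u.symm x, u.symm y, u.symm z]) (h.symm.trans h')
  simp only [comp_three_apply, ContinuousLinearEquiv.coe_coe,
    ContinuousLinearEquiv.apply_symm_apply] at e
  rw [comp_three_apply]
  exact e

theorem g2Metric_eq {φ : E [⋀^Fin 3]→L[ℝ] ℝ} {u : E ≃L[ℝ] V7} (hu : IsAdapted φ u) (v w : E) :
    g2Metric φ v w = inner ℝ (u v) (u w) := by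
  have hex : ∃ u : E ≃L[ℝ] V7, IsAdapted φ u := ⟨u, hu⟩
  rw [g2Metric, dif_pos hex]
  obtain ⟨θ', h'⟩ := hex.choose_spec
  obtain ⟨θ, h⟩ := hu
  have := inner_map_of_model_comp _ (model_comp_of_adapted h h') (u v) (u w)
  simpa using this

/-- The cross product of independent vectors does not vanish, because |x × y|² is their Gram
determinant. This is the nondegeneracy of G₂-forms used against degenerate candidates later on. -/
theorem exists_ne_zero_of_linearIndependent {φ : E [⋀^Fin 3]→L[ℝ] ℝ} (hφ : IsG2Form φ) {v w : E}
    (h : ∀ a b : ℝ, a • v + b • w = 0 → a = 0 ∧ b = 0) : ∃ z, φ ![v, w, z] ≠ 0 := by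
  obtain ⟨u, θ, hu⟩ := hφ
  by_contra! hz
  have h0 : cross θ (u v) (u w) = 0 := by
    refine ext_inner_right ℝ fun z => ?_
    have := hz (u.symm z)
    rw [hu, comp_three_apply] at this
    rw [inner_cross, inner_zero_left]
    simpa using this
  have h1 := inner_cross_cross θ (u v) (u w) (u v) (u w)
  rw [h0, starForm_repeat, inner_zero_left] at h1
  -- The equality case of the Cauchy–Schwarz inequality: the square of the length of this vector is
  -- |u w|² times the vanishing Gram determinant.
  have h2 : inner ℝ (u w) (u w) • u v - inner ℝ (u v) (u w) • u w = 0 := by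
    rw [← inner_self_eq_zero (𝕜 := ℝ)]
    simp only [inner_sub_left, inner_sub_right, inner_smul_left, inner_smul_right,
      real_inner_comm (u v) (u w), conj_trivial]
    rw [real_inner_comm (u v) (u w)] at h1
    linear_combination (-inner ℝ (u w) (u w)) * h1
  have h3 : inner ℝ (u w) (u w) • v + (-inner ℝ (u v) (u w)) • w = 0 := by
    apply u.injective
    rw [map_add, map_smul, map_smul, neg_smul, ← sub_eq_add_neg, h2, map_zero]
  have h4 := (h _ _ h3).1
  rw [inner_self_eq_zero, map_eq_zero_iff _ u.injective] at h4
  exact one_ne_zero (h 0 1 (by rw [h4]; simp)).2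

end Forms

/-! ### The Hodge dual -/

open Matrix in
/-- Complementary blocks of a permutation matrix have equal determinants, up to the sign. -/
theorem det_complementary_block {m n : Type*} [Fintype m] [Fintype n] [DecidableEq m]
    [DecidableEq n] (ρ : Equiv.Perm (m ⊕ n)) :
    (Matrix.of fun i j : n => if Sum.inr i = ρ (Sum.inr j) then (1 : ℤ) else 0).det =
      Equiv.Perm.sign ρ *
        (Matrix.of fun i j : m => if Sum.inl i = ρ (Sum.inl j) then (1 : ℤ) else 0).det := by
  -- If ρ carries an index of the first block into the second, both blocks are degenerate: one has a
  -- zero column, the other a zero row.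
  by_cases h : ∃ (i : m) (j : n), ρ (Sum.inl i) = Sum.inr j
  · obtain ⟨i, j, hij⟩ := h
    rw [det_eq_zero_of_row_eq_zero j, det_eq_zero_of_column_eq_zero i, mul_zero]
    · intro k; simp [hij]
    · intro k
      rw [of_apply, if_neg]
      intro h
      have := ρ.injective (hij.trans h)
      simp at this
  push Not at h
  set A : Matrix m m ℤ := Matrix.of fun i j : m => if Sum.inl i = ρ (Sum.inl j) then (1 : ℤ) else 0
  set D : Matrix n n ℤ := Matrix.of fun i j : n => if Sum.inr i = ρ (Sum.inr j) then (1 : ℤ) else 0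
  set B : Matrix m n ℤ := Matrix.of fun i j => if Sum.inl i = ρ (Sum.inr j) then (1 : ℤ) else 0
  -- Otherwise the permutation matrix is block triangular, so the sign of ρ is the product of the
  -- two block determinants.
  have hP : (ρ⁻¹).permMatrix ℤ = fromBlocks A B 0 D := by
    have hent (i j : m ⊕ n) : (ρ⁻¹).permMatrix ℤ i j = if i = ρ j then (1 : ℤ) else 0 := by
      simp only [Equiv.Perm.permMatrix, PEquiv.toMatrix_apply, Equiv.toPEquiv_apply,
        Option.mem_some_iff]
      exact if_congr Equiv.Perm.inv_eq_iff_eq rfl rfl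
    ext i j
    rw [hent]
    rcases i with i | i <;> rcases j with j | j <;> simp [A, B, D]
    exact fun e => h _ _ e.symm
  have hdet := congrArg det hP
  rw [det_permutation, det_fromBlocks_zero₂₁, Equiv.Perm.sign_inv] at hdet
  -- The determinant of A is a unit of ℤ, hence its own inverse.
  have hA : A.det * A.det = 1 := by
    have h1 : IsUnit (A.det * D.det) := by
      rw [← hdet]; exact (Equiv.Perm.sign ρ).isUnit
    rcases Int.isUnit_iff.1 (isUnit_of_mul_isUnit_left h1) with h | h <;> rw [h] <;> norm_num
  calc D.det = A.det * A.det * D.det := by rw [hA, one_mul]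
    _ = A.det * D.det * A.det := by ring
    _ = _ := by rw [← hdet]; rfl

theorem IsHodgeDual.add {η η' : V7 [⋀^Fin 3]→L[ℝ] ℝ} {ψ ψ' : V7 [⋀^Fin 4]→L[ℝ] ℝ}
    (h : IsHodgeDual η ψ) (h' : IsHodgeDual η' ψ') : IsHodgeDual (η + η') (ψ + ψ') := by
  intro σ
  rw [ContinuousAlternatingMap.add_apply, ContinuousAlternatingMap.add_apply, h σ, h' σ, mul_add]

theorem IsHodgeDual.smul {η : V7 [⋀^Fin 3]→L[ℝ] ℝ} {ψ : V7 [⋀^Fin 4]→L[ℝ] ℝ}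
    (h : IsHodgeDual η ψ) (c : ℝ) : IsHodgeDual (c • η) (c • ψ) := by
  intro σ
  rw [ContinuousAlternatingMap.smul_apply, ContinuousAlternatingMap.smul_apply, h σ]
  simp only [smul_eq_mul]; ring

theorem IsHodgeDual.sub {η η' : V7 [⋀^Fin 3]→L[ℝ] ℝ} {ψ ψ' : V7 [⋀^Fin 4]→L[ℝ] ℝ}
    (h : IsHodgeDual η ψ) (h' : IsHodgeDual η' ψ') : IsHodgeDual (η - η') (ψ - ψ') := by
  intro σ
  rw [ContinuousAlternatingMap.sub_apply, ContinuousAlternatingMap.sub_apply, h σ, h' σ, mul_sub]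

/-- Coordinate forms of complementary degrees are Hodge dual up to the sign. -/
theorem isHodgeDual_wedge (τ : Equiv.Perm (Fin 7)) :
    IsHodgeDual
      (wedge ![EuclideanSpace.proj (τ 0), EuclideanSpace.proj (τ 1), EuclideanSpace.proj (τ 2)])
      (((Equiv.Perm.sign τ : ℤ) : ℝ) • wedge ![EuclideanSpace.proj (τ 3),
        EuclideanSpace.proj (τ 4), EuclideanSpace.proj (τ 5), EuclideanSpace.proj (τ 6)]) := by
  intro σ
  let e : Fin 3 ⊕ Fin 4 ≃ Fin 7 := finSumFinEquiv (m := 3) (n := 4)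
  -- The value of a coordinate form numbered by τ on basis vectors numbered by σ is the determinant
  -- of a diagonal block of the permutation matrix of τ⁻¹σ. The degrees 3 and 4 give the two
  -- complementary blocks.
  set ρ : Equiv.Perm (Fin 3 ⊕ Fin 4) := e.trans ((τ⁻¹ * σ).trans e.symm) with hρ
  have hsign : Equiv.Perm.sign ρ = Equiv.Perm.sign τ * Equiv.Perm.sign σ := by
    have : ρ = e.symm.permCongr (τ⁻¹ * σ) := by ext x; rfl
    rw [this, Equiv.Perm.sign_permCongr, map_mul, Equiv.Perm.sign_inv]
  have hent (i j : Fin 3 ⊕ Fin 4) : i = ρ j ↔ τ (e i) = σ (e j) := by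
    rw [hρ, Equiv.trans_apply, Equiv.trans_apply, Equiv.eq_symm_apply, Equiv.Perm.mul_apply,
      Equiv.Perm.eq_inv_iff_eq]
  have key := det_complementary_block ρ
  rw [hsign] at key
  have h3 : wedge ![EuclideanSpace.proj (τ 0), EuclideanSpace.proj (τ 1), EuclideanSpace.proj (τ 2)]
      ![bas (σ 0), bas (σ 1), bas (σ 2)] =
      ((Matrix.of fun i j : Fin 3 =>
        if Sum.inl i = ρ (Sum.inl j) then (1 : ℤ) else 0).det : ℝ) := by
    rw [Int.cast_det, ← Matrix.det_transpose]
    change Matrix.det (Matrix.of fun (j i : Fin 3) => _) = _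
    congr 1
    ext j i
    simp only [Matrix.transpose_apply, Matrix.map_apply, Matrix.of_apply, hent, Int.cast_ite,
      Int.cast_one, Int.cast_zero]
    fin_cases i <;> fin_cases j <;> simp [bas_apply, Pi.single_apply] <;> rfl
  have h4 : wedge ![EuclideanSpace.proj (τ 3), EuclideanSpace.proj (τ 4),
        EuclideanSpace.proj (τ 5), EuclideanSpace.proj (τ 6)]
      ![bas (σ 3), bas (σ 4), bas (σ 5), bas (σ 6)] =
      ((Matrix.of fun i j : Fin 4 =>
        if Sum.inr i = ρ (Sum.inr j) then (1 : ℤ) else 0).det : ℝ) := by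
    rw [Int.cast_det, ← Matrix.det_transpose]
    change Matrix.det (Matrix.of fun (j i : Fin 4) => _) = _
    congr 1
    ext j i
    simp only [Matrix.transpose_apply, Matrix.map_apply, Matrix.of_apply, hent, Int.cast_ite,
      Int.cast_one, Int.cast_zero]
    fin_cases i <;> fin_cases j <;> simp [bas_apply, Pi.single_apply] <;> rfl
  rw [ContinuousAlternatingMap.smul_apply, h3, h4, key, smul_eq_mul]
  have hs : ((Equiv.Perm.sign τ : ℤ) : ℝ) * ((Equiv.Perm.sign τ : ℤ) : ℝ) = 1 := by
    norm_cast; exact Int.units_coe_mul_self _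
  rw [Units.val_mul, Int.cast_mul, Int.cast_mul, ← mul_assoc, ← mul_assoc, hs, one_mul]

/-- `isHodgeDual_wedge` for a permutation given by the tables of its values and inverse values. -/
theorem isHodgeDual_wedge_table (f g : Fin 7 → Fin 7) (h₁ : Function.LeftInverse g f)
    (h₂ : Function.RightInverse g f) (s : ℤ)
    (hs : (Equiv.Perm.sign (⟨f, g, h₁, h₂⟩ : Equiv.Perm (Fin 7)) : ℤ) = s) :
    IsHodgeDual
      (wedge ![EuclideanSpace.proj (f 0), EuclideanSpace.proj (f 1), EuclideanSpace.proj (f 2)])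
      ((s : ℝ) • wedge ![EuclideanSpace.proj (f 3), EuclideanSpace.proj (f 4),
        EuclideanSpace.proj (f 5), EuclideanSpace.proj (f 6)]) := by
  subst hs
  exact isHodgeDual_wedge ⟨f, g, h₁, h₂⟩

theorem isHodgeDual_model (θ : ℝ) : IsHodgeDual (modelForm θ) (starForm θ) := by
  have w1 := isHodgeDual_wedge_table ![1,2,0,3,4,5,6] ![2,0,1,3,4,5,6] (by decide) (by decide)
    (1) (by decide)
  have w2 := isHodgeDual_wedge_table ![3,4,0,1,2,5,6] ![2,3,4,0,1,5,6] (by decide) (by decide)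
    (1) (by decide)
  have w3 := isHodgeDual_wedge_table ![5,6,0,1,2,3,4] ![2,3,4,5,6,0,1] (by decide) (by decide)
    (1) (by decide)
  have a1 := isHodgeDual_wedge_table ![2,4,6,0,1,3,5] ![3,4,0,5,1,6,2] (by decide) (by decide)
    (-1) (by decide)
  have a2 := isHodgeDual_wedge_table ![2,3,5,0,1,4,6] ![3,4,0,1,5,2,6] (by decide) (by decide)
    (-1) (by decide)
  have a3 := isHodgeDual_wedge_table ![1,4,5,0,2,3,6] ![3,0,4,5,1,2,6] (by decide) (by decide)
    (-1) (by decide)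
  have a4 := isHodgeDual_wedge_table ![1,3,6,0,2,4,5] ![3,0,4,1,5,6,2] (by decide) (by decide)
    (-1) (by decide)
  have b1 := isHodgeDual_wedge_table ![1,3,5,0,2,4,6] ![3,0,4,1,5,2,6] (by decide) (by decide)
    (1) (by decide)
  have b2 := isHodgeDual_wedge_table ![1,4,6,0,2,3,5] ![3,0,4,5,1,6,2] (by decide) (by decide)
    (1) (by decide)
  have b3 := isHodgeDual_wedge_table ![2,3,6,0,1,4,5] ![3,4,0,1,5,6,2] (by decide) (by decide)
    (1) (by decide)
  have b4 := isHodgeDual_wedge_table ![2,4,5,0,1,3,6] ![3,4,0,5,1,2,6] (by decide) (by decide)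
    (1) (by decide)
  have h := ((w1.add (w2.add w3)).add ((((a1.sub a2).sub a3).sub a4).smul (Real.cos θ))).add
    ((((b1.sub b2).sub b3).sub b4).smul (Real.sin θ))
  convert h using 1
  · simp only [modelForm, omegaOneForm, omegaTwoForm, alphaForm, betaForm, Matrix.cons_val]
  · refine ext_four fun x y z w => ?_
    simp only [starForm, ContinuousAlternatingMap.add_apply, ContinuousAlternatingMap.sub_apply,
      ContinuousAlternatingMap.smul_apply, smul_eq_mul, Matrix.cons_val, Int.cast_neg, Int.cast_one]
    ring

theorem IsHodgeDual.unique {η : V7 [⋀^Fin 3]→L[ℝ] ℝ} {ψ ψ' : V7 [⋀^Fin 4]→L[ℝ] ℝ}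
    (h : IsHodgeDual η ψ) (h' : IsHodgeDual η ψ') : ψ = ψ' := by
  apply ContinuousAlternatingMap.toAlternatingMap_injective
  refine (EuclideanSpace.basisFun (Fin 7) ℝ).toBasis.ext_alternating fun v hv => ?_
  let k : Fin 4 → Fin 7 := Fin.natAdd 3
  have hk : Function.Injective k := fun a b hab => by
    have := congrArg Fin.val hab
    simp only [k, Fin.val_natAdd] at this
    exact Fin.ext (by omega)
  have hcard : Fintype.card (Fin 7) = (Finset.univ : Finset (Fin 7)).card := by simp
  -- The four distinct indices v are extended to a permutation of all seven that takes 3, 4, 5, 6 to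
  -- them, since duality is stated for permutations.
  obtain ⟨g, hg⟩ := Finset.exists_equiv_extend_of_card_eq hcard
    (s := Finset.univ.image k) (f := fun a => v (Function.invFun k a)) (Finset.subset_univ _) (by
      intro a ha b hb hab
      simp only [Finset.coe_image, Finset.coe_univ, Set.image_univ, Set.mem_range] at ha hb
      obtain ⟨a, rfl⟩ := ha
      obtain ⟨b, rfl⟩ := hb
      have := hv hab
      rw [Function.leftInverse_invFun hk, Function.leftInverse_invFun hk] at this
      rw [this])
  let σ : Equiv.Perm (Fin 7) := g.trans (Equiv.subtypeUnivEquiv (fun x => Finset.mem_univ x))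
  have hσ (i : Fin 4) : σ (k i) = v i := by
    have := hg (k i) (Finset.mem_image_of_mem _ (Finset.mem_univ i))
    rw [Function.leftInverse_invFun hk] at this
    exact this
  have e : (fun i => (EuclideanSpace.basisFun (Fin 7) ℝ).toBasis (v i)) =
      ![bas (σ 3), bas (σ 4), bas (σ 5), bas (σ 6)] := by
    ext1 i
    rw [← hσ]
    simp only [OrthonormalBasis.coe_toBasis, EuclideanSpace.basisFun_apply]
    fin_cases i <;> rfl
  rw [e]
  exact (h σ).trans (h' σ).symm

section Forms

variable {E : Type*} [AddCommGroup E] [Module ℝ E] [TopologicalSpace E]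

/-- Two adapted frames differ by a map carrying one model form to another, hence one `starForm` to
another. So the dual may be computed in a single adapted frame, whichever is at hand. -/
theorem isG2Dual_iff {φ : E [⋀^Fin 3]→L[ℝ] ℝ} {ψ : E [⋀^Fin 4]→L[ℝ] ℝ} {u : E ≃L[ℝ] V7} {θ : ℝ}
    (h : φ = (modelForm θ).compContinuousLinearMap (u : E →L[ℝ] V7)) :
    IsG2Dual φ ψ ↔ ψ = (starForm θ).compContinuousLinearMap (u : E →L[ℝ] V7) := by
  have key {u' : E ≃L[ℝ] V7} {θ' : ℝ}
      (h' : φ = (modelForm θ').compContinuousLinearMap (u' : E →L[ℝ] V7)) :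
      φ.compContinuousLinearMap (u'.symm : V7 →L[ℝ] E) = modelForm θ' := by
    rw [h']
    refine ext_three fun x y z => ?_
    simp only [comp_three_apply, ContinuousLinearEquiv.coe_coe,
      ContinuousLinearEquiv.apply_symm_apply]
  constructor
  · rintro ⟨u', ⟨θ', h'⟩, hd⟩
    rw [key h'] at hd
    have h1 := hd.unique (isHodgeDual_model θ')
    have h2 := starForm_of_model_comp _ (model_comp_of_adapted h h')
    rw [h2, ← h1]
    refine ext_four fun x y z w => ?_
    simp only [comp_four_apply, ContinuousLinearEquiv.coe_coe, ContinuousLinearEquiv.trans_apply,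
      ContinuousLinearEquiv.apply_symm_apply, ContinuousLinearEquiv.symm_apply_apply]
  · intro hψ
    refine ⟨u, ⟨θ, h⟩, ?_⟩
    rw [key h]
    convert isHodgeDual_model θ using 1
    rw [hψ]
    refine ext_four fun x y z w => ?_
    simp only [comp_four_apply, ContinuousLinearEquiv.coe_coe, ContinuousLinearEquiv.trans_apply,
      ContinuousLinearEquiv.apply_symm_apply, ContinuousLinearEquiv.symm_apply_apply]

end Forms

/-! ### The metric depends smoothly on the form -/

/-- Up to a factor that does not depend on `v`, the square of the length of `v ≠ 0`. -/
def weightedNormSq (φ : V7 [⋀^Fin 3]→L[ℝ] ℝ) (v : V7) : ℝ :=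
  (bordered φ v ^ 2) ^ (4⁻¹ : ℝ) / inner ℝ v v

/-- The polarization of `weightedNormSq`, on the standard basis. -/
def weightedGram (φ : V7 [⋀^Fin 3]→L[ℝ] ℝ) : Matrix (Fin 7) (Fin 7) ℝ :=
  Matrix.of fun i j => (weightedNormSq φ (bas i + bas j) - weightedNormSq φ (bas i)
    - weightedNormSq φ (bas j)) / 2

/-- The Gram matrix of the metric, as an explicit function of the form. -/
def gram (φ : V7 [⋀^Fin 3]→L[ℝ] ℝ) (i j : Fin 7) : ℝ :=
  weightedGram φ i j / (weightedGram φ).det ^ (9⁻¹ : ℝ)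

theorem bas_ne_zero (i : Fin 7) : bas i ≠ 0 := by simp [bas]

theorem bas_add_bas_ne_zero (i j : Fin 7) : bas i + bas j ≠ 0 := by
  intro h
  have := congrArg (fun x : V7 => x i) h
  by_cases hij : i = j
  · subst hij; simp [bas] at this
  · simp [bas, Pi.single_apply, hij] at this

section Gram

variable {φ : V7 [⋀^Fin 3]→L[ℝ] ℝ} {θ : ℝ} {U : V7 ≃L[ℝ] V7}

theorem weightedNormSq_eq
    (h : φ = (modelForm θ).compContinuousLinearMap (U : V7 →L[ℝ] V7)) {v : V7} (hv : v ≠ 0) : weightedNormSq φ v =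
    |(matrixOf (U : V7 →L[ℝ] V7)).det| * inner ℝ (U v) (U v) := by
  have h1 : 0 ≤ |(matrixOf (U : V7 →L[ℝ] V7)).det| * inner ℝ (U v) (U v) * inner ℝ v v :=
    mul_nonneg (mul_nonneg (abs_nonneg _) real_inner_self_nonneg) real_inner_self_nonneg
  rw [weightedNormSq, h, bordered_sq θ U v hv, ← Real.rpow_natCast, ← Real.rpow_mul h1]
  norm_num
  rw [mul_div_assoc, div_self (pow_ne_zero _ (norm_ne_zero_iff.2 hv)), mul_one]

theorem weightedGram_eq
    (h : φ = (modelForm θ).compContinuousLinearMap (U : V7 →L[ℝ] V7)) :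
    weightedGram φ = |(matrixOf (U : V7 →L[ℝ] V7)).det| •
    ((matrixOf (U : V7 →L[ℝ] V7)).transpose * matrixOf (U : V7 →L[ℝ] V7)) := by
  ext i j
  rw [Matrix.smul_apply, matrixOf_gram, weightedGram, Matrix.of_apply,
    weightedNormSq_eq h (bas_ne_zero i), weightedNormSq_eq h (bas_ne_zero j),
    weightedNormSq_eq h (bas_add_bas_ne_zero i j), map_add, inner_add_add_self (𝕜 := ℝ),
    real_inner_comm (U (bas i)) (U (bas j))]
  simp only [smul_eq_mul, ContinuousLinearEquiv.coe_coe]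
  ring

/-- The exponent is 7 + 2: seven from the scalar factor of a 7 × 7 matrix, two from det (PᵀP). This
explains the ninth root in `gram`. -/
theorem det_weightedGram_eq
    (h : φ = (modelForm θ).compContinuousLinearMap (U : V7 →L[ℝ] V7)) :
    (weightedGram φ).det = |(matrixOf (U : V7 →L[ℝ] V7)).det| ^ 9 := by
  rw [weightedGram_eq h, Matrix.det_smul, Matrix.det_mul, Matrix.det_transpose, Fintype.card_fin,
    ← sq, ← sq_abs, ← pow_add]

theorem gram_eq
    (h : φ = (modelForm θ).compContinuousLinearMap (U : V7 →L[ℝ] V7)) (i j : Fin 7) : gram φ i j = inner ℝ (U (bas i)) (U (bas j)) := by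
  have h0 := abs_pos.2 (det_matrixOf_ne_zero U)
  rw [gram, det_weightedGram_eq h, weightedGram_eq h, Matrix.smul_apply, matrixOf_gram,
    ← Real.rpow_natCast, ← Real.rpow_mul h0.le]
  norm_num
  rw [mul_div_assoc, mul_comm, div_mul_cancel₀ _ h0.ne']

end Gram

theorem IsG2Form.g2Metric_eq_gram {φ : V7 [⋀^Fin 3]→L[ℝ] ℝ} (hφ : IsG2Form φ) (x y : V7) :
    g2Metric φ x y = ∑ i, ∑ j, x i * y j * gram φ i j := by
  obtain ⟨U, θ, h⟩ := hφ
  rw [g2Metric_eq ⟨θ, h⟩]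
  conv_lhs => rw [← sum_smul_bas x, ← sum_smul_bas y]
  simp only [map_sum, map_smul, sum_inner, inner_sum, inner_smul_left, inner_smul_right,
    gram_eq h, conj_trivial, Finset.mul_sum]
  rw [Finset.sum_comm]
  refine Finset.sum_congr rfl fun i _ => Finset.sum_congr rfl fun j _ => ?_
  ring

section Smooth

variable {E : Type*} [NormedAddCommGroup E] [NormedSpace ℝ E]

theorem contDiffAt_det {n : ℕ} {r : WithTop ℕ∞} {A : E → Matrix (Fin n) (Fin n) ℝ} {x : E}
    (hA : ∀ i j, ContDiffAt ℝ r (fun y => A y i j) x) : ContDiffAt ℝ r (fun y => (A y).det) x := by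
  simp only [Matrix.det_apply]
  exact ContDiffAt.sum fun σ _ => (contDiffAt_prod fun i _ => hA _ _).const_smul _

/-- Only the value at x has to be a G₂-form: `gram` is made of polynomials and of real powers of
quantities that do not vanish at x. -/
theorem contDiffAt_gram {r : WithTop ℕ∞} {η : E → V7 [⋀^Fin 3]→L[ℝ] ℝ} {x : E}
    (hη : ∀ v, ContDiffAt ℝ r (fun y => η y v) x) (hG : IsG2Form (η x)) (i j : Fin 7) :
    ContDiffAt ℝ r (fun y => gram (η y) i j) x := by
  obtain ⟨U, θ, h⟩ := hG
  have h0 := abs_pos.2 (det_matrixOf_ne_zero U)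
  have hn (v : V7) (hv : v ≠ 0) : ContDiffAt ℝ r (fun y => weightedNormSq (η y) v) x := by
    have hb : ContDiffAt ℝ r (fun y => bordered (η y) v) x :=
      contDiffAt_det fun i j => (hη _).add contDiffAt_const
    have h1 : bordered (η x) v ^ 2 ≠ 0 := by
      rw [h, bordered_sq θ U v hv]
      have h2 := real_inner_self_pos.2 hv
      have h3 : 0 < inner ℝ (U v) (U v) :=
        real_inner_self_pos.2 (by rw [Ne, map_eq_zero_iff _ U.injective]; exact hv)
      positivity
    exact ((hb.pow 2).rpow_const_of_ne h1).div_const _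
  have hg (i j : Fin 7) : ContDiffAt ℝ r (fun y => weightedGram (η y) i j) x :=
    (((hn _ (bas_add_bas_ne_zero i j)).sub (hn _ (bas_ne_zero i))).sub
      (hn _ (bas_ne_zero j))).div_const _
  have hd : (weightedGram (η x)).det ≠ 0 := by
    rw [det_weightedGram_eq h]; positivity
  refine (hg i j).div ((contDiffAt_det hg).rpow_const_of_ne hd) ?_
  rw [det_weightedGram_eq h]; positivity

end Smooth

/-! ### The Lie algebra `sp(2)` and the adjoint action -/

theorem toMat_injective : Function.Injective toMat := Subtype.val_injective

theorem star_toMat (X : sp2) : star (toMat X) = -toMat X := X.2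

/-- The skew-Hermitian part of a quaternionic matrix. -/
def skewPart : Matrix (Fin 2) (Fin 2) ℍ[ℝ] →ₗ[ℝ] sp2 where
  toFun M := (⟨(2⁻¹ : ℝ) • (M - star M), by
    change star ((2⁻¹ : ℝ) • (M - star M)) = -((2⁻¹ : ℝ) • (M - star M))
    ext i j <;> simp [Matrix.star_apply] <;> ring⟩ : sp2Submodule)
  map_add' M N := Subtype.ext (by
    change (2⁻¹ : ℝ) • (M + N - star (M + N)) = (2⁻¹ : ℝ) • (M - star M) + (2⁻¹ : ℝ) • (N - star N)
    rw [star_add]; module)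
  map_smul' c M := Subtype.ext (by
    change (2⁻¹ : ℝ) • (c • M - star (c • M)) = c • ((2⁻¹ : ℝ) • (M - star M))
    ext i j <;> simp [Matrix.star_apply] <;> ring)

theorem toMat_skewPart (M : Matrix (Fin 2) (Fin 2) ℍ[ℝ]) :
    toMat (skewPart M) = (2⁻¹ : ℝ) • (M - star M) := rfl

theorem skewPart_toMat (X : sp2) : skewPart (toMat X) = X := by
  apply toMat_injective
  rw [toMat_skewPart, star_toMat]; module

/-- The adjoint action of `Sp(2)`. -/
def Ad (a : Sp2) : sp2 →ₗ[ℝ] sp2 :=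
  skewPart ∘ₗ LinearMap.mulLeftRight ℝ
    ((a : Matrix (Fin 2) (Fin 2) ℍ[ℝ]), star (a : Matrix (Fin 2) (Fin 2) ℍ[ℝ])) ∘ₗ toMat

theorem toMat_Ad (a : Sp2) (X : sp2) : toMat (Ad a X) =
    (a : Matrix (Fin 2) (Fin 2) ℍ[ℝ]) * toMat X * star (a : Matrix (Fin 2) (Fin 2) ℍ[ℝ]) := by
  change (2⁻¹ : ℝ) • ((a : Matrix (Fin 2) (Fin 2) ℍ[ℝ]) * toMat X * star (a : Matrix (Fin 2) (Fin 2) ℍ[ℝ]) -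
    star ((a : Matrix (Fin 2) (Fin 2) ℍ[ℝ]) * toMat X * star (a : Matrix (Fin 2) (Fin 2) ℍ[ℝ]))) = _
  rw [star_mul, star_mul, star_star, star_toMat, neg_mul, mul_neg, ← mul_assoc]
  module

theorem Ad_mul (a b : Sp2) (X : sp2) : Ad (a * b) X = Ad a (Ad b X) := by
  apply toMat_injective
  simp only [toMat_Ad, Submonoid.coe_mul, star_mul, mul_assoc]

theorem Ad_one (X : sp2) : Ad 1 X = X := by
  apply toMat_injective
  rw [toMat_Ad]; simp

theorem Ad_inv_Ad (a : Sp2) (X : sp2) : Ad a⁻¹ (Ad a X) = X := by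
  rw [← Ad_mul, inv_mul_cancel, Ad_one]

theorem Ad_Ad_inv (a : Sp2) (X : sp2) : Ad a (Ad a⁻¹ X) = X := by
  rw [← Ad_mul, mul_inv_cancel, Ad_one]

/-- The Lie bracket of `sp(2)`. -/
def bracket (X Y : sp2) : sp2 := (⟨toMat X * toMat Y - toMat Y * toMat X, by
    change star (toMat X * toMat Y - toMat Y * toMat X) = -(toMat X * toMat Y - toMat Y * toMat X)
    rw [star_sub, star_mul, star_mul, star_toMat, star_toMat]; noncomm_ring⟩ : sp2Submodule)

theorem toMat_bracket (X Y : sp2) :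
    toMat (bracket X Y) = toMat X * toMat Y - toMat Y * toMat X := rfl

theorem Ad_bracket (a : Sp2) (X Y : sp2) : Ad a (bracket X Y) = bracket (Ad a X) (Ad a Y) := by
  apply toMat_injective
  have h : star (a : Matrix (Fin 2) (Fin 2) ℍ[ℝ]) * (a : Matrix (Fin 2) (Fin 2) ℍ[ℝ]) = 1 :=
    Unitary.coe_star_mul_self a
  simp only [toMat_Ad, toMat_bracket, mul_sub, sub_mul, mul_assoc]
  rw [← mul_assoc (star (a : Matrix (Fin 2) (Fin 2) ℍ[ℝ])) (a : Matrix (Fin 2) (Fin 2) ℍ[ℝ]),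
    ← mul_assoc (star (a : Matrix (Fin 2) (Fin 2) ℍ[ℝ])) (a : Matrix (Fin 2) (Fin 2) ℍ[ℝ]), h,
    one_mul, one_mul]

theorem bracket_swap (X Y : sp2) : bracket Y X = -bracket X Y := by
  apply toMat_injective
  rw [map_neg, toMat_bracket, toMat_bracket, neg_sub]

theorem bracket_add (X Y Z : sp2) : bracket X (Y + Z) = bracket X Y + bracket X Z := by
  apply toMat_injective
  simp only [toMat_bracket, map_add, mul_add, add_mul]; abel

theorem bracket_smul (c : ℝ) (X Y : sp2) : bracket X (c • Y) = c • bracket X Y := by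
  apply toMat_injective
  simp only [toMat_bracket, map_smul, mul_smul_comm, smul_mul_assoc, smul_sub]

theorem smul_bracket (c : ℝ) (X Y : sp2) : bracket (c • X) Y = c • bracket X Y := by
  rw [← neg_inj, ← bracket_swap, bracket_smul, bracket_swap X, smul_neg]

theorem coe_expSp (X : sp2) :
    (expSp X : Matrix (Fin 2) (Fin 2) ℍ[ℝ]) = NormedSpace.exp (toMat X) := rfl

theorem expSp_zero : expSp 0 = 1 := by
  apply Subtype.ext
  rw [coe_expSp, map_zero, NormedSpace.exp_zero]; rfl

theorem expSp_add_smul (s t : ℝ) (X : sp2) :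
    expSp ((s + t) • X) = expSp (s • X) * expSp (t • X) := by
  apply Subtype.ext
  let _ : NormedAlgebra ℚ ℍ[ℝ] := NormedAlgebra.restrictScalars ℚ ℝ ℍ[ℝ]
  rw [Submonoid.coe_mul, coe_expSp, coe_expSp, coe_expSp, add_smul, map_add,
    Matrix.exp_add_of_commute]
  rw [map_smul, map_smul]
  exact ((Commute.refl (toMat X)).smul_left s).smul_right t

theorem expSp_neg (X : sp2) : expSp (-X) = (expSp X)⁻¹ := by
  have := expSp_add_smul (-1) 1 X
  rw [neg_add_cancel, zero_smul, expSp_zero, neg_one_smul, one_smul] at this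
  exact eq_inv_of_mul_eq_one_left this.symm

theorem expSp_Ad (a : Sp2) (X : sp2) : expSp (Ad a X) = a * expSp X * a⁻¹ := by
  apply Subtype.ext
  let _ : NormedAlgebra ℚ ℍ[ℝ] := NormedAlgebra.restrictScalars ℚ ℝ ℍ[ℝ]
  rw [coe_expSp, toMat_Ad, Submonoid.coe_mul, Submonoid.coe_mul, coe_expSp]
  have h := Matrix.exp_units_conj (𝔸 := ℍ[ℝ]) (Unitary.toUnits a) (toMat X)
  exact h

section Smooth

attribute [local instance] Matrix.linftyOpNormedAddCommGroup Matrix.linftyOpNormedSpace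
  Matrix.linftyOpNormedRing Matrix.linftyOpNormedAlgebra

theorem contDiff_exp_toMat : ContDiff ℝ ∞ fun X : sp2 => NormedSpace.exp (toMat X) := by
  have h1 : ContDiff ℝ ∞ fun X : sp2 => toMat X :=
    (LinearMap.toContinuousLinearMap toMat).contDiff
  have h2 : ContDiff ℝ ∞ (NormedSpace.exp : Matrix (Fin 2) (Fin 2) ℍ[ℝ] → _) :=
    contDiff_iff_contDiffAt.2 fun x => (NormedSpace.exp_analytic (𝕂 := ℝ) x).contDiffAt
  exact h2.comp h1

theorem contDiff_Ad_expSp : ContDiff ℝ ∞ fun p : sp2 × sp2 => Ad (expSp p.1) p.2 := by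
  have h1 : ContDiff ℝ ∞ fun p : sp2 × sp2 => NormedSpace.exp (toMat p.1) :=
    contDiff_exp_toMat.comp contDiff_fst
  have h2 : ContDiff ℝ ∞ fun p : sp2 × sp2 => NormedSpace.exp (toMat (-p.1)) :=
    contDiff_exp_toMat.comp contDiff_fst.neg
  have h3 : ContDiff ℝ ∞ fun p : sp2 × sp2 => toMat p.2 :=
    (LinearMap.toContinuousLinearMap toMat).contDiff.comp contDiff_snd
  have h4 : ContDiff ℝ ∞ (fun M : Matrix (Fin 2) (Fin 2) ℍ[ℝ] => skewPart M) :=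
    (LinearMap.toContinuousLinearMap skewPart).contDiff
  have h5 := h4.comp ((h1.mul h3).mul h2)
  convert h5 using 2 with p
  apply toMat_injective
  rw [Function.comp_apply, toMat_Ad]
  have : star (expSp p.1 : Matrix (Fin 2) (Fin 2) ℍ[ℝ]) = NormedSpace.exp (toMat (-p.1)) := by
    rw [← coe_expSp, expSp_neg]; rfl
  have h6 : toMat (Ad (expSp p.1) p.2) =
      NormedSpace.exp (toMat p.1) * toMat p.2 * NormedSpace.exp (toMat (-p.1)) := by
    rw [toMat_Ad, this]; rfl
  rw [← h6, skewPart_toMat, ← toMat_Ad]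

theorem hasDerivAt_Ad_expSp (X Y : sp2) :
    HasDerivAt (fun s : ℝ => Ad (expSp (s • X)) Y) (bracket X Y) 0 := by
  have h1 := hasDerivAt_exp_smul_const (𝕂 := ℝ) (toMat X) (0 : ℝ)
  have h2 := hasDerivAt_exp_smul_const (𝕂 := ℝ) (-toMat X) (0 : ℝ)
  rw [zero_smul, NormedSpace.exp_zero, one_mul] at h1 h2
  have h4 : HasFDerivAt (fun M : Matrix (Fin 2) (Fin 2) ℍ[ℝ] => skewPart M) _ _ :=
    (LinearMap.toContinuousLinearMap skewPart).hasFDerivAt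
      (x := (NormedSpace.exp ((0 : ℝ) • toMat X) * toMat Y) * NormedSpace.exp ((0 : ℝ) • -toMat X))
  have h5 : HasDerivAt (fun s : ℝ => skewPart
      (NormedSpace.exp (s • toMat X) * toMat Y * NormedSpace.exp (s • -toMat X)))
      (skewPart ((toMat X * toMat Y) * NormedSpace.exp ((0 : ℝ) • -toMat X) +
        NormedSpace.exp ((0 : ℝ) • toMat X) * toMat Y * -toMat X)) 0 := by
    have h := h4.comp_hasDerivAt (0 : ℝ) ((h1.mul_const (toMat Y)).mul h2)
    exact h
  convert h5 using 1
  · funext s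
    have : star (expSp (s • X) : Matrix (Fin 2) (Fin 2) ℍ[ℝ]) =
        NormedSpace.exp (s • -toMat X) := by
      have h : (expSp (-(s • X)) : Matrix (Fin 2) (Fin 2) ℍ[ℝ]) = star (expSp (s • X)).1 := by
        rw [expSp_neg]; rfl
      rw [← h, coe_expSp, map_neg, map_smul, smul_neg]
    have h6 : toMat (Ad (expSp (s • X)) Y) =
        NormedSpace.exp (s • toMat X) * toMat Y * NormedSpace.exp (s • -toMat X) := by
      rw [toMat_Ad, this, coe_expSp, map_smul]
    rw [← h6, skewPart_toMat]
  · have : toMat (bracket X Y) = (toMat X * toMat Y) * NormedSpace.exp ((0 : ℝ) • -toMat X) +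
        NormedSpace.exp ((0 : ℝ) • toMat X) * toMat Y * -toMat X := by
      rw [zero_smul, zero_smul, NormedSpace.exp_zero, toMat_bracket]; noncomm_ring
    rw [← this, skewPart_toMat]

end Smooth

/-! ### Coordinates on `sp(2)` -/

/-- The quaternion with the given components. -/
def quat (r i j k : ℝ) : ℍ[ℝ] := ⟨r, i, j, k⟩

@[simp] theorem re_quat (r i j k : ℝ) : (quat r i j k).re = r := rfl

@[simp] theorem imI_quat (r i j k : ℝ) : (quat r i j k).imI = i := rfl

@[simp] theorem imJ_quat (r i j k : ℝ) : (quat r i j k).imJ = j := rfl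

@[simp] theorem imK_quat (r i j k : ℝ) : (quat r i j k).imK = k := rfl

/-- The element of `sp(2)` with diagonal entries `a, d` and lower left entry `b`. -/
def spOf (a₁ a₂ a₃ d₁ d₂ d₃ b₀ b₁ b₂ b₃ : ℝ) : sp2 :=
  (⟨!![quat 0 a₁ a₂ a₃, quat (-b₀) b₁ b₂ b₃; quat b₀ b₁ b₂ b₃, quat 0 d₁ d₂ d₃], by
    change star (_ : Matrix (Fin 2) (Fin 2) ℍ[ℝ]) = -_
    ext i j <;> fin_cases i <;> fin_cases j <;> simp [Matrix.star_apply]⟩ : sp2Submodule)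

theorem toMat_spOf (a₁ a₂ a₃ d₁ d₂ d₃ b₀ b₁ b₂ b₃ : ℝ) :
    toMat (spOf a₁ a₂ a₃ d₁ d₂ d₃ b₀ b₁ b₂ b₃) =
      !![quat 0 a₁ a₂ a₃, quat (-b₀) b₁ b₂ b₃; quat b₀ b₁ b₂ b₃, quat 0 d₁ d₂ d₃] := rfl

theorem exists_spOf (X : sp2) : ∃ a₁ a₂ a₃ d₁ d₂ d₃ b₀ b₁ b₂ b₃ : ℝ,
    X = spOf a₁ a₂ a₃ d₁ d₂ d₃ b₀ b₁ b₂ b₃ := by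
  refine ⟨(toMat X 0 0).imI, (toMat X 0 0).imJ, (toMat X 0 0).imK, (toMat X 1 1).imI,
    (toMat X 1 1).imJ, (toMat X 1 1).imK, (toMat X 1 0).re, (toMat X 1 0).imI, (toMat X 1 0).imJ,
    (toMat X 1 0).imK, toMat_injective ?_⟩
  have h (i j) := congrFun (congrFun (star_toMat X) i) j
  have h00 := h 0 0
  have h11 := h 1 1
  have h01 := h 0 1
  rw [toMat_spOf]
  simp only [Matrix.star_apply, Matrix.neg_apply, Quaternion.ext_iff, Quaternion.re_star,
    Quaternion.imI_star, Quaternion.imJ_star, Quaternion.imK_star, Quaternion.re_neg,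
    Quaternion.imI_neg, Quaternion.imJ_neg, Quaternion.imK_neg] at h00 h11 h01
  ext i j <;> fin_cases i <;> fin_cases j <;> simp <;> linarith

theorem spOf_add (a₁ a₂ a₃ d₁ d₂ d₃ b₀ b₁ b₂ b₃ a₁' a₂' a₃' d₁' d₂' d₃' b₀' b₁' b₂' b₃' : ℝ) :
    spOf a₁ a₂ a₃ d₁ d₂ d₃ b₀ b₁ b₂ b₃ + spOf a₁' a₂' a₃' d₁' d₂' d₃' b₀' b₁' b₂' b₃' =
      spOf (a₁ + a₁') (a₂ + a₂') (a₃ + a₃') (d₁ + d₁') (d₂ + d₂') (d₃ + d₃') (b₀ + b₀')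
        (b₁ + b₁') (b₂ + b₂') (b₃ + b₃') := by
  apply toMat_injective
  rw [map_add, toMat_spOf, toMat_spOf, toMat_spOf]
  ext i j <;> fin_cases i <;> fin_cases j <;> simp <;> ring

theorem smul_spOf (c a₁ a₂ a₃ d₁ d₂ d₃ b₀ b₁ b₂ b₃ : ℝ) :
    c • spOf a₁ a₂ a₃ d₁ d₂ d₃ b₀ b₁ b₂ b₃ = spOf (c * a₁) (c * a₂) (c * a₃) (c * d₁) (c * d₂)
      (c * d₃) (c * b₀) (c * b₁) (c * b₂) (c * b₃) := by
  apply toMat_injective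
  rw [map_smul, toMat_spOf, toMat_spOf]
  ext i j <;> fin_cases i <;> fin_cases j <;> simp

theorem bracket_spOf
    (a₁ a₂ a₃ d₁ d₂ d₃ b₀ b₁ b₂ b₃ a₁' a₂' a₃' d₁' d₂' d₃' b₀' b₁' b₂' b₃' : ℝ) :
    bracket (spOf a₁ a₂ a₃ d₁ d₂ d₃ b₀ b₁ b₂ b₃)
        (spOf a₁' a₂' a₃' d₁' d₂' d₃' b₀' b₁' b₂' b₃') =
      spOf
        (2 * (a₂ * a₃' - a₃ * a₂') - 2 * (b₀ * b₁' - b₁ * b₀' - b₂ * b₃' + b₃ * b₂'))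
        (2 * (a₃ * a₁' - a₁ * a₃') - 2 * (b₀ * b₂' - b₂ * b₀' + b₁ * b₃' - b₃ * b₁'))
        (2 * (a₁ * a₂' - a₂ * a₁') - 2 * (b₀ * b₃' - b₁ * b₂' + b₂ * b₁' - b₃ * b₀'))
        (2 * (d₂ * d₃' - d₃ * d₂') - 2 * (-b₀ * b₁' + b₁ * b₀' - b₂ * b₃' + b₃ * b₂'))
        (2 * (d₃ * d₁' - d₁ * d₃') - 2 * (-b₀ * b₂' + b₂ * b₀' + b₁ * b₃' - b₃ * b₁'))
        (2 * (d₁ * d₂' - d₂ * d₁') - 2 * (-b₀ * b₃' - b₁ * b₂' + b₂ * b₁' + b₃ * b₀'))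
        ((-b₁ * a₁' - b₂ * a₂' - b₃ * a₃') + (-d₁ * b₁' - d₂ * b₂' - d₃ * b₃')
          - (-b₁' * a₁ - b₂' * a₂ - b₃' * a₃) - (-d₁' * b₁ - d₂' * b₂ - d₃' * b₃))
        ((b₀ * a₁' + b₂ * a₃' - b₃ * a₂') + (d₁ * b₀' + d₂ * b₃' - d₃ * b₂')
          - (b₀' * a₁ + b₂' * a₃ - b₃' * a₂) - (d₁' * b₀ + d₂' * b₃ - d₃' * b₂))
        ((b₀ * a₂' - b₁ * a₃' + b₃ * a₁') + (-d₁ * b₃' + d₂ * b₀' + d₃ * b₁')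
          - (b₀' * a₂ - b₁' * a₃ + b₃' * a₁) - (-d₁' * b₃ + d₂' * b₀ + d₃' * b₁))
        ((b₀ * a₃' + b₁ * a₂' - b₂ * a₁') + (d₁ * b₂' - d₂ * b₁' + d₃ * b₀')
          - (b₀' * a₃ + b₁' * a₂ - b₂' * a₁) - (d₁' * b₂ - d₂' * b₁ + d₃' * b₀)) := by
  apply toMat_injective
  rw [toMat_bracket, toMat_spOf, toMat_spOf, toMat_spOf]
  ext i j <;> fin_cases i <;> fin_cases j <;> simp [Matrix.mul_apply, Fin.sum_univ_two] <;> ring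

/-! ### Velocities of curves and the derivative of the action -/

section Action

variable {M : Type*} [TopologicalSpace M] [ChartedSpace V7 M]

/-- The curve `c` has velocity `v` at `t`. -/
def HasVelocity (c : ℝ → M) (t : ℝ) (v : V7) : Prop :=
  HasMFDerivAt 𝓘(ℝ, ℝ) 𝓘(ℝ, V7) c t
    (ContinuousLinearMap.toSpanSingleton ℝ v : ℝ →L[ℝ] V7)

theorem HasVelocity.unique {c : ℝ → M} {t : ℝ} {v w : V7} (hv : HasVelocity c t v)
    (hw : HasVelocity c t w) : v = w := by
  have h := hasMFDerivAt_unique hv hw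
  have h1 := congrArg (fun f : ℝ →L[ℝ] V7 => f 1) h
  simpa using h1

theorem HasVelocity.velocity_eq {c : ℝ → M} {t : ℝ} {v : V7} (hv : HasVelocity c t v) :
    velocity c t = v := by
  have h : mfderiv 𝓘(ℝ, ℝ) 𝓘(ℝ, V7) c t = (ContinuousLinearMap.toSpanSingleton ℝ v : ℝ →L[ℝ] V7) :=
    hv.mfderiv
  have h1 : (mfderiv 𝓘(ℝ, ℝ) 𝓘(ℝ, V7) c t : ℝ →L[ℝ] V7) 1 = _ :=
    congrArg (fun f : ℝ →L[ℝ] V7 => f 1) h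
  rw [ContinuousLinearMap.toSpanSingleton_apply, one_smul] at h1
  exact h1

theorem HasVelocity.congr {c c' : ℝ → M} {t : ℝ} {v : V7} (hv : HasVelocity c t v)
    (h : c' =ᶠ[nhds t] c) : HasVelocity c' t v :=
  HasMFDerivAt.congr_of_eventuallyEq hv h

theorem hasVelocity_of_mdifferentiableAt {c : ℝ → M} {t : ℝ}
    (hc : MDifferentiableAt 𝓘(ℝ, ℝ) 𝓘(ℝ, V7) c t) : HasVelocity c t (velocity c t) := by
  have h := hc.hasMFDerivAt
  have e : (mfderiv 𝓘(ℝ, ℝ) 𝓘(ℝ, V7) c t : ℝ →L[ℝ] V7) =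
      (ContinuousLinearMap.toSpanSingleton ℝ (velocity c t : V7) : ℝ →L[ℝ] V7) := by
    ext1
    exact (one_smul ℝ (velocity c t : V7)).symm
  exact h.congr_mfderiv e

/-- The derivative of a chart. -/
def dChart (e : OpenPartialHomeomorph M V7) (x : M) : V7 →L[ℝ] V7 :=
  (mfderiv 𝓘(ℝ, V7) 𝓘(ℝ, V7) e x :)

section Chart

variable [IsManifold 𝓘(ℝ, V7) ∞ M] {e : OpenPartialHomeomorph M V7}

theorem contMDiffAt_chart (he : e ∈ atlas V7 M) {x : M} (hx : x ∈ e.source) :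
    ContMDiffAt 𝓘(ℝ, V7) 𝓘(ℝ, V7) ∞ e x :=
  (contMDiffOn_of_mem_maximalAtlas (IsManifold.subset_maximalAtlas he)).contMDiffAt
    (e.open_source.mem_nhds hx)

theorem contMDiffAt_chart_symm (he : e ∈ atlas V7 M) {y : V7} (hy : y ∈ e.target) :
    ContMDiffAt 𝓘(ℝ, V7) 𝓘(ℝ, V7) ∞ e.symm y :=
  (contMDiffOn_symm_of_mem_maximalAtlas (IsManifold.subset_maximalAtlas he)).contMDiffAt
    (e.open_target.mem_nhds hy)

theorem mdifferentiableAt_chart_symm (he : e ∈ atlas V7 M) {y : V7} (hy : y ∈ e.target) :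
    MDifferentiableAt 𝓘(ℝ, V7) 𝓘(ℝ, V7) e.symm y :=
  (contMDiffAt_chart_symm he hy).mdifferentiableAt (by simp)

theorem hasFDerivAt_chart_comp {E : Type*} [NormedAddCommGroup E] [NormedSpace ℝ E]
    (he : e ∈ atlas V7 M) {G : E → M} {p : E} {G' : E →L[ℝ] V7}
    (hG : HasMFDerivAt 𝓘(ℝ, E) 𝓘(ℝ, V7) G p G') (hx : G p ∈ e.source) :
    HasFDerivAt (fun q => e (G q)) ((dChart e (G p)).comp G') p := by
  have h := HasMFDerivAt.comp p
    ((contMDiffAt_chart he hx).mdifferentiableAt (by simp)).hasMFDerivAt hG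
  exact hasMFDerivAt_iff_hasFDerivAt.1 h

theorem HasVelocity.chart {c : ℝ → M} {t : ℝ} {v : V7} (hv : HasVelocity c t v)
    (he : e ∈ atlas V7 M) (hx : c t ∈ e.source) :
    HasDerivAt (fun s => e (c s)) (dChart e (c t) v) t := by
  have h := (hasFDerivAt_chart_comp he hv hx).hasDerivAt
  simpa using h

end Chart

theorem HasVelocity.shift {c : ℝ → M} {t : ℝ} {v : V7} (hv : HasVelocity c t v) :
    HasVelocity (fun s => c (t + s)) 0 v := by
  have h1 : HasMFDerivAt 𝓘(ℝ, ℝ) 𝓘(ℝ, ℝ) (fun s : ℝ => t + s) 0 (ContinuousLinearMap.id ℝ ℝ) :=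
    ((hasFDerivAt_id (0 : ℝ)).const_add t).hasMFDerivAt
  have h2 : HasVelocity c (t + 0) v := by rwa [add_zero]
  exact HasMFDerivAt.comp (0 : ℝ) h2 h1

section Normed

variable {E : Type*} [NormedAddCommGroup E] [NormedSpace ℝ E]

/-- The derivative of a map into `M`, as a map between vector spaces. -/
def deriv7 (G : E → M) (p : E) : E →L[ℝ] V7 := (mfderiv 𝓘(ℝ, E) 𝓘(ℝ, V7) G p :)

theorem hasVelocity_comp {G : E → M} {p v : E} {l : ℝ → E} {t : ℝ}
    (hG : MDifferentiableAt 𝓘(ℝ, E) 𝓘(ℝ, V7) G p) (hl : HasDerivAt l v t) (hp : l t = p) :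
    HasVelocity (fun s => G (l s)) t (deriv7 G p v) := by
  subst hp
  have h := HasMFDerivAt.comp t hG.hasMFDerivAt hl.hasFDerivAt.hasMFDerivAt
  have e : (ContinuousLinearMap.toSpanSingleton ℝ (deriv7 G (l t) v) : ℝ →L[ℝ] V7) =
      (deriv7 G (l t)).comp (ContinuousLinearMap.toSpanSingleton ℝ v) := by
    ext1
    simp
  rw [HasVelocity, e]
  exact h

end Normed

variable [MulAction Sp2 M]

/-- The derivative of `y ↦ a • y` at `x`, as an endomorphism of `ℝ⁷`. -/
def dAct (a : Sp2) (x : M) : V7 →L[ℝ] V7 :=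
  (mfderiv 𝓘(ℝ, V7) 𝓘(ℝ, V7) (fun y : M => a • y) x :)

theorem contMDiff_act (hact : IsSmoothAction M) (a : Sp2) :
    ContMDiff 𝓘(ℝ, V7) 𝓘(ℝ, V7) ∞ fun x : M => a • x := by
  have h := (hact a).comp ((contMDiff_const (c := (0 : sp2))).prodMk (contMDiff_id (M := M)
    (I := 𝓘(ℝ, V7)) (n := ∞)))
  convert h using 2 with x
  simp [expSp_zero]

theorem contMDiff_expSp_smul (hact : IsSmoothAction M) {E : Type*} [NormedAddCommGroup E]
    [NormedSpace ℝ E] {G : E → M} {X : E → sp2} {p : E}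
    (hG : ContMDiffAt 𝓘(ℝ, E) 𝓘(ℝ, V7) ∞ G p) (hX : ContDiff ℝ ∞ X) :
    ContMDiffAt 𝓘(ℝ, E) 𝓘(ℝ, V7) ∞ (fun q => expSp (X q) • G q) p := by
  have h := (hact 1).contMDiffAt.comp p (hX.contDiffAt.contMDiffAt.prodMk hG)
  convert h using 2 with q
  simp

theorem mdifferentiableAt_act (hact : IsSmoothAction M) (a : Sp2) (x : M) :
    MDifferentiableAt 𝓘(ℝ, V7) 𝓘(ℝ, V7) (fun x : M => a • x) x :=
  (contMDiff_act hact a).contMDiffAt.mdifferentiableAt (by simp)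

theorem HasVelocity.act (hact : IsSmoothAction M) {c : ℝ → M} {t : ℝ} {v : V7}
    (hv : HasVelocity c t v) (a : Sp2) : HasVelocity (fun s => a • c s) t (dAct a (c t) v) := by
  have h := HasMFDerivAt.comp t (mdifferentiableAt_act hact a (c t)).hasMFDerivAt hv
  have e : (ContinuousLinearMap.toSpanSingleton ℝ (dAct a (c t) v) : ℝ →L[ℝ] V7) =
      (dAct a (c t)).comp (ContinuousLinearMap.toSpanSingleton ℝ v) := by
    ext1
    simp
  rw [HasVelocity, e]
  exact h

theorem dAct_mul (hact : IsSmoothAction M) (a b : Sp2) (x : M) :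
    dAct (a * b) x = (dAct a (b • x)).comp (dAct b x) := by
  have h := HasMFDerivAt.comp x (mdifferentiableAt_act hact a (b • x)).hasMFDerivAt
    (mdifferentiableAt_act hact b x).hasMFDerivAt
  have e : (fun y : M => (a * b) • y) = (fun y : M => a • y) ∘ (fun y : M => b • y) := by
    funext y; exact mul_smul a b y
  rw [dAct, e]
  exact h.mfderiv

theorem dAct_one (x : M) : dAct 1 x = ContinuousLinearMap.id ℝ V7 := by
  have e : (fun y : M => (1 : Sp2) • y) = id := by funext y; exact one_smul _ y
  rw [dAct, e]
  exact mfderiv_id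

theorem dAct_inv_dAct (hact : IsSmoothAction M) (a : Sp2) (x : M) (v : V7) :
    dAct a⁻¹ (a • x) (dAct a x v) = v := by
  have h := congrArg (fun f : V7 →L[ℝ] V7 => f v) (dAct_mul hact a⁻¹ a x)
  rw [inv_mul_cancel, dAct_one] at h
  exact h.symm

theorem dAct_dAct_inv (hact : IsSmoothAction M) (a : Sp2) (x : M) (v : V7) :
    dAct a x (dAct a⁻¹ (a • x) v) = v := by
  have h := dAct_inv_dAct hact a⁻¹ (a • x) v
  rwa [inv_inv, inv_smul_smul] at h

/-- The derivative of `y ↦ a • y` is invertible. -/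
def dActEquiv (hact : IsSmoothAction M) (a : Sp2) (x : M) : V7 ≃L[ℝ] V7 :=
  ContinuousLinearEquiv.equivOfInverse (dAct a x) (dAct a⁻¹ (a • x)) (dAct_inv_dAct hact a x)
    (dAct_dAct_inv hact a x)

/-- The infinitesimal action, with values in `ℝ⁷`. -/
def infAct (x : M) : sp2 →L[ℝ] V7 := infAction x

theorem mdifferentiableAt_orbit (hact : IsSmoothAction M) (x : M) (X : sp2) :
    MDifferentiableAt 𝓘(ℝ, sp2) 𝓘(ℝ, V7) (fun X : sp2 => expSp X • x) X :=
  (contMDiff_expSp_smul hact (G := fun _ : sp2 => x) contMDiffAt_const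
    contDiff_id).mdifferentiableAt (by simp)

theorem hasVelocity_expSp_smul (hact : IsSmoothAction M) (x : M) {l : ℝ → sp2} {X : sp2} {t : ℝ}
    (hl : HasDerivAt l X t) (h0 : l t = 0) :
    HasVelocity (fun s => expSp (l s) • x) t (infAct x X) :=
  hasVelocity_comp (mdifferentiableAt_orbit hact x 0) hl h0

theorem hasDerivAt_smul_const_zero {F : Type*} [NormedAddCommGroup F] [NormedSpace ℝ F] (X : F) :
    HasDerivAt (fun s : ℝ => s • X) X 0 := by
  simpa using (hasDerivAt_id (0 : ℝ)).smul_const X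

theorem hasVelocity_orbit (hact : IsSmoothAction M) (x : M) (X : sp2) :
    HasVelocity (fun s : ℝ => expSp (s • X) • x) 0 (infAct x X) :=
  hasVelocity_expSp_smul hact x (hasDerivAt_smul_const_zero X) (zero_smul _ _)

theorem expSp_smul_smul (a : Sp2) (X : sp2) (x : M) :
    expSp X • a • x = a • expSp (Ad a⁻¹ X) • x := by
  rw [expSp_Ad, inv_inv, ← mul_smul, ← mul_smul, ← mul_assoc, mul_inv_cancel_left]

theorem infAct_smul (hact : IsSmoothAction M) (a : Sp2) (x : M) (X : sp2) :
    infAct (a • x) X = dAct a x (infAct x (Ad a⁻¹ X)) := by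
  have h1 := hasVelocity_orbit hact (a • x) X
  have h2 := (hasVelocity_orbit hact x (Ad a⁻¹ X)).act hact a
  have e : (fun s : ℝ => expSp (s • X) • a • x) = fun s : ℝ => a • expSp (s • Ad a⁻¹ X) • x := by
    funext s; rw [expSp_smul_smul, map_smul]
  rw [e] at h1
  have h3 := h1.unique h2
  rwa [zero_smul, expSp_zero, one_smul] at h3

theorem infAct_smul' (hact : IsSmoothAction M) (a : Sp2) (x : M) (X : sp2) :
    infAct (a • x) (Ad a X) = dAct a x (infAct x X) := by
  rw [infAct_smul hact, Ad_inv_Ad]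

theorem hasVelocity_orbit_at (hact : IsSmoothAction M) (x : M) (X : sp2) (t : ℝ) :
    HasVelocity (fun s : ℝ => expSp (s • X) • x) t (dAct (expSp (t • X)) x (infAct x X)) := by
  have hl : HasDerivAt (fun s : ℝ => (s - t) • X) X t := by
    simpa using ((hasDerivAt_id t).sub_const t).smul_const X
  have h := (hasVelocity_expSp_smul hact x hl (by simp)).act hact (expSp (t • X))
  have e : (fun s : ℝ => expSp (t • X) • expSp ((s - t) • X) • x) =
      fun s : ℝ => expSp (s • X) • x := by
    funext s
    rw [← mul_smul, ← expSp_add_smul, add_sub_cancel]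
  rw [e] at h
  simpa [expSp_zero] using h

/-! ### Points fixed by one-parameter subgroups -/

section Manifold

variable [IsManifold 𝓘(ℝ, V7) ∞ M]

/-- A curve with vanishing velocity is locally constant. -/
theorem eventually_eq_of_hasVelocity_zero {c : ℝ → M} {t : ℝ} (h : ∀ s, HasVelocity c s 0) :
    ∀ᶠ s in nhds t, c s = c t := by
  set e := chartAt V7 (c t)
  have hmem : ∀ᶠ s in nhds t, c s ∈ e.source :=
    (h t).continuousAt.eventually_mem (e.open_source.mem_nhds (mem_chart_source V7 (c t)))
  obtain ⟨δ, hδ, hball⟩ := Metric.eventually_nhds_iff_ball.1 hmem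
  have hder : ∀ s ∈ Metric.ball t δ, HasDerivAt (fun s => e (c s)) 0 s := by
    intro s hs
    simpa using (h s).chart (chart_mem_atlas V7 (c t)) (hball s hs)
  filter_upwards [Metric.ball_mem_nhds t hδ] with s hs
  have h1 : e (c s) = e (c t) :=
    (convex_ball t δ).is_const_of_fderivWithin_eq_zero (𝕜 := ℝ)
      (fun x hx => (hder x hx).differentiableAt.differentiableWithinAt) (fun x hx => by
        rw [fderivWithin_of_isOpen Metric.isOpen_ball hx, (hder x hx).hasFDerivAt.fderiv]
        ext; simp) hs (Metric.mem_ball_self hδ)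
  exact e.injOn (hball s hs) (hball t (Metric.mem_ball_self hδ)) h1

theorem expSp_nsmul (n : ℕ) (X : sp2) : expSp ((n : ℝ) • X) = expSp X ^ n := by
  induction n with
  | zero => simp [expSp_zero]
  | succ n ih => rw [Nat.cast_succ, expSp_add_smul, ih, one_smul, pow_succ]

/-- If the infinitesimal action of `X` vanishes at `x`, then `exp X` fixes `x`. -/
theorem expSp_smul_eq_of_infAct_eq_zero (hact : IsSmoothAction M) {x : M} {X : sp2}
    (h : infAct x X = 0) (s : ℝ) : expSp (s • X) • x = x := by
  have hv (s : ℝ) : HasVelocity (fun s : ℝ => expSp (s • X) • x) s 0 := by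
    have := hasVelocity_orbit_at hact x X s
    rwa [h, map_zero] at this
  have h1 := eventually_eq_of_hasVelocity_zero (t := 0) hv
  simp only [zero_smul, expSp_zero, one_smul] at h1
  obtain ⟨δ, hδ, hball⟩ := Metric.eventually_nhds_iff.1 h1
  -- Constancy is known only for small parameters; exp (sX) is the n-th power of exp ((s/n)X), which
  -- fixes x once s/n is small.
  obtain ⟨n, hn⟩ := exists_nat_gt (|s| / δ)
  have hn0 : 0 < (n : ℝ) := lt_of_le_of_lt (by positivity) hn
  have h2 : expSp ((s / n) • X) • x = x := by
    apply hball
    rw [dist_zero_right, Real.norm_eq_abs, abs_div, abs_of_pos hn0, div_lt_iff₀ hn0]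
    rwa [div_lt_iff₀ hδ, mul_comm] at hn
  have h3 : expSp (s • X) = expSp ((s / n) • X) ^ n := by
    rw [← expSp_nsmul, smul_smul, mul_div_cancel₀ _ hn0.ne']
  have key (m : ℕ) : expSp ((s / n) • X) ^ m • x = x := by
    induction m with
    | zero => simp
    | succ m ihm => rw [pow_succ, mul_smul, h2, ihm]
  rw [h3, key]

end Manifold

end Action

/-! ### Tubes along a curve and coordinates of the second kind -/

/-- The vectors `E₁, …, E₆` of `sp(2)` (and `0` for the index `0`). -/
def spFrame : Fin 7 → sp2 :=
  ![0, spOf 0 0 0 0 (1 / 2) 0 0 0 0 0, spOf 0 0 0 0 0 (-1 / 2) 0 0 0 0,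
    spOf 0 0 0 0 0 0 (1 / (2 * √2)) 0 0 0, spOf 0 0 0 0 0 0 0 (1 / (2 * √2)) 0 0,
    spOf 0 0 0 0 0 0 0 0 (1 / (2 * √2)) 0, spOf 0 0 0 0 0 0 0 0 0 (1 / (2 * √2))]

theorem coframe_spOf (τ a₁ a₂ a₃ d₁ d₂ d₃ b₀ b₁ b₂ b₃ : ℝ) (i : Fin 7) :
    coframe i (τ, spOf a₁ a₂ a₃ d₁ d₂ d₃ b₀ b₁ b₂ b₃) =
      ![τ, 2 * d₂, -2 * d₃, 2 * √2 * b₀, 2 * √2 * b₁, 2 * √2 * b₂, 2 * √2 * b₃] i := by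
  fin_cases i <;> rfl

/-- The frame of `ℝ ⊕ sp(2)` modulo `k` that is dual to the coframe. -/
def frame (i : Fin 7) : ℝ × sp2 := (if i = 0 then 1 else 0, spFrame i)

theorem coframe_frame (i j : Fin 7) : coframe i (frame j) = if i = j then 1 else 0 := by
  have h : 2 * √2 * ((√2)⁻¹ * 2⁻¹) = 1 := by
    have : √2 ≠ 0 := by positivity
    field_simp
  have h' : -(2 * (-1 / 2)) = (1 : ℝ) := by norm_num
  have h0 : (0 : sp2) = spOf 0 0 0 0 0 0 0 0 0 0 := by
    have := smul_spOf 0 0 0 0 0 0 0 0 0 0 0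
    rw [zero_smul] at this
    rw [this]; simp
  have e : frame j = (if j = 0 then 1 else 0, ![spOf 0 0 0 0 0 0 0 0 0 0,
    spOf 0 0 0 0 (1 / 2) 0 0 0 0 0, spOf 0 0 0 0 0 (-1 / 2) 0 0 0 0,
    spOf 0 0 0 0 0 0 (1 / (2 * √2)) 0 0 0, spOf 0 0 0 0 0 0 0 (1 / (2 * √2)) 0 0,
    spOf 0 0 0 0 0 0 0 0 (1 / (2 * √2)) 0, spOf 0 0 0 0 0 0 0 0 0 (1 / (2 * √2))] j) := by
    rw [frame, spFrame, h0]
  rw [e]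
  fin_cases j <;> simp only [Fin.reduceFinMk, Fin.zero_eta, Fin.mk_one, Matrix.cons_val,
    coframe_spOf] <;> fin_cases i <;> simp [h, h']

/-- The twist by `exp (-p_k E_k)`. -/
def twist (k : Fin 7) (p : V7) (Y : sp2) : sp2 := Ad (expSp (-(p k • spFrame k))) Y

/-- The left-trivialized partial derivatives of `p ↦ exp (p₁E₁) ⋯ exp (p₆E₆)`. -/
def partialField (p : V7) : Fin 7 → sp2 :=
  ![0,
    twist 6 p (twist 5 p (twist 4 p (twist 3 p (twist 2 p (spFrame 1))))),
    twist 6 p (twist 5 p (twist 4 p (twist 3 p (spFrame 2)))),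
    twist 6 p (twist 5 p (twist 4 p (spFrame 3))),
    twist 6 p (twist 5 p (spFrame 4)),
    twist 6 p (spFrame 5),
    spFrame 6]

/-- The product `exp (p₁E₁) ⋯ exp (p₆E₆)`. -/
def groupCoord (p : V7) : Sp2 :=
  expSp (p 1 • spFrame 1) * (expSp (p 2 • spFrame 2) * (expSp (p 3 • spFrame 3) *
    (expSp (p 4 • spFrame 4) * (expSp (p 5 • spFrame 5) * expSp (p 6 • spFrame 6)))))

/-- The linear map `p ↦ -p_k E_k`. -/
def negCoordSmul (k : Fin 7) : V7 →L[ℝ] sp2 :=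
  -((EuclideanSpace.proj k : V7 →L[ℝ] ℝ).smulRight (spFrame k))

theorem negCoordSmul_apply (k : Fin 7) (p : V7) : negCoordSmul k p = -(p k • spFrame k) := rfl

theorem contDiff_twist (k : Fin 7) {Y : V7 → sp2} (hY : ContDiff ℝ ∞ Y) :
    ContDiff ℝ ∞ fun p => twist k p (Y p) := by
  have h := ContDiff.comp contDiff_Ad_expSp ((negCoordSmul k).contDiff.prodMk hY)
  convert h using 2 with p
  rw [twist, Function.comp_apply, negCoordSmul_apply]

theorem contDiff_partialField (i : Fin 7) : ContDiff ℝ ∞ fun p => partialField p i := by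
  fin_cases i
  · exact contDiff_const
  · exact contDiff_twist _ (contDiff_twist _ (contDiff_twist _ (contDiff_twist _ (contDiff_twist _
      contDiff_const))))
  · exact contDiff_twist _ (contDiff_twist _ (contDiff_twist _ (contDiff_twist _ contDiff_const)))
  · exact contDiff_twist _ (contDiff_twist _ (contDiff_twist _ contDiff_const))
  · exact contDiff_twist _ (contDiff_twist _ contDiff_const)
  · exact contDiff_twist _ contDiff_const
  · exact contDiff_const

section Vector

variable {α : Type*} (a₀ a₁ a₂ a₃ a₄ a₅ a₆ : α)

theorem vec_seven_zero : ![a₀, a₁, a₂, a₃, a₄, a₅, a₆] 0 = a₀ := rfl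

theorem vec_seven_one : ![a₀, a₁, a₂, a₃, a₄, a₅, a₆] 1 = a₁ := rfl

theorem vec_seven_two : ![a₀, a₁, a₂, a₃, a₄, a₅, a₆] 2 = a₂ := rfl

theorem vec_seven_three : ![a₀, a₁, a₂, a₃, a₄, a₅, a₆] 3 = a₃ := rfl

theorem vec_seven_four : ![a₀, a₁, a₂, a₃, a₄, a₅, a₆] 4 = a₄ := rfl

theorem vec_seven_five : ![a₀, a₁, a₂, a₃, a₄, a₅, a₆] 5 = a₅ := rfl

theorem vec_seven_six : ![a₀, a₁, a₂, a₃, a₄, a₅, a₆] 6 = a₆ := rfl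

end Vector

theorem partialField_zero (p : V7) : partialField p 0 =
    0 := by
  rw [partialField, vec_seven_zero]

theorem partialField_one (p : V7) : partialField p 1 =
    twist 6 p (twist 5 p (twist 4 p (twist 3 p (twist 2 p (spFrame 1))))) := by
  rw [partialField, vec_seven_one]

theorem partialField_two (p : V7) : partialField p 2 =
    twist 6 p (twist 5 p (twist 4 p (twist 3 p (spFrame 2)))) := by
  rw [partialField, vec_seven_two]

theorem partialField_three (p : V7) : partialField p 3 =
    twist 6 p (twist 5 p (twist 4 p (spFrame 3))) := by
  rw [partialField, vec_seven_three]

theorem partialField_four (p : V7) : partialField p 4 =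
    twist 6 p (twist 5 p (spFrame 4)) := by
  rw [partialField, vec_seven_four]

theorem partialField_five (p : V7) : partialField p 5 =
    twist 6 p (spFrame 5) := by
  rw [partialField, vec_seven_five]

theorem partialField_six (p : V7) : partialField p 6 =
    spFrame 6 := by
  rw [partialField, vec_seven_six]

theorem eq_zero_or_one_or_six (i : Fin 7) :
    i = 0 ∨ i = 1 ∨ i = 2 ∨ i = 3 ∨ i = 4 ∨ i = 5 ∨ i = 6 := by
  revert i; decide

theorem expSp_mul_twist (p : V7) (k : Fin 7) (Y : sp2) :
    expSp Y * expSp (p k • spFrame k) = expSp (p k • spFrame k) * expSp (twist k p Y) := by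
  rw [twist, expSp_Ad, expSp_neg, inv_inv, mul_assoc, mul_inv_cancel_left]

theorem smul_twist (k : Fin 7) (p : V7) (s : ℝ) (Y : sp2) :
    s • twist k p Y = twist k p (s • Y) := by
  rw [twist, twist, map_smul]

/-- Moving exp Y to the right past a factor of `groupCoord` conjugates it by the inverse of that
factor, which is what `twist` records. -/
theorem expSp_mul_twist_mul (p : V7) (k : Fin 7) (Y : sp2) (R : Sp2) :
    expSp Y * (expSp (p k • spFrame k) * R) =
      expSp (p k • spFrame k) * (expSp (twist k p Y) * R) := by
  rw [← mul_assoc, expSp_mul_twist, mul_assoc]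

/-- Varying pᵢ inserts exp (sEᵢ) next to the i-th factor. Commuting it through the later factors to
the right end twists it by each of them, and the nested twists of `partialField` are the result. -/
theorem groupCoord_add_smul (p : V7) (i : Fin 7) (hi : i ≠ 0) (s : ℝ) :
    groupCoord (p + s • bas i) = groupCoord p * expSp (s • partialField p i) := by
  have e (j k : Fin 7) (h : k ≠ j) : (p + s • bas j) k = p k := by
    simp [bas, Pi.single_apply, h]
  have e' (j : Fin 7) : (p + s • bas j) j = p j + s := by simp [bas]
  rcases eq_zero_or_one_or_six i with rfl | rfl | rfl | rfl | rfl | rfl | rfl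
  · exact absurd rfl hi
  all_goals
    rw [groupCoord, groupCoord]
    simp only [partialField_one, partialField_two, partialField_three, partialField_four,
      partialField_five, partialField_six, smul_twist]
  · rw [e' 1, e 1 2 (by decide), e 1 3 (by decide), e 1 4 (by decide), e 1 5 (by decide), e 1 6 (by decide),
      expSp_add_smul]
    simp only [mul_assoc]
    rw [expSp_mul_twist_mul p 2 (s • spFrame 1),
      expSp_mul_twist_mul p 3 (twist 2 p (s • spFrame 1)),
      expSp_mul_twist_mul p 4 (twist 3 p (twist 2 p (s • spFrame 1))),
      expSp_mul_twist_mul p 5 (twist 4 p (twist 3 p (twist 2 p (s • spFrame 1)))),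
      expSp_mul_twist p 6 (twist 5 p (twist 4 p (twist 3 p (twist 2 p (s • spFrame 1)))))]
  · rw [e' 2, e 2 1 (by decide), e 2 3 (by decide), e 2 4 (by decide), e 2 5 (by decide), e 2 6 (by decide),
      expSp_add_smul]
    simp only [mul_assoc]
    rw [expSp_mul_twist_mul p 3 (s • spFrame 2),
      expSp_mul_twist_mul p 4 (twist 3 p (s • spFrame 2)),
      expSp_mul_twist_mul p 5 (twist 4 p (twist 3 p (s • spFrame 2))),
      expSp_mul_twist p 6 (twist 5 p (twist 4 p (twist 3 p (s • spFrame 2))))]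
  · rw [e' 3, e 3 1 (by decide), e 3 2 (by decide), e 3 4 (by decide), e 3 5 (by decide), e 3 6 (by decide),
      expSp_add_smul]
    simp only [mul_assoc]
    rw [expSp_mul_twist_mul p 4 (s • spFrame 3),
      expSp_mul_twist_mul p 5 (twist 4 p (s • spFrame 3)),
      expSp_mul_twist p 6 (twist 5 p (twist 4 p (s • spFrame 3)))]
  · rw [e' 4, e 4 1 (by decide), e 4 2 (by decide), e 4 3 (by decide), e 4 5 (by decide), e 4 6 (by decide),
      expSp_add_smul]
    simp only [mul_assoc]
    rw [expSp_mul_twist_mul p 5 (s • spFrame 4),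
      expSp_mul_twist p 6 (twist 5 p (s • spFrame 4))]
  · rw [e' 5, e 5 1 (by decide), e 5 2 (by decide), e 5 3 (by decide), e 5 4 (by decide), e 5 6 (by decide),
      expSp_add_smul]
    simp only [mul_assoc]
    rw [expSp_mul_twist p 6 (s • spFrame 5)]
  · rw [e' 6, e 6 1 (by decide), e 6 2 (by decide), e 6 3 (by decide), e 6 4 (by decide), e 6 5 (by decide),
      expSp_add_smul]
    simp only [mul_assoc]

theorem groupCoord_add_smul_zero (p : V7) (s : ℝ) : groupCoord (p + s • bas 0) = groupCoord p := by
  have e (k : Fin 7) (h : k ≠ 0) : (p + s • bas 0) k = p k := by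
    simp [bas, Pi.single_apply, h]
  simp only [groupCoord]
  rw [e 1 (by decide), e 2 (by decide), e 3 (by decide), e 4 (by decide), e 5 (by decide),
    e 6 (by decide)]

theorem groupCoord_smul_bas_zero (t : ℝ) : groupCoord (t • bas 0) = 1 := by
  have h := groupCoord_add_smul_zero 0 t
  rw [zero_add] at h
  rw [h]
  simp [groupCoord, expSp_zero]

theorem twist_eq_self {k : Fin 7} {p : V7} (h : p k = 0) (Y : sp2) : twist k p Y = Y := by
  rw [twist, h, zero_smul, neg_zero, expSp_zero, Ad_one]

theorem partialField_smul_bas_zero (t : ℝ) : partialField (t • bas 0) = spFrame := by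
  have e (k : Fin 7) (h : k ≠ 0) : (t • bas 0) k = 0 := by simp [bas, Pi.single_apply, h]
  funext i
  have h2 := e 2 (by decide)
  have h3 := e 3 (by decide)
  have h4 := e 4 (by decide)
  have h5 := e 5 (by decide)
  have h6 := e 6 (by decide)
  fin_cases i <;> simp only [Fin.reduceFinMk, Fin.zero_eta, Fin.mk_one, partialField,
    Matrix.cons_val, twist_eq_self h2, twist_eq_self h3, twist_eq_self h4, twist_eq_self h5,
    twist_eq_self h6]
  rfl

theorem hasDerivAt_twist_curve {p : ℝ → V7} {j : Fin 7} (hp : ∀ s, p s j = s) (Y : sp2) :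
    HasDerivAt (fun s => twist j (p s) Y) (bracket Y (spFrame j)) 0 := by
  have h := hasDerivAt_Ad_expSp (-spFrame j) Y
  have e : bracket (-spFrame j) Y = bracket Y (spFrame j) := by
    rw [← neg_one_smul ℝ (spFrame j), smul_bracket, neg_one_smul, ← bracket_swap]
  rw [e] at h
  refine h.congr_deriv rfl |>.congr_of_eventuallyEq (Filter.Eventually.of_forall fun s => ?_)
  simp only [twist, hp, smul_neg]

/-- The derivative of `partialField` in the direction of a coordinate `j ≠ 0`. -/
theorem hasDerivAt_partialField (t : ℝ) (i j : Fin 7) (hj : j ≠ 0) :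
    HasDerivAt (fun s : ℝ => partialField (t • bas 0 + s • bas j) i)
      (if i < j then bracket (spFrame i) (spFrame j) else 0) 0 := by
  have e (k : Fin 7) (h : k ≠ 0) (s : ℝ) : (t • bas 0 + s • bas j) k = if k = j then s else 0 := by
    by_cases hk : k = j
    · subst hk; simp [bas, Pi.single_apply, h]
    · simp [bas, Pi.single_apply, h, hk]
  -- Off the axis in direction j only the j-th twist is nontrivial. It occurs in `partialField`
  -- exactly for the indices i < j, which causes the asymmetry of the result.
  have hz (k : Fin 7) (h : k ≠ 0) (hk : k ≠ j) (s : ℝ) (Y : sp2) :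
      twist k (t • bas 0 + s • bas j) Y = Y := twist_eq_self (by rw [e k h, if_neg hk]) Y
  have hd (Y : sp2) : HasDerivAt (fun s : ℝ => twist j (t • bas 0 + s • bas j) Y)
      (bracket Y (spFrame j)) 0 :=
    hasDerivAt_twist_curve (fun s => by rw [e j hj, if_pos rfl]) Y
  have h0 (Y : sp2) : bracket 0 Y = 0 := by
    have := smul_bracket 0 0 Y
    rwa [zero_smul, zero_smul] at this
  have hs0 : spFrame 0 = 0 := rfl
  have hz2 := hz 2 (by decide)
  have hz3 := hz 3 (by decide)
  have hz4 := hz 4 (by decide)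
  have hz5 := hz 5 (by decide)
  have hz6 := hz 6 (by decide)
  rcases eq_zero_or_one_or_six j with rfl | rfl | rfl | rfl | rfl | rfl | rfl
  · exact absurd rfl hj
  all_goals
    simp only [ne_eq, Fin.reduceEq, not_false_eq_true,
      not_true_eq_false, forall_const, IsEmpty.forall_iff] at hz2 hz3 hz4 hz5 hz6 hd ⊢
    rcases eq_zero_or_one_or_six i with rfl | rfl | rfl | rfl | rfl | rfl | rfl <;>
    simp only [partialField_zero, partialField_one, partialField_two, partialField_three,
      partialField_four, partialField_five, partialField_six, hz2, hz3, hz4, hz5, hz6, hs0, h0, ite_self, Fin.reduceLT, if_true, if_false,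
      lt_self_iff_false] <;>
    first
      | exact hasDerivAt_const _ _
      | exact hd _

/-! ### Pull-backs of fields of forms -/

section Pull

section Normed

variable {E : Type*} [NormedAddCommGroup E] [NormedSpace ℝ E] {k : ℕ}

/-- The components of a form. -/
def formComponents (k : ℕ) : (V7 [⋀^Fin k]→L[ℝ] ℝ) →ₗ[ℝ] (Fin k → Fin 7) → ℝ where
  toFun κ f := κ fun i => bas (f i)
  map_add' _ _ := rfl
  map_smul' _ _ := rfl

theorem form_apply_eq_sum (κ : V7 [⋀^Fin k]→L[ℝ] ℝ) (w : Fin k → V7) :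
    κ w = ∑ f : Fin k → Fin 7, (∏ i, w i (f i)) * formComponents k κ f := by
  have h1 : w = fun i => ∑ j, w i j • bas j := funext fun i => (sum_smul_bas (w i)).symm
  conv_lhs => rw [h1]
  have h2 := κ.toAlternatingMap.toMultilinearMap.map_sum fun i j => w i j • bas j
  refine h2.trans (Finset.sum_congr rfl fun f _ => ?_)
  exact κ.toAlternatingMap.toMultilinearMap.map_smul_univ (fun i => w i (f i)) fun i => bas (f i)

theorem formComponents_injective (k : ℕ) : Function.Injective (formComponents k) := by
  intro κ κ' h
  ext w
  rw [form_apply_eq_sum, form_apply_eq_sum, h]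

instance finiteDimensional_form : FiniteDimensional ℝ (V7 [⋀^Fin k]→L[ℝ] ℝ) :=
  Module.Finite.of_injective (formComponents k) (formComponents_injective k)

variable {r : WithTop ℕ∞} {κ : E → V7 [⋀^Fin k]→L[ℝ] ℝ} {x : E}

theorem contDiffAt_form
    (h : ∀ f : Fin k → Fin 7, ContDiffAt ℝ r (fun y => κ y fun i => bas (f i)) x) :
    ContDiffAt ℝ r κ x := by
  obtain ⟨g, hg⟩ := LinearMap.exists_leftInverse_of_injective (formComponents k)
    (LinearMap.ker_eq_bot.2 (formComponents_injective k))
  have h1 : ContDiffAt ℝ r (fun y => formComponents k (κ y)) x := contDiffAt_pi.2 h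
  have h2 := (LinearMap.toContinuousLinearMap g).contDiff.contDiffAt.comp x h1
  refine h2.congr_of_eventuallyEq (Filter.Eventually.of_forall fun y => ?_)
  exact (LinearMap.congr_fun hg (κ y)).symm

theorem contDiffAt_form_apply (h : ContDiffAt ℝ r κ x) {w : Fin k → E → V7}
    (hw : ∀ i, ContDiffAt ℝ r (w i) x) : ContDiffAt ℝ r (fun y => κ y fun i => w i y) x := by
  have h1 : ContDiffAt ℝ r (fun y => formComponents k (κ y)) x :=
    (LinearMap.toContinuousLinearMap (formComponents k)).contDiff.contDiffAt.comp x h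
  have e : (fun y => κ y fun i => w i y) =
      fun y => ∑ f : Fin k → Fin 7, (∏ i, w i y (f i)) * formComponents k (κ y) f :=
    funext fun y => form_apply_eq_sum _ _
  rw [e]
  refine ContDiffAt.sum fun f _ => ContDiffAt.mul (contDiffAt_prod fun i _ => ?_)
    (contDiffAt_pi.1 h1 f)
  exact (EuclideanSpace.proj (f i) : V7 →L[ℝ] ℝ).contDiff.contDiffAt.comp x (hw i)

end Normed

variable {M : Type*} [TopologicalSpace M] [ChartedSpace V7 M] {k : ℕ}

/-- The pull-back of a field of forms under a map from `ℝ⁷`. -/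
def pull (η : FormField M k) (G : V7 → M) (q : V7) : V7 [⋀^Fin k]→L[ℝ] ℝ :=
  (η (G q) : V7 [⋀^Fin k]→L[ℝ] ℝ).compContinuousLinearMap (deriv7 G q)

theorem pull_apply (η : FormField M k) (G : V7 → M) (q : V7) (v : Fin k → V7) :
    pull η G q v = (η (G q) : V7 [⋀^Fin k]→L[ℝ] ℝ) fun i => deriv7 G q (v i) := rfl

variable [IsManifold 𝓘(ℝ, V7) ∞ M] {e : OpenPartialHomeomorph M V7} {G : V7 → M} {p : V7}
  {η : FormField M k}

theorem minSmoothness_two_le : minSmoothness ℝ 2 ≤ ∞ := by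
  simpa using WithTop.coe_le_coe.2 (le_top : (2 : ℕ∞) ≤ ⊤)

theorem contDiffAt_chart_comp (he : e ∈ atlas V7 M) (hx : G p ∈ e.source)
    (hG : ContMDiffAt 𝓘(ℝ, V7) 𝓘(ℝ, V7) ∞ G p) : ContDiffAt ℝ ∞ (fun q => e (G q)) p :=
  contMDiffAt_iff_contDiffAt.1 ((contMDiffAt_chart he hx).comp p hG)

/-- The pull-back under G is an ordinary pull-back, under e ∘ G, of the form in the chart. This
brings the calculus of forms on vector spaces to bear on M. -/
theorem inChart_comp (he : e ∈ atlas V7 M) {q : V7} (hx : G q ∈ e.source)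
    (hG : MDifferentiableAt 𝓘(ℝ, V7) 𝓘(ℝ, V7) G q) (η : FormField M k) :
    (η.inChart e (e (G q))).compContinuousLinearMap (fderiv ℝ (fun q => e (G q)) q) =
      pull η G q := by
  have hy : e (G q) ∈ e.target := e.map_source hx
  have h1 := (hasFDerivAt_chart_comp he hG.hasMFDerivAt hx).differentiableAt
  have h2 := HasMFDerivAt.comp q (mdifferentiableAt_chart_symm he hy).hasMFDerivAt
    h1.hasFDerivAt.hasMFDerivAt
  have hnear : ∀ᶠ q' in nhds q, e.symm (e (G q')) = G q' := by
    filter_upwards [hG.continuousAt.eventually_mem (e.open_source.mem_nhds hx)] with q' hq'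
    exact e.left_inv hq'
  have h3 := hasMFDerivAt_unique (hG.hasMFDerivAt) (h2.congr_of_eventuallyEq
    (hnear.mono fun q' hq' => hq'.symm))
  have h4 : deriv7 G q = ((mfderiv 𝓘(ℝ, V7) 𝓘(ℝ, V7) e.symm (e (G q)) :) : V7 →L[ℝ] V7).comp
      (fderiv ℝ (fun q => e (G q)) q) := h3
  have h5 (y : M) (hy : y = G q) : (η y : V7 [⋀^Fin k]→L[ℝ] ℝ) = η (G q) := by rw [hy]
  ext v
  rw [pull_apply, h4]
  exact congrArg (fun κ : V7 [⋀^Fin k]→L[ℝ] ℝ => κ fun i =>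
    ((mfderiv 𝓘(ℝ, V7) 𝓘(ℝ, V7) e.symm (e (G q)) :) : V7 →L[ℝ] V7)
      (fderiv ℝ (fun q => e (G q)) q (v i))) (h5 _ (e.left_inv hx))

theorem inChart_comp_eventually (he : e ∈ atlas V7 M) (hx : G p ∈ e.source)
    (hG : ∀ᶠ q in nhds p, ContMDiffAt 𝓘(ℝ, V7) 𝓘(ℝ, V7) ∞ G q) (η : FormField M k) :
    pull η G =ᶠ[nhds p] fun q =>
      (η.inChart e (e (G q))).compContinuousLinearMap (fderiv ℝ (fun q => e (G q)) q) := by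
  filter_upwards [hG, hG.self_of_nhds.continuousAt.eventually_mem (e.open_source.mem_nhds hx)]
    with q h1 h2
  exact (inChart_comp he h2 (h1.mdifferentiableAt (by simp)) η).symm

theorem FormField.IsOfClass.contDiffAt {r : WithTop ℕ∞} (hη : η.IsOfClass r) (he : e ∈ atlas V7 M)
    {y : V7} (hy : y ∈ e.target) : ContDiffAt ℝ r (η.inChart e) y :=
  (hη e he).contDiffAt (e.open_target.mem_nhds hy)

/-- The pull-back involves one derivative of G, whence r + 1 ≤ ∞; this includes r = ∞, because ∞ + 1
= ∞. -/
theorem FormField.IsOfClass.contDiffAt_pull {r : WithTop ℕ∞} (hη : η.IsOfClass r)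
    (hr : r + 1 ≤ ∞) (hG : ∀ᶠ q in nhds p, ContMDiffAt 𝓘(ℝ, V7) 𝓘(ℝ, V7) ∞ G q) :
    ContDiffAt ℝ r (pull η G) p := by
  have he := chart_mem_atlas V7 (G p)
  have hx := mem_chart_source V7 (G p)
  refine ContDiffAt.congr_of_eventuallyEq ?_ (inChart_comp_eventually he hx hG η)
  have h1 := contDiffAt_chart_comp he hx hG.self_of_nhds
  have h2 := (hη.contDiffAt he ((chartAt V7 (G p)).map_source hx)).comp p
    (h1.of_le (le_self_add.trans hr))
  have h3 : ContDiffAt ℝ r (fderiv ℝ (fun q => chartAt V7 (G p) (G q))) p := h1.fderiv_right hr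
  refine contDiffAt_form fun f => ?_
  exact contDiffAt_form_apply h2 (w := fun i q => fderiv ℝ (fun q => chartAt V7 (G p) (G q)) q
    (bas (f i))) fun i => h3.clm_apply contDiffAt_const

theorem FormField.IsClosed.extDeriv_pull (hη : η.IsClosed)
    (hG : ∀ᶠ q in nhds p, ContMDiffAt 𝓘(ℝ, V7) 𝓘(ℝ, V7) ∞ G q) : extDeriv (pull η G) p = 0 := by
  have he := chart_mem_atlas V7 (G p)
  have hx := mem_chart_source V7 (G p)
  have hy := (chartAt V7 (G p)).map_source hx
  rw [(inChart_comp_eventually he hx hG η).extDeriv_eq,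
    extDeriv_pullback (r := ∞) (f := fun q => chartAt V7 (G p) (G q))
      ((hη.1.contDiffAt he hy).differentiableAt (by simp))
      (contDiffAt_chart_comp he hx hG.self_of_nhds) minSmoothness_two_le, hη.2 _ he _ hy]
  rfl

/-! ### Descent of regularity and closedness along local diffeomorphisms -/

section Descend

theorem exists_fderiv_equiv (he : e ∈ atlas V7 M) (hx : G p ∈ e.source)
    (hG : ∀ᶠ q in nhds p, ContMDiffAt 𝓘(ℝ, V7) 𝓘(ℝ, V7) ∞ G q)
    (hinj : Function.Injective (deriv7 G p)) :
    ∃ H' : V7 ≃L[ℝ] V7, HasFDerivAt (fun q => e (G q)) (H' : V7 →L[ℝ] V7) p := by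
  have hGp := hG.self_of_nhds
  have hmd := hGp.mdifferentiableAt (n := ∞) (by simp)
  have h1 := hasFDerivAt_chart_comp he hmd.hasMFDerivAt hx
  have hinj' : Function.Injective ((dChart e (G p)).comp (deriv7 G p)) := by
    refine (injective_iff_map_eq_zero _).2 fun v hv => ?_
    have h3 := HasMFDerivAt.comp p (mdifferentiableAt_chart_symm he (e.map_source hx)).hasMFDerivAt
      h1.hasMFDerivAt
    have hnear : ∀ᶠ q' in nhds p, e.symm (e (G q')) = G q' := by
      filter_upwards [hmd.continuousAt.eventually_mem (e.open_source.mem_nhds hx)] with q' hq'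
      exact e.left_inv hq'
    have h4 := hasMFDerivAt_unique hmd.hasMFDerivAt (h3.congr_of_eventuallyEq
      (hnear.mono fun q' hq' => hq'.symm))
    -- The derivative of G factors through that of e ∘ G, so injectivity passes to the latter.
    obtain ⟨T, hT⟩ : ∃ T : V7 →L[ℝ] V7, deriv7 G p = T.comp ((dChart e (G p)).comp (deriv7 G p)) :=
      ⟨_, h4⟩
    have h5 : deriv7 G p v = T ((dChart e (G p)).comp (deriv7 G p) v) :=
      congrArg (fun f : V7 →L[ℝ] V7 => f v) hT
    rw [hv, map_zero] at h5
    exact hinj (by rw [h5, map_zero])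
  set L : V7 ≃L[ℝ] V7 := (LinearEquiv.ofInjectiveEndo
    ((dChart e (G p)).comp (deriv7 G p) : V7 →ₗ[ℝ] V7) hinj').toContinuousLinearEquiv
  have hL : (L : V7 →L[ℝ] V7) = (dChart e (G p)).comp (deriv7 G p) := by
    ext1 v; rfl
  exact ⟨L, hL ▸ h1⟩

/-- By the inverse function theorem e ∘ G has a smooth local inverse h, and near e (G p) the form in
the chart is the pull-back under h of the form `pull η G`. -/
theorem contDiffAt_inChart_of_pull {r : WithTop ℕ∞} (hr : r + 1 ≤ ∞) (he : e ∈ atlas V7 M)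
    (hx : G p ∈ e.source) (hG : ∀ᶠ q in nhds p, ContMDiffAt 𝓘(ℝ, V7) 𝓘(ℝ, V7) ∞ G q)
    (hinj : Function.Injective (deriv7 G p)) (hη : ContDiffAt ℝ r (pull η G) p) :
    ContDiffAt ℝ r (η.inChart e) (e (G p)) := by
  obtain ⟨H', hH'⟩ := exists_fderiv_equiv he hx hG hinj
  set H : V7 → V7 := fun q => e (G q) with hH
  have hHs : ContDiffAt ℝ ∞ H p := contDiffAt_chart_comp he hx hG.self_of_nhds
  have hst := hHs.hasStrictFDerivAt' hH' (by simp)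
  set h : V7 → V7 := hHs.localInverse hH' (by simp) with hh
  have hhs : ContDiffAt ℝ ∞ h (H p) := hHs.to_localInverse hH' (by simp)
  have hhp : h (H p) = p := hHs.localInverse_apply_image hH' (by simp)
  have hright : ∀ᶠ y in nhds (H p), H (h y) = y := hst.eventually_right_inverse
  have htend : Filter.Tendsto h (nhds (H p)) (nhds p) := by
    have := hhs.continuousAt.tendsto; rwa [hhp] at this
  have hsource : ∀ᶠ q in nhds p, G q ∈ e.source :=
    hG.self_of_nhds.continuousAt.eventually_mem (e.open_source.mem_nhds hx)
  have hdiff : ∀ᶠ y in nhds (H p), DifferentiableAt ℝ h y := by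
    have h1 : ContDiffAt ℝ 1 h (H p) := hhs.of_le (by exact_mod_cast le_top)
    exact (h1.eventually (by simp)).mono fun y hy => hy.differentiableAt (by simp)
  have key : η.inChart e =ᶠ[nhds (H p)] fun y =>
      (pull η G (h y)).compContinuousLinearMap (fderiv ℝ h y) := by
    filter_upwards [hright.eventually_nhds, htend.eventually hG, htend.eventually hsource, hdiff]
      with y h1 h2 h3 h4
    have h5 := inChart_comp he h3 (h2.mdifferentiableAt (by simp)) η
    have h6 : HasFDerivAt H (fderiv ℝ H (h y)) (h y) :=
      (contDiffAt_chart_comp he h3 h2).differentiableAt (by simp) |>.hasFDerivAt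
    have h7 : HasFDerivAt (fun y => H (h y)) (ContinuousLinearMap.id ℝ V7) y :=
      (hasFDerivAt_id y).congr_of_eventuallyEq h1
    have h8 := (h6.comp y h4.hasFDerivAt).unique h7
    rw [← h5, show e (G (h y)) = y from h1.self_of_nhds]
    ext v
    have h9 (i) : fderiv ℝ H (h y) (fderiv ℝ h y (v i)) = v i :=
      congrArg (fun f : V7 →L[ℝ] V7 => f (v i)) h8
    exact congrArg (η.inChart e y) (funext fun i => (h9 i).symm)
  refine ContDiffAt.congr_of_eventuallyEq ?_ key
  have h10 : ContDiffAt ℝ r (fun y => pull η G (h y)) (H p) := by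
    refine ContDiffAt.comp (g := pull η G) (f := h) (H p) ?_ (hhs.of_le (le_self_add.trans hr))
    rw [hhp]; exact hη
  refine contDiffAt_form fun f => ?_
  exact contDiffAt_form_apply h10 (w := fun i y => fderiv ℝ h y (bas (f i)))
    fun i => (hhs.fderiv_right hr).clm_apply contDiffAt_const

/-- The exterior derivative commutes with the pull-back under e ∘ G, whose derivative at p is
invertible and can be cancelled. -/
theorem extDeriv_inChart_of_pull (he : e ∈ atlas V7 M)
    (hx : G p ∈ e.source) (hG : ∀ᶠ q in nhds p, ContMDiffAt 𝓘(ℝ, V7) 𝓘(ℝ, V7) ∞ G q)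
    (hinj : Function.Injective (deriv7 G p)) (hη : ContDiffAt ℝ 1 (pull η G) p)
    (h0 : extDeriv (pull η G) p = 0) : extDeriv (η.inChart e) (e (G p)) = 0 := by
  obtain ⟨H', hH'⟩ := exists_fderiv_equiv he hx hG hinj
  have h1 := contDiffAt_inChart_of_pull (by norm_cast) he hx hG hinj hη
  rw [(inChart_comp_eventually he hx hG η).extDeriv_eq,
    extDeriv_pullback (r := ∞) (f := fun q => e (G q)) (h1.differentiableAt (by simp))
      (contDiffAt_chart_comp he hx hG.self_of_nhds) minSmoothness_two_le, hH'.fderiv] at h0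
  ext v
  have h2 := congrArg (fun κ => κ fun i => H'.symm (v i)) h0
  simpa [ContinuousAlternatingMap.compContinuousLinearMap_apply, Function.comp_def] using h2

end Descend

end Pull

/-! ### The tube around a curve -/

section Tube

variable {M : Type*} [TopologicalSpace M] [ChartedSpace V7 M]

/-- The velocity of a curve, as a vector of `ℝ⁷`. -/
def vel (γ : ℝ → M) (t : ℝ) : V7 := velocity γ t

theorem HasVelocity.vel_eq {c : ℝ → M} {t : ℝ} {v : V7} (hv : HasVelocity c t v) : vel c t = v :=
  hv.velocity_eq

variable [MulAction Sp2 M]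

/-- `tubeDeriv`, with values in `ℝ⁷`. -/
def tubeD (γ : ℝ → M) (t : ℝ) : (ℝ × sp2) →L[ℝ] V7 := tubeDeriv γ t

variable {γ : ℝ → M} {t : ℝ}

theorem hasVelocity_vel (hγ : ContMDiffAt 𝓘(ℝ, ℝ) 𝓘(ℝ, V7) ∞ γ t) : HasVelocity γ t (vel γ t) :=
  hasVelocity_of_mdifferentiableAt (hγ.mdifferentiableAt (by simp))

theorem tubeD_apply (hact : IsSmoothAction M) (hγ : ContMDiffAt 𝓘(ℝ, ℝ) 𝓘(ℝ, V7) ∞ γ t) (τ : ℝ)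
    (X : sp2) : tubeD γ t (τ, X) = τ • vel γ t + infAct (γ t) X := by
  have hG : ContMDiffAt 𝓘(ℝ, ℝ × sp2) 𝓘(ℝ, V7) ∞ (fun p : ℝ × sp2 => expSp p.2 • γ p.1) (t, 0) :=
    contMDiff_expSp_smul hact
      (ContMDiffAt.comp (t, (0 : sp2)) (g := γ) (f := fun p : ℝ × sp2 => p.1) hγ
        contDiff_fst.contDiffAt.contMDiffAt) contDiff_snd
  have hmd := hG.mdifferentiableAt (n := ∞) (by simp)
  have h1 : tubeD γ t (1, 0) = vel γ t := by
    have hl : HasDerivAt (fun s : ℝ => ((s, 0) : ℝ × sp2)) (1, 0) t :=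
      (hasDerivAt_id t).prodMk (hasDerivAt_const t (0 : sp2))
    have h2 := hasVelocity_comp hmd hl rfl
    simp only [expSp_zero, one_smul] at h2
    exact h2.unique (hasVelocity_vel hγ)
  have h3 : tubeD γ t (0, X) = infAct (γ t) X := by
    have hl : HasDerivAt (fun s : ℝ => ((t, s • X) : ℝ × sp2)) (0, X) 0 :=
      (hasDerivAt_const 0 t).prodMk (hasDerivAt_smul_const_zero X)
    have h2 := hasVelocity_comp hmd hl (by simp)
    exact h2.unique (hasVelocity_orbit hact (γ t) X)
  have e : ((τ, X) : ℝ × sp2) = τ • (1, 0) + (0, X) := by simp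
  rw [e, map_add, map_smul, h1, h3]

/-- The map `p ↦ a exp (p₁E₁) ⋯ exp (p₆E₆) • γ(p₀)`. -/
def tubeMap (γ : ℝ → M) (a : Sp2) (p : V7) : M := (a * groupCoord p) • γ (p 0)

/-- The frame of `ℝ ⊕ sp(2)` modulo `k` corresponding to the partial derivatives of `tubeMap`. -/
def tubeField (p : V7) (i : Fin 7) : ℝ × sp2 := (if i = 0 then 1 else 0, partialField p i)

theorem tubeField_smul_bas_zero (t : ℝ) : tubeField (t • bas 0) = frame := by
  funext i
  rw [tubeField, partialField_smul_bas_zero, frame]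

theorem contDiff_tubeField (i : Fin 7) : ContDiff ℝ ∞ fun p => tubeField p i :=
  contDiff_const.prodMk (contDiff_partialField i)

theorem contMDiffAt_tubeMap (hact : IsSmoothAction M) (a : Sp2) {p : V7}
    (hγ : ContMDiffAt 𝓘(ℝ, ℝ) 𝓘(ℝ, V7) ∞ γ (p 0)) :
    ContMDiffAt 𝓘(ℝ, V7) 𝓘(ℝ, V7) ∞ (tubeMap γ a) p := by
  have h0 : ContMDiffAt 𝓘(ℝ, V7) 𝓘(ℝ, V7) ∞ (fun p : V7 => γ (p 0)) p :=
    ContMDiffAt.comp p (g := γ) (f := fun p : V7 => p 0) hγ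
      (EuclideanSpace.proj 0 : V7 →L[ℝ] ℝ).contDiff.contDiffAt.contMDiffAt
  have hc (k : Fin 7) : ContDiff ℝ ∞ fun p : V7 => p k • spFrame k :=
    ((EuclideanSpace.proj k : V7 →L[ℝ] ℝ).smulRight (spFrame k)).contDiff
  have h1 := contMDiff_expSp_smul hact (contMDiff_expSp_smul hact (contMDiff_expSp_smul hact
    (contMDiff_expSp_smul hact (contMDiff_expSp_smul hact (contMDiff_expSp_smul hact h0 (hc 6))
      (hc 5)) (hc 4)) (hc 3)) (hc 2)) (hc 1)
  have h2 := (contMDiff_act hact a).contMDiffAt.comp p h1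
  refine h2.congr_of_eventuallyEq (Filter.Eventually.of_forall fun q => ?_)
  simp only [tubeMap, groupCoord, mul_smul, Function.comp_apply]

/-- The partial derivative is a translate, under the group element a · `groupCoord p`, of a vector
at γ(p₀). An invariant form does not see the translation, so its pull-back has the components of the
form at γ(p₀) on the fields `tubeField`. -/
theorem deriv7_tubeMap (hact : IsSmoothAction M) (a : Sp2) {p : V7}
    (hγ : ContMDiffAt 𝓘(ℝ, ℝ) 𝓘(ℝ, V7) ∞ γ (p 0)) (i : Fin 7) :
    deriv7 (tubeMap γ a) p (bas i) =
      dAct (a * groupCoord p) (γ (p 0)) (tubeD γ (p 0) (tubeField p i)) := by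
  have hmd := (contMDiffAt_tubeMap hact a hγ).mdifferentiableAt (n := ∞) (by simp)
  have hl : HasDerivAt (fun s : ℝ => p + s • bas i) (bas i) 0 :=
    (hasDerivAt_smul_const_zero (bas i)).const_add p
  have h1 := hasVelocity_comp hmd hl (by simp)
  refine h1.unique ?_
  rw [tubeField, tubeD_apply hact hγ]
  by_cases hi : i = 0
  · subst hi
    have e : (fun s : ℝ => tubeMap γ a (p + s • bas 0)) =
        fun s => (a * groupCoord p) • γ (p 0 + s) := by
      funext s
      rw [tubeMap, groupCoord_add_smul_zero]
      simp [bas]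
    rw [e, if_pos rfl, one_smul, partialField_zero, map_zero, add_zero]
    have h2 := (hasVelocity_vel hγ).shift.act hact (a * groupCoord p)
    rwa [add_zero] at h2
  · have e : (fun s : ℝ => tubeMap γ a (p + s • bas i)) =
        fun s => (a * groupCoord p) • expSp (s • partialField p i) • γ (p 0) := by
      funext s
      rw [tubeMap, groupCoord_add_smul p i hi, ← mul_assoc, mul_smul]
      simp [bas, Pi.single_apply, Ne.symm hi]
    rw [e, if_neg hi, zero_smul, zero_add]
    have h2 := (hasVelocity_orbit hact (γ (p 0)) (partialField p i)).act hact (a * groupCoord p)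
    rwa [zero_smul, expSp_zero, one_smul] at h2

theorem tubeD_smul (hact : IsSmoothAction M) (b : Sp2)
    (hγ : ContMDiffAt 𝓘(ℝ, ℝ) 𝓘(ℝ, V7) ∞ γ t) (τ : ℝ) (X : sp2) :
    tubeD (fun t => b • γ t) t (τ, X) = dAct b (γ t) (tubeD γ t (τ, Ad b⁻¹ X)) := by
  have hb : ContMDiffAt 𝓘(ℝ, ℝ) 𝓘(ℝ, V7) ∞ (fun t => b • γ t) t :=
    (contMDiff_act hact b).contMDiffAt.comp t hγ
  rw [tubeD_apply hact hγ, tubeD_apply hact hb, infAct_smul hact, map_add, map_smul,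
    ((hasVelocity_vel hγ).act hact b).vel_eq]

/-- Along the tube, an invariant form is determined by its pull-back under `tubeDeriv`. -/
theorem pull_tubeMap {k : ℕ} (hact : IsSmoothAction M) {η : FormField M k}
    (hη : ∀ (a : Sp2) (x : M), ((η (a • x) : V7 [⋀^Fin k]→L[ℝ] ℝ)).compContinuousLinearMap
      (dAct a x) = η x) (a : Sp2) {p : V7}
    (hγ : ContMDiffAt 𝓘(ℝ, ℝ) 𝓘(ℝ, V7) ∞ γ (p 0)) (f : Fin k → Fin 7) :
    pull η (tubeMap γ a) p (fun i => bas (f i)) =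
      (η (γ (p 0)) : V7 [⋀^Fin k]→L[ℝ] ℝ) fun i => tubeD γ (p 0) (tubeField p (f i)) := by
  rw [pull_apply, ← hη (a * groupCoord p) (γ (p 0))]
  simp only [deriv7_tubeMap hact a hγ]
  rfl

end Tube

/-! ### The exterior derivative of an invariant four-form on the tube -/

/-- The coordinates of a vector of `ℝ ⊕ sp(2)` modulo `k`. -/
def coords : (ℝ × sp2) →L[ℝ] V7 :=
  ((EuclideanSpace.equiv (Fin 7) ℝ).symm : (Fin 7 → ℝ) →L[ℝ] V7).comp
    (ContinuousLinearMap.pi coframe)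

theorem coords_apply (v : ℝ × sp2) (i : Fin 7) : coords v i = coframe i v := rfl

theorem coords_frame (i : Fin 7) : coords (frame i) = bas i := by
  ext j
  rw [coords_apply, coframe_frame, bas_apply]

theorem coords_zero_spOf (a₁ a₂ a₃ d₁ d₂ d₃ b₀ b₁ b₂ b₃ : ℝ) :
    coords (0, spOf a₁ a₂ a₃ d₁ d₂ d₃ b₀ b₁ b₂ b₃) = WithLp.toLp 2
      ![0, 2 * d₂, -2 * d₃, 2 * √2 * b₀, 2 * √2 * b₁, 2 * √2 * b₂, 2 * √2 * b₃] := by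
  ext i
  rw [coords_apply, coframe_spOf]

/-- The index `k` such that `[Eᵢ, Eⱼ]` is a multiple of `E_k` modulo `k`, for `i < j`. -/
def bracketIndex : Fin 7 → Fin 7 → Fin 7 :=
  ![0, ![0, 0, 0, 5, 6, 3, 4], ![0, 0, 0, 6, 5, 4, 3], ![0, 0, 0, 0, 0, 1, 2],
    ![0, 0, 0, 0, 0, 2, 1], 0, 0]

/-- Twice the factor in question. -/
def bracketCoeff : Fin 7 → Fin 7 → ℤ :=
  ![0, ![0, 0, 0, 1, -1, -1, 1], ![0, 0, 0, -1, -1, 1, 1], ![0, 0, 0, 0, 0, 1, -1],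
    ![0, 0, 0, 0, 0, -1, -1], 0, 0]

/-- The structure constants of sp(2) modulo the Lie algebra of K. In this normalization of the Eᵢ
they become integers after doubling, so that the exterior derivative can be evaluated in integer
arithmetic. -/
theorem coords_bracket (i j : Fin 7) (h : i < j) :
    coords (0, bracket (spFrame i) (spFrame j)) =
      ((bracketCoeff i j : ℝ) / 2) • bas (bracketIndex i j) := by
  have h2 : √2 * √2 = 2 := Real.mul_self_sqrt zero_le_two
  have h3 : √2 ≠ 0 := by positivity
  have h4 : (√2)⁻¹ * (√2)⁻¹ = 1 / 2 := by rw [← mul_inv, h2]; norm_num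
  have h5 : √2 * (√2)⁻¹ = 1 := mul_inv_cancel₀ h3
  have hz : bracket (spFrame 0) (spFrame j) = spOf 0 0 0 0 0 0 0 0 0 0 := by
    have e : spFrame 0 = (0 : ℝ) • (0 : sp2) := by rw [zero_smul]; rfl
    have e0 := smul_spOf 0 0 0 0 0 0 0 0 0 0 0
    rw [zero_smul] at e0
    rw [e, smul_bracket, zero_smul, e0]; simp
  have e1 : spFrame 1 = spOf 0 0 0 0 (1 / 2) 0 0 0 0 0 := rfl
  have e2 : spFrame 2 = spOf 0 0 0 0 0 (-1 / 2) 0 0 0 0 := rfl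
  have e3 : spFrame 3 = spOf 0 0 0 0 0 0 (1 / (2 * √2)) 0 0 0 := rfl
  have e4 : spFrame 4 = spOf 0 0 0 0 0 0 0 (1 / (2 * √2)) 0 0 := rfl
  have e5 : spFrame 5 = spOf 0 0 0 0 0 0 0 0 (1 / (2 * √2)) 0 := rfl
  have e6 : spFrame 6 = spOf 0 0 0 0 0 0 0 0 0 (1 / (2 * √2)) := rfl
  have q1 : 2 * √2 * ((√2)⁻¹ * 2⁻¹ * 2⁻¹) = 1 / 2 := by linear_combination (1 / 2) * h5
  have q2 : 2 * √2 * (2⁻¹ * ((√2)⁻¹ * 2⁻¹)) = 1 / 2 := by linear_combination (1 / 2) * h5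
  have q3 : 2 * (2 * ((√2)⁻¹ * 2⁻¹ * ((√2)⁻¹ * 2⁻¹))) = 1 / 2 := by linear_combination h4
  rcases eq_zero_or_one_or_six i with rfl | rfl | rfl | rfl | rfl | rfl | rfl
  · rw [hz, coords_zero_spOf]
    ext k
    simp [bracketCoeff]
    fin_cases k <;> rfl
  all_goals
    rcases eq_zero_or_one_or_six j with rfl | rfl | rfl | rfl | rfl | rfl | rfl <;>
    first
      | exact absurd h (by decide)
      | (simp only [e1, e2, e3, e4, e5, e6]
         rw [bracket_spOf, coords_zero_spOf]
         ext k
         rw [PiLp.smul_apply, bas_apply]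
         fin_cases k <;> simp [bracketCoeff, bracketIndex, q1, q2, q3] <;>
           first | (field_simp; done) | (field_simp; norm_num))

/-- The scaling with the factors `1, f₁, f₁, f₂, f₂, f₂, f₂`. -/
def scaleMap (f₁ f₂ : ℝ) : V7 →L[ℝ] V7 :=
  ((EuclideanSpace.equiv (Fin 7) ℝ).symm : (Fin 7 → ℝ) →L[ℝ] V7).comp
    (ContinuousLinearMap.pi fun i => (![1, f₁, f₁, f₂, f₂, f₂, f₂] i : ℝ) •
      (EuclideanSpace.proj i : V7 →L[ℝ] ℝ))

theorem scaleMap_apply (f₁ f₂ : ℝ) (x : V7) (i : Fin 7) :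
    scaleMap f₁ f₂ x i = (![1, f₁, f₁, f₂, f₂, f₂, f₂] i : ℝ) * x i := rfl

theorem scaleMap_scaleMap (f₁ f₂ g₁ g₂ : ℝ) (h₁ : f₁ * g₁ = 1) (h₂ : f₂ * g₂ = 1) (x : V7) :
    scaleMap f₁ f₂ (scaleMap g₁ g₂ x) = x := by
  ext i
  rw [scaleMap_apply, scaleMap_apply, ← mul_assoc]
  fin_cases i <;> simp [h₁, h₂]

/-- The scaling with nonzero factors, as an equivalence. -/
def scaleEquiv {f₁ f₂ : ℝ} (h₁ : f₁ ≠ 0) (h₂ : f₂ ≠ 0) : V7 ≃L[ℝ] V7 :=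
  ContinuousLinearEquiv.equivOfInverse (scaleMap f₁ f₂) (scaleMap f₁⁻¹ f₂⁻¹)
    (scaleMap_scaleMap _ _ _ _ (inv_mul_cancel₀ h₁) (inv_mul_cancel₀ h₂))
    (scaleMap_scaleMap _ _ _ _ (mul_inv_cancel₀ h₁) (mul_inv_cancel₀ h₂))

theorem coe_scaleEquiv {f₁ f₂ : ℝ} (h₁ : f₁ ≠ 0) (h₂ : f₂ ≠ 0) :
    (scaleEquiv h₁ h₂ : V7 →L[ℝ] V7) = scaleMap f₁ f₂ := rfl

/-- The invariant four-forms on the tube. -/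
def fourForm (c : Fin 4 → ℝ) : V7 [⋀^Fin 4]→L[ℝ] ℝ :=
  let v : Fin 7 → V7 →L[ℝ] ℝ := fun i => EuclideanSpace.proj i
  c 0 • (wedge ![v 1, v 2, v 3, v 4] + wedge ![v 1, v 2, v 5, v 6])
    + c 1 • wedge ![v 3, v 4, v 5, v 6]
    + c 2 • (wedge ![v 0, v 2, v 4, v 6] - wedge ![v 0, v 2, v 3, v 5]
        - wedge ![v 0, v 1, v 4, v 5] - wedge ![v 0, v 1, v 3, v 6])
    - c 3 • (wedge ![v 0, v 1, v 3, v 5] - wedge ![v 0, v 1, v 4, v 6]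
        - wedge ![v 0, v 2, v 3, v 6] - wedge ![v 0, v 2, v 4, v 5])

/-- The coefficients of the dual of the form in normal form. -/
def starCoeff (f₁ f₂ θ : ℝ) : Fin 4 → ℝ :=
  ![f₁ ^ 2 * f₂ ^ 2, f₂ ^ 4, f₁ * f₂ ^ 2 * Real.sin θ, f₁ * f₂ ^ 2 * Real.cos θ]

theorem starForm_comp_scaleMap (f₁ f₂ θ : ℝ) :
    (starForm θ).compContinuousLinearMap (scaleMap f₁ f₂) = fourForm (starCoeff f₁ f₂ θ) := by
  refine ext_four fun x y z w => ?_
  rw [comp_four_apply]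
  simp only [starForm, fourForm, starCoeff, ContinuousAlternatingMap.add_apply,
    ContinuousAlternatingMap.sub_apply, ContinuousAlternatingMap.smul_apply, wedge_four_apply,
    PiLp.proj_apply, smul_eq_mul, scaleMap_apply, Matrix.cons_val]
  ring

theorem modelForm_comp_scaleMap_coords (f₁ f₂ θ : ℝ) :
    ((modelForm θ).compContinuousLinearMap (scaleMap f₁ f₂)).compContinuousLinearMap coords =
      f₁ ^ 2 • omegaOneForm coframe + f₂ ^ 2 • omegaTwoForm coframe +
        (f₁ * f₂ ^ 2) • (Real.cos θ • alphaForm coframe + Real.sin θ • betaForm coframe) := by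
  refine ext_three fun x y z => ?_
  rw [comp_three_apply, comp_three_apply]
  simp only [modelForm, omegaOneForm, omegaTwoForm, alphaForm, betaForm,
    ContinuousAlternatingMap.add_apply, ContinuousAlternatingMap.sub_apply,
    ContinuousAlternatingMap.smul_apply, wedge_three_apply, PiLp.proj_apply, smul_eq_mul,
    scaleMap_apply, Matrix.cons_val, coords_apply]
  ring

/-! ### Integer tables for the exterior derivative of invariant four-forms -/

section Table

/-- The value of `e_k` on the basis vector with number `a`. -/
def wedgeOne (k a : Fin 7) : ℤ := if a = k then 1 else 0

/-- The value of `e_k ∧ e_l` on basis vectors. -/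
def wedgeTwo (k l a b : Fin 7) : ℤ :=
  (if a = k then wedgeOne l b else 0) - if a = l then wedgeOne k b else 0

/-- The value of `e_k ∧ e_l ∧ e_m` on basis vectors. -/
def wedgeThree (k l m a b c : Fin 7) : ℤ :=
  (if a = k then wedgeTwo l m b c else 0) - (if a = l then wedgeTwo k m b c else 0)
    + if a = m then wedgeTwo k l b c else 0

/-- The value of `e_k ∧ e_l ∧ e_m ∧ e_n` on basis vectors. -/
def wedgeFour (k l m n a b c d : Fin 7) : ℤ :=
  (if a = k then wedgeThree l m n b c d else 0) - (if a = l then wedgeThree k m n b c d else 0)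
    + (if a = m then wedgeThree k l n b c d else 0) - if a = n then wedgeThree k l m b c d else 0

theorem wedge_bas (k l m n a b c d : Fin 7) :
    wedge ![(EuclideanSpace.proj k : V7 →L[ℝ] ℝ), EuclideanSpace.proj l, EuclideanSpace.proj m,
      EuclideanSpace.proj n] ![bas a, bas b, bas c, bas d] = wedgeFour k l m n a b c d := by
  have h (P : Prop) [Decidable P] (x : ℤ) : (if P then x else 0) = (if P then 1 else 0) * x := by
    split_ifs <;> simp
  have h' (i j : Fin 7) : bas i j = ((wedgeOne j i : ℤ) : ℝ) := by
    rw [bas_apply, wedgeOne]; simp [eq_comm]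
  rw [wedge_four_apply]
  simp only [PiLp.proj_apply, h', wedgeFour, wedgeThree, wedgeTwo, h _ (wedgeOne _ _),
    h _ (_ - _), h _ (_ + _)]
  have hone (i j : Fin 7) : (if j = i then (1 : ℤ) else 0) = wedgeOne i j := rfl
  simp only [hone]
  push_cast
  ring

/-- The coefficients of the value of a `fourForm` on basis vectors. -/
def fourCoeff (a b c d : Fin 7) : Fin 4 → ℤ :=
  ![wedgeFour 1 2 3 4 a b c d + wedgeFour 1 2 5 6 a b c d, wedgeFour 3 4 5 6 a b c d,
    wedgeFour 0 2 4 6 a b c d - wedgeFour 0 2 3 5 a b c d - wedgeFour 0 1 4 5 a b c d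
      - wedgeFour 0 1 3 6 a b c d,
    -(wedgeFour 0 1 3 5 a b c d - wedgeFour 0 1 4 6 a b c d - wedgeFour 0 2 3 6 a b c d
      - wedgeFour 0 2 4 5 a b c d)]

theorem fourForm_bas (c : Fin 4 → ℝ) (g : Fin 4 → Fin 7) :
    fourForm c (fun i => bas (g i)) = ∑ l, (fourCoeff (g 0) (g 1) (g 2) (g 3) l : ℝ) * c l := by
  have e : (fun i => bas (g i)) = ![bas (g 0), bas (g 1), bas (g 2), bas (g 3)] := by
    ext i : 1; fin_cases i <;> rfl
  rw [e, Fin.sum_univ_four]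
  simp only [fourForm, ContinuousAlternatingMap.add_apply, ContinuousAlternatingMap.sub_apply,
    ContinuousAlternatingMap.smul_apply, wedge_bas, smul_eq_mul, fourCoeff, Matrix.cons_val]
  push_cast
  ring

/-- The contribution of the derivatives of the coefficients to the exterior derivative. -/
def derivPart (f : Fin 5 → Fin 7) (l : Fin 4) : ℤ :=
  ∑ m : Fin 5, if f m = 0 then (-1) ^ m.val *
    fourCoeff (m.removeNth f 0) (m.removeNth f 1) (m.removeNth f 2) (m.removeNth f 3) l else 0

/-- The index tuple arising from the bracket of the entry `i` of `g` with the vector `j`. -/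
def bracketTuple (g : Fin 4 → Fin 7) (j : Fin 7) (i i' : Fin 4) : Fin 7 :=
  if i' = i then bracketIndex (g i) j else g i'

/-- The contribution of the brackets to the exterior derivative along `j`, multiplied by two. -/
def slotPart (g : Fin 4 → Fin 7) (j : Fin 7) (l : Fin 4) : ℤ :=
  ∑ i : Fin 4, if g i < j then bracketCoeff (g i) j * fourCoeff (bracketTuple g j i 0)
    (bracketTuple g j i 1) (bracketTuple g j i 2) (bracketTuple g j i 3) l else 0

/-- The contribution of the brackets to the exterior derivative, multiplied by two. -/
def bracketPart (f : Fin 5 → Fin 7) (l : Fin 4) : ℤ :=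
  ∑ m : Fin 5, if f m = 0 then 0 else (-1) ^ m.val * slotPart (m.removeNth f) (f m) l

/-- The outcome of computing d of the invariant forms on increasing tuples: c₀ and c₁ enter through
their derivatives only, c₃ through brackets only, and c₂ not at all, since it multiplies a closed
form. Because `bracketPart` is doubled, the factor -4 means that a value of d is D₀ (c₀' - 2c₃) + D₁
(c₁' - 2c₃), with D₀, D₁ the values of `derivPart`. -/
theorem part_table (a b : Fin 7) (hab : a < b) (c : Fin 7) (hbc : b < c) (d : Fin 7) (hcd : c < d)
    (e : Fin 7) (hde : d < e) :
    let f := ![a, b, c, d, e]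
    derivPart f 2 = 0 ∧ derivPart f 3 = 0 ∧ bracketPart f 0 = 0 ∧ bracketPart f 1 = 0 ∧
      bracketPart f 2 = 0 ∧ bracketPart f 3 = -4 * (derivPart f 0 + derivPart f 1) := by
  revert a b c d e
  decide +kernel

/-- Two tuples that isolate c₀ and c₁, which makes the conditions c₀' = 2c₃ and c₁' = 2c₃ necessary
and not only sufficient. -/
theorem part_first : derivPart ![0, 1, 2, 3, 4] 0 = 1 ∧ derivPart ![0, 1, 2, 3, 4] 1 = 0 ∧
    derivPart ![0, 3, 4, 5, 6] 0 = 0 ∧ derivPart ![0, 3, 4, 5, 6] 1 = 1 := by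
  decide +kernel

end Table

/-! ### The exterior derivative on the axis of the tube -/

section TubeForm

variable {κ : V7 → V7 [⋀^Fin 4]→L[ℝ] ℝ} {c : ℝ → Fin 4 → ℝ} {c' : Fin 4 → ℝ} {t : ℝ}

theorem smul_bas_zero_apply (t : ℝ) : (t • bas 0 : V7) 0 = t := by simp [bas]

theorem smul_bas_zero_add_apply (t s : ℝ) (j : Fin 7) (hj : j ≠ 0) :
    (t • bas 0 + s • bas j : V7) 0 = t := by simp [bas, Pi.single_apply, hj.symm]

theorem hasDerivAt_coords_tubeField (t : ℝ) (i j : Fin 7) (hj : j ≠ 0) :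
    HasDerivAt (fun s : ℝ => coords (tubeField (t • bas 0 + s • bas j) i))
      ((if i < j then (bracketCoeff i j : ℝ) / 2 else 0) • bas (bracketIndex i j)) 0 := by
  have h1 := (hasDerivAt_const (0 : ℝ) (if i = 0 then (1 : ℝ) else 0)).prodMk
    (hasDerivAt_partialField t i j hj)
  have h2 : HasDerivAt (fun s : ℝ => coords (tubeField (t • bas 0 + s • bas j) i)) _ 0 :=
    coords.hasFDerivAt.comp_hasDerivAt (0 : ℝ) h1
  refine h2.congr_deriv ?_
  split_ifs with h
  · exact coords_bracket i j h
  · rw [zero_smul]; exact map_zero coords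

/-- The Leibniz rule: the coefficients are fixed, and differentiating the i-th argument replaces it
by its bracket with E_j when its index is smaller than j, and by zero otherwise. -/
theorem hasDerivAt_fourForm_line (C : Fin 4 → ℝ) (g : Fin 4 → Fin 7) (t : ℝ) (j : Fin 7)
    (hj : j ≠ 0) :
    HasDerivAt (fun s : ℝ => fourForm C fun i => coords (tubeField (t • bas 0 + s • bas j) (g i)))
      (∑ l, (slotPart g j l : ℝ) / 2 * C l) 0 := by
  have h1 := HasFDerivAt.continuousAlternatingMap_apply
    (hasFDerivAt_const (fourForm C) (0 : ℝ))
    (fun i => (hasDerivAt_coords_tubeField t (g i) j hj).hasFDerivAt)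
  have h2 := h1.hasDerivAt
  have e0 : (fun i => coords (tubeField (t • bas 0 + (0 : ℝ) • bas j) (g i))) =
      fun i => bas (g i) := by
    funext i
    rw [zero_smul, add_zero, tubeField_smul_bas_zero, coords_frame]
  refine h2.congr_deriv ?_
  simp only [e0, ContinuousLinearMap.comp_zero, zero_add, ContinuousLinearMap.sum_apply,
    ContinuousLinearMap.comp_apply, ContinuousLinearMap.toSpanSingleton_apply, one_smul]
  have e1 (i : Fin 4) : (fourForm C).toContinuousLinearMap (fun i => bas (g i)) i
      ((if g i < j then (bracketCoeff (g i) j : ℝ) / 2 else 0) • bas (bracketIndex (g i) j)) =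
      ∑ l, (((if g i < j then bracketCoeff (g i) j * fourCoeff (bracketTuple g j i 0)
        (bracketTuple g j i 1) (bracketTuple g j i 2) (bracketTuple g j i 3) l else 0 : ℤ)) : ℝ) / 2
        * C l := by
    have e2 : Function.update (fun i => bas (g i)) i (bas (bracketIndex (g i) j)) =
        fun i' => bas (bracketTuple g j i i') := by
      funext i'
      by_cases h : i' = i
      · subst h; simp [bracketTuple]
      · simp [bracketTuple, h]
    rw [map_smul]
    change _ • fourForm C (Function.update (fun i => bas (g i)) i (bas (bracketIndex (g i) j))) = _
    rw [e2, fourForm_bas, smul_eq_mul, Finset.mul_sum]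
    refine Finset.sum_congr rfl fun l _ => ?_
    split_ifs
    · push_cast; ring
    · simp
  rw [Finset.sum_congr rfl fun i _ => e1 i, Finset.sum_comm]
  refine Finset.sum_congr rfl fun l _ => ?_
  rw [slotPart, Int.cast_sum, Finset.sum_div, Finset.sum_mul]

/-- The two directions decouple on the axis. Along t the frame is constant and only the coefficients
vary; along the other coordinates the coefficients are constant and only the frame varies. -/
theorem fderiv_tube_bas (hκ : DifferentiableAt ℝ κ (t • bas 0)) (hc : HasDerivAt c c' t)
    (h : ∀ᶠ p in nhds (t • bas 0), ∀ g : Fin 4 → Fin 7, κ p (fun i => bas (g i)) =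
      fourForm (c (p 0)) fun i => coords (tubeField p (g i))) (g : Fin 4 → Fin 7) (j : Fin 7) :
    fderiv ℝ (fun p => κ p fun i => bas (g i)) (t • bas 0) (bas j) =
      if j = 0 then ∑ l, (fourCoeff (g 0) (g 1) (g 2) (g 3) l : ℝ) * c' l
      else ∑ l, (slotPart g j l : ℝ) / 2 * c t l := by
  have hu : DifferentiableAt ℝ (fun p => κ p fun i => bas (g i)) (t • bas 0) :=
    (hκ.hasFDerivAt.continuousAlternatingMap_apply_const _).differentiableAt
  have hl : HasDerivAt (fun s : ℝ => t • bas 0 + s • bas j) (bas j) 0 :=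
    (hasDerivAt_smul_const_zero (bas j)).const_add _
  have hl0 : t • bas 0 + (0 : ℝ) • bas j = t • bas 0 := by rw [zero_smul, add_zero]
  have h1 : HasDerivAt (fun s : ℝ => κ (t • bas 0 + s • bas j) fun i => bas (g i))
      (fderiv ℝ (fun p => κ p fun i => bas (g i)) (t • bas 0) (bas j)) 0 := by
    have hu' := hu.hasFDerivAt
    rw [← hl0] at hu'
    have := hu'.comp_hasDerivAt (0 : ℝ) hl
    rwa [hl0] at this
  have hnear : ∀ᶠ s : ℝ in nhds 0, κ (t • bas 0 + s • bas j) (fun i => bas (g i)) =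
      fourForm (c ((t • bas 0 + s • bas j : V7) 0))
        fun i => coords (tubeField (t • bas 0 + s • bas j) (g i)) := by
    have := hl.continuousAt.tendsto
    rw [hl0] at this
    exact (this.eventually h).mono fun s hs => hs g
  refine h1.unique ?_
  split_ifs with hj
  · subst hj
    have h2 : HasDerivAt (fun s : ℝ => ∑ l, (fourCoeff (g 0) (g 1) (g 2) (g 3) l : ℝ) * c (t + s) l)
        (∑ l, (fourCoeff (g 0) (g 1) (g 2) (g 3) l : ℝ) * c' l) 0 := by
      refine HasDerivAt.fun_sum fun l _ => HasDerivAt.const_mul _ ?_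
      have h3 := (hasDerivAt_pi.1 hc l)
      have h4 : HasDerivAt (fun s : ℝ => c s l) (c' l) (t + 0) := by rwa [add_zero]
      exact h4.comp_const_add t 0
    refine h2.congr_of_eventuallyEq (hnear.mono fun s hs => ?_)
    beta_reduce
    rw [hs]
    have e : (t • bas 0 + s • bas 0 : V7) = (t + s) • bas 0 := (add_smul t s _).symm
    rw [e, smul_bas_zero_apply, tubeField_smul_bas_zero]
    simp only [coords_frame]
    rw [fourForm_bas]
  · refine (hasDerivAt_fourForm_line (c t) g t j hj).congr_of_eventuallyEq
      (hnear.mono fun s hs => ?_)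
    beta_reduce
    rw [hs, smul_bas_zero_add_apply t s j hj]

theorem extDeriv_tube_bas (hκ : DifferentiableAt ℝ κ (t • bas 0)) (hc : HasDerivAt c c' t)
    (h : ∀ᶠ p in nhds (t • bas 0), ∀ g : Fin 4 → Fin 7, κ p (fun i => bas (g i)) =
      fourForm (c (p 0)) fun i => coords (tubeField p (g i))) (f : Fin 5 → Fin 7) :
    extDeriv κ (t • bas 0) (fun i => bas (f i)) =
      ∑ l, ((derivPart f l : ℝ) * c' l + (bracketPart f l : ℝ) / 2 * c t l) := by
  rw [extDeriv_apply hκ]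
  have h1 (m : Fin 5) : (-1 : ℤ) ^ m.val • fderiv ℝ (fun p => κ p
      (m.removeNth fun i => bas (f i))) (t • bas 0) (bas (f m)) =
      ∑ l, (((if f m = 0 then (-1) ^ m.val * fourCoeff (m.removeNth f 0) (m.removeNth f 1)
        (m.removeNth f 2) (m.removeNth f 3) l else 0 : ℤ) : ℝ) * c' l +
        ((if f m = 0 then 0 else (-1) ^ m.val * slotPart (m.removeNth f) (f m) l : ℤ) : ℝ) / 2
          * c t l) := by
    have h2 := fderiv_tube_bas hκ hc h (m.removeNth f) (f m)
    have e : (m.removeNth fun i => bas (f i)) = fun i => bas (m.removeNth f i) := rfl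
    rw [e, h2, zsmul_eq_mul]
    split_ifs
    · rw [Finset.mul_sum]
      refine Finset.sum_congr rfl fun l _ => ?_
      push_cast; ring
    · rw [Finset.mul_sum]
      refine Finset.sum_congr rfl fun l _ => ?_
      push_cast; ring
  refine (Finset.sum_congr rfl fun m _ => h1 m).trans ?_
  rw [Finset.sum_comm]
  refine Finset.sum_congr rfl fun l _ => ?_
  rw [Finset.sum_add_distrib, derivPart, bracketPart, Int.cast_sum, Int.cast_sum, Finset.sum_mul,
    Finset.sum_div, Finset.sum_mul]

theorem five_form_ext {κ : V7 [⋀^Fin 5]→L[ℝ] ℝ}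
    (h : ∀ f : Fin 5 → Fin 7, StrictMono f → κ (fun i => bas (f i)) = 0) : κ = 0 := by
  apply formComponents_injective
  funext f
  change κ (fun i => bas (f i)) = 0
  by_cases hf : Function.Injective f
  · have h1 := h (f ∘ Tuple.sort f) ((Tuple.monotone_sort f).strictMono_of_injective
      (hf.comp (Tuple.sort f).injective))
    have h2 := κ.toAlternatingMap.map_perm (fun i => bas (f i)) (Tuple.sort f)
    have h3 : κ.toAlternatingMap ((fun i => bas (f i)) ∘ Tuple.sort f) = 0 := h1
    rw [h3] at h2
    rcases Int.units_eq_one_or (Equiv.Perm.sign (Tuple.sort f)) with h4 | h4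
    · rw [h4, one_smul] at h2; exact h2.symm
    · rw [h4] at h2
      have h5 : (0 : ℝ) = -κ.toAlternatingMap fun i => bas (f i) := by simpa using h2
      exact neg_eq_zero.1 h5.symm
  · obtain ⟨i, j, hij, hne⟩ : ∃ i j, f i = f j ∧ i ≠ j := by
      simpa [Function.Injective] using hf
    exact κ.toAlternatingMap.map_eq_zero_of_eq (fun i => bas (f i)) (by simp [hij]) hne

/-- The invariant form with coefficients `c` is closed if `c₀' = c₁' = 2c₃`. -/
theorem extDeriv_tube_eq_zero (hκ : DifferentiableAt ℝ κ (t • bas 0)) (hc : HasDerivAt c c' t)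
    (h : ∀ᶠ p in nhds (t • bas 0), ∀ g : Fin 4 → Fin 7, κ p (fun i => bas (g i)) =
      fourForm (c (p 0)) fun i => coords (tubeField p (g i)))
    (h0 : c' 0 = 2 * c t 3) (h1 : c' 1 = 2 * c t 3) : extDeriv κ (t • bas 0) = 0 := by
  refine five_form_ext fun f hf => ?_
  have e : f = ![f 0, f 1, f 2, f 3, f 4] := by ext i : 1; fin_cases i <;> rfl
  have ht := part_table (f 0) (f 1) (hf (by decide)) (f 2) (hf (by decide)) (f 3) (hf (by decide))
    (f 4) (hf (by decide))
  simp only [← e] at ht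
  obtain ⟨e2, e3, b0, b1, b2, b3⟩ := ht
  rw [extDeriv_tube_bas hκ hc h, Fin.sum_univ_four, e2, e3, b0, b1, b2, b3, h0, h1]
  push_cast
  ring

/-- If the invariant form with coefficients `c` is closed, then `c₀' = c₁' = 2c₃`. -/
theorem coeff_deriv_of_extDeriv_eq_zero (hκ : DifferentiableAt ℝ κ (t • bas 0))
    (hc : HasDerivAt c c' t)
    (h : ∀ᶠ p in nhds (t • bas 0), ∀ g : Fin 4 → Fin 7, κ p (fun i => bas (g i)) =
      fourForm (c (p 0)) fun i => coords (tubeField p (g i)))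
    (h0 : extDeriv κ (t • bas 0) = 0) : c' 0 = 2 * c t 3 ∧ c' 1 = 2 * c t 3 := by
  obtain ⟨p0, p1, q0, q1⟩ := part_first
  constructor
  · have h1 := extDeriv_tube_bas hκ hc h ![0, 1, 2, 3, 4]
    obtain ⟨e2, e3, b0, b1, b2, b3⟩ := part_table 0 1 (by decide) 2 (by decide) 3 (by decide) 4
      (by decide)
    rw [h0, Fin.sum_univ_four, e2, e3, b0, b1, b2, b3, p0, p1] at h1
    norm_num at h1
    linarith
  · have h1 := extDeriv_tube_bas hκ hc h ![0, 3, 4, 5, 6]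
    obtain ⟨e2, e3, b0, b1, b2, b3⟩ := part_table 0 3 (by decide) 4 (by decide) 5 (by decide) 6
      (by decide)
    rw [h0, Fin.sum_univ_four, e2, e3, b0, b1, b2, b3, q0, q1] at h1
    norm_num at h1
    linarith

end TubeForm

/-! ### Structures in normal form -/

section Dual

variable {E : Type*} [AddCommGroup E] [Module ℝ E] [TopologicalSpace E]

theorem IsG2Dual.unique {φ : E [⋀^Fin 3]→L[ℝ] ℝ} {ψ ψ' : E [⋀^Fin 4]→L[ℝ] ℝ}
    (h : IsG2Dual φ ψ) (h' : IsG2Dual φ ψ') : ψ = ψ' := by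
  obtain ⟨u, ⟨θ, hu⟩, -⟩ := id h
  rw [(isG2Dual_iff hu).1 h, (isG2Dual_iff hu).1 h']

theorem IsG2Dual.comp {E' : Type*} [AddCommGroup E'] [Module ℝ E'] [TopologicalSpace E']
    {φ : E [⋀^Fin 3]→L[ℝ] ℝ} {ψ : E [⋀^Fin 4]→L[ℝ] ℝ}
    (h : IsG2Dual φ ψ) (L : E' ≃L[ℝ] E) :
    IsG2Dual (φ.compContinuousLinearMap (L : E' →L[ℝ] E))
      (ψ.compContinuousLinearMap (L : E' →L[ℝ] E)) := by
  obtain ⟨u, ⟨θ, hu⟩, -⟩ := id h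
  have h1 := (isG2Dual_iff hu).1 h
  rw [isG2Dual_iff (u := L.trans u) (θ := θ) (by
    rw [hu]; exact ext_three fun x y z => rfl), h1]
  exact ext_four fun x y z w => rfl

end Dual

/-- The section of `coords` given by the frame. -/
def frameMap : V7 →ₗ[ℝ] ℝ × sp2 := Fintype.linearCombination ℝ frame ∘ₗ
  (EuclideanSpace.equiv (Fin 7) ℝ).toLinearMap

theorem frameMap_apply (x : V7) : frameMap x = ∑ i, x i • frame i := rfl

theorem coords_frameMap (x : V7) : coords (frameMap x) = x := by
  rw [frameMap_apply, map_sum]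
  simp only [map_smul, coords_frame, sum_smul_bas]

theorem inner_scaleMap (f₁ f₂ : ℝ) (x y : V7) :
    inner ℝ (scaleMap f₁ f₂ x) (scaleMap f₁ f₂ y) = x 0 * y 0 + f₁ ^ 2 * (x 1 * y 1 + x 2 * y 2)
      + f₂ ^ 2 * (x 3 * y 3 + x 4 * y 4 + x 5 * y 5 + x 6 * y 6) := by
  rw [inner_eq_sum7]
  simp only [scaleMap_apply, Matrix.cons_val]
  ring

/-- The metric condition forces T and `coords` to have the same kernel, so T induces an isomorphism
L of ℝ⁷. Then L⁻¹ followed by the scaling is an adapted frame, in which the dual of Φ can be read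
off. -/
theorem exists_adapted_of_normalForm {Φ : V7 [⋀^Fin 3]→L[ℝ] ℝ} (hΦ : IsG2Form Φ)
    {T : (ℝ × sp2) →L[ℝ] V7} {f₁ f₂ θ : ℝ} (h₁ : f₁ ≠ 0) (h₂ : f₂ ≠ 0)
    (hmetric : ∀ v w : ℝ × sp2, g2Metric Φ (T v) (T w) =
      inner ℝ (scaleMap f₁ f₂ (coords v)) (scaleMap f₁ f₂ (coords w)))
    (hform : Φ.compContinuousLinearMap T =
      ((modelForm θ).compContinuousLinearMap (scaleMap f₁ f₂)).compContinuousLinearMap coords) :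
    ∃ u : V7 ≃L[ℝ] V7, Φ = (modelForm θ).compContinuousLinearMap (u : V7 →L[ℝ] V7) ∧
      ∀ v, u (T v) = scaleMap f₁ f₂ (coords v) := by
  obtain ⟨u₀, hu₀⟩ := hΦ
  -- Both kernels are the null vectors of one and the same semidefinite form, because the scaling is
  -- injective.
  have hzero (v : ℝ × sp2) : T v = 0 ↔ coords v = 0 := by
    have h := hmetric v v
    rw [g2Metric_eq hu₀] at h
    rw [← map_eq_zero_iff u₀ u₀.injective, ← inner_self_eq_zero (𝕜 := ℝ), h, inner_self_eq_zero,
      ← coe_scaleEquiv h₁ h₂]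
    exact map_eq_zero_iff (scaleEquiv h₁ h₂) (scaleEquiv h₁ h₂).injective
  have hT (v : ℝ × sp2) : T (frameMap (coords v)) = T v := by
    rw [← sub_eq_zero, ← map_sub, hzero, map_sub, coords_frameMap, sub_self]
  set L₀ : V7 →ₗ[ℝ] V7 := (T : (ℝ × sp2) →ₗ[ℝ] V7) ∘ₗ frameMap with hL₀
  have hinj : Function.Injective L₀ := by
    refine (injective_iff_map_eq_zero _).2 fun x hx => ?_
    have h := (hzero (frameMap x)).1 hx
    rwa [coords_frameMap] at h
  obtain ⟨L, hL⟩ : ∃ L : V7 ≃L[ℝ] V7, ∀ x, L x = T (frameMap x) :=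
    ⟨(LinearEquiv.ofInjectiveEndo L₀ hinj).toContinuousLinearEquiv, fun x => rfl⟩
  have hL' (x : V7) : T (frameMap (L.symm x)) = x := by
    rw [← hL, ContinuousLinearEquiv.apply_symm_apply]
  refine ⟨L.symm.trans (scaleEquiv h₁ h₂), ?_, fun v => ?_⟩
  · refine ext_three fun x y z => ?_
    have h := congrArg (fun κ : (ℝ × sp2) [⋀^Fin 3]→L[ℝ] ℝ => κ ![frameMap (L.symm x),
      frameMap (L.symm y), frameMap (L.symm z)]) hform
    beta_reduce at h
    rw [comp_three_apply, comp_three_apply, comp_three_apply, coords_frameMap, coords_frameMap,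
      coords_frameMap, hL', hL', hL'] at h
    rw [h, comp_three_apply]
    rfl
  · have h : L.symm (T v) = coords v := by
      rw [← hT, ← hL, ContinuousLinearEquiv.symm_apply_apply]
    rw [ContinuousLinearEquiv.trans_apply, h]
    rfl

section Manifold

variable {M : Type*} [TopologicalSpace M] [ChartedSpace V7 M] [MulAction Sp2 M]

theorem isInvariant_iff {φ : FormField M 3} : IsInvariant φ ↔ ∀ (a : Sp2) (x : M),
    ((φ (a • x) : V7 [⋀^Fin 3]→L[ℝ] ℝ)).compContinuousLinearMap (dAct a x) = φ x := Iff.rfl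

theorem dual_invariant (hact : IsSmoothAction M) {φ : FormField M 3} {ψ : FormField M 4}
    (hφ : IsInvariant φ) (hψ : ∀ x, IsG2Dual (φ x) (ψ x)) (a : Sp2) (x : M) :
    ((ψ (a • x) : V7 [⋀^Fin 4]→L[ℝ] ℝ)).compContinuousLinearMap (dAct a x) = ψ x := by
  have h1 : IsG2Dual (E := V7) (φ (a • x)) (ψ (a • x)) := hψ (a • x)
  have h2 : IsG2Dual ((φ (a • x) : V7 [⋀^Fin 3]→L[ℝ] ℝ).compContinuousLinearMap (dAct a x))
      ((ψ (a • x) : V7 [⋀^Fin 4]→L[ℝ] ℝ).compContinuousLinearMap (dAct a x)) :=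
    h1.comp (dActEquiv hact a x)
  rw [isInvariant_iff.1 hφ a x] at h2
  exact h2.unique (hψ x)

variable {φ : FormField M 3} {I : Set ℝ} {γ : ℝ → M} {f₁ f₂ θ : ℝ → ℝ} {r : WithTop ℕ∞} {t : ℝ}

theorem IsNormalForm.exists_adapted (h : IsNormalForm r φ I γ f₁ f₂ θ)
    (hφ : ∀ x, IsG2Form (φ x)) (ht : t ∈ I) : ∃ u : V7 ≃L[ℝ] V7,
      (φ (γ t) : V7 [⋀^Fin 3]→L[ℝ] ℝ) =
        (modelForm (θ t)).compContinuousLinearMap (u : V7 →L[ℝ] V7) ∧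
      ∀ v, u (tubeD γ t v) = scaleMap (f₁ t) (f₂ t) (coords v) := by
  refine exists_adapted_of_normalForm (hφ (γ t)) (h.f₁_ne t ht) (h.f₂_ne t ht) (fun v w => ?_) ?_
  · rw [inner_scaleMap]
    exact h.metric t ht v w
  · rw [modelForm_comp_scaleMap_coords]
    exact h.form t ht

theorem IsNormalForm.dual_apply (h : IsNormalForm r φ I γ f₁ f₂ θ)
    (hφ : ∀ x, IsG2Form (φ x)) {ψ : FormField M 4} (hψ : ∀ x, IsG2Dual (φ x) (ψ x)) (ht : t ∈ I)
    (v : Fin 4 → ℝ × sp2) :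
    (ψ (γ t) : V7 [⋀^Fin 4]→L[ℝ] ℝ) (fun i => tubeD γ t (v i)) =
      fourForm (starCoeff (f₁ t) (f₂ t) (θ t)) fun i => coords (v i) := by
  obtain ⟨u, hu, huT⟩ := h.exists_adapted hφ ht
  have h1 : (ψ (γ t) : V7 [⋀^Fin 4]→L[ℝ] ℝ) = _ := (isG2Dual_iff hu).1 (hψ (γ t))
  rw [h1, ← starForm_comp_scaleMap]
  exact congrArg (starForm (θ t)) (funext fun i => huT (v i))

theorem IsNormalForm.contMDiffAt (h : IsNormalForm r φ I γ f₁ f₂ θ) (hI : IsOpen I) (ht : t ∈ I) :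
    ContMDiffAt 𝓘(ℝ, ℝ) 𝓘(ℝ, V7) ∞ γ t :=
  h.curve.contMDiffAt (hI.mem_nhds ht)

theorem hasDerivAt_starCoeff {f₁ f₂ θ : ℝ → ℝ} {t : ℝ} (h₁ : DifferentiableAt ℝ f₁ t)
    (h₂ : DifferentiableAt ℝ f₂ t) (hθ : DifferentiableAt ℝ θ t) :
    HasDerivAt (fun t => starCoeff (f₁ t) (f₂ t) (θ t))
      ![deriv (fun t => f₁ t ^ 2 * f₂ t ^ 2) t, deriv (fun t => f₂ t ^ 4) t,
        deriv (fun t => f₁ t * f₂ t ^ 2 * Real.sin (θ t)) t,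
        deriv (fun t => f₁ t * f₂ t ^ 2 * Real.cos (θ t)) t] t := by
  refine hasDerivAt_pi.2 fun l => ?_
  have d0 : DifferentiableAt ℝ (fun t => f₁ t ^ 2 * f₂ t ^ 2) t := by fun_prop
  have d1 : DifferentiableAt ℝ (fun t => f₂ t ^ 4) t := by fun_prop
  have d2 : DifferentiableAt ℝ (fun t => f₁ t * f₂ t ^ 2 * Real.sin (θ t)) t := by fun_prop
  have d3 : DifferentiableAt ℝ (fun t => f₁ t * f₂ t ^ 2 * Real.cos (θ t)) t := by fun_prop
  fin_cases l
  · exact d0.hasDerivAt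
  · exact d1.hasDerivAt
  · exact d2.hasDerivAt
  · exact d3.hasDerivAt

variable [IsManifold 𝓘(ℝ, V7) ∞ M]

/-- The conservation laws for a cosymplectic structure in normal form. -/
theorem IsNormalForm.hasDerivAt (hact : IsSmoothAction M) (h : IsNormalForm ∞ φ I γ f₁ f₂ θ)
    (hI : IsOpen I) (hφ : ∀ x, IsG2Form (φ x)) (hinv : IsInvariant φ) (hcos : IsCosymplectic φ)
    (ht : t ∈ I) :
    HasDerivAt (fun t => f₁ t ^ 2 * f₂ t ^ 2) (2 * (f₁ t * f₂ t ^ 2 * Real.cos (θ t))) t ∧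
      HasDerivAt (fun t => f₂ t ^ 4) (2 * (f₁ t * f₂ t ^ 2 * Real.cos (θ t))) t := by
  obtain ⟨ψ, hψ, hclosed⟩ := hcos
  have hnhds := hI.mem_nhds ht
  have h₁ : DifferentiableAt ℝ f₁ t := (h.class_f₁.contDiffAt hnhds).differentiableAt (by simp)
  have h₂ : DifferentiableAt ℝ f₂ t := (h.class_f₂.contDiffAt hnhds).differentiableAt (by simp)
  have hθ : DifferentiableAt ℝ θ t := (h.class_θ.contDiffAt hnhds).differentiableAt (by simp)
  have hnear : ∀ᶠ p : V7 in nhds (t • bas 0), p 0 ∈ I := by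
    have hcont : ContinuousAt (fun p : V7 => p 0) (t • bas 0) :=
      (EuclideanSpace.proj 0 : V7 →L[ℝ] ℝ).continuous.continuousAt
    apply hcont.eventually_mem
    rw [smul_bas_zero_apply]; exact hnhds
  have hG : ∀ᶠ p in nhds (t • bas 0), ContMDiffAt 𝓘(ℝ, V7) 𝓘(ℝ, V7) ∞ (tubeMap γ 1) p :=
    hnear.mono fun p hp => contMDiffAt_tubeMap hact 1 (h.contMDiffAt hI hp)
  have h3 := coeff_deriv_of_extDeriv_eq_zero (κ := pull ψ (tubeMap γ 1))
    ((hclosed.1.contDiffAt_pull (by norm_cast) hG).differentiableAt (by simp))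
    (hasDerivAt_starCoeff h₁ h₂ hθ) (hnear.mono fun p hp g => by
      rw [pull_tubeMap hact (dual_invariant hact hinv hψ) 1 (h.contMDiffAt hI hp)]
      exact h.dual_apply hφ hψ hp _) (hclosed.extDeriv_pull hG)
  simp only [starCoeff, Matrix.cons_val] at h3
  have d0 : DifferentiableAt ℝ (fun t => f₁ t ^ 2 * f₂ t ^ 2) t := by fun_prop
  have d1 : DifferentiableAt ℝ (fun t => f₂ t ^ 4) t := by fun_prop
  exact ⟨d0.hasDerivAt.congr_deriv h3.1, d1.hasDerivAt.congr_deriv h3.2⟩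

end Manifold

/-! ### The relations between the functions of a normal form -/

section Relations

variable {I : Set ℝ} {f₁ f₂ θ : ℝ → ℝ}

theorem exists_conserved (hI : IsOpen I) (hI' : I.OrdConnected) {D : ℝ → ℝ}
    (h₁ : ∀ t ∈ I, HasDerivAt (fun t => f₁ t ^ 2 * f₂ t ^ 2) (D t) t)
    (h₂ : ∀ t ∈ I, HasDerivAt (fun t => f₂ t ^ 4) (D t) t) :
    ∃ C : ℝ, ∀ t ∈ I, f₂ t ^ 4 - f₁ t ^ 2 * f₂ t ^ 2 = C := by
  rcases I.eq_empty_or_nonempty with rfl | ⟨t₀, ht₀⟩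
  · exact ⟨0, by simp⟩
  refine ⟨f₂ t₀ ^ 4 - f₁ t₀ ^ 2 * f₂ t₀ ^ 2, fun t ht => ?_⟩
  have hd : ∀ t ∈ I, HasDerivAt (fun t => f₂ t ^ 4 - f₁ t ^ 2 * f₂ t ^ 2) 0 t := by
    intro t ht
    have := (h₂ t ht).sub (h₁ t ht)
    rwa [sub_self] at this
  exact (hI'.convex).is_const_of_fderivWithin_eq_zero (𝕜 := ℝ)
    (fun x hx => (hd x hx).differentiableAt.differentiableWithinAt) (fun x hx => by
      rw [fderivWithin_of_isOpen hI hx, (hd x hx).hasFDerivAt.fderiv]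
      ext; simp) ht ht₀

/-- Here (x, y, c) stands for (f₁, f₂, cos θ). The equations simplify to 2yy' = xc and 2y²x' = (2y²
- x²)c. If C = ν² ≥ 0, then 2y² - x² is the root of x⁴ + 4ν²; if C = -ν² ≤ 0, then |xy| is the root
of y⁴ + ν². In either case the absolute value of the derivative in question is |c| times the bound.
-/
theorem relations_of_conserved {x' y' x y c C : ℝ} (hx : x ≠ 0) (hy : y ≠ 0)
    (h₁ : 2 * x * x' * y ^ 2 + x ^ 2 * (2 * y * y') = 2 * (x * y ^ 2 * c))
    (h₂ : 4 * y ^ 3 * y' = 2 * (x * y ^ 2 * c)) (hC : y ^ 4 - x ^ 2 * y ^ 2 = C) (hc : |c| ≤ 1) :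
    (0 ≤ C → 2 * y ^ 2 = x ^ 2 + √(x ^ 4 + 4 * √C ^ 2) ∧ |x'| ≤ bound₁ (√C) x) ∧
      (C ≤ 0 → x ^ 2 = y ^ 2 + √(-C) ^ 2 * (y ^ 2)⁻¹ ∧ |y'| ≤ bound₂ (√(-C)) y) := by
  have hy2 : 0 < y ^ 2 := by positivity
  have ey : 2 * y * y' = x * c := by
    have : y ^ 2 * (2 * (2 * y * y') - 2 * (x * c)) = 0 := by linear_combination h₂
    rcases mul_eq_zero.1 this with h | h
    · exact absurd h hy2.ne'
    · linarith
  have ex : 2 * y ^ 2 * x' = (2 * y ^ 2 - x ^ 2) * c := by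
    have : x * (2 * y ^ 2 * x' - (2 * y ^ 2 - x ^ 2) * c) = 0 := by
      linear_combination h₁ - x ^ 2 * ey
    rcases mul_eq_zero.1 this with h | h
    · exact absurd h hx
    · linarith
  constructor
  · intro h
    -- C = y² (y² - x²), so C ≥ 0 means x² ≤ y². This ensures that 2y² - x² is the nonnegative root.
    have hxy : x ^ 2 ≤ y ^ 2 := by
      by_contra! hlt
      nlinarith
    have hs : √(x ^ 4 + 4 * √C ^ 2) = 2 * y ^ 2 - x ^ 2 := by
      rw [Real.sq_sqrt h, ← hC, show x ^ 4 + 4 * (y ^ 4 - x ^ 2 * y ^ 2) = (2 * y ^ 2 - x ^ 2) ^ 2 by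
        ring]
      exact Real.sqrt_sq (by linarith)
    refine ⟨by rw [hs]; ring, ?_⟩
    rw [bound₁, hs, show x ^ 2 + (2 * y ^ 2 - x ^ 2) = 2 * y ^ 2 by ring, le_div_iff₀ (by positivity)]
    have h3 : |x'| * (2 * y ^ 2) = (2 * y ^ 2 - x ^ 2) * |c| := by
      have := congrArg abs ex
      rw [abs_mul (2 * y ^ 2), abs_mul (2 * y ^ 2 - x ^ 2),
        abs_of_pos (by positivity : 0 < 2 * y ^ 2), abs_of_nonneg (by linarith : 0 ≤ 2 * y ^ 2 - x ^ 2)] at this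
      linarith
    rw [h3]
    exact mul_le_of_le_one_right (by linarith) hc
  · intro h
    have h1 : √(-C) ^ 2 = -C := Real.sq_sqrt (by linarith)
    refine ⟨?_, ?_⟩
    · rw [h1, ← hC]; field_simp; ring
    · have hs : √(y ^ 4 + √(-C) ^ 2) = |x| * |y| := by
        rw [h1, ← hC, show y ^ 4 + -(y ^ 4 - x ^ 2 * y ^ 2) = (x * y) ^ 2 by ring, Real.sqrt_sq_eq_abs,
          abs_mul]
      rw [bound₂, hs, le_div_iff₀ (by positivity)]
      have h3 : 2 * |y| * |y'| = |x| * |c| := by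
        have := congrArg abs ey
        rwa [abs_mul, abs_mul, abs_mul, abs_two] at this
      have h4 : |y'| * (2 * y ^ 2) = |y| * (|x| * |c|) := by
        rw [← h3, ← sq_abs y]; ring
      rw [h4, mul_comm |x| |y|]
      exact mul_le_mul_of_nonneg_left (mul_le_of_le_one_right (abs_nonneg _) hc) (abs_nonneg _)

theorem relations_of_hasDerivAt (hI : IsOpen I) (hI' : I.OrdConnected)
    (d₁ : ∀ t ∈ I, DifferentiableAt ℝ f₁ t) (d₂ : ∀ t ∈ I, DifferentiableAt ℝ f₂ t)
    (n₁ : ∀ t ∈ I, f₁ t ≠ 0) (n₂ : ∀ t ∈ I, f₂ t ≠ 0)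
    (h₁ : ∀ t ∈ I, HasDerivAt (fun t => f₁ t ^ 2 * f₂ t ^ 2)
      (2 * (f₁ t * f₂ t ^ 2 * Real.cos (θ t))) t)
    (h₂ : ∀ t ∈ I, HasDerivAt (fun t => f₂ t ^ 4) (2 * (f₁ t * f₂ t ^ 2 * Real.cos (θ t))) t) :
    (∃ s : SignType, ∀ t ∈ I, SignType.sign (f₁ t ^ 2 - f₂ t ^ 2) = s) ∧
      ((∀ t ∈ I, f₁ t ^ 2 ≤ f₂ t ^ 2) → ∃ ν : ℝ, 0 ≤ ν ∧ Relations₁ ν I f₁ f₂) ∧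
      ((∀ t ∈ I, f₂ t ^ 2 ≤ f₁ t ^ 2) → ∃ ν : ℝ, 0 ≤ ν ∧ Relations₂ ν I f₁ f₂) := by
  obtain ⟨C, hC⟩ := exists_conserved hI hI' h₁ h₂
  have key (t : ℝ) (ht : t ∈ I) := relations_of_conserved (x' := deriv f₁ t) (y' := deriv f₂ t)
    (c := Real.cos (θ t)) (n₁ t ht) (n₂ t ht) (by
      have h := (((d₁ t ht).hasDerivAt.pow 2).mul ((d₂ t ht).hasDerivAt.pow 2)).unique (h₁ t ht)
      norm_num at h
      linarith) (by
      have h := ((d₂ t ht).hasDerivAt.pow 4).unique (h₂ t ht)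
      norm_num at h
      linarith) (hC t ht) (Real.abs_cos_le_one _)
  -- Since f₂² > 0, the sign of f₁² - f₂² is that of the constant -C.
  have hsign (t : ℝ) (ht : t ∈ I) : (f₁ t ^ 2 - f₂ t ^ 2) * f₂ t ^ 2 = -C := by
    rw [← hC t ht]; ring
  have hpos (t : ℝ) (ht : t ∈ I) : 0 < f₂ t ^ 2 := by have := n₂ t ht; positivity
  refine ⟨⟨SignType.sign (-C), fun t ht => ?_⟩, fun h => ?_, fun h => ?_⟩
  · rw [← hsign t ht, sign_mul, sign_pos (hpos t ht), mul_one]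
  · refine ⟨√C, Real.sqrt_nonneg _, fun t ht => (key t ht).1 ?_⟩
    nlinarith [hsign t ht, hpos t ht, h t ht]
  · refine ⟨√(-C), Real.sqrt_nonneg _, fun t ht => (key t ht).2 ?_⟩
    nlinarith [hsign t ht, hpos t ht, h t ht]

end Relations

/-! ### The unit normal field of the six-dimensional orbits -/

theorem g2Metric_comp {E E' : Type*} [AddCommGroup E] [Module ℝ E] [TopologicalSpace E]
    [AddCommGroup E'] [Module ℝ E'] [TopologicalSpace E'] {φ : E [⋀^Fin 3]→L[ℝ] ℝ}
    (hφ : IsG2Form φ) (L : E' ≃L[ℝ] E) (v w : E') :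
    IsG2Form (φ.compContinuousLinearMap (L : E' →L[ℝ] E)) ∧
      g2Metric (φ.compContinuousLinearMap (L : E' →L[ℝ] E)) v w = g2Metric φ (L v) (L w) := by
  obtain ⟨u, θ, hu⟩ := hφ
  have h : IsAdapted (φ.compContinuousLinearMap (L : E' →L[ℝ] E)) (L.trans u) :=
    ⟨θ, by rw [hu]; exact ext_three fun x y z => rfl⟩
  exact ⟨⟨_, h⟩, by rw [g2Metric_eq h, g2Metric_eq ⟨θ, hu⟩]; rfl⟩

section Field

variable {M : Type*} [TopologicalSpace M] [ChartedSpace V7 M]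

/-- The derivative of the inverse of a chart. -/
def dSymm (e : OpenPartialHomeomorph M V7) (y : V7) : V7 →L[ℝ] V7 :=
  (mfderiv 𝓘(ℝ, V7) 𝓘(ℝ, V7) e.symm y :)

theorem inChart_eq {k : ℕ} (η : FormField M k) (e : OpenPartialHomeomorph M V7) (y : V7) :
    η.inChart e y =
      (η (e.symm y) : V7 [⋀^Fin k]→L[ℝ] ℝ).compContinuousLinearMap (dSymm e y) := rfl

variable [IsManifold 𝓘(ℝ, V7) ∞ M] {e : OpenPartialHomeomorph M V7}

theorem dChart_dSymm (he : e ∈ atlas V7 M) {y : V7} (hy : y ∈ e.target) (v : V7) :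
    dChart e (e.symm y) (dSymm e y v) = v := by
  have h1 := hasFDerivAt_chart_comp he (mdifferentiableAt_chart_symm he hy).hasMFDerivAt
    (e.map_target hy)
  have h2 : HasFDerivAt (fun q => e (e.symm q)) (ContinuousLinearMap.id ℝ V7) y :=
    (hasFDerivAt_id y).congr_of_eventuallyEq (by
      filter_upwards [e.open_target.mem_nhds hy] with q hq using e.right_inv hq)
  exact congrArg (fun f : V7 →L[ℝ] V7 => f v) (h1.unique h2)

/-- The derivative of the inverse of a chart is invertible. -/
def dSymmEquiv (he : e ∈ atlas V7 M) {y : V7} (hy : y ∈ e.target) : V7 ≃L[ℝ] V7 :=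
  (LinearEquiv.ofInjectiveEndo (dSymm e y : V7 →ₗ[ℝ] V7)
    (Function.LeftInverse.injective (dChart_dSymm he hy))).toContinuousLinearEquiv

theorem coe_dSymmEquiv (he : e ∈ atlas V7 M) {y : V7} (hy : y ∈ e.target) :
    (dSymmEquiv he hy : V7 →L[ℝ] V7) = dSymm e y := by
  ext1 v; rfl

theorem dSymm_dChart (he : e ∈ atlas V7 M) {y : V7} (hy : y ∈ e.target) (v : V7) :
    dSymm e y (dChart e (e.symm y) v) = v := by
  obtain ⟨w, rfl⟩ := (dSymmEquiv he hy).surjective v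
  have h : dSymmEquiv he hy w = dSymm e y w := rfl
  rw [h, dChart_dSymm he hy]

theorem isG2Form_inChart {φ : FormField M 3} (hφ : ∀ x, IsG2Form (φ x)) (he : e ∈ atlas V7 M)
    {y : V7} (hy : y ∈ e.target) : IsG2Form (φ.inChart e y) := by
  rw [inChart_eq, ← coe_dSymmEquiv he hy]
  have h0 : IsG2Form (φ (e.symm y) : V7 [⋀^Fin 3]→L[ℝ] ℝ) := hφ (e.symm y)
  exact (g2Metric_comp h0 _ 0 0).1

theorem g2Metric_inChart {φ : FormField M 3} (hφ : ∀ x, IsG2Form (φ x)) (he : e ∈ atlas V7 M)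
    {y : V7} (hy : y ∈ e.target) (v w : V7) : g2Metric (φ.inChart e y) v w =
      g2Metric (φ (e.symm y) : V7 [⋀^Fin 3]→L[ℝ] ℝ) (dSymm e y v) (dSymm e y w) := by
  rw [inChart_eq, ← coe_dSymmEquiv he hy]
  have h0 : IsG2Form (φ (e.symm y) : V7 [⋀^Fin 3]→L[ℝ] ℝ) := hφ (e.symm y)
  exact (g2Metric_comp h0 _ v w).2

theorem contDiffAt_g2Metric {φ : FormField M 3} (hφ : IsG2Structure ∞ φ) (he : e ∈ atlas V7 M)
    {y : V7} (hy : y ∈ e.target) (i j : Fin 7) :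
    ContDiffAt ℝ ∞ (fun y => gram (φ.inChart e y) i j) y :=
  contDiffAt_gram (fun v => contDiffAt_form_apply (hφ.1.contDiffAt he hy)
    (w := fun i _ => v i) fun i => contDiffAt_const) (isG2Form_inChart hφ.2 he hy) i j

variable [MulAction Sp2 M]

theorem orbitDim_eq (x : M) :
    orbitDim x = Module.finrank ℝ (LinearMap.range (infAct x : sp2 →ₗ[ℝ] V7)) := rfl

/-- The vector field generated by `X`, in a chart. -/
def fieldInChart (e : OpenPartialHomeomorph M V7) (X : sp2) (y : V7) : V7 :=
  dChart e (e.symm y) (infAct (e.symm y) X)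

theorem dSymm_fieldInChart (he : e ∈ atlas V7 M) {y : V7} (hy : y ∈ e.target) (X : sp2) :
    dSymm e y (fieldInChart e X y) = infAct (e.symm y) X := dSymm_dChart he hy _

theorem contDiffAt_fieldInChart (hact : IsSmoothAction M) (he : e ∈ atlas V7 M) {y : V7}
    (hy : y ∈ e.target) (X : sp2) : ContDiffAt ℝ ∞ (fieldInChart e X) y := by
  -- The generated field is the derivative at s = 0 of the flow (s, z) ↦ exp (sX) • z read in the
  -- chart. The flow is jointly smooth, hence so is this partial derivative.
  have hsm (z : V7) (hz : z ∈ e.target) :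
      ContDiffAt ℝ ∞ (fun q : ℝ × V7 => e (expSp (q.1 • X) • e.symm q.2)) (0, z) := by
    have h1 : ContMDiffAt 𝓘(ℝ, ℝ × V7) 𝓘(ℝ, V7) ∞
        (fun q : ℝ × V7 => expSp (q.1 • X) • e.symm q.2) (0, z) :=
      contMDiff_expSp_smul hact (ContMDiffAt.comp ((0 : ℝ), z) (g := e.symm)
        (f := fun q : ℝ × V7 => q.2) (contMDiffAt_chart_symm he hz)
        contDiff_snd.contDiffAt.contMDiffAt) (contDiff_fst.smul contDiff_const)
    refine contMDiffAt_iff_contDiffAt.1 (ContMDiffAt.comp ((0 : ℝ), z) (g := e) ?_ h1)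
    refine contMDiffAt_chart he ?_
    simp only [zero_smul, expSp_zero, one_smul]
    exact e.map_target hz
  have h2 : ContDiffAt ℝ ∞ (fun z : V7 =>
      fderiv ℝ (fun q : ℝ × V7 => e (expSp (q.1 • X) • e.symm q.2)) (0, z) (1, 0)) y := by
    have h3 : ContDiffAt ℝ ∞ (fderiv ℝ (fun q : ℝ × V7 => e (expSp (q.1 • X) • e.symm q.2)))
        (0, y) := (hsm y hy).fderiv_right (by simp)
    exact (ContDiffAt.comp (g := fderiv ℝ (fun q : ℝ × V7 => e (expSp (q.1 • X) • e.symm q.2)))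
      (f := fun z : V7 => ((0 : ℝ), z)) y h3
      (contDiff_const.prodMk contDiff_id).contDiffAt).clm_apply contDiffAt_const
  refine h2.congr_of_eventuallyEq ?_
  filter_upwards [e.open_target.mem_nhds hy] with z hz
  have h4 := ((hsm z hz).differentiableAt (by simp)).hasFDerivAt
  have hl : HasDerivAt (fun s : ℝ => (s, z)) ((1 : ℝ), (0 : V7)) 0 :=
    (hasDerivAt_id 0).prodMk (hasDerivAt_const 0 z)
  have h5 := h4.comp_hasDerivAt (0 : ℝ) hl
  have h6 := (hasVelocity_orbit hact (e.symm z) X).chart he (by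
    simp only [zero_smul, expSp_zero, one_smul]; exact e.map_target hz)
  simp only [zero_smul, expSp_zero, one_smul] at h6
  exact h6.unique h5

theorem exists_six_fields {p : M} (hp : orbitDim p = 6) :
    ∃ X : Fin 6 → sp2, LinearIndependent ℝ fun i => infAct p (X i) := by
  have b := Module.finBasisOfFinrankEq ℝ (LinearMap.range (infAct p : sp2 →ₗ[ℝ] V7)) hp
  choose X hX using fun i => (b i).2
  refine ⟨X, ?_⟩
  have h := b.linearIndependent.map' (Submodule.subtype _) (Submodule.ker_subtype _)
  have e : (fun i => infAct p (X i)) =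
      (LinearMap.range (infAct p : sp2 →ₗ[ℝ] V7)).subtype ∘ b := by
    funext i; exact hX i
  rw [e]; exact h

/-! ### A smooth normal vector from cofactors -/

section Matrix

variable {φ : V7 [⋀^Fin 3]→L[ℝ] ℝ} {r : Fin 7 → V7}

/-- The matrix of the linear forms dual to the vectors `r`, for the metric of `φ`. -/
def dualMatrix (φ : V7 [⋀^Fin 3]→L[ℝ] ℝ) (r : Fin 7 → V7) : Matrix (Fin 7) (Fin 7) ℝ :=
  Matrix.of fun i k => ∑ a, r i a * gram φ a k

theorem dualMatrix_mulVec (hφ : IsG2Form φ) (r : Fin 7 → V7) (v : V7) (i : Fin 7) :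
    (dualMatrix φ r).mulVec (fun k => v k) i = g2Metric φ (r i) v := by
  rw [hφ.g2Metric_eq_gram, Matrix.mulVec, dotProduct]
  simp only [dualMatrix, Matrix.of_apply, Finset.sum_mul]
  rw [Finset.sum_comm]
  refine Finset.sum_congr rfl fun a _ => Finset.sum_congr rfl fun k _ => ?_
  ring

theorem det_dualMatrix_ne_zero (hφ : IsG2Form φ) (hr : LinearIndependent ℝ r) :
    (dualMatrix φ r).det ≠ 0 := by
  intro h
  obtain ⟨v, hv, hv0⟩ := Matrix.exists_mulVec_eq_zero_iff.2 h
  obtain ⟨u, hu⟩ := id hφ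
  set x : V7 := WithLp.toLp 2 v
  have h1 (i : Fin 7) : inner ℝ (u (r i)) (u x) = 0 := by
    rw [← g2Metric_eq hu, ← dualMatrix_mulVec hφ]
    exact congrFun hv0 i
  have hspan : x ∈ Submodule.span ℝ (Set.range r) := by
    rw [hr.span_eq_top_of_card_eq_finrank (by simp)]
    trivial
  obtain ⟨c, hc⟩ := (Submodule.mem_span_range_iff_exists_fun ℝ).1 hspan
  have h2 : inner ℝ (u x) (u x) = 0 := by
    have h3 (z : V7) : inner ℝ (u x) z = ∑ i, c i * inner ℝ (u (r i)) z := by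
      rw [← hc, map_sum, sum_inner]
      exact Finset.sum_congr rfl fun i _ => by rw [map_smul, inner_smul_left, conj_trivial]
    rw [h3]
    exact Finset.sum_eq_zero fun i _ => by rw [h1, mul_zero]
  have h3 : x = 0 := by
    rwa [inner_self_eq_zero, map_eq_zero_iff u u.injective] at h2
  exact hv (by
    funext k
    exact congrArg (fun y : V7 => y k) h3)

theorem linearIndependent_of_det_dualMatrix (h : (dualMatrix φ r).det ≠ 0) :
    LinearIndependent ℝ r := by
  rw [Fintype.linearIndependent_iff]
  intro c hc
  have h1 : Matrix.vecMul c (dualMatrix φ r) = 0 := by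
    funext k
    have h2 (a : Fin 7) : ∑ i, c i * r i a = 0 := by
      have := congrArg (fun y : V7 => y a) hc
      simpa [Finset.sum_apply] using this
    simp only [Matrix.vecMul, dotProduct, dualMatrix, Matrix.of_apply, Finset.mul_sum, Pi.zero_apply]
    rw [Finset.sum_comm]
    refine Finset.sum_eq_zero fun a _ => ?_
    rw [← zero_mul (gram φ a k), ← h2 a, Finset.sum_mul]
    exact Finset.sum_congr rfl fun i _ => by ring
  exact fun i => congrFun (Matrix.eq_zero_of_vecMul_eq_zero h h1) i

/-- A vector orthogonal to `r 1, …, r 6`. -/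
def cofactorVec (φ : V7 [⋀^Fin 3]→L[ℝ] ℝ) (r : Fin 7 → V7) : V7 :=
  WithLp.toLp 2 fun k => (dualMatrix φ r).adjugate k 0

/-- The first column of the identity A · adj A = det A. A cofactor vector is preferred to an
orthogonal projection because its entries are polynomial in the form's metric and the fields, hence
smooth. -/
theorem g2Metric_cofactorVec (hφ : IsG2Form φ) (r : Fin 7 → V7) (i : Fin 7) :
    g2Metric φ (r i) (cofactorVec φ r) = if i = 0 then (dualMatrix φ r).det else 0 := by
  rw [← dualMatrix_mulVec hφ]
  have h := congrFun (congrFun (Matrix.mul_adjugate (dualMatrix φ r)) i) 0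
  rw [Matrix.mul_apply] at h
  refine h.trans ?_
  simp [Matrix.one_apply]

end Matrix

theorem g2Metric_comm {φ : V7 [⋀^Fin 3]→L[ℝ] ℝ} (hφ : IsG2Form φ) (v w : V7) :
    g2Metric φ v w = g2Metric φ w v := by
  obtain ⟨u, hu⟩ := hφ
  rw [g2Metric_eq hu, g2Metric_eq hu, real_inner_comm]

/-- Near a point of a six-dimensional orbit, there is a smooth field of unit normal vectors. -/
theorem exists_normal_field (hact : IsSmoothAction M) {φ : FormField M 3}
    (hφ : IsG2Structure ∞ φ) (hdim : ∀ x : M, orbitDim x ≤ 6) (he : e ∈ atlas V7 M) {p : M}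
    (hpe : p ∈ e.source) (hp : orbitDim p = 6) :
    ∃ N : V7 → V7, ∀ᶠ y in nhds (e p), y ∈ e.target ∧ ContDiffAt ℝ ∞ N y ∧
      orbitDim (e.symm y) = 6 ∧ g2Metric (φ.inChart e y) (N y) (N y) = 1 ∧
      ∀ X, g2Metric (φ.inChart e y) (N y) (fieldInChart e X y) = 0 := by
  obtain ⟨X, hX⟩ := exists_six_fields hp
  have hy₀ : e p ∈ e.target := e.map_source hpe
  have hX' : LinearIndependent ℝ fun i => fieldInChart e (X i) (e p) := by
    have h := hX.map' ((dSymmEquiv he hy₀).symm : V7 →L[ℝ] V7).toLinearMap (by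
      rw [LinearMap.ker_eq_bot]; exact (dSymmEquiv he hy₀).symm.injective)
    have e1 : (fun i => fieldInChart e (X i) (e p)) =
        ((dSymmEquiv he hy₀).symm : V7 →L[ℝ] V7).toLinearMap ∘ fun i => infAct p (X i) := by
      funext i
      refine ((dSymmEquiv he hy₀).symm_apply_eq.2 ?_).symm
      have h2 := dSymm_fieldInChart he hy₀ (X i)
      rw [e.left_inv hpe] at h2
      exact h2.symm
    rw [e1]; exact h
  -- A constant vector completes the six generating fields to a basis at p. Independence persists
  -- nearby, as the nonvanishing of a determinant.
  obtain ⟨w, hw⟩ : ∃ w : V7, w ∉ Submodule.span ℝ (Set.range fun i =>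
      fieldInChart e (X i) (e p)) := by
    by_contra! hcon
    have h1 : Submodule.span ℝ (Set.range fun i => fieldInChart e (X i) (e p)) = ⊤ :=
      Submodule.eq_top_iff'.2 hcon
    have h2 := finrank_span_eq_card hX'
    rw [h1, finrank_top] at h2
    simp at h2
  set r : V7 → Fin 7 → V7 := fun y => Fin.cons w fun i => fieldInChart e (X i) y with hr
  have hr₀ : LinearIndependent ℝ (r (e p)) := linearIndependent_finCons.2 ⟨hX', hw⟩
  have hrs (y : V7) (hy : y ∈ e.target) (i : Fin 7) : ContDiffAt ℝ ∞ (fun y => r y i) y := by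
    refine Fin.cases ?_ (fun i => ?_) i
    · exact contDiffAt_const
    · exact contDiffAt_fieldInChart hact he hy (X i)
  have hAs (y : V7) (hy : y ∈ e.target) (i k : Fin 7) :
      ContDiffAt ℝ ∞ (fun y => dualMatrix (φ.inChart e y) (r y) i k) y := by
    simp only [dualMatrix, Matrix.of_apply]
    refine ContDiffAt.sum fun a _ => ContDiffAt.mul ?_ (contDiffAt_g2Metric hφ he hy a k)
    exact (EuclideanSpace.proj a : V7 →L[ℝ] ℝ).contDiff.contDiffAt.comp y (hrs y hy i)
  have hNs (y : V7) (hy : y ∈ e.target) (k : Fin 7) :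
      ContDiffAt ℝ ∞ (fun y => cofactorVec (φ.inChart e y) (r y) k) y := by
    have e1 (y : V7) : cofactorVec (φ.inChart e y) (r y) k =
        ((dualMatrix (φ.inChart e y) (r y)).updateRow 0 (Pi.single k 1)).det :=
      Matrix.adjugate_apply _ _ _
    simp only [e1]
    refine contDiffAt_det fun i j => ?_
    by_cases hi : i = 0
    · subst hi
      simp only [Matrix.updateRow_self]
      exact contDiffAt_const
    · simp only [Matrix.updateRow_ne hi]
      exact hAs y hy i j
  have hns (y : V7) (hy : y ∈ e.target) : ContDiffAt ℝ ∞ (fun y => g2Metric (φ.inChart e y)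
      (cofactorVec (φ.inChart e y) (r y)) (cofactorVec (φ.inChart e y) (r y))) y := by
    have h1 : ContDiffAt ℝ ∞ (fun y => ∑ i, ∑ j, cofactorVec (φ.inChart e y) (r y) i *
        cofactorVec (φ.inChart e y) (r y) j * gram (φ.inChart e y) i j) y :=
      ContDiffAt.sum fun i _ => ContDiffAt.sum fun j _ =>
        ((hNs y hy i).mul (hNs y hy j)).mul (contDiffAt_g2Metric hφ he hy i j)
    refine h1.congr_of_eventuallyEq ?_
    filter_upwards [e.open_target.mem_nhds hy] with z hz
    exact (isG2Form_inChart hφ.2 he hz).g2Metric_eq_gram _ _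
  have hdet : ∀ᶠ y in nhds (e p), (dualMatrix (φ.inChart e y) (r y)).det ≠ 0 :=
    (contDiffAt_det (hAs (e p) hy₀)).continuousAt.eventually_ne
      (det_dualMatrix_ne_zero (isG2Form_inChart hφ.2 he hy₀) hr₀)
  refine ⟨fun y => (√(g2Metric (φ.inChart e y) (cofactorVec (φ.inChart e y) (r y))
    (cofactorVec (φ.inChart e y) (r y))))⁻¹ • cofactorVec (φ.inChart e y) (r y), ?_⟩
  filter_upwards [hdet, e.open_target.mem_nhds hy₀] with y hdy hy
  have hG := isG2Form_inChart hφ.2 he hy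
  obtain ⟨u, hu⟩ := id hG
  set n := cofactorVec (φ.inChart e y) (r y) with hn
  have hn0 : n ≠ 0 := by
    intro h0
    have h1 := g2Metric_cofactorVec hG (r y) 0
    rw [if_pos rfl, ← hn, h0, g2Metric_eq hu, map_zero, inner_zero_right] at h1
    exact hdy h1.symm
  have hpos : 0 < g2Metric (φ.inChart e y) n n := by
    rw [g2Metric_eq hu, real_inner_self_pos]
    rwa [Ne, map_eq_zero_iff u u.injective]
  have hind := linearIndependent_of_det_dualMatrix hdy
  have hind' : LinearIndependent ℝ fun i => infAct (e.symm y) (X i) := by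
    have h := ((linearIndependent_finCons.1 hind).1).map'
      (dSymmEquiv he hy : V7 →L[ℝ] V7).toLinearMap (by
        rw [LinearMap.ker_eq_bot]; exact (dSymmEquiv he hy).injective)
    have e1 : (fun i => infAct (e.symm y) (X i)) =
        (dSymmEquiv he hy : V7 →L[ℝ] V7).toLinearMap ∘ fun i => fieldInChart e (X i) y :=
      funext fun i => (dSymm_fieldInChart he hy (X i)).symm
    rw [e1]; exact h
  -- Orbits have dimension at most six everywhere, so the six independent fields already span the
  -- tangent spaces of the nearby orbits; a vector normal to them is normal to the orbits.
  have hspan : Submodule.span ℝ (Set.range fun i => infAct (e.symm y) (X i)) =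
      LinearMap.range (infAct (e.symm y) : sp2 →ₗ[ℝ] V7) := by
    refine Submodule.eq_of_le_of_finrank_le (Submodule.span_le.2 ?_) ?_
    · rintro _ ⟨i, rfl⟩; exact ⟨X i, rfl⟩
    · rw [finrank_span_eq_card hind', Fintype.card_fin, ← orbitDim_eq]
      exact hdim _
  refine ⟨hy, ?_, ?_, ?_, fun Y => ?_⟩
  · refine ContDiffAt.smul (ContDiffAt.inv ((hns y hy).sqrt hpos.ne') (Real.sqrt_ne_zero'.2 hpos)) ?_
    exact contDiffAt_euclidean.2 (hNs y hy)
  · rw [orbitDim_eq, ← hspan, finrank_span_eq_card hind', Fintype.card_fin]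
  · rw [g2Metric_eq hu, map_smul, inner_smul_left, inner_smul_right, ← g2Metric_eq hu]
    simp only [conj_trivial]
    rw [← mul_assoc, ← mul_inv, Real.mul_self_sqrt hpos.le, inv_mul_cancel₀ hpos.ne']
  · rw [g2Metric_eq hu, map_smul, inner_smul_left]
    have hY : infAct (e.symm y) Y ∈ Submodule.span ℝ
        (Set.range fun i => infAct (e.symm y) (X i)) := by
      rw [hspan]; exact ⟨Y, rfl⟩
    obtain ⟨c, hc⟩ := (Submodule.mem_span_range_iff_exists_fun ℝ).1 hY
    have h1 : fieldInChart e Y y = ∑ i, c i • r y i.succ := by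
      rw [fieldInChart, ← hc, map_sum]
      exact Finset.sum_congr rfl fun i _ => map_smul _ _ _
    have h2 (i : Fin 6) : inner ℝ (u n) (u (r y i.succ)) = 0 := by
      rw [← g2Metric_eq hu, g2Metric_comm hG, g2Metric_cofactorVec hG, if_neg (Fin.succ_ne_zero i)]
    rw [h1, map_sum, inner_sum, Finset.sum_eq_zero, mul_zero]
    intro i _
    rw [map_smul, inner_smul_right, h2, mul_zero]

end Field

/-! ### Normal curves -/

/-- Bootstrapping: if c is of class Cⁿ then so is c' = N ∘ c, and c is of class Cⁿ⁺¹. -/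
theorem contDiffOn_of_hasDerivAt_comp {E : Type*} [NormedAddCommGroup E] [NormedSpace ℝ E]
    {N : E → E} {c : ℝ → E} {I : Set ℝ} (hI : IsOpen I) (hc : ∀ t ∈ I, HasDerivAt c (N (c t)) t)
    (hN : ∀ t ∈ I, ContDiffAt ℝ ∞ N (c t)) : ContDiffOn ℝ ∞ c I := by
  refine contDiffOn_infty.2 fun n => ?_
  induction n with
  | zero =>
    exact contDiffOn_zero.2 fun t ht => (hc t ht).continuousAt.continuousWithinAt
  | succ n ih =>
    push_cast
    refine (contDiffOn_succ_iff_deriv_of_isOpen hI).2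
      ⟨fun t ht => (hc t ht).differentiableAt.differentiableWithinAt, by simp, fun t ht => ?_⟩
    have h1 : ContDiffAt ℝ n (fun t => N (c t)) t :=
      ContDiffAt.comp t ((hN t ht).of_le (by exact_mod_cast le_top)) (ih.contDiffAt (hI.mem_nhds ht))
    refine (h1.congr_of_eventuallyEq ?_).contDiffWithinAt
    filter_upwards [hI.mem_nhds ht] with t' ht' using (hc t' ht').deriv

/-- The orthogonal complement of a hyperplane is a line, with two unit vectors. -/
theorem eq_or_eq_neg_of_orthogonal {φ : V7 [⋀^Fin 3]→L[ℝ] ℝ} (hφ : IsG2Form φ)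
    {R : Submodule ℝ V7} (hR : Module.finrank ℝ R = 6) {v w : V7} (hv : g2Metric φ v v = 1)
    (hw : g2Metric φ w w = 1) (hv' : ∀ x ∈ R, g2Metric φ v x = 0)
    (hw' : ∀ x ∈ R, g2Metric φ w x = 0) : w = v ∨ w = -v := by
  obtain ⟨u, hu⟩ := hφ
  rw [g2Metric_eq hu] at hv hw
  set R' : Submodule ℝ V7 := R.map (u : V7 →L[ℝ] V7).toLinearMap with hR'
  have h1 : Module.finrank ℝ R' = 6 := by
    rw [← hR]
    exact LinearEquiv.finrank_map_eq u.toLinearEquiv R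
  have h2 : Module.finrank ℝ (R'ᗮ : Submodule ℝ V7) = 1 := by
    have := R'.finrank_add_finrank_orthogonal
    rw [h1, finrank_euclideanSpace_fin] at this
    omega
  have hmem {z : V7} (hz : ∀ x ∈ R, g2Metric φ z x = 0) : u z ∈ R'ᗮ := by
    rw [Submodule.mem_orthogonal]
    rintro _ ⟨x, hx, rfl⟩
    rw [real_inner_comm]
    have := hz x hx
    rwa [g2Metric_eq hu] at this
  have hne : (⟨u v, hmem hv'⟩ : (R'ᗮ : Submodule ℝ V7)) ≠ 0 := by
    intro h0
    have h3 : u v = 0 := congrArg Subtype.val h0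
    rw [h3, inner_zero_left] at hv
    exact zero_ne_one hv
  obtain ⟨c, hc⟩ := exists_smul_eq_of_finrank_eq_one h2 hne ⟨u w, hmem hw'⟩
  have h3 : c • u v = u w := congrArg Subtype.val hc
  rw [← map_smul] at h3
  have h4 : c • v = w := u.injective h3
  rw [← h4, map_smul, inner_smul_left, inner_smul_right, hv] at hw
  have h5 : c * c = 1 := by simpa using hw
  rcases mul_self_eq_one_iff.1 h5 with h | h
  · left; rw [← h4, h, one_smul]
  · right; rw [← h4, h, neg_one_smul]

section Curve

variable {M : Type*} [TopologicalSpace M] [ChartedSpace V7 M]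

theorem form_congr {k : ℕ} (η : FormField M k) {x y : M} (h : x = y) :
    (η x : V7 [⋀^Fin k]→L[ℝ] ℝ) = η y := by subst h; rfl

variable [IsManifold 𝓘(ℝ, V7) ∞ M] {e : OpenPartialHomeomorph M V7}

variable [MulAction Sp2 M]

theorem fieldInChart_apply {x : M} (hx : x ∈ e.source) (X : sp2) :
    fieldInChart e X (e x) = dChart e x (infAct x X) := by
  rw [fieldInChart, e.left_inv hx]

variable {φ : FormField M 3} {I : Set ℝ} {γ : ℝ → M} {t : ℝ}

theorem IsNormalCurve.contMDiffAt (h : IsNormalCurve φ I γ) (hI : IsOpen I) (ht : t ∈ I) :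
    ContMDiffAt 𝓘(ℝ, ℝ) 𝓘(ℝ, V7) ∞ γ t :=
  h.1.contMDiffAt (hI.mem_nhds ht)

theorem IsNormalCurve.unit (h : IsNormalCurve φ I γ) (ht : t ∈ I) :
    g2Metric (φ (γ t) : V7 [⋀^Fin 3]→L[ℝ] ℝ) (vel γ t) (vel γ t) = 1 := (h.2 t ht).2.1

theorem IsNormalCurve.orthogonal (h : IsNormalCurve φ I γ) (ht : t ∈ I) (X : sp2) :
    g2Metric (φ (γ t) : V7 [⋀^Fin 3]→L[ℝ] ℝ) (vel γ t) (infAct (γ t) X) = 0 := (h.2 t ht).2.2 X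

/-- A smooth unit-speed curve orthogonal to the orbits starts at each point of a six-dimensional
orbit. -/
theorem exists_normal_curve (hact : IsSmoothAction M) (hφ : IsG2Structure ∞ φ)
    (hdim : ∀ x : M, orbitDim x ≤ 6) {p : M} (hp : orbitDim p = 6) :
    ∃ (I : Set ℝ) (γ : ℝ → M) (t₀ : ℝ), IsOpen I ∧ I.OrdConnected ∧ t₀ ∈ I ∧ γ t₀ = p ∧
      IsNormalCurve φ I γ := by
  have he := chart_mem_atlas V7 p
  have hpe := mem_chart_source V7 p
  set e := chartAt V7 p
  obtain ⟨N, hN⟩ := exists_normal_field hact hφ hdim he hpe hp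
  obtain ⟨c, hc0, ε, hε, hc⟩ :=
    (hN.self_of_nhds.2.1.of_le (by exact_mod_cast le_top) :
      ContDiffAt ℝ 1 N (e p)).exists_forall_mem_closedBall_exists_eq_forall_mem_Ioo_hasDerivAt₀ 0
  have hcont : ContinuousAt c 0 := (hc 0 (by simp [hε])).continuousAt
  have hev : ∀ᶠ t in nhds (0 : ℝ), c t ∈ e.target ∧ ContDiffAt ℝ ∞ N (c t) ∧
      orbitDim (e.symm (c t)) = 6 ∧ g2Metric (φ.inChart e (c t)) (N (c t)) (N (c t)) = 1 ∧
      ∀ X, g2Metric (φ.inChart e (c t)) (N (c t)) (fieldInChart e X (c t)) = 0 := by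
    rw [← hc0] at hN
    exact hcont.tendsto.eventually hN
  obtain ⟨δ, hδ, hball⟩ := Metric.eventually_nhds_iff_ball.1
    (hev.and (Ioo_mem_nhds (by linarith : (0 : ℝ) - ε < 0) (by linarith : (0 : ℝ) < 0 + ε)))
  have hcs : ContDiffOn ℝ ∞ c (Metric.ball 0 δ) :=
    contDiffOn_of_hasDerivAt_comp Metric.isOpen_ball (fun t ht => hc t (hball t ht).2)
      fun t ht => (hball t ht).1.2.1
  refine ⟨Metric.ball 0 δ, fun t => e.symm (c t), 0, Metric.isOpen_ball,
    (convex_ball 0 δ).ordConnected, Metric.mem_ball_self hδ, by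
      show e.symm (c 0) = p
      rw [hc0]; exact e.left_inv hpe,
    fun t ht => ?_, fun t ht => ?_⟩
  · have h1 := (hcs.contDiffAt (Metric.isOpen_ball.mem_nhds ht)).contMDiffAt
    exact ((contMDiffAt_chart_symm he (hball t ht).1.1).comp t h1).contMDiffWithinAt
  · obtain ⟨⟨hy, -, h6, h1, h0⟩, ht'⟩ := hball t ht
    have hv : HasVelocity (fun t => e.symm (c t)) t (dSymm e (c t) (N (c t))) :=
      hasVelocity_comp (mdifferentiableAt_chart_symm he hy) (hc t ht') rfl
    rw [g2Metric_inChart hφ.2 he hy] at h1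
    have hv' := hv.velocity_eq
    refine ⟨h6, ?_, fun X => ?_⟩
    · rw [hv']; exact h1
    · have h2 := h0 X
      rw [g2Metric_inChart hφ.2 he hy, dSymm_fieldInChart he hy] at h2
      rw [hv']; exact h2

/-- At each parameter the velocity is N or -N. The sum of velocity and N is continuous and equals 2N
≠ 0 at t, which excludes the minus sign nearby: a normal curve is an integral curve of the unit
normal field. -/
theorem eventually_hasDerivAt_normal_field (hφ : IsG2Structure ∞ φ) (hI : IsOpen I)
    (hγ : IsNormalCurve φ I γ) (ht : t ∈ I) (he : e ∈ atlas V7 M) (hpe : γ t ∈ e.source)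
    {N : V7 → V7} (hN : ∀ᶠ y in nhds (e (γ t)), y ∈ e.target ∧ ContDiffAt ℝ ∞ N y ∧
      orbitDim (e.symm y) = 6 ∧ g2Metric (φ.inChart e y) (N y) (N y) = 1 ∧
      ∀ X, g2Metric (φ.inChart e y) (N y) (fieldInChart e X y) = 0)
    (h0 : dChart e (γ t) (vel γ t) = N (e (γ t))) :
    ∀ᶠ t' in nhds t, HasDerivAt (fun t => e (γ t)) (N (e (γ t'))) t' := by
  have hct := hγ.contMDiffAt hI ht
  have hcs : ContDiffAt ℝ ∞ (fun t => e (γ t)) t :=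
    contMDiffAt_iff_contDiffAt.1 ((contMDiffAt_chart he hpe).comp t hct)
  have hder {t' : ℝ} (ht' : t' ∈ I) (hs : γ t' ∈ e.source) :
      HasDerivAt (fun t => e (γ t)) (dChart e (γ t') (vel γ t')) t' :=
    (hasVelocity_vel (hγ.contMDiffAt hI ht')).chart he hs
  have hNt := hN.self_of_nhds
  have hcont : ContinuousAt (fun t' => deriv (fun t => e (γ t)) t' + N (e (γ t'))) t := by
    refine ContinuousAt.add ?_ (ContinuousAt.comp (g := N) hNt.2.1.continuousAt hcs.continuousAt)
    have h1 : ContDiffAt ℝ 0 (fderiv ℝ fun t => e (γ t)) t := hcs.fderiv_right (by simp)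
    exact h1.continuousAt.clm_apply continuousAt_const
  have hne : deriv (fun t => e (γ t)) t + N (e (γ t)) ≠ 0 := by
    rw [(hder ht hpe).deriv, h0, ← two_smul ℝ]
    refine smul_ne_zero two_ne_zero fun hz => ?_
    obtain ⟨u, hu⟩ := isG2Form_inChart hφ.2 he hNt.1
    have h1 := hNt.2.2.2.1
    rw [hz, g2Metric_eq hu, map_zero, inner_zero_left] at h1
    exact zero_ne_one h1
  filter_upwards [hcont.eventually_ne hne, hI.mem_nhds ht,
    hct.continuousAt.eventually_mem (e.open_source.mem_nhds hpe),
    hcs.continuousAt.tendsto.eventually hN] with t' h1 ht' hs hNt'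
  have h2 := hder ht' hs
  obtain ⟨hy, -, h6, hu1, hu0⟩ := hNt'
  rw [e.left_inv hs] at h6
  have h3 (w : V7) : dSymm e (e (γ t')) (dChart e (γ t') w) = w := by
    have := dSymm_dChart he hy w
    rwa [e.left_inv hs] at this
  have hu1' := hu1
  rw [g2Metric_inChart hφ.2 he hy, form_congr φ (e.left_inv hs)] at hu1'
  rcases eq_or_eq_neg_of_orthogonal (hφ.2 (γ t')) h6 (hγ.unit ht') hu1'
    (by rintro _ ⟨X, rfl⟩; exact hγ.orthogonal ht' X) (by
      rintro _ ⟨X, rfl⟩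
      have h4 := hu0 X
      rw [g2Metric_inChart hφ.2 he hy, fieldInChart_apply hs, h3,
        form_congr φ (e.left_inv hs)] at h4
      exact h4) with h4 | h4
  · have h5 : N (e (γ t')) = dChart e (γ t') (vel γ t') := by
      have h7 := dChart_dSymm he hy (N (e (γ t')))
      rw [h4, e.left_inv hs] at h7
      exact h7.symm
    rw [h5]; exact h2
  · exfalso
    have h5 : N (e (γ t')) = -dChart e (γ t') (vel γ t') := by
      have h7 := dChart_dSymm he hy (N (e (γ t')))
      rw [h4, e.left_inv hs, map_neg] at h7
      exact h7.symm
    exact h1 (by rw [h2.deriv, h5, add_neg_cancel])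

/-- Normal curves are locally determined by their initial velocity. -/
theorem IsNormalCurve.eventually_eq (hact : IsSmoothAction M) (hφ : IsG2Structure ∞ φ)
    (hdim : ∀ x : M, orbitDim x ≤ 6) (hI : IsOpen I) {γ' : ℝ → M} (hγ : IsNormalCurve φ I γ)
    (hγ' : IsNormalCurve φ I γ') (ht : t ∈ I) (h0 : γ' t = γ t) (h1 : vel γ' t = vel γ t) :
    γ' =ᶠ[nhds t] γ := by
  have he := chart_mem_atlas V7 (γ t)
  have hpe := mem_chart_source V7 (γ t)
  set e := chartAt V7 (γ t)
  obtain ⟨N₀, hN₀⟩ := exists_normal_field hact hφ hdim he hpe (hγ.2 t ht).1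
  obtain ⟨N, hN, hNt⟩ : ∃ N : V7 → V7, (∀ᶠ y in nhds (e (γ t)), y ∈ e.target ∧
      ContDiffAt ℝ ∞ N y ∧ orbitDim (e.symm y) = 6 ∧ g2Metric (φ.inChart e y) (N y) (N y) = 1 ∧
      ∀ X, g2Metric (φ.inChart e y) (N y) (fieldInChart e X y) = 0) ∧
      dChart e (γ t) (vel γ t) = N (e (γ t)) := by
    obtain ⟨hy, -, h6, hu1, hu0⟩ := hN₀.self_of_nhds
    have hx := e.left_inv hpe
    have hortho : ∀ x ∈ LinearMap.range (infAct (γ t) : sp2 →ₗ[ℝ] V7),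
        g2Metric (φ (γ t) : V7 [⋀^Fin 3]→L[ℝ] ℝ) (dSymm e (e (γ t)) (N₀ (e (γ t)))) x = 0 := by
      rintro _ ⟨X, rfl⟩
      have h4 := hu0 X
      rw [g2Metric_inChart hφ.2 he hy, dSymm_fieldInChart he hy, form_congr φ hx, hx] at h4
      exact h4
    have hu1' := hu1
    rw [g2Metric_inChart hφ.2 he hy, form_congr φ hx] at hu1'
    have h7 := dChart_dSymm he hy (N₀ (e (γ t)))
    rw [hx] at h6 h7
    -- The initial velocity is N₀ or -N₀ at the point; in the second case the opposite field is
    -- used, which is a unit normal field as well.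
    rcases eq_or_eq_neg_of_orthogonal (hφ.2 (γ t)) h6 hu1' (hγ.unit ht) hortho
      (by rintro _ ⟨X, rfl⟩; exact hγ.orthogonal ht X) with h4 | h4
    · exact ⟨N₀, hN₀, by rw [h4]; exact h7⟩
    · refine ⟨fun y => -N₀ y, ?_, by rw [h4, map_neg, h7]⟩
      filter_upwards [hN₀] with y ⟨hy, a1, a2, a3, a4⟩
      obtain ⟨u, hu⟩ := isG2Form_inChart hφ.2 he hy
      refine ⟨hy, a1.neg, a2, ?_, fun X => ?_⟩
      · rw [g2Metric_eq hu, map_neg, inner_neg_neg, ← g2Metric_eq hu, a3]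
      · rw [g2Metric_eq hu, map_neg, inner_neg_left, ← g2Metric_eq hu, a4, neg_zero]
  have hpe' : γ' t ∈ e.source := by rw [h0]; exact hpe
  have d1 := eventually_hasDerivAt_normal_field hφ hI hγ ht he hpe hN hNt
  have d2 := eventually_hasDerivAt_normal_field hφ hI hγ' ht he hpe' (by rw [h0]; exact hN)
    (by rw [h0, h1]; exact hNt)
  obtain ⟨K, s, hs, hK⟩ := ((hN.self_of_nhds.2.1).of_le
    (by exact_mod_cast le_top : (1 : WithTop ℕ∞) ≤ ∞)).exists_lipschitzOnWith
  have m1 : ∀ᶠ t' in nhds t, e (γ t') ∈ s :=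
    d1.self_of_nhds.continuousAt.eventually_mem hs
  have m2 : ∀ᶠ t' in nhds t, e (γ' t') ∈ s :=
    d2.self_of_nhds.continuousAt.eventually_mem (by rw [h0]; exact hs)
  -- Both curves solve the same equation with a locally Lipschitz right-hand side and the same
  -- initial value.
  have h2 := ODE_solution_unique_of_eventually (v := fun _ => N) (s := fun _ => s)
    (Filter.Eventually.of_forall fun _ => hK) (d2.and m2) (d1.and m1) (by rw [h0])
  filter_upwards [h2, (hγ.contMDiffAt hI ht).continuousAt.eventually_mem
    (e.open_source.mem_nhds hpe), (hγ'.contMDiffAt hI ht).continuousAt.eventually_mem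
    (e.open_source.mem_nhds hpe')] with t' a1 a2 a3
  exact e.injOn a3 a2 a1

end Curve

/-! ### The isotropy algebra along a normal curve -/

section Isotropy

variable {M : Type*} [TopologicalSpace M] [ChartedSpace V7 M] [IsManifold 𝓘(ℝ, V7) ∞ M]
  [MulAction Sp2 M] {φ : FormField M 3} {I : Set ℝ} {γ : ℝ → M} {t : ℝ}

theorem g2Metric_dAct (hact : IsSmoothAction M) (hφ : ∀ x, IsG2Form (φ x)) (hinv : IsInvariant φ)
    (b : Sp2) (x : M) (v w : V7) :
    g2Metric (φ (b • x) : V7 [⋀^Fin 3]→L[ℝ] ℝ) (dAct b x v) (dAct b x w) =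
      g2Metric (φ x : V7 [⋀^Fin 3]→L[ℝ] ℝ) v w := by
  have h0 : IsG2Form (φ (b • x) : V7 [⋀^Fin 3]→L[ℝ] ℝ) := hφ (b • x)
  have h1 := (g2Metric_comp h0 (dActEquiv hact b x) v w).2
  have h2 : (φ (b • x) : V7 [⋀^Fin 3]→L[ℝ] ℝ).compContinuousLinearMap
      (dActEquiv hact b x : V7 →L[ℝ] V7) = φ x := isInvariant_iff.1 hinv b x
  exact h1.symm.trans (congrArg (fun η : V7 [⋀^Fin 3]→L[ℝ] ℝ => g2Metric η v w) h2)

theorem orbitDim_smul (hact : IsSmoothAction M) (b : Sp2) (x : M) :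
    orbitDim (b • x) = orbitDim x := by
  rw [orbitDim_eq, orbitDim_eq, ← LinearEquiv.finrank_map_eq (dActEquiv hact b x).toLinearEquiv
    (LinearMap.range (infAct x : sp2 →ₗ[ℝ] V7))]
  have e : LinearMap.range (infAct (b • x) : sp2 →ₗ[ℝ] V7) = Submodule.map
      ((dActEquiv hact b x).toLinearEquiv : V7 →ₗ[ℝ] V7)
      (LinearMap.range (infAct x : sp2 →ₗ[ℝ] V7)) := by
    ext v
    constructor
    · rintro ⟨X, rfl⟩
      exact ⟨_, ⟨Ad b⁻¹ X, rfl⟩, (infAct_smul hact b x X).symm⟩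
    · rintro ⟨_, ⟨X, rfl⟩, rfl⟩
      exact ⟨Ad b X, infAct_smul' hact b x X⟩
  rw [e]

theorem IsNormalCurve.smul (hact : IsSmoothAction M) (hφ : ∀ x, IsG2Form (φ x))
    (hinv : IsInvariant φ) (hI : IsOpen I) (hγ : IsNormalCurve φ I γ) (b : Sp2) :
    IsNormalCurve φ I fun t => b • γ t := by
  refine ⟨(contMDiff_act hact b).comp_contMDiffOn hγ.1, fun t ht => ?_⟩
  have hv : velocity (fun t => b • γ t) t = dAct b (γ t) (vel γ t) :=
    ((hasVelocity_vel (hγ.contMDiffAt hI ht)).act hact b).velocity_eq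
  refine ⟨(orbitDim_smul hact b _).trans (hγ.2 t ht).1, ?_, fun X => ?_⟩
  · rw [hv]
    exact (g2Metric_dAct hact hφ hinv b (γ t) _ _).trans (hγ.unit ht)
  · rw [hv]
    change g2Metric _ _ (infAct (b • γ t) X) = 0
    rw [infAct_smul hact]
    exact (g2Metric_dAct hact hφ hinv b (γ t) _ _).trans (hγ.orthogonal ht _)

theorem vel_smul (hact : IsSmoothAction M) (hI : IsOpen I) (hγ : IsNormalCurve φ I γ) (ht : t ∈ I)
    (b : Sp2) : vel (fun t => b • γ t) t = dAct b (γ t) (vel γ t) :=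
  ((hasVelocity_vel (hγ.contMDiffAt hI ht)).act hact b).vel_eq

/-- Two normal curves which agree to first order at one point are equal. -/
theorem IsNormalCurve.eqOn [T2Space M] (hact : IsSmoothAction M) (hφ : IsG2Structure ∞ φ)
    (hdim : ∀ x : M, orbitDim x ≤ 6) (hI : IsOpen I) (hI' : I.OrdConnected) {γ' : ℝ → M}
    (hγ : IsNormalCurve φ I γ) (hγ' : IsNormalCurve φ I γ') (ht : t ∈ I) (h0 : γ' t = γ t)
    (h1 : vel γ' t = vel γ t) : EqOn γ' γ I := by
  set u : Set ℝ := {t | γ' =ᶠ[nhds t] γ} with hu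
  have huo : IsOpen u := isOpen_iff_eventually.2 fun s hs => hs.eventually_nhds
  have key : I ⊆ u := by
    -- The set of local agreement is open. At a limit point of it in I, positions and velocities
    -- agree by continuity, and local uniqueness applies again, so the set is also relatively
    -- closed.
    refine hI'.isPreconnected.subset_of_closure_inter_subset huo
      ⟨t, ht, hγ.eventually_eq hact hφ hdim hI hγ' ht h0 h1⟩ ?_
    rintro s ⟨hs, hsI⟩
    rw [mem_closure_iff_frequently] at hs
    have c1 := hγ.contMDiffAt hI hsI
    have c2 := hγ'.contMDiffAt hI hsI
    have e0 : γ' s = γ s := tendsto_nhds_unique_of_frequently_eq c2.continuousAt c1.continuousAt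
      (hs.mono fun r hr => hr.self_of_nhds)
    refine hγ.eventually_eq hact hφ hdim hI hγ' hsI e0 ?_
    have he := chart_mem_atlas V7 (γ s)
    have hpe := mem_chart_source V7 (γ s)
    set e := chartAt V7 (γ s)
    have hpe' : γ' s ∈ e.source := by rw [e0]; exact hpe
    have cd {c : ℝ → M} (hc : ContMDiffAt 𝓘(ℝ, ℝ) 𝓘(ℝ, V7) ∞ c s) (hce : c s ∈ e.source) :
        ContinuousAt (deriv fun r => e (c r)) s := by
      have h2 : ContDiffAt ℝ ∞ (fun r => e (c r)) s :=
        contMDiffAt_iff_contDiffAt.1 ((contMDiffAt_chart he hce).comp s hc)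
      have h3 : ContDiffAt ℝ 0 (fderiv ℝ fun r => e (c r)) s := h2.fderiv_right (by simp)
      exact h3.continuousAt.clm_apply continuousAt_const
    have e1 : deriv (fun r => e (γ' r)) s = deriv (fun r => e (γ r)) s :=
      tendsto_nhds_unique_of_frequently_eq (cd c2 hpe') (cd c1 hpe) (hs.mono fun r hr =>
        Filter.EventuallyEq.deriv_eq (hr.mono fun r' hr' => congrArg e hr'))
    rw [((hasVelocity_vel c2).chart he hpe').deriv, ((hasVelocity_vel c1).chart he hpe).deriv,
      e0] at e1
    have h4 := congrArg (dSymm e (e (γ s))) e1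
    have h5 (w : V7) : dSymm e (e (γ s)) (dChart e (γ s) w) = w := by
      have := dSymm_dChart he (e.map_source hpe) w
      rwa [e.left_inv hpe] at this
    rwa [h5, h5] at h4
  exact fun s hs => (key hs).self_of_nhds

theorem dAct_eq_of_smul_eq {b : Sp2} {x : M} (hact : IsSmoothAction M) (hb : b • x = x) (v : V7) :
    dAct (b * b) x v = dAct b x (dAct b x v) := by
  rw [dAct_mul hact, hb]; rfl

/-- The isotropy algebra is constant along a normal curve, and fixes its velocity. -/
theorem IsNormalCurve.isotropy [T2Space M] (hact : IsSmoothAction M) (hφ : IsG2Structure ∞ φ)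
    (hinv : IsInvariant φ) (hdim : ∀ x : M, orbitDim x ≤ 6) (hI : IsOpen I) (hI' : I.OrdConnected)
    (hγ : IsNormalCurve φ I γ) (ht : t ∈ I) {X : sp2} (hX : infAct (γ t) X = 0) {t' : ℝ}
    (ht' : t' ∈ I) : infAct (γ t') X = 0 ∧
      ∀ s : ℝ, expSp (s • X) • γ t' = γ t' ∧ dAct (expSp (s • X)) (γ t') (vel γ t') = vel γ t' := by
  have key (s : ℝ) : EqOn (fun t => expSp (s • X) • γ t) γ I := by
    -- The element exp ((s/2)X) fixes γ(t) and maps the unit normal to itself or to its negative.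
    -- Its square exp (sX) therefore fixes the normal, and it moves γ to a normal curve with the
    -- same initial data.
    set b := expSp ((s / 2) • X) with hb
    have hbt : b • γ t = γ t := expSp_smul_eq_of_infAct_eq_zero hact hX _
    have hbb : expSp (s • X) = b * b := by rw [hb, ← expSp_add_smul, add_halves]
    have hbγ := hγ.smul hact hφ.2 hinv hI b
    have hv := vel_smul hact hI hγ ht b
    have hpm : vel (fun t => b • γ t) t = vel γ t ∨ vel (fun t => b • γ t) t = -vel γ t := by
      have u1 := hbγ.unit ht
      have o1 := hbγ.orthogonal ht
      rw [form_congr φ hbt] at u1 o1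
      refine eq_or_eq_neg_of_orthogonal (hφ.2 (γ t)) (hγ.2 t ht).1 (hγ.unit ht) u1 ?_ ?_
      · rintro _ ⟨Y, rfl⟩; exact hγ.orthogonal ht Y
      · rintro _ ⟨Y, rfl⟩
        have := o1 Y
        rwa [hbt] at this
    rw [hbb]
    refine hγ.eqOn hact hφ hdim hI hI' (hγ.smul hact hφ.2 hinv hI (b * b)) ht
      (by rw [mul_smul, hbt, hbt]) ?_
    rw [vel_smul hact hI hγ ht, dAct_eq_of_smul_eq hact hbt]
    rcases hpm with h | h <;> rw [hv] at h
    · rw [h, h]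
    · rw [h, map_neg, h, neg_neg]
  refine ⟨?_, fun s => ⟨key s ht', ?_⟩⟩
  · have h1 := hasVelocity_orbit hact (γ t') X
    have h2 : (fun s : ℝ => expSp (s • X) • γ t') = fun _ => γ t' := by
      funext s; exact key s ht'
    rw [h2] at h1
    have h3 : HasVelocity (fun _ : ℝ => γ t') 0 (0 : V7) := by
      have h4 := hasMFDerivAt_const (I := 𝓘(ℝ, ℝ)) (I' := 𝓘(ℝ, V7)) (γ t') (0 : ℝ)
      have e : (ContinuousLinearMap.toSpanSingleton ℝ (0 : V7) : ℝ →L[ℝ] V7) = 0 := by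
        ext1; simp
      rw [HasVelocity, e]; exact h4
    exact h1.unique h3
  · rw [← vel_smul hact hI hγ ht']
    exact ((hasVelocity_vel (hγ.contMDiffAt hI ht')).congr
      (Filter.eventuallyEq_of_mem (hI.mem_nhds ht') (key s))).vel_eq

end Isotropy

/-! ### Maximal tori and four-dimensional subalgebras of `sp(2)` -/

/-- The invariant inner product on `sp(2)`. -/
def ip (D : sp2) : sp2 →ₗ[ℝ] ℝ where
  toFun X := (toMat D 0 0).imI * (toMat X 0 0).imI + (toMat D 0 0).imJ * (toMat X 0 0).imJ
    + (toMat D 0 0).imK * (toMat X 0 0).imK + (toMat D 1 1).imI * (toMat X 1 1).imI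
    + (toMat D 1 1).imJ * (toMat X 1 1).imJ + (toMat D 1 1).imK * (toMat X 1 1).imK
    + 2 * ((toMat D 1 0).re * (toMat X 1 0).re + (toMat D 1 0).imI * (toMat X 1 0).imI
      + (toMat D 1 0).imJ * (toMat X 1 0).imJ + (toMat D 1 0).imK * (toMat X 1 0).imK)
  map_add' X Y := by simp; ring
  map_smul' c X := by simp; ring

theorem ip_spOf (a₁ a₂ a₃ d₁ d₂ d₃ b₀ b₁ b₂ b₃ a₁' a₂' a₃' d₁' d₂' d₃' b₀' b₁' b₂' b₃' : ℝ) :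
    ip (spOf a₁ a₂ a₃ d₁ d₂ d₃ b₀ b₁ b₂ b₃) (spOf a₁' a₂' a₃' d₁' d₂' d₃' b₀' b₁' b₂' b₃') =
      a₁ * a₁' + a₂ * a₂' + a₃ * a₃' + d₁ * d₁' + d₂ * d₂' + d₃ * d₃'
        + 2 * (b₀ * b₀' + b₁ * b₁' + b₂ * b₂' + b₃ * b₃') := rfl

theorem spOf_zero : spOf 0 0 0 0 0 0 0 0 0 0 = 0 := by
  have h := smul_spOf 0 0 0 0 0 0 0 0 0 0 0
  rw [zero_smul, mul_zero] at h
  exact h.symm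

theorem ip_comm (X Y : sp2) : ip X Y = ip Y X := by
  obtain ⟨a₁, a₂, a₃, d₁, d₂, d₃, b₀, b₁, b₂, b₃, rfl⟩ := exists_spOf X
  obtain ⟨a₁', a₂', a₃', d₁', d₂', d₃', b₀', b₁', b₂', b₃', rfl⟩ := exists_spOf Y
  rw [ip_spOf, ip_spOf]; ring

theorem ip_bracket (X Y Z : sp2) : ip (bracket X Y) Z = ip X (bracket Y Z) := by
  obtain ⟨a₁, a₂, a₃, d₁, d₂, d₃, b₀, b₁, b₂, b₃, rfl⟩ := exists_spOf X
  obtain ⟨a₁', a₂', a₃', d₁', d₂', d₃', b₀', b₁', b₂', b₃', rfl⟩ := exists_spOf Y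
  obtain ⟨r₁, r₂, r₃, s₁, s₂, s₃, t₀, t₁, t₂, t₃, rfl⟩ := exists_spOf Z
  rw [bracket_spOf, bracket_spOf, ip_spOf, ip_spOf]; ring

theorem eq_zero_of_ip_self {X : sp2} (h : ip X X = 0) : X = 0 := by
  obtain ⟨a₁, a₂, a₃, d₁, d₂, d₃, b₀, b₁, b₂, b₃, rfl⟩ := exists_spOf X
  rw [ip_spOf] at h
  have n1 := mul_self_nonneg a₁
  have n2 := mul_self_nonneg a₂
  have n3 := mul_self_nonneg a₃
  have n4 := mul_self_nonneg d₁
  have n5 := mul_self_nonneg d₂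
  have n6 := mul_self_nonneg d₃
  have n7 := mul_self_nonneg b₀
  have n8 := mul_self_nonneg b₁
  have n9 := mul_self_nonneg b₂
  have n0 := mul_self_nonneg b₃
  have h1 : a₁ = 0 := mul_self_eq_zero.1 (by linarith)
  have h2 : a₂ = 0 := mul_self_eq_zero.1 (by linarith)
  have h3 : a₃ = 0 := mul_self_eq_zero.1 (by linarith)
  have h4 : d₁ = 0 := mul_self_eq_zero.1 (by linarith)
  have h5 : d₂ = 0 := mul_self_eq_zero.1 (by linarith)
  have h6 : d₃ = 0 := mul_self_eq_zero.1 (by linarith)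
  have h7 : b₀ = 0 := mul_self_eq_zero.1 (by linarith)
  have h8 : b₁ = 0 := mul_self_eq_zero.1 (by linarith)
  have h9 : b₂ = 0 := mul_self_eq_zero.1 (by linarith)
  have h0 : b₃ = 0 := mul_self_eq_zero.1 (by linarith)
  rw [h1, h2, h3, h4, h5, h6, h7, h8, h9, h0, spOf_zero]

theorem bracket_self (X : sp2) : bracket X X = 0 := by
  apply toMat_injective
  rw [toMat_bracket, sub_self, map_zero]

theorem bracket_zero (X : sp2) : bracket X 0 = 0 := by
  have h := bracket_smul 0 X 0
  rwa [zero_smul, zero_smul] at h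

theorem jacobi (X Y Z : sp2) :
    bracket X (bracket Y Z) = bracket (bracket X Y) Z + bracket Y (bracket X Z) := by
  apply toMat_injective
  simp only [toMat_bracket, map_add]
  noncomm_ring

/-- The elements of the standard maximal torus. -/
def torus (x y : ℝ) : sp2 := spOf x 0 0 y 0 0 0 0 0 0

theorem bracket_torus (x y x' y' : ℝ) : bracket (torus x y) (torus x' y') = 0 := by
  rw [torus, torus, bracket_spOf, ← spOf_zero]
  congr 1 <;> ring

/-- The element diag (i, 2i) is regular: -ad² has on the four root planes the eigenvalues 4, 16, 1,
9, none of them zero, so its centralizer is the torus. The off-diagonal entries have weight two in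
`ip`, which turns 1 and 9 into the coefficients 2 and 18. -/
theorem exists_torus_of_bracket_eq_zero {X : sp2} (h : bracket X (torus 1 2) = 0) :
    ∃ x y, X = torus x y := by
  obtain ⟨a₁, a₂, a₃, d₁, d₂, d₃, b₀, b₁, b₂, b₃, rfl⟩ := exists_spOf X
  have h' : ip (bracket (spOf a₁ a₂ a₃ d₁ d₂ d₃ b₀ b₁ b₂ b₃) (torus 1 2))
    (bracket (spOf a₁ a₂ a₃ d₁ d₂ d₃ b₀ b₁ b₂ b₃) (torus 1 2)) = 0 := by rw [h, map_zero]
  rw [torus, bracket_spOf, ip_spOf] at h'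
  have e : 4 * (a₂ ^ 2 + a₃ ^ 2) + 16 * (d₂ ^ 2 + d₃ ^ 2) + 2 * (b₀ ^ 2 + b₁ ^ 2)
    + 18 * (b₂ ^ 2 + b₃ ^ 2) = 0 := by linear_combination h'
  have n2 := sq_nonneg a₂
  have n3 := sq_nonneg a₃
  have n5 := sq_nonneg d₂
  have n6 := sq_nonneg d₃
  have n7 := sq_nonneg b₀
  have n8 := sq_nonneg b₁
  have n9 := sq_nonneg b₂
  have n0 := sq_nonneg b₃
  have h2 : a₂ = 0 := (pow_eq_zero_iff two_ne_zero).1 (by linarith)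
  have h3 : a₃ = 0 := (pow_eq_zero_iff two_ne_zero).1 (by linarith)
  have h5 : d₂ = 0 := (pow_eq_zero_iff two_ne_zero).1 (by linarith)
  have h6 : d₃ = 0 := (pow_eq_zero_iff two_ne_zero).1 (by linarith)
  have h7 : b₀ = 0 := (pow_eq_zero_iff two_ne_zero).1 (by linarith)
  have h8 : b₁ = 0 := (pow_eq_zero_iff two_ne_zero).1 (by linarith)
  have h9 : b₂ = 0 := (pow_eq_zero_iff two_ne_zero).1 (by linarith)
  have h0 : b₃ = 0 := (pow_eq_zero_iff two_ne_zero).1 (by linarith)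
  exact ⟨a₁, d₁, by rw [h2, h3, h5, h6, h7, h8, h9, h0, torus]⟩

/-- The diagonal of A A* = 1 bounds every entry of a unitary matrix by 1. Compactness provides the
maximum on which the conjugation into the torus rests. -/
instance : CompactSpace Sp2 := by
  refine (isCompact_iff_compactSpace (s := (unitary (Matrix (Fin 2) (Fin 2) ℍ[ℝ]) :
    Set (Matrix (Fin 2) (Fin 2) ℍ[ℝ])))).1 ?_
  have h1 : IsClosed (unitary (Matrix (Fin 2) (Fin 2) ℍ[ℝ]) :
      Set (Matrix (Fin 2) (Fin 2) ℍ[ℝ])) := by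
    have e : (unitary (Matrix (Fin 2) (Fin 2) ℍ[ℝ]) : Set (Matrix (Fin 2) (Fin 2) ℍ[ℝ])) =
        {A | star A * A = 1} ∩ {A | A * star A = 1} := by
      ext A; exact Unitary.mem_iff
    rw [e]
    exact (isClosed_eq (by fun_prop) continuous_const).inter
      (isClosed_eq (by fun_prop) continuous_const)
  have : ProperSpace ℍ[ℝ] := FiniteDimensional.proper ℝ ℍ[ℝ]
  have h2 : IsCompact (Set.pi univ fun _ => Set.pi univ fun _ => Metric.closedBall 0 1 :
      Set (Fin 2 → Fin 2 → ℍ[ℝ])) :=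
    isCompact_univ_pi fun _ => isCompact_univ_pi fun _ => isCompact_closedBall 0 1
  refine IsCompact.of_isClosed_subset h2 h1 fun A hA => ?_
  have h3 : A * star A = 1 := (Unitary.mem_iff.1 hA).2
  intro i _ j _
  have h4 := congrArg (fun B : Matrix (Fin 2) (Fin 2) ℍ[ℝ] => (B i i).re) h3
  simp only [Matrix.mul_apply, Matrix.star_apply, Quaternion.self_mul_star, Fin.sum_univ_two,
    Quaternion.re_add, Quaternion.re_coe, Matrix.one_apply_eq, Quaternion.re_one, Quaternion.normSq_eq_norm_mul_self]
    at h4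
  rw [mem_closedBall_zero_iff]
  have h5 := Finset.single_le_sum (f := fun j => ‖A i j‖ * ‖A i j‖)
    (fun j _ => mul_self_nonneg _) (Finset.mem_univ j)
  rw [Fin.sum_univ_two, h4] at h5
  nlinarith [norm_nonneg (A i j)]

theorem Ad_eq_iff (g : Sp2) (A : sp2) : Ad g A = A ↔
    (g : Matrix (Fin 2) (Fin 2) ℍ[ℝ]) * toMat A = toMat A * g := by
  rw [← toMat_injective.eq_iff, toMat_Ad]
  constructor
  · intro h
    have h0 : star (g : Matrix (Fin 2) (Fin 2) ℍ[ℝ]) * (g : Matrix (Fin 2) (Fin 2) ℍ[ℝ]) = 1 :=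
      Unitary.coe_star_mul_self g
    conv_rhs => rw [← h]
    rw [mul_assoc, h0, mul_one]
  · intro h
    have h0 : (g : Matrix (Fin 2) (Fin 2) ℍ[ℝ]) * star (g : Matrix (Fin 2) (Fin 2) ℍ[ℝ]) = 1 :=
      Unitary.coe_mul_star_self g
    rw [h, mul_assoc, h0, mul_one]

theorem Ad_expSp_eq {Z A : sp2} (h : bracket Z A = 0) (s : ℝ) : Ad (expSp (s • Z)) A = A := by
  rw [Ad_eq_iff, coe_expSp]
  have h1 : toMat Z * toMat A = toMat A * toMat Z := by
    rw [← sub_eq_zero, ← toMat_bracket, h, map_zero]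
  have h2 : Commute (toMat (s • Z)) (toMat A) := by
    rw [map_smul]; exact Commute.smul_left h1 s
  let _ : NormedAlgebra ℚ ℍ[ℝ] := NormedAlgebra.restrictScalars ℚ ℝ ℍ[ℝ]
  exact h2.exp_left

theorem continuous_ip_Ad (D X : sp2) : Continuous fun g : Sp2 => ip D (Ad g X) := by
  have h : Continuous fun g : Sp2 => toMat (Ad g X) := by
    simp only [toMat_Ad]
    fun_prop
  have h' (i j : Fin 2) : Continuous fun g : Sp2 => toMat (Ad g X) i j := h.matrix_elem i j
  have hr (i j : Fin 2) := Quaternion.continuous_re.comp (h' i j)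
  have hi (i j : Fin 2) := Quaternion.continuous_imI.comp (h' i j)
  have hj (i j : Fin 2) := Quaternion.continuous_imJ.comp (h' i j)
  have hk (i j : Fin 2) := Quaternion.continuous_imK.comp (h' i j)
  exact ((((((continuous_const.mul (hi 0 0)).add (continuous_const.mul (hj 0 0))).add (continuous_const.mul (hk 0 0))).add (continuous_const.mul (hi 1 1))).add (continuous_const.mul (hj 1 1))).add (continuous_const.mul (hk 1 1))).add
    (continuous_const.mul ((((continuous_const.mul (hr 1 0)).add (continuous_const.mul (hi 1 0))).add (continuous_const.mul (hj 1 0))).add (continuous_const.mul (hk 1 0))))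

/-- An element commuting with a given element of the torus can be conjugated into the torus without
moving the latter. -/
theorem exists_Ad_torus {A X : sp2} (hA : bracket A (torus 1 2) = 0) (hAX : bracket A X = 0) :
    ∃ g : Sp2, Ad g A = A ∧ ∃ x y, Ad g X = torus x y := by
  have hc : IsCompact {g : Sp2 | Ad g A = A} := by
    simp only [Ad_eq_iff]
    exact (isClosed_eq (by fun_prop) (by fun_prop)).isCompact
  -- A variational argument: ⟨D, Ad g X⟩, with D = diag (i, 2i) regular, is maximized over the
  -- centralizer of A in the group.
  obtain ⟨g, hg, hmax⟩ := hc.exists_isMaxOn ⟨1, Ad_one A⟩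
    (continuous_ip_Ad (torus 1 2) X).continuousOn
  refine ⟨g, hg, exists_torus_of_bracket_eq_zero (eq_zero_of_ip_self ?_)⟩
  set D := torus 1 2
  set Z := bracket (Ad g X) D
  have h1 : bracket A (Ad g X) = 0 := by
    have := Ad_bracket g A X
    rw [hAX, hg, map_zero] at this
    exact this.symm
  -- By the Jacobi identity Z commutes with A, so exp (sZ) g stays in the centralizer and is an
  -- admissible variation.
  have hZ : bracket Z A = 0 := by
    have h0 := bracket_zero (Ad g X)
    have e := jacobi A (Ad g X) D
    have h00 : bracket 0 D = 0 := by rw [bracket_swap, bracket_zero, neg_zero]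
    rw [h1, hA, h0, h00, add_zero] at e
    rw [bracket_swap, e, neg_zero]
  have hd : HasDerivAt (fun s : ℝ => ip D (Ad (expSp (s • Z)) (Ad g X)))
      (ip D (bracket Z (Ad g X))) 0 :=
    ((LinearMap.toContinuousLinearMap (ip D)).hasFDerivAt.comp_hasDerivAt (0 : ℝ)
      (hasDerivAt_Ad_expSp Z (Ad g X)))
  have hloc : IsLocalMax (fun s : ℝ => ip D (Ad (expSp (s • Z)) (Ad g X))) 0 := by
    refine Filter.Eventually.of_forall fun s => ?_
    change ip D (Ad (expSp (s • Z)) (Ad g X)) ≤ ip D (Ad (expSp ((0 : ℝ) • Z)) (Ad g X))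
    rw [zero_smul, expSp_zero, Ad_one, ← Ad_mul]
    refine hmax ?_
    change Ad (expSp (s • Z) * g) A = A
    rw [Ad_mul, hg, Ad_expSp_eq hZ]
  -- The first variation is ⟨D, [Z, Ad g X]⟩ = ⟨Z, [Ad g X, D]⟩ = ⟨Z, Z⟩. It vanishes, so Ad g X
  -- commutes with D and lies in the torus.
  have h2 := hloc.hasDerivAt_eq_zero hd
  rwa [ip_comm, ip_bracket] at h2

/-! ### Four-dimensional subalgebras of `sp(2)` -/

section Subalgebra

/-- In a four-dimensional subalgebra there are two independent commuting elements. -/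
theorem exists_commuting {h : Submodule ℝ sp2} (hb : ∀ X ∈ h, ∀ Y ∈ h, bracket X Y ∈ h)
    (hd : Module.finrank ℝ h = 4) :
    ∃ X ∈ h, ∃ Y ∈ h, bracket X Y = 0 ∧ ∀ a b : ℝ, a • X + b • Y = 0 → a = 0 ∧ b = 0 := by
  have B := Module.finBasisOfFinrankEq ℝ h hd
  have hmem (i : Fin 4) : (B i : sp2) ∈ h := (B i).2
  -- A skew form on the four-dimensional algebra, with B₀ in its kernel. A skew form on the
  -- three-dimensional quotient has even rank, so its kernel contains a second vector Y.
  set κ : sp2 → sp2 → ℝ := fun u v => ip (bracket (B 0) u) v with hκ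
  have hskew (u v : sp2) : κ v u = -κ u v := by
    change ip (bracket (B 0) v) u = -ip (bracket (B 0) u) v
    rw [ip_comm _ u, bracket_swap v, map_neg, ← ip_bracket, ip_comm, ← ip_bracket]
  have hself (u : sp2) : κ u u = 0 := by linarith [hskew u u]
  have h0 (u : sp2) : κ u (B 0) = 0 := by
    rw [← neg_eq_zero, ← hskew]
    change ip (bracket (B 0) (B 0)) u = 0
    rw [bracket_self, ip_comm, map_zero]
  have hlin (c d : ℝ) (u v w : sp2) : κ (c • u + d • v) w = c * κ u w + d * κ v w := by
    change ip (bracket (B 0) (c • u + d • v)) w = _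
    rw [bracket_add, bracket_smul, bracket_smul, ip_comm, map_add, map_smul, map_smul, ip_comm w,
      ip_comm w]
    rfl
  obtain ⟨c, hc, hcκ⟩ : ∃ c : Fin 3 → ℝ, c ≠ 0 ∧ ∀ i : Fin 4,
      c 0 * κ (B 1) (B i) + c 1 * κ (B 2) (B i) + c 2 * κ (B 3) (B i) = 0 := by
    by_cases hz : κ (B 1) (B 2) = 0 ∧ κ (B 1) (B 3) = 0 ∧ κ (B 2) (B 3) = 0
    · refine ⟨![1, 0, 0], fun h => one_ne_zero (congrFun h 0), fun i => ?_⟩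
      fin_cases i
      · simp [h0]
      · simp [hself]
      · simp [hz.1]
      · simp [hz.2.1]
    -- The kernel vector of a nonzero skew 3 × 3 matrix.
    · refine ⟨![κ (B 2) (B 3), -κ (B 1) (B 3), κ (B 1) (B 2)], fun h => hz ?_, fun i => ?_⟩
      · have e0 := congrFun h 0
        have e1 := congrFun h 1
        have e2 := congrFun h 2
        simp at e0 e1 e2
        exact ⟨e2, e1, e0⟩
      · have s12 := hskew (B 1) (B 2)
        have s13 := hskew (B 1) (B 3)
        have s23 := hskew (B 2) (B 3)
        fin_cases i
        · simp [h0]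
        · simp [hself, s12, s13]; ring
        · simp [hself, s23]; ring
        · simp [hself]; ring
  set Y : h := c 0 • B 1 + c 1 • B 2 + c 2 • B 3 with hY
  have hYc : (Y : sp2) = c 0 • (B 1 : sp2) + c 1 • (B 2 : sp2) + c 2 • (B 3 : sp2) := rfl
  refine ⟨B 0, hmem 0, Y, Y.2, ?_, fun a b hab => ?_⟩
  · have hall (i : Fin 4) : κ Y (B i) = 0 := by
      have e1 := hlin 1 (c 2) (c 0 • (B 1 : sp2) + c 1 • (B 2 : sp2)) (B 3) (B i)
      rw [one_smul, ← hYc, hlin] at e1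
      linarith [hcκ i]
    -- The bracket [B₀, Y] lies in the algebra and is orthogonal to it, hence vanishes.
    have hW : bracket (B 0) Y ∈ h := hb _ (hmem 0) _ Y.2
    have e := B.sum_repr ⟨_, hW⟩
    have e' := congrArg Subtype.val e
    rw [Submodule.coe_sum] at e'
    refine eq_zero_of_ip_self ?_
    have e2 : ip (bracket (B 0) Y) (bracket (B 0) Y) = ip (bracket (B 0) Y)
      (∑ i, ((B.repr ⟨_, hW⟩ i • B i : h) : sp2)) := by rw [e']
    rw [e2, map_sum]
    refine Finset.sum_eq_zero fun i _ => ?_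
    rw [Submodule.coe_smul, map_smul]
    change _ • κ Y (B i) = 0
    rw [hall, smul_zero]
  · have hli := Fintype.linearIndependent_iff.1 B.linearIndependent ![a, b * c 0, b * c 1, b * c 2]
      (by
        apply Subtype.ext
        rw [Fin.sum_univ_four]
        change a • (B 0 : sp2) + (b * c 0) • (B 1 : sp2) + (b * c 1) • (B 2 : sp2)
          + (b * c 2) • (B 3 : sp2) = 0
        rw [← hab, hYc]; module)
    have e0 := hli 0
    have e1 := hli 1
    have e2 := hli 2
    have e3 := hli 3
    simp at e0 e1 e2 e3
    refine ⟨e0, ?_⟩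
    by_contra hb0
    simp only [hb0, false_or] at e1 e2 e3
    exact hc (by ext i; fin_cases i <;> assumption)

theorem smul_mem_iff_torus {h : Submodule ℝ sp2} {x y x' y' : ℝ} (hX : torus x y ∈ h)
    (hY : torus x' y' ∈ h) (hind : ∀ a b : ℝ, a • torus x y + b • torus x' y' = 0 → a = 0 ∧ b = 0)
    (s t : ℝ) : torus s t ∈ h := by
  have hlin (a b : ℝ) : a • torus x y + b • torus x' y' = torus (a * x + b * x') (a * y + b * y') := by
    simp only [torus, smul_spOf, spOf_add, mul_zero, add_zero]
  -- Cramer's rule: a vanishing determinant would give linear relations with coefficients (y', -y)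
  -- and (x', -x), hence zero vectors.
  have hdet : x * y' - y * x' ≠ 0 := by
    intro h0
    have h1 := hind y' (-y) (by
      rw [hlin, torus, ← spOf_zero]; congr 1 <;> linarith)
    have h2 := hind x' (-x) (by
      rw [hlin, torus, ← spOf_zero]; congr 1 <;> linarith)
    have h3 := hind 1 0 (by
      rw [hlin, torus, ← spOf_zero]; congr 1 <;> linarith)
    exact one_ne_zero h3.1
  have e : torus s t = ((s * y' - t * x') / (x * y' - y * x')) • torus x y +
      ((t * x - s * y) / (x * y' - y * x')) • torus x' y' := by
    rw [hlin]; congr 1 <;>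
      rw [div_mul_eq_mul_div, div_mul_eq_mul_div, ← add_div, eq_div_iff hdet] <;> ring
  rw [e]
  exact h.add_mem (h.smul_mem _ hX) (h.smul_mem _ hY)

/-- The square of `ad (diag (i, 4i))`. -/
theorem bracket_bracket_torus (x y a₁ a₂ a₃ d₁ d₂ d₃ b₀ b₁ b₂ b₃ : ℝ) :
    bracket (torus x y) (bracket (torus x y) (spOf a₁ a₂ a₃ d₁ d₂ d₃ b₀ b₁ b₂ b₃)) =
      spOf 0 (-(4 * x ^ 2) * a₂) (-(4 * x ^ 2) * a₃) 0 (-(4 * y ^ 2) * d₂) (-(4 * y ^ 2) * d₃)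
        (-(y - x) ^ 2 * b₀) (-(y - x) ^ 2 * b₁) (-(y + x) ^ 2 * b₂) (-(y + x) ^ 2 * b₃) := by
  rw [torus, bracket_spOf, bracket_spOf]
  congr 1 <;> ring

/-- The operator (ad T)² + c for T = diag (i, 4i), applied after removal of the toral part. The
element T separates the root planes: -ad² has on them the distinct eigenvalues 4, 64, 9, 25. So c
equal to one of these kills a plane, and three such steps project onto a single root plane without
leaving h. -/
theorem combination_mem {h : Submodule ℝ sp2} (hb : ∀ X ∈ h, ∀ Y ∈ h, bracket X Y ∈ h)
    (ht : ∀ x y, torus x y ∈ h) {a₁ a₂ a₃ d₁ d₂ d₃ b₀ b₁ b₂ b₃ : ℝ}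
    (hZ : spOf a₁ a₂ a₃ d₁ d₂ d₃ b₀ b₁ b₂ b₃ ∈ h) (c : ℝ) :
    spOf 0 ((c - 4) * a₂) ((c - 4) * a₃) 0 ((c - 64) * d₂) ((c - 64) * d₃)
      ((c - 9) * b₀) ((c - 9) * b₁) ((c - 25) * b₂) ((c - 25) * b₃) ∈ h := by
  have h1 := hb _ (ht 1 4) _ (hb _ (ht 1 4) _ hZ)
  have h3 := h.add_mem hZ (ht (-a₁) (-d₁))
  have h2 := h.add_mem h1 (h.smul_mem c h3)
  rw [bracket_bracket_torus, torus, spOf_add, smul_spOf, spOf_add] at h2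
  convert h2 using 1
  congr 1 <;> ring

/-- The plane spanned by a nonzero element of a root space. -/
theorem plane_mem {h : Submodule ℝ sp2} {P : ℝ → ℝ → sp2} (hP : ∀ c x y x' y',
    c • P x y + P x' y' = P (c * x + x') (c * y + y')) {x y : ℝ} (h1 : P x y ∈ h)
    (h2 : P (-y) x ∈ h) (hne : x ≠ 0 ∨ y ≠ 0) (s t : ℝ) : P s t ∈ h := by
  have hpos : x ^ 2 + y ^ 2 ≠ 0 := by
    rcases hne with h | h <;> positivity
  have e0 : P 0 0 ∈ h := by
    have := hP (-1) x y x y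
    rw [neg_one_mul, neg_one_mul, neg_add_cancel, neg_add_cancel] at this
    rw [← this]
    exact h.add_mem (h.smul_mem _ h1) h1
  have e2 := hP ((t * x - s * y) / (x ^ 2 + y ^ 2)) (-y) x 0 0
  have e1 := hP ((s * x + t * y) / (x ^ 2 + y ^ 2)) x y
    ((t * x - s * y) / (x ^ 2 + y ^ 2) * -y + 0) ((t * x - s * y) / (x ^ 2 + y ^ 2) * x + 0)
  have e : P s t = P ((s * x + t * y) / (x ^ 2 + y ^ 2) * x +
      ((t * x - s * y) / (x ^ 2 + y ^ 2) * -y + 0)) ((s * x + t * y) / (x ^ 2 + y ^ 2) * y +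
      ((t * x - s * y) / (x ^ 2 + y ^ 2) * x + 0)) := by
    congr 1 <;> field_simp <;> ring
  rw [e, ← e1, ← e2]
  exact h.add_mem (h.smul_mem _ h1) (h.add_mem (h.smul_mem _ h2) e0)

/-- The Lie algebra of `K`. -/
def subK : Submodule ℝ sp2 := LinearMap.ker ((coords : (ℝ × sp2) →ₗ[ℝ] V7) ∘ₗ LinearMap.inr ℝ ℝ sp2)

theorem mem_subK {X : sp2} : X ∈ subK ↔ coords (0, X) = 0 := Iff.rfl

theorem spOf_mem_subK {a₁ a₂ a₃ d₁ d₂ d₃ b₀ b₁ b₂ b₃ : ℝ} :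
    spOf a₁ a₂ a₃ d₁ d₂ d₃ b₀ b₁ b₂ b₃ ∈ subK ↔
      d₂ = 0 ∧ d₃ = 0 ∧ b₀ = 0 ∧ b₁ = 0 ∧ b₂ = 0 ∧ b₃ = 0 := by
  have h2 : √2 ≠ 0 := by positivity
  rw [mem_subK, coords_zero_spOf]
  constructor
  · intro h
    have h1 (i : Fin 7) := congrArg (fun v : V7 => v i) h
    have e1 := h1 1; have e2 := h1 2; have e3 := h1 3; have e4 := h1 4; have e5 := h1 5
    have e6 := h1 6
    simp at e1 e2 e3 e4 e5 e6
    exact ⟨e1, e2, e3, e4, e5, e6⟩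
  · rintro ⟨rfl, rfl, rfl, rfl, rfl, rfl⟩
    ext i; fin_cases i <;> simp

theorem four_le_finrank_subK : 4 ≤ Module.finrank ℝ subK := by
  set L : (Fin 4 → ℝ) →ₗ[ℝ] subK :=
    { toFun := fun v => ⟨spOf (v 0) (v 1) (v 2) (v 3) 0 0 0 0 0 0,
        spOf_mem_subK.2 ⟨rfl, rfl, rfl, rfl, rfl, rfl⟩⟩
      map_add' := fun v w => Subtype.ext (by
        change _ = spOf _ _ _ _ _ _ _ _ _ _ + spOf _ _ _ _ _ _ _ _ _ _
        rw [spOf_add]; simp)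
      map_smul' := fun c v => Subtype.ext (by
        change _ = c • spOf _ _ _ _ _ _ _ _ _ _
        rw [smul_spOf]; simp) }
  have hL : Function.Injective L := by
    refine (injective_iff_map_eq_zero L).2 fun v hv => ?_
    have h1 : spOf (v 0) (v 1) (v 2) (v 3) 0 0 0 0 0 0 = 0 := congrArg Subtype.val hv
    have h2 : ip (spOf (v 0) (v 1) (v 2) (v 3) 0 0 0 0 0 0)
      (spOf (v 0) (v 1) (v 2) (v 3) 0 0 0 0 0 0) = 0 := by rw [h1, map_zero]
    rw [ip_spOf] at h2
    have n0 := mul_self_nonneg (v 0)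
    have n1 := mul_self_nonneg (v 1)
    have n2 := mul_self_nonneg (v 2)
    have n3 := mul_self_nonneg (v 3)
    ext i
    fin_cases i
    · exact mul_self_eq_zero.1 (show v 0 * v 0 = 0 by linarith)
    · exact mul_self_eq_zero.1 (show v 1 * v 1 = 0 by linarith)
    · exact mul_self_eq_zero.1 (show v 2 * v 2 = 0 by linarith)
    · exact mul_self_eq_zero.1 (show v 3 * v 3 = 0 by linarith)
  have := LinearMap.finrank_le_finrank_of_injective hL
  simpa using this

/-- The adjoint action as a linear equivalence. -/
def AdEquiv (b : Sp2) : sp2 ≃ₗ[ℝ] sp2 :=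
  LinearEquiv.ofLinear (Ad b) (Ad b⁻¹) (LinearMap.ext (Ad_Ad_inv b)) (LinearMap.ext (Ad_inv_Ad b))

theorem mem_map_AdEquiv {h : Submodule ℝ sp2} {b : Sp2} {X : sp2} :
    X ∈ h.map (AdEquiv b : sp2 →ₗ[ℝ] sp2) ↔ Ad b⁻¹ X ∈ h := by
  constructor
  · rintro ⟨Y, hY, rfl⟩
    change Ad b⁻¹ (Ad b Y) ∈ h
    rwa [Ad_inv_Ad]
  · exact fun hX => ⟨_, hX, Ad_Ad_inv b X⟩

/-- The element of `Sp(2)` exchanging the two coordinates. -/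
def swapSp : Sp2 := ⟨!![0, 1; 1, 0], by
  rw [Unitary.mem_iff]
  constructor <;> ext i j <;> fin_cases i <;> fin_cases j <;> simp [Matrix.mul_apply]⟩

theorem Ad_swapSp (a₁ a₂ a₃ d₁ d₂ d₃ b₀ b₁ b₂ b₃ : ℝ) :
    Ad swapSp (spOf a₁ a₂ a₃ d₁ d₂ d₃ b₀ b₁ b₂ b₃) =
      spOf d₁ d₂ d₃ a₁ a₂ a₃ (-b₀) b₁ b₂ b₃ := by
  apply toMat_injective
  rw [toMat_Ad, toMat_spOf, toMat_spOf]
  ext i j <;> fin_cases i <;> fin_cases j <;>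
    simp [swapSp, Matrix.mul_apply, Fin.sum_univ_two, Matrix.star_apply]

open Classical in
/-- A four-dimensional subalgebra containing the torus. -/
theorem subalgebra_of_torus {h : Submodule ℝ sp2} (hb : ∀ X ∈ h, ∀ Y ∈ h, bracket X Y ∈ h)
    (hd : Module.finrank ℝ h = 4) (ht : ∀ x y, torus x y ∈ h) :
    subK ≤ h ∨ subK ≤ h.map (AdEquiv swapSp : sp2 →ₗ[ℝ] sp2) ∨
      ∃ H ∈ h, ∀ Y, bracket H (bracket H Y) + Y ∈ h := by
  -- The torus has dimension two, less than four, so h contains more.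
  obtain ⟨Z, hZ, hne⟩ : ∃ Z ∈ h, ∀ x y, Z ≠ torus x y := by
    by_contra! hall
    have hle : h ≤ Submodule.span ℝ (({torus 1 0, torus 0 1} : Finset sp2) : Set sp2) := by
      intro Z hZ
      obtain ⟨x, y, rfl⟩ := hall Z hZ
      have e : torus x y = x • torus 1 0 + y • torus 0 1 := by
        simp [torus, smul_spOf, spOf_add]
      rw [e]
      exact add_mem (Submodule.smul_mem _ _ (Submodule.subset_span (by simp)))
        (Submodule.smul_mem _ _ (Submodule.subset_span (by simp)))
    have h1 := Submodule.finrank_mono hle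
    have h2 := finrank_span_finset_le_card (R := ℝ) ({torus 1 0, torus 0 1} : Finset sp2)
    have h3 := Finset.card_le_two (a := torus 1 0) (b := torus 0 1)
    rw [Set.finrank] at h2
    omega
  obtain ⟨a₁, a₂, a₃, d₁, d₂, d₃, b₀, b₁, b₂, b₃, rfl⟩ := exists_spOf Z
  have hc (c : ℝ) {a₁ a₂ a₃ d₁ d₂ d₃ b₀ b₁ b₂ b₃ : ℝ} := combination_mem hb ht (c := c)
    (a₁ := a₁) (a₂ := a₂) (a₃ := a₃) (d₁ := d₁) (d₂ := d₂) (d₃ := d₃) (b₀ := b₀) (b₁ := b₁)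
    (b₂ := b₂) (b₃ := b₃)
  have hrot {a₁ a₂ a₃ d₁ d₂ d₃ b₀ b₁ b₂ b₃ : ℝ} (x y : ℝ)
      (hZ : spOf a₁ a₂ a₃ d₁ d₂ d₃ b₀ b₁ b₂ b₃ ∈ h) :
      spOf 0 (-(2 * x * a₃)) (2 * x * a₂) 0 (-(2 * y * d₃)) (2 * y * d₂) ((x - y) * b₁)
        ((y - x) * b₀) (-((x + y) * b₃)) ((x + y) * b₂) ∈ h := by
    have := hb _ (ht x y) _ hZ
    rw [torus, bracket_spOf] at this
    convert this using 1
    congr 1 <;> ring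
  by_cases ha : a₂ ≠ 0 ∨ a₃ ≠ 0
  · left
    -- A nonzero component in the long root plane of the first diagonal entry: 6300 = (64 - 4)(9 -
    -- 4)(25 - 4) is what the projection multiplies it by. Bracketing with the torus turns the
    -- component by a right angle, so the whole plane lies in h, and torus and plane make up the Lie
    -- algebra of K.
    have h1 := hc 64 (hc 9 (hc 25 hZ))
    have h2 := plane_mem (P := fun x y => spOf 0 x y 0 0 0 0 0 0 0) (h := h)
      (by intros; simp [smul_spOf, spOf_add]) (x := a₂) (y := a₃)
      (by convert h.smul_mem (1 / 6300) h1 using 1; rw [smul_spOf]; congr 1 <;> ring)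
      (by convert h.smul_mem (1 / 6300) (hrot (1 / 2) 0 h1) using 1; rw [smul_spOf]; congr 1 <;> ring)
      ha
    intro X hX
    obtain ⟨a₁', a₂', a₃', d₁', d₂', d₃', b₀', b₁', b₂', b₃', rfl⟩ := exists_spOf X
    obtain ⟨rfl, rfl, rfl, rfl, rfl, rfl⟩ := spOf_mem_subK.1 hX
    have h3 := h.add_mem (ht a₁' d₁') (h2 a₂' a₃')
    rw [torus, spOf_add] at h3
    simpa using h3
  by_cases hd' : d₂ ≠ 0 ∨ d₃ ≠ 0
  · right; left
    -- The other long root, carried to the first by exchanging the coordinates; -128700 = (4 - 64)(9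
    -- - 64)(25 - 64).
    have h1 := hc 4 (hc 9 (hc 25 hZ))
    have h2 := plane_mem (P := fun x y => spOf 0 0 0 0 x y 0 0 0 0) (h := h)
      (by intros; simp [smul_spOf, spOf_add]) (x := d₂) (y := d₃)
      (by convert h.smul_mem (-1 / 128700) h1 using 1; rw [smul_spOf]; congr 1 <;> ring)
      (by convert h.smul_mem (-1 / 128700) (hrot 0 (1 / 2) h1) using 1; rw [smul_spOf]; congr 1 <;> ring)
      hd'
    intro X hX
    obtain ⟨a₁', a₂', a₃', d₁', d₂', d₃', b₀', b₁', b₂', b₃', rfl⟩ := exists_spOf X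
    obtain ⟨rfl, rfl, rfl, rfl, rfl, rfl⟩ := spOf_mem_subK.1 hX
    have h3 := h.add_mem (ht d₁' a₁') (h2 a₂' a₃')
    rw [torus, spOf_add] at h3
    refine ⟨_, h3, ?_⟩
    change Ad swapSp _ = _
    rw [Ad_swapSp]
    simp
  right; right
  by_cases hb01 : b₀ ≠ 0 ∨ b₁ ≠ 0
  -- A short root; -4400 = (4 - 9)(64 - 9)(25 - 9).
  · have h1 := hc 4 (hc 64 (hc 25 hZ))
    have h2 := plane_mem (P := fun x y => spOf 0 0 0 0 0 0 x y 0 0) (h := h)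
      (by intros; simp [smul_spOf, spOf_add]) (x := b₀) (y := b₁)
      (by convert h.smul_mem (-1 / 4400) h1 using 1; rw [smul_spOf]; congr 1 <;> ring)
      (by convert h.smul_mem (-1 / 4400) (hrot (-1) 0 h1) using 1; rw [smul_spOf]; congr 1 <;> ring)
      hb01
    -- For this H, ad² vanishes on the torus and on the plane of (b₀, b₁), both contained in h, and
    -- is -1 on the three other root planes.
    refine ⟨torus (1 / 2) (1 / 2), ht _ _, fun Y => ?_⟩
    obtain ⟨a₁', a₂', a₃', d₁', d₂', d₃', b₀', b₁', b₂', b₃', rfl⟩ := exists_spOf Y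
    rw [bracket_bracket_torus]
    convert h.add_mem (ht a₁' d₁') (h2 b₀' b₁') using 1
    rw [torus, spOf_add, spOf_add]
    congr 1 <;> ring
  · have hb23 : b₂ ≠ 0 ∨ b₃ ≠ 0 := by
      by_contra! h0
      push Not at ha hd' hb01
      refine hne a₁ d₁ ?_
      rw [ha.1, ha.2, hd'.1, hd'.2, hb01.1, hb01.2, h0.1, h0.2, torus]
    -- The other short root, with 13104 = (4 - 25)(64 - 25)(9 - 25). The sign change in H below
    -- exchanges the roles of the two short root planes.
    have h1 := hc 4 (hc 64 (hc 9 hZ))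
    have h2 := plane_mem (P := fun x y => spOf 0 0 0 0 0 0 0 0 x y) (h := h)
      (by intros; simp [smul_spOf, spOf_add]) (x := b₂) (y := b₃)
      (by convert h.smul_mem (1 / 13104) h1 using 1; rw [smul_spOf]; congr 1 <;> ring)
      (by convert h.smul_mem (1 / 13104) (hrot 1 0 h1) using 1; rw [smul_spOf]; congr 1 <;> ring)
      hb23
    refine ⟨torus (1 / 2) (-1 / 2), ht _ _, fun Y => ?_⟩
    obtain ⟨a₁', a₂', a₃', d₁', d₂', d₃', b₀', b₁', b₂', b₃', rfl⟩ := exists_spOf Y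
    rw [bracket_bracket_torus]
    convert h.add_mem (ht a₁' d₁') (h2 b₂' b₃') using 1
    rw [torus, spOf_add, spOf_add]
    congr 1 <;> ring

end Subalgebra

/-- A four-dimensional subalgebra is conjugate to the Lie algebra of `K`, unless the tangent space
of the corresponding homogeneous space has an invariant complex structure coming from an element of
the subalgebra. -/
theorem exists_map_eq_subK {h : Submodule ℝ sp2} (hb : ∀ X ∈ h, ∀ Y ∈ h, bracket X Y ∈ h)
    (hd : Module.finrank ℝ h = 4) : (∃ b : Sp2, h.map (AdEquiv b : sp2 →ₗ[ℝ] sp2) = subK) ∨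
      ∃ H ∈ h, ∀ Y, bracket H (bracket H Y) + Y ∈ h := by
  obtain ⟨X, hX, Y, hY, hXY, hind⟩ := exists_commuting hb hd
  have hz (Z : sp2) : bracket 0 Z = 0 := by rw [bracket_swap, bracket_zero, neg_zero]
  -- The commuting pair is moved into the torus one element at a time: X first, with no constraint
  -- (A = 0), and then Y by an element that keeps X in place.
  obtain ⟨g, -, x, y, hx⟩ := exists_Ad_torus (hz (torus 1 2)) (hz X)
  obtain ⟨g', hg', x', y', hy⟩ := exists_Ad_torus (A := Ad g X) (X := Ad g Y)
    (by rw [hx, bracket_torus]) (by rw [← Ad_bracket, hXY, map_zero])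
  set b := g' * g with hb'
  have hbX : Ad b X = torus x y := by rw [hb', Ad_mul, hg', hx]
  have hbY : Ad b Y = torus x' y' := by rw [hb', Ad_mul, hy]
  set h' := h.map (AdEquiv b : sp2 →ₗ[ℝ] sp2) with hh'
  have hmem {Z : sp2} : Z ∈ h' ↔ Ad b⁻¹ Z ∈ h := mem_map_AdEquiv
  have h1 : ∀ X ∈ h', ∀ Y ∈ h', bracket X Y ∈ h' := fun X hX Y hY => by
    rw [hmem, Ad_bracket]
    exact hb _ (hmem.1 hX) _ (hmem.1 hY)
  have h2 : Module.finrank ℝ h' = 4 := (LinearEquiv.finrank_map_eq (AdEquiv b) h).trans hd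
  have h3 := smul_mem_iff_torus (h := h') (hmem.2 (by rw [← hbX, Ad_inv_Ad]; exact hX))
    (hmem.2 (by rw [← hbY, Ad_inv_Ad]; exact hY)) (by
      intro c d hcd
      rw [← hbX, ← hbY, ← map_smul, ← map_smul, ← map_add] at hcd
      have := congrArg (Ad b⁻¹) hcd
      rw [Ad_inv_Ad, map_zero] at this
      exact hind c d this)
  rcases subalgebra_of_torus h1 h2 h3 with h4 | h4 | ⟨H, hH, hJ⟩
  · exact Or.inl ⟨b, (Submodule.eq_of_le_of_finrank_le h4 (h2.trans_le four_le_finrank_subK)).symm⟩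
  · refine Or.inl ⟨swapSp * b, ?_⟩
    have e : h.map (AdEquiv (swapSp * b) : sp2 →ₗ[ℝ] sp2) =
        h'.map (AdEquiv swapSp : sp2 →ₗ[ℝ] sp2) := by
      ext Z
      rw [mem_map_AdEquiv, mem_map_AdEquiv, hmem, mul_inv_rev, Ad_mul]
    rw [e]
    exact (Submodule.eq_of_le_of_finrank_le h4 (((LinearEquiv.finrank_map_eq (AdEquiv swapSp)
      h').trans h2).trans_le four_le_finrank_subK)).symm
  · refine Or.inr ⟨Ad b⁻¹ H, hmem.1 hH, fun Y => ?_⟩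
    have h5 := hmem.1 (hJ (Ad b Y))
    rwa [map_add, Ad_bracket, Ad_bracket, Ad_inv_Ad] at h5

theorem finrank_sp2 : Module.finrank ℝ sp2 = 10 := by
  set L : (Fin 10 → ℝ) →ₗ[ℝ] sp2 :=
    { toFun := fun v => spOf (v 0) (v 1) (v 2) (v 3) (v 4) (v 5) (v 6) (v 7) (v 8) (v 9)
      map_add' := fun v w => by rw [spOf_add]; rfl
      map_smul' := fun c v => by rw [smul_spOf]; rfl } with hL
  have h1 : Function.Surjective L := fun X => by
    obtain ⟨a₁, a₂, a₃, d₁, d₂, d₃, b₀, b₁, b₂, b₃, rfl⟩ := exists_spOf X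
    exact ⟨![a₁, a₂, a₃, d₁, d₂, d₃, b₀, b₁, b₂, b₃], rfl⟩
  have h2 : Function.Injective L := by
    refine (injective_iff_map_eq_zero L).2 fun v hv => ?_
    have h2 : ip (L v) (L v) = 0 := by rw [hv, map_zero]
    have h3 : v 0 * v 0 + v 1 * v 1 + v 2 * v 2 + v 3 * v 3 + v 4 * v 4 + v 5 * v 5 +
      2 * (v 6 * v 6 + v 7 * v 7 + v 8 * v 8 + v 9 * v 9) = 0 := h2
    have n (i : Fin 10) := mul_self_nonneg (v i)
    have n0 := n 0; have n1 := n 1; have n2 := n 2; have n3 := n 3; have n4 := n 4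
    have n5 := n 5; have n6 := n 6; have n7 := n 7; have n8 := n 8; have n9 := n 9
    ext i
    fin_cases i
    · exact mul_self_eq_zero.1 (show v 0 * v 0 = 0 by linarith)
    · exact mul_self_eq_zero.1 (show v 1 * v 1 = 0 by linarith)
    · exact mul_self_eq_zero.1 (show v 2 * v 2 = 0 by linarith)
    · exact mul_self_eq_zero.1 (show v 3 * v 3 = 0 by linarith)
    · exact mul_self_eq_zero.1 (show v 4 * v 4 = 0 by linarith)
    · exact mul_self_eq_zero.1 (show v 5 * v 5 = 0 by linarith)
    · exact mul_self_eq_zero.1 (show v 6 * v 6 = 0 by linarith)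
    · exact mul_self_eq_zero.1 (show v 7 * v 7 = 0 by linarith)
    · exact mul_self_eq_zero.1 (show v 8 * v 8 = 0 by linarith)
    · exact mul_self_eq_zero.1 (show v 9 * v 9 = 0 by linarith)
  have := (LinearEquiv.ofBijective L ⟨h2, h1⟩).finrank_eq
  rw [← this, Module.finrank_fin_fun]

/-- The infinitesimal version of invariance. -/
theorem derivation_eq_zero {Φ : (ℝ × sp2) [⋀^Fin 3]→L[ℝ] ℝ} {X : sp2}
    (h : ∀ (s : ℝ) (u v w : ℝ × sp2), Φ ![(u.1, Ad (expSp (s • X)) u.2),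
      (v.1, Ad (expSp (s • X)) v.2), (w.1, Ad (expSp (s • X)) w.2)] = Φ ![u, v, w])
    (u v w : ℝ × sp2) : Φ ![(0, bracket X u.2), v, w] + Φ ![u, (0, bracket X v.2), w]
      + Φ ![u, v, (0, bracket X w.2)] = 0 := by
  set c : ℝ → Fin 3 → ℝ × sp2 := fun s => ![(u.1, Ad (expSp (s • X)) u.2),
      (v.1, Ad (expSp (s • X)) v.2), (w.1, Ad (expSp (s • X)) w.2)] with hc
  have hc0 : c 0 = ![u, v, w] := by
    simp only [hc, zero_smul, expSp_zero, Ad_one]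
  have hder (u : ℝ × sp2) : HasDerivAt (fun s : ℝ => ((u.1, Ad (expSp (s • X)) u.2) : ℝ × sp2))
      (0, bracket X u.2) 0 := (hasDerivAt_const 0 u.1).prodMk (hasDerivAt_Ad_expSp X u.2)
  have hcd : HasDerivAt c ![(0, bracket X u.2), (0, bracket X v.2), (0, bracket X w.2)] 0 := by
    rw [hasDerivAt_pi]
    intro i
    fin_cases i
    · exact hder u
    · exact hder v
    · exact hder w
  have h1 := (Φ.toContinuousMultilinearMap.hasFDerivAt (c 0)).comp_hasDerivAt (0 : ℝ) hcd
  have h2 : (Φ.toContinuousMultilinearMap ∘ c) = fun _ => Φ ![u, v, w] := by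
    funext s; exact h s u v w
  rw [h2] at h1
  have h3 := h1.unique (hasDerivAt_const (0 : ℝ) (Φ ![u, v, w]))
  rw [ContinuousMultilinearMap.linearDeriv_apply, Fin.sum_univ_three, hc0, update_three_zero,
    update_three_one, update_three_two] at h3
  exact h3

/-- A three-form annihilated by a complex structure acting as a derivation is zero. -/
theorem trilinear_eq_zero_of_derivation {V : Type*} {T : V → V → V → ℝ} {J : V → V}
    (h₁ : ∀ x y z, T (J (J x)) y z = -T x y z) (h₂ : ∀ x y z, T x (J (J y)) z = -T x y z)
    (h₃ : ∀ x y z, T x y (J (J z)) = -T x y z)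
    (hS : ∀ x y z, T (J x) y z + T x (J y) z + T x y (J z) = 0) (x y z : V) : T x y z = 0 := by
  have key (x y z : V) : T (J x) y z = 0 := by
    -- With a, b, c the three values with a single J and d the value with three, the relations read
    -- a + b + c = 0 and a + b = a + c = b + c = d, so all vanish. In terms of types, J acts on (p,
    -- q)-forms by i(p - q) up to sign, and p - q is odd for three-forms.
    have s0 := hS x y z
    have s1 := hS (J x) (J y) z
    have s2 := hS (J x) y (J z)
    have s3 := hS x (J y) (J z)
    rw [h₁, h₂] at s1
    rw [h₁, h₃] at s2
    rw [h₂, h₃] at s3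
    linarith
  have := key (J x) y z
  rw [h₁] at this
  linarith

/-! ### The isotropy algebra is that of K -/

section Isotropy

variable {M : Type*} [TopologicalSpace M] [ChartedSpace V7 M] [IsManifold 𝓘(ℝ, V7) ∞ M]
  [MulAction Sp2 M] {φ : FormField M 3} {I : Set ℝ} {γ : ℝ → M} {t : ℝ}

/-- The value of a field of forms, as a form on `ℝ⁷`. -/
def formAt {k : ℕ} (η : FormField M k) (x : M) : V7 [⋀^Fin k]→L[ℝ] ℝ := η x

/-- The isotropy algebra. -/
def isoAlg (x : M) : Submodule ℝ sp2 := LinearMap.ker (infAct x : sp2 →ₗ[ℝ] V7)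

theorem mem_isoAlg {x : M} {X : sp2} : X ∈ isoAlg x ↔ infAct x X = 0 := Iff.rfl

theorem infAct_Ad_of_smul_eq (hact : IsSmoothAction M) {b : Sp2} {x : M} (hb : b • x = x)
    (Y : sp2) : infAct x (Ad b Y) = dAct b x (infAct x Y) := by
  rw [← infAct_smul' hact, hb]

/-- Since exp (sX) fixes x, the elements Ad (exp (sX)) Y remain in the isotropy algebra; the bracket
is their derivative at s = 0. -/
theorem bracket_mem_isoAlg (hact : IsSmoothAction M) {x : M} {X Y : sp2} (hX : X ∈ isoAlg x)
    (hY : Y ∈ isoAlg x) : bracket X Y ∈ isoAlg x := by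
  have h1 : HasDerivAt (fun s : ℝ => infAct x (Ad (expSp (s • X)) Y)) (infAct x (bracket X Y)) 0 :=
    (infAct x).hasFDerivAt.comp_hasDerivAt (0 : ℝ) (hasDerivAt_Ad_expSp X Y)
  have h2 : (fun s : ℝ => infAct x (Ad (expSp (s • X)) Y)) = fun _ => 0 := by
    funext s
    rw [infAct_Ad_of_smul_eq hact (expSp_smul_eq_of_infAct_eq_zero hact (mem_isoAlg.1 hX) s),
      mem_isoAlg.1 hY, map_zero]
  rw [h2] at h1
  exact h1.unique (hasDerivAt_const _ _)

theorem finrank_isoAlg {x : M} (hx : orbitDim x = 6) : Module.finrank ℝ (isoAlg x) = 4 := by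
  have h1 := LinearMap.finrank_range_add_finrank_ker (infAct x : sp2 →ₗ[ℝ] V7)
  rw [orbitDim_eq] at hx
  rw [hx, finrank_sp2] at h1
  change Module.finrank ℝ (LinearMap.ker (infAct x : sp2 →ₗ[ℝ] V7)) = 4
  omega

theorem isoAlg_smul (hact : IsSmoothAction M) (b : Sp2) (x : M) :
    isoAlg (b • x) = (isoAlg x).map (AdEquiv b : sp2 →ₗ[ℝ] sp2) := by
  ext X
  rw [mem_map_AdEquiv, mem_isoAlg, mem_isoAlg, infAct_smul hact]
  exact map_eq_zero_iff (dActEquiv hact b x) (dActEquiv hact b x).injective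

theorem g2Metric_self_zero {φ : V7 [⋀^Fin 3]→L[ℝ] ℝ} (hφ : IsG2Form φ) (v : V7) :
    g2Metric φ v 0 = 0 := by
  obtain ⟨u, hu⟩ := hφ
  rw [g2Metric_eq hu, map_zero, inner_zero_right]

theorem g2Metric_smul_add {φ : V7 [⋀^Fin 3]→L[ℝ] ℝ} (hφ : IsG2Form φ) (r : ℝ) (v w : V7) :
    g2Metric φ v (r • v + w) = r * g2Metric φ v v + g2Metric φ v w := by
  obtain ⟨u, hu⟩ := hφ
  rw [g2Metric_eq hu, g2Metric_eq hu, g2Metric_eq hu, map_add, inner_add_right, map_smul,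
    inner_smul_right]

theorem formAt_smul_apply (hinv : IsInvariant φ) (b : Sp2) (x : M) (u v w : V7) :
    formAt φ (b • x) ![dAct b x u, dAct b x v, dAct b x w] = formAt φ x ![u, v, w] := by
  have h : (formAt φ (b • x)).compContinuousLinearMap (dAct b x) = formAt φ x :=
    isInvariant_iff.1 hinv b x
  rw [← comp_three_apply, h]

theorem IsNormalCurve.tubeD_eq_zero (hact : IsSmoothAction M) (hφ : ∀ x, IsG2Form (φ x))
    (hI : IsOpen I) (hγ : IsNormalCurve φ I γ) (ht : t ∈ I) {v : ℝ × sp2} (hv : tubeD γ t v = 0) :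
    v.1 = 0 ∧ v.2 ∈ isoAlg (γ t) := by
  have h1 := tubeD_apply hact (hγ.contMDiffAt hI ht) v.1 v.2
  rw [Prod.mk.eta, hv] at h1
  have hG : IsG2Form (formAt φ (γ t)) := hφ (γ t)
  have h0 : v.1 = 0 := by
    have h2 := g2Metric_self_zero hG (vel γ t)
    have u1 : g2Metric (formAt φ (γ t)) (vel γ t) (vel γ t) = 1 := hγ.unit ht
    have u2 : g2Metric (formAt φ (γ t)) (vel γ t) (infAct (γ t) v.2) = 0 := hγ.orthogonal ht v.2
    rw [h1, g2Metric_smul_add hG, u1, u2] at h2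
    linarith
  rw [h0, zero_smul, zero_add] at h1
  exact ⟨h0, h1.symm⟩

theorem IsNormalCurve.tubeD_surjective (hact : IsSmoothAction M) (hφ : ∀ x, IsG2Form (φ x))
    (hI : IsOpen I) (hγ : IsNormalCurve φ I γ) (ht : t ∈ I) :
    Function.Surjective (tubeD γ t) := by
  have hap := tubeD_apply hact (hγ.contMDiffAt hI ht)
  have hlt : LinearMap.range (infAct (γ t) : sp2 →ₗ[ℝ] V7) <
      LinearMap.range (tubeD γ t : (ℝ × sp2) →ₗ[ℝ] V7) := by
    refine lt_of_le_of_ne ?_ fun he => ?_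
    · rintro _ ⟨X, rfl⟩
      refine ⟨(0, X), ?_⟩
      change tubeD γ t (0, X) = _
      rw [hap, zero_smul, zero_add]
      rfl
    · have h1 : vel γ t ∈ LinearMap.range (infAct (γ t) : sp2 →ₗ[ℝ] V7) := by
        rw [he]
        refine ⟨(1, 0), ?_⟩
        change tubeD γ t (1, 0) = _
        rw [hap, one_smul, map_zero, add_zero]
      obtain ⟨X, hX⟩ := h1
      have h2 := (hγ.tubeD_eq_zero hact hφ hI ht (v := (1, -X)) (by
        rw [hap, one_smul, map_neg]
        change vel γ t + -((infAct (γ t) : sp2 →ₗ[ℝ] V7) X) = 0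
        rw [hX, add_neg_cancel])).1
      exact one_ne_zero h2
  have h3 := Submodule.finrank_lt_finrank_of_lt hlt
  have h4 : Module.finrank ℝ (LinearMap.range (infAct (γ t) : sp2 →ₗ[ℝ] V7)) = 6 := (hγ.2 t ht).1
  have h5 := Submodule.finrank_le (LinearMap.range (tubeD γ t : (ℝ × sp2) →ₗ[ℝ] V7))
  have h6 : Module.finrank ℝ V7 = 7 := finrank_euclideanSpace_fin
  have h7 := Submodule.eq_top_of_finrank_eq
    (S := LinearMap.range (tubeD γ t : (ℝ × sp2) →ₗ[ℝ] V7)) (by omega)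
  exact LinearMap.range_eq_top.1 h7

/-- The pull-back of the structure to the tube. -/
def tubeForm (φ : FormField M 3) (γ : ℝ → M) (t : ℝ) : (ℝ × sp2) [⋀^Fin 3]→L[ℝ] ℝ :=
  (formAt φ (γ t)).compContinuousLinearMap (tubeD γ t)

theorem tubeForm_apply (u v w : ℝ × sp2) : tubeForm φ γ t ![u, v, w] =
    (formAt φ (γ t)) ![tubeD γ t u, tubeD γ t v, tubeD γ t w] :=
  comp_three_apply _ _ _ _ _

theorem tubeD_isoAlg (hact : IsSmoothAction M) (hI : IsOpen I) (hγ : IsNormalCurve φ I γ)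
    (ht : t ∈ I) {X : sp2} (hX : X ∈ isoAlg (γ t)) : tubeD γ t (0, X) = 0 := by
  rw [tubeD_apply hact (hγ.contMDiffAt hI ht), mem_isoAlg.1 hX, zero_smul, add_zero]

/-- The isotropy algebra acts on the pull-back of the structure by zero. -/
theorem IsNormalCurve.derivation_tubeForm [T2Space M] (hact : IsSmoothAction M)
    (hφ : IsG2Structure ∞ φ) (hinv : IsInvariant φ) (hdim : ∀ x : M, orbitDim x ≤ 6)
    (hI : IsOpen I) (hI' : I.OrdConnected) (hγ : IsNormalCurve φ I γ) (ht : t ∈ I) {X : sp2}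
    (hX : X ∈ isoAlg (γ t)) (u v w : ℝ × sp2) :
    tubeForm φ γ t ![(0, bracket X u.2), v, w] + tubeForm φ γ t ![u, (0, bracket X v.2), w]
      + tubeForm φ γ t ![u, v, (0, bracket X w.2)] = 0 := by
  refine derivation_eq_zero (fun s u v w => ?_) u v w
  obtain ⟨h1, h2⟩ := (hγ.isotropy hact hφ hinv hdim hI hI' ht hX ht).2 s
  have h3 (u : ℝ × sp2) : tubeD γ t (u.1, Ad (expSp (s • X)) u.2) =
      dAct (expSp (s • X)) (γ t) (tubeD γ t u) := by
    have h4 := tubeD_apply hact (hγ.contMDiffAt hI ht) u.1 u.2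
    rw [Prod.mk.eta] at h4
    rw [tubeD_apply hact (hγ.contMDiffAt hI ht), h4, map_add, map_smul, h2,
      infAct_Ad_of_smul_eq hact h1]
  rw [tubeForm_apply, tubeForm_apply, h3, h3, h3]
  have h5 := formAt_smul_apply hinv (expSp (s • X)) (γ t) (tubeD γ t u) (tubeD γ t v) (tubeD γ t w)
  rw [h1] at h5
  exact h5

/-- The isotropy algebra along a normal curve is conjugate to the Lie algebra of `K`. -/
theorem IsNormalCurve.exists_isoAlg_eq [T2Space M] (hact : IsSmoothAction M)
    (hφ : IsG2Structure ∞ φ) (hinv : IsInvariant φ) (hdim : ∀ x : M, orbitDim x ≤ 6)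
    (hI : IsOpen I) (hI' : I.OrdConnected) (hγ : IsNormalCurve φ I γ) :
    ∃ b : Sp2, ∀ t ∈ I, isoAlg (b • γ t) = subK := by
  rcases I.eq_empty_or_nonempty with rfl | ⟨t, ht⟩
  · exact ⟨1, fun t ht => ht.elim⟩
  rcases exists_map_eq_subK (fun X hX Y hY => bracket_mem_isoAlg hact hX hY)
    (finrank_isoAlg (hγ.2 t ht).1) with ⟨b, hb⟩ | ⟨H, hH, hJ⟩
  · refine ⟨b, fun t' ht' => ?_⟩
    rw [isoAlg_smul hact, ← hb]
    congr 1
    ext X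
    exact ⟨fun h => (hγ.isotropy hact hφ hinv hdim hI hI' ht' h ht).1,
      fun h => (hγ.isotropy hact hφ hinv hdim hI hI' ht h ht').1⟩
  -- Modulo the isotropy algebra ad H is a complex structure on the tangent space of the orbit, and
  -- it annihilates the three-form as a derivation. Hence φ vanishes on triples of vectors tangent
  -- to the orbit.
  · exfalso
    have hker {Y : sp2} (hY : Y ∈ isoAlg (γ t)) := tubeD_isoAlg hact hI hγ ht hY
    have hJ' (Y : sp2) : tubeD γ t (0, bracket H (bracket H Y)) = -tubeD γ t (0, Y) := by
      have h1 := hker (hJ Y)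
      have e : ((0, bracket H (bracket H Y) + Y) : ℝ × sp2) =
        (0, bracket H (bracket H Y)) + (0, Y) := by simp
      rw [e, map_add] at h1
      exact eq_neg_of_add_eq_zero_left h1
    have hT (x y z : sp2) : tubeForm φ γ t ![(0, x), (0, y), (0, z)] = 0 := by
      refine trilinear_eq_zero_of_derivation (T := fun x y z => tubeForm φ γ t ![(0, x), (0, y),
        (0, z)]) (J := bracket H) (fun x y z => ?_) (fun x y z => ?_) (fun x y z => ?_)
        (fun x y z => ?_) x y z
      · rw [tubeForm_apply, tubeForm_apply, hJ', ← curryThree_apply, map_neg]; rfl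
      · rw [tubeForm_apply, tubeForm_apply, hJ', ← curryThree_apply, map_neg]; rfl
      · rw [tubeForm_apply, tubeForm_apply, hJ', ← curryThree_apply, map_neg]; rfl
      · exact hγ.derivation_tubeForm hact hφ hinv hdim hI hI' ht hH (0, x) (0, y) (0, z)
    obtain ⟨X, hX⟩ := exists_six_fields (hγ.2 t ht).1
    have hG : IsG2Form (formAt φ (γ t)) := hφ.2 (γ t)
    set Φ := formAt φ (γ t)
    have hap := tubeD_apply hact (hγ.contMDiffAt hI ht)
    have h0 (X : sp2) : tubeD γ t (0, X) = infAct (γ t) X := by rw [hap, zero_smul, zero_add]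
    have hz (x y : sp2) (v : ℝ × sp2) : Φ ![infAct (γ t) x, infAct (γ t) y, tubeD γ t v] =
        v.1 * Φ ![infAct (γ t) x, infAct (γ t) y, vel γ t] := by
      have h1 := hap v.1 v.2
      rw [Prod.mk.eta] at h1
      have h2 := hT x y v.2
      rw [tubeForm_apply, h0, h0, h0, ← curryThree_apply] at h2
      rw [h1, ← curryThree_apply, map_add, map_smul]
      change _ + curryThree Φ _ _ _ = _
      rw [h2, add_zero]; rfl
    -- Contraction of φ with two orbit vectors is now a multiple of dt. Among the products of X₀
    -- with X₁ and X₂ a linear combination vanishes altogether, namely with qX₁ - pX₂, which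
    -- contradicts nondegeneracy.
    set p := Φ ![infAct (γ t) (X 0), infAct (γ t) (X 1), vel γ t]
    set q := Φ ![infAct (γ t) (X 0), infAct (γ t) (X 2), vel γ t]
    have hli {c : Fin 6 → ℝ} (hc : ∑ i, c i • infAct (γ t) (X i) = 0) (i : Fin 6) : c i = 0 :=
      Fintype.linearIndependent_iff.1 hX c hc i
    have hp : p ≠ 0 := by
      obtain ⟨z, hz'⟩ := exists_ne_zero_of_linearIndependent hG (v := infAct (γ t) (X 0))
        (w := infAct (γ t) (X 1)) (fun a b hab => by
          have := hli (c := ![a, b, 0, 0, 0, 0]) (by simpa [Fin.sum_univ_six] using hab)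
          exact ⟨this 0, this 1⟩)
      obtain ⟨v, rfl⟩ := hγ.tubeD_surjective hact hφ.2 hI ht z
      rw [hz] at hz'
      exact right_ne_zero_of_mul hz'
    obtain ⟨z, hz'⟩ := exists_ne_zero_of_linearIndependent hG (v := infAct (γ t) (X 0))
      (w := infAct (γ t) (q • X 1 + (-p) • X 2)) (fun a b hab => by
        rw [map_add, map_smul, map_smul] at hab
        have := hli (c := ![a, b * q, -(b * p), 0, 0, 0]) (by
          simp [Fin.sum_univ_six]
          rw [← hab]; module)
        refine ⟨this 0, ?_⟩
        have h2 := this 2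
        simp at h2
        exact h2.resolve_right hp)
    obtain ⟨v, rfl⟩ := hγ.tubeD_surjective hact hφ.2 hI ht z
    refine hz' ?_
    rw [hz, map_add, map_smul, map_smul, ← curryThree_apply, map_add, map_smul, map_smul]
    change v.1 * (q * p + -p * q) = 0
    ring

end Isotropy

/-! ### Invariant three-forms on the tube -/

/-- The three-form with constant coefficients that is invariant under `K`. -/
def isotropicForm {E : Type*} [AddCommGroup E] [Module ℝ E] [TopologicalSpace E]
    [IsTopologicalAddGroup E] [ContinuousSMul ℝ E] (e : Fin 7 → E →L[ℝ] ℝ) (a c p q : ℝ) :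
    E [⋀^Fin 3]→L[ℝ] ℝ :=
  a • omegaOneForm e + c • omegaTwoForm e + p • alphaForm e + q • betaForm e

/-- The coordinate forms on `ℝ⁷`. -/
def proj7 (i : Fin 7) : V7 →L[ℝ] ℝ := EuclideanSpace.proj i

theorem proj7_apply (i : Fin 7) (x : V7) : proj7 i x = x i := rfl

theorem isotropicForm_apply (a c p q : ℝ) (x y z : V7) :
    isotropicForm proj7 a c p q ![x, y, z] =
      (a * (x 1 * y 2 - x 2 * y 1) + c * ((x 3 * y 4 - x 4 * y 3) + (x 5 * y 6 - x 6 * y 5))) * z 0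
      + (a * (x 2 * y 0 - x 0 * y 2)
          - p * ((x 4 * y 5 - x 5 * y 4) + (x 3 * y 6 - x 6 * y 3))
          + q * ((x 3 * y 5 - x 5 * y 3) - (x 4 * y 6 - x 6 * y 4))) * z 1
      + (a * (x 0 * y 1 - x 1 * y 0)
          + p * ((x 4 * y 6 - x 6 * y 4) - (x 3 * y 5 - x 5 * y 3))
          - q * ((x 3 * y 6 - x 6 * y 3) + (x 4 * y 5 - x 5 * y 4))) * z 2
      + (c * (x 4 * y 0 - x 0 * y 4)
          + p * ((x 2 * y 5 - x 5 * y 2) + (x 1 * y 6 - x 6 * y 1))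
          + q * ((x 2 * y 6 - x 6 * y 2) - (x 1 * y 5 - x 5 * y 1))) * z 3
      + (c * (x 0 * y 3 - x 3 * y 0)
          + p * (-(x 2 * y 6 - x 6 * y 2) + (x 1 * y 5 - x 5 * y 1))
          + q * ((x 1 * y 6 - x 6 * y 1) + (x 2 * y 5 - x 5 * y 2))) * z 4
      + (c * (x 6 * y 0 - x 0 * y 6)
          - p * ((x 2 * y 3 - x 3 * y 2) + (x 1 * y 4 - x 4 * y 1))
          + q * ((x 1 * y 3 - x 3 * y 1) - (x 2 * y 4 - x 4 * y 2))) * z 5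
      + (c * (x 0 * y 5 - x 5 * y 0)
          + p * ((x 2 * y 4 - x 4 * y 2) - (x 1 * y 3 - x 3 * y 1))
          - q * ((x 1 * y 4 - x 4 * y 1) + (x 2 * y 3 - x 3 * y 2))) * z 6 := by
  simp only [isotropicForm, omegaOneForm, omegaTwoForm, alphaForm, betaForm,
    ContinuousAlternatingMap.add_apply, ContinuousAlternatingMap.sub_apply,
    ContinuousAlternatingMap.smul_apply, wedge_three_apply, proj7_apply, smul_eq_mul]
  ring

/-- Three-forms on `ℝ⁷` with the same components are equal. -/
theorem three_form_ext {η ξ : V7 [⋀^Fin 3]→L[ℝ] ℝ}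
    (h : ∀ i j k : Fin 7, i < j → j < k → η ![bas i, bas j, bas k] = ξ ![bas i, bas j, bas k]) :
    η = ξ := by
  have key (i j k : Fin 7) : η ![bas i, bas j, bas k] = ξ ![bas i, bas j, bas k] := by
    have sw1 := three_swap_left η
    have sw2 := three_swap_right η
    have sw3 := three_swap_left ξ
    have sw4 := three_swap_right ξ
    rcases lt_trichotomy i j with h1 | rfl | h1
    · rcases lt_trichotomy j k with h2 | rfl | h2
      · exact h i j k h1 h2
      · rw [three_self_right, three_self_right]
      · rcases lt_trichotomy i k with h3 | rfl | h3
        · rw [sw2 _ (bas k), sw4 _ (bas k), h i k j h3 h2]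
        · rw [three_self_outer, three_self_outer]
        · rw [sw2 _ (bas k), sw4 _ (bas k), sw1 (bas k), sw3 (bas k), h k i j h3 h1]
    · rw [three_self_left, three_self_left]
    · rcases lt_trichotomy i k with h2 | rfl | h2
      · rw [sw1 (bas j), sw3 (bas j), h j i k h1 h2]
      · rw [three_self_outer, three_self_outer]
      · rcases lt_trichotomy j k with h3 | rfl | h3
        · rw [sw1 (bas j), sw3 (bas j), sw2 _ (bas k), sw4 _ (bas k), h j k i h3 h2]
        · rw [three_self_right, three_self_right]
        · rw [sw1 (bas j), sw3 (bas j), sw2 _ (bas k), sw4 _ (bas k), sw1 (bas k), sw3 (bas k),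
            h k j i h3 h1]
  refine ext_three fun x y z => ?_
  have h1 (ζ : V7 [⋀^Fin 3]→L[ℝ] ℝ) : ζ ![x, y, z] =
      ∑ k, ∑ j, ∑ i, z k * (y j * (x i * ζ ![bas i, bas j, bas k])) := by
    rw [← curryThree_apply]
    conv_lhs => rw [← sum_smul_bas x, ← sum_smul_bas y, ← sum_smul_bas z]
    simp only [map_sum, map_smul, LinearMap.sum_apply, LinearMap.smul_apply, smul_eq_mul,
      curryThree_apply, Finset.mul_sum]
  rw [h1 η, h1 ξ]
  simp only [key]

/-- The frame map, as a continuous linear map. -/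
def frameMapL : V7 →L[ℝ] ℝ × sp2 := LinearMap.toContinuousLinearMap frameMap

theorem frameMapL_bas (i : Fin 7) : frameMapL (bas i) = frame i := by
  change frameMap (bas i) = frame i
  rw [frameMap_apply, Finset.sum_eq_single i]
  · simp [bas_apply]
  · intro j _ hj; simp [bas_apply, hj]
  · simp

theorem coords_eq_zero_iff {v : ℝ × sp2} : coords v = 0 ↔ v.1 = 0 ∧ v.2 ∈ subK := by
  have h0 : coords v 0 = v.1 := rfl
  have e : v = v.1 • (1, 0) + (0, v.2) := by simp
  constructor
  · intro h
    have h1 : v.1 = 0 := by rw [← h0, h]; rfl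
    refine ⟨h1, mem_subK.2 ?_⟩
    rw [h1, zero_smul, zero_add] at e
    rwa [← e]
  · rintro ⟨h1, h2⟩
    rw [e, h1, zero_smul, zero_add]
    exact mem_subK.1 h2

/-- A form that vanishes on the Lie algebra of `K` is determined by its values on the frame. -/
theorem eq_comp_coords {Φ : (ℝ × sp2) [⋀^Fin 3]→L[ℝ] ℝ}
    (h : ∀ X ∈ subK, ∀ v w, Φ ![(0, X), v, w] = 0) :
    Φ = (Φ.compContinuousLinearMap frameMapL).compContinuousLinearMap coords := by
  have key (v w z : ℝ × sp2) : Φ ![frameMapL (coords v), w, z] = Φ ![v, w, z] := by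
    have h1 : coords (v - frameMapL (coords v)) = 0 := by
      rw [map_sub]
      change coords v - coords (frameMap (coords v)) = 0
      rw [coords_frameMap, sub_self]
    obtain ⟨h2, h3⟩ := coords_eq_zero_iff.1 h1
    have h4 := h _ h3 w z
    have e : ((0, (v - frameMapL (coords v)).2) : ℝ × sp2) = v - frameMapL (coords v) :=
      Prod.ext h2.symm rfl
    rw [e, ← curryThree_apply, map_sub] at h4
    have h5 : curryThree Φ v w z - curryThree Φ (frameMapL (coords v)) w z = 0 := h4
    rw [curryThree_apply, curryThree_apply] at h5
    linarith
  have key' (v w z : ℝ × sp2) : Φ ![v, frameMapL (coords w), z] = Φ ![v, w, z] := by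
    rw [three_swap_left Φ (frameMapL (coords w)) v, key]
    exact (three_swap_left Φ w v z).symm
  refine ext_three fun x y z => ?_
  rw [comp_three_apply, comp_three_apply, key, key', three_swap_right Φ x (frameMapL (coords z)),
    key']
  exact three_swap_right Φ x z y

/-- The action of the Lie algebra of `K` on the frame. -/
theorem bracket_frame :
    (∀ i, bracket (torus 0 1) (frame i).2 = ![0, (-2 : ℝ) • spFrame 2, (2 : ℝ) • spFrame 1,
      spFrame 4, -spFrame 3, spFrame 6, -spFrame 5] i) ∧
    (∀ i, bracket (torus 1 0) (frame i).2 = ![0, 0, 0, -spFrame 4, spFrame 3, spFrame 6,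
      -spFrame 5] i) ∧
    (∀ i, bracket (spOf 0 1 0 0 0 0 0 0 0 0) (frame i).2 = ![0, 0, 0, -spFrame 5, -spFrame 6,
      spFrame 3, spFrame 4] i) := by
  have n (a₁ a₂ a₃ d₁ d₂ d₃ b₀ b₁ b₂ b₃ : ℝ) := (by
    rw [← neg_one_smul ℝ, smul_spOf] : -spOf a₁ a₂ a₃ d₁ d₂ d₃ b₀ b₁ b₂ b₃ = _)
  have e1 : spFrame 1 = spOf 0 0 0 0 (1 / 2) 0 0 0 0 0 := rfl
  have e2 : spFrame 2 = spOf 0 0 0 0 0 (-1 / 2) 0 0 0 0 := rfl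
  have e3 : spFrame 3 = spOf 0 0 0 0 0 0 (1 / (2 * √2)) 0 0 0 := rfl
  have e4 : spFrame 4 = spOf 0 0 0 0 0 0 0 (1 / (2 * √2)) 0 0 := rfl
  have e5 : spFrame 5 = spOf 0 0 0 0 0 0 0 0 (1 / (2 * √2)) 0 := rfl
  have e6 : spFrame 6 = spOf 0 0 0 0 0 0 0 0 0 (1 / (2 * √2)) := rfl
  have e0 : spFrame 0 = 0 := rfl
  refine ⟨fun i => ?_, fun i => ?_, fun i => ?_⟩
  all_goals
    rcases eq_zero_or_one_or_six i with rfl | rfl | rfl | rfl | rfl | rfl | rfl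
    · exact bracket_zero _
    all_goals
      simp only [frame, Matrix.cons_val, e1, e2, e3, e4, e5, e6, n, smul_spOf, torus, bracket_spOf,
        ← spOf_zero]
      congr 1 <;> ring

theorem zero_spFrame {i : Fin 7} (hi : i ≠ 0) : ((0, spFrame i) : ℝ × sp2) = frame i := by
  rw [frame, if_neg hi]

set_option maxHeartbeats 1000000 in
-- Three elements of the Lie algebra of K suffice: diag (0, i), diag (i, 0) and diag (j, 0). The
-- resulting linear equations leave four free components, those of ω₁ ∧ dt, ω₂ ∧ dt, α and β.
theorem isotropic_components {Φ : (ℝ × sp2) [⋀^Fin 3]→L[ℝ] ℝ}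
    (hD : ∀ X ∈ subK, ∀ u v w : ℝ × sp2, Φ ![(0, bracket X u.2), v, w] +
      Φ ![u, (0, bracket X v.2), w] + Φ ![u, v, (0, bracket X w.2)] = 0) :
    Φ.compContinuousLinearMap frameMapL =
      isotropicForm proj7 (Φ ![frame 1, frame 2, frame 0]) (Φ ![frame 3, frame 4, frame 0])
        (Φ ![frame 2, frame 4, frame 6]) (Φ ![frame 1, frame 3, frame 5]) := by
  set C := curryThree Φ with hC
  have g (i : Fin 7) (hi : i ≠ 0) := zero_spFrame hi
  have gn (i : Fin 7) (hi : i ≠ 0) : ((0, -spFrame i) : ℝ × sp2) = -frame i := by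
    rw [← g i hi]; simp
  have gs (i : Fin 7) (hi : i ≠ 0) (c : ℝ) : ((0, c • spFrame i) : ℝ × sp2) = c • frame i := by
    rw [← g i hi]; simp
  have g0 : ((0, 0) : ℝ × sp2) = 0 := rfl
  obtain ⟨b4, b1, b2⟩ := bracket_frame
  have R4 (i j k : Fin 7) := hD (torus 0 1) (spOf_mem_subK.2 ⟨rfl, rfl, rfl, rfl, rfl, rfl⟩)
    (frame i) (frame j) (frame k)
  have R1 (i j k : Fin 7) := hD (torus 1 0) (spOf_mem_subK.2 ⟨rfl, rfl, rfl, rfl, rfl, rfl⟩)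
    (frame i) (frame j) (frame k)
  have R2 (i j k : Fin 7) := hD (spOf 0 1 0 0 0 0 0 0 0 0)
    (spOf_mem_subK.2 ⟨rfl, rfl, rfl, rfl, rfl, rfl⟩) (frame i) (frame j) (frame k)
  simp only [b4, b1, b2, ← curryThree_apply] at R4 R1 R2
  have c1 : ∀ i : Fin 7, ((0, (![0, 0, 0, -spFrame 4, spFrame 3, spFrame 6, -spFrame 5] i : sp2)) :
      ℝ × sp2) = ![0, 0, 0, -frame 4, frame 3, frame 6, -frame 5] i := by
    intro i; fin_cases i <;> simp [g, gn, g0]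
  have c2 : ∀ i : Fin 7, ((0, (![0, 0, 0, -spFrame 5, -spFrame 6, spFrame 3, spFrame 4] i : sp2)) :
      ℝ × sp2) = ![0, 0, 0, -frame 5, -frame 6, frame 3, frame 4] i := by
    intro i; fin_cases i <;> simp [g, gn, g0]
  have c4 : ∀ i : Fin 7, ((0, (![0, (-2 : ℝ) • spFrame 2, (2 : ℝ) • spFrame 1, spFrame 4,
      -spFrame 3, spFrame 6, -spFrame 5] i : sp2)) : ℝ × sp2) =
      ![0, (-2 : ℝ) • frame 2, (2 : ℝ) • frame 1, frame 4, -frame 3, frame 6, -frame 5] i := by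
    intro i; fin_cases i <;> simp [g, gn, gs, g0, -neg_smul]
  simp only [c1, c2, c4, ← hC] at R4 R1 R2
  set F : Fin 7 → Fin 7 → Fin 7 → ℝ := fun i j k => C (frame i) (frame j) (frame k) with hF
  have hFC (i j k : Fin 7) : C (frame i) (frame j) (frame k) = F i j k := rfl
  have s1 (i j k : Fin 7) : F j i k = -F i j k := three_swap_left Φ _ _ _
  have s2 (i j k : Fin 7) : F i k j = -F i j k := three_swap_right Φ _ _ _
  have n1 (i k : Fin 7) : F i i k = 0 := three_self_left Φ _ _
  have n2 (i k : Fin 7) : F i k k = 0 := three_self_right Φ _ _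
  -- The element diag (i, 0) fixes E₀, E₁, E₂ and rotates the planes of (E₃, E₄) and (E₅, E₆) with
  -- weight one, so components with an odd number of indices among 3, …, 6 vanish. The remaining
  -- ones of this kind are x1, …, x4 below.
  have z (i j : Fin 7) (hi : i = 0 ∨ i = 1 ∨ i = 2) (hj : j = 0 ∨ j = 1 ∨ j = 2) :
      F i j 3 = 0 ∧ F i j 4 = 0 ∧ F i j 5 = 0 ∧ F i j 6 = 0 := by
    have e3 := R1 i j 3
    have e4 := R1 i j 4
    have e5 := R1 i j 5
    have e6 := R1 i j 6
    rcases hi with rfl | rfl | rfl <;> rcases hj with rfl | rfl | rfl <;>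
      (simp [hFC] at e3 e4 e5 e6; exact ⟨e4, e3, e6, e5⟩)
  -- Invariance under diag (i, 0) and diag (j, 0) cuts the six two-forms in E₃, …, E₆ down to three,
  -- for each index i ≤ 2.
  have w (i : Fin 7) (hi : i = 0 ∨ i = 1 ∨ i = 2) :
      F i 4 5 = F i 3 6 ∧ F i 4 6 = -F i 3 5 ∧ F i 5 6 = F i 3 4 := by
    have e1 := R1 i 3 5
    have e2 := R1 i 3 6
    have e3 := R2 i 3 6
    rcases hi with rfl | rfl | rfl <;>
    · simp [hFC] at e1 e2 e3
      exact ⟨by linarith, by linarith, by linarith⟩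
  have x1 : F 3 4 6 = 0 := by have := R1 3 4 5; simpa [hFC, n1, n2] using this
  have x2 : F 3 4 5 = 0 := by have := R1 3 4 6; simpa [hFC, n1, n2] using this
  have x3 : F 4 5 6 = 0 := by have := R1 3 5 6; simpa [hFC, n1, n2] using this
  have x4 : F 3 5 6 = 0 := by have := R1 4 5 6; simpa [hFC, n1, n2] using this
  -- The element diag (0, i) rotates E₁, E₂ with weight two. This removes ω₂ against E₁, E₂, removes
  -- the two other two-forms against E₀, and ties the rest together to α and β.
  have y1 : F 2 3 4 = 0 := by have := R4 1 3 4; simpa [hFC, n1, n2] using this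
  have y2 : F 1 3 4 = 0 := by have := R4 2 3 4; simpa [hFC, n1, n2] using this
  have y3 : -(2 * F 2 3 5) + F 1 4 5 + F 1 3 6 = 0 := by
    have := R4 1 3 5; simpa [hFC, n1, n2] using this
  have y4 : 2 * F 1 3 5 + F 2 4 5 + F 2 3 6 = 0 := by
    have := R4 2 3 5; simpa [hFC, n1, n2] using this
  have y5 : F 0 4 5 + F 0 3 6 = 0 := by have := R4 0 3 5; simpa [hFC, n1, n2] using this
  have y6 : F 0 4 6 + -F 0 3 5 = 0 := by have := R4 0 3 6; simpa [hFC, n1, n2] using this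
  have w0 := w 0 (by simp)
  have w1 := w 1 (by simp)
  have w2 := w 2 (by simp)
  have z01 := z 0 1 (by simp) (by simp)
  have z02 := z 0 2 (by simp) (by simp)
  have z12 := z 1 2 (by simp) (by simp)
  have t1 : F 1 2 0 = F 0 1 2 := by rw [s2, s1, neg_neg]
  have t2 : F 3 4 0 = F 0 3 4 := by rw [s2, s1, neg_neg]
  change _ = isotropicForm proj7 (F 1 2 0) (F 3 4 0) (F 2 4 6) (F 1 3 5)
  refine three_form_ext fun i j k hij hjk => ?_
  have hl : Φ.compContinuousLinearMap frameMapL ![bas i, bas j, bas k] = F i j k := by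
    rw [comp_three_apply, frameMapL_bas, frameMapL_bas, frameMapL_bas]; rfl
  rw [hl]
  rcases eq_zero_or_one_or_six i with rfl | rfl | rfl | rfl | rfl | rfl | rfl <;>
  rcases eq_zero_or_one_or_six j with rfl | rfl | rfl | rfl | rfl | rfl | rfl <;>
  first
  | exact absurd hij (by decide)
  | (rcases eq_zero_or_one_or_six k with rfl | rfl | rfl | rfl | rfl | rfl | rfl <;>
      first
      | exact absurd hjk (by decide)
      | (rw [isotropicForm_apply]; simp [bas_apply] <;> linarith))

/-! ### Angle functions -/

theorem eq_of_hasDerivAt_zero {I : Set ℝ} (hI : IsOpen I) (hI' : I.OrdConnected) {f : ℝ → ℝ}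
    (hf : ∀ t ∈ I, HasDerivAt f 0 t) {s t : ℝ} (hs : s ∈ I) (ht : t ∈ I) : f s = f t :=
  (hI'.convex).is_const_of_fderivWithin_eq_zero (𝕜 := ℝ)
    (fun x hx => (hf x hx).differentiableAt.differentiableWithinAt) (fun x hx => by
      rw [fderivWithin_of_isOpen hI hx, (hf x hx).hasFDerivAt.fderiv]
      ext; simp) hs ht

theorem exists_hasDerivAt_of_continuousOn {I : Set ℝ} (hI : IsOpen I) (hI' : I.OrdConnected)
    {g : ℝ → ℝ} (hg : ContinuousOn g I) {t₀ : ℝ} (ht₀ : t₀ ∈ I) (θ₀ : ℝ) :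
    ∃ θ : ℝ → ℝ, θ t₀ = θ₀ ∧ ∀ t ∈ I, HasDerivAt θ (g t) t := by
  refine ⟨fun t => θ₀ + ∫ x in t₀..t, g x, by simp, fun t ht => ?_⟩
  refine HasDerivAt.const_add θ₀ ?_
  refine intervalIntegral.integral_hasDerivAt_right
    ((hg.mono (hI'.uIcc_subset ht₀ ht)).intervalIntegrable) ?_ (hg.continuousAt (hI.mem_nhds ht))
  exact hg.stronglyMeasurableAtFilter hI t ht

theorem exists_angle_at (p q : ℝ) : ∃ θ : ℝ, √(p ^ 2 + q ^ 2) * Real.cos θ = p ∧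
    √(p ^ 2 + q ^ 2) * Real.sin θ = q := by
  have h : ‖(⟨p, q⟩ : ℂ)‖ = √(p ^ 2 + q ^ 2) := by
    rw [Complex.norm_def, Complex.normSq_mk, sq, sq]
  refine ⟨Complex.arg ⟨p, q⟩, ?_, ?_⟩
  · rw [← h, Complex.norm_mul_cos_arg]
  · rw [← h, Complex.norm_mul_sin_arg]

/-- A curve in the unit circle has an angle function of the same class. -/
theorem exists_angle {I : Set ℝ} (hI : IsOpen I) (hI' : I.OrdConnected) {r : WithTop ℕ∞}
    (hr : r = 1 ∨ r = ∞) {c s : ℝ → ℝ} (hc : ContDiffOn ℝ r c I) (hs : ContDiffOn ℝ r s I)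
    (h1 : ∀ t ∈ I, c t ^ 2 + s t ^ 2 = 1) :
    ∃ θ : ℝ → ℝ, ContDiffOn ℝ r θ I ∧ ∀ t ∈ I, Real.cos (θ t) = c t ∧ Real.sin (θ t) = s t := by
  rcases I.eq_empty_or_nonempty with rfl | ⟨t₀, ht₀⟩
  · exact ⟨0, contDiffOn_empty, fun t ht => ht.elim⟩
  have hr1 : 1 ≤ r := by rcases hr with rfl | rfl; exacts [le_rfl, by exact_mod_cast le_top]
  have hdc {c : ℝ → ℝ} (hc : ContDiffOn ℝ r c I) (t : ℝ) (ht : t ∈ I) :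
      HasDerivAt c (deriv c t) t :=
    ((hc.contDiffAt (hI.mem_nhds ht)).differentiableAt (by
      rintro rfl; exact absurd hr1 (by simp))).hasDerivAt
  have hd1 {c : ℝ → ℝ} (hc : ContDiffOn ℝ r c I) : ContinuousOn (deriv c) I :=
    ((contDiffOn_succ_iff_deriv_of_isOpen (n := 0) hI).1 (by simpa using hc.of_le hr1)).2.2.continuousOn
  -- The derivative that an angle function of (c, s) must have; θ is its primitive.
  set g : ℝ → ℝ := fun t => c t * deriv s t - s t * deriv c t with hg
  have hgc : ContinuousOn g I := (hc.continuousOn.mul (hd1 hs)).sub (hs.continuousOn.mul (hd1 hc))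
  obtain ⟨θ₀, h0c, h0s⟩ := exists_angle_at (c t₀) (s t₀)
  rw [h1 t₀ ht₀, Real.sqrt_one, one_mul] at h0c h0s
  obtain ⟨θ, hθ0, hθ⟩ := exists_hasDerivAt_of_continuousOn hI hI' hgc ht₀ θ₀
  refine ⟨θ, ?_, fun t ht => ?_⟩
  · rcases hr with rfl | rfl
    · have := (contDiffOn_succ_iff_deriv_of_isOpen (𝕜 := ℝ) (f := θ) (n := 0) hI).2
        ⟨fun t ht => (hθ t ht).differentiableAt.differentiableWithinAt, by simp,
          contDiffOn_zero.2 (hgc.congr fun t ht => (hθ t ht).deriv)⟩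
      simpa using this
    · refine (contDiffOn_infty_iff_deriv_of_isOpen hI).2
        ⟨fun t ht => (hθ t ht).differentiableAt.differentiableWithinAt, ?_⟩
      have h2 : ContDiffOn ℝ ∞ g I :=
        (hc.mul ((contDiffOn_infty_iff_deriv_of_isOpen hI).1 hs).2).sub
          (hs.mul ((contDiffOn_infty_iff_deriv_of_isOpen hI).1 hc).2)
      exact h2.congr fun t ht => (hθ t ht).deriv
  -- The cosine of the difference between the angle of (c, s) and θ. It is constant and equal to 1
  -- at t₀, so the two unit vectors coincide.
  · set A : ℝ → ℝ := fun t => c t * Real.cos (θ t) + s t * Real.sin (θ t) with hA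
    have hA' : ∀ t ∈ I, HasDerivAt A 0 t := by
      intro t ht
      have e1 := hdc hc t ht
      have e2 := hdc hs t ht
      have e3 := (e1.pow 2).add (e2.pow 2)
      have e4 : HasDerivAt (fun t => c t ^ 2 + s t ^ 2) 0 t :=
        (hasDerivAt_const t (1 : ℝ)).congr_of_eventuallyEq
          (Filter.eventuallyEq_of_mem (hI.mem_nhds ht) h1)
      have e5 := e3.unique e4
      have e6 := h1 t ht
      have hc' : deriv c t = -s t * g t := by
        simp at e5
        simp only [hg]
        linear_combination (-deriv c t) * e6 + (1 / 2 : ℝ) * c t * e5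
      have hs' : deriv s t = c t * g t := by
        simp at e5
        simp only [hg]
        linear_combination (-deriv s t) * e6 + (1 / 2 : ℝ) * s t * e5
      refine ((e1.mul (hθ t ht).cos).add (e2.mul (hθ t ht).sin)).congr_deriv ?_
      rw [hc', hs']; ring
    have h3 := eq_of_hasDerivAt_zero hI hI' hA' ht ht₀
    simp only [hA] at h3
    rw [hθ0, h0c, h0s] at h3
    have h4 := h1 t ht
    have h5 := h1 t₀ ht₀
    have h6 := Real.sin_sq_add_cos_sq (θ t)
    have n1 := sq_nonneg (c t - Real.cos (θ t))
    have n2 := sq_nonneg (s t - Real.sin (θ t))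
    have h7 : (c t - Real.cos (θ t)) ^ 2 + (s t - Real.sin (θ t)) ^ 2 = 0 := by
      linear_combination h4 + h6 - 2 * h3 - 2 * h5
    have h8 := (pow_eq_zero_iff two_ne_zero).1 (by linarith : (c t - Real.cos (θ t)) ^ 2 = 0)
    have h9 := (pow_eq_zero_iff two_ne_zero).1 (by linarith : (s t - Real.sin (θ t)) ^ 2 = 0)
    exact ⟨by linarith, by linarith⟩

/-! ### Positivity conditions -/

/-- The scaling with the factors `τ, f₁, f₁, f₂, f₂, f₂, f₂`. -/
def stretch (τ : ℝ) : V7 →L[ℝ] V7 :=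
  ContinuousLinearMap.id ℝ V7 + (proj7 0).smulRight ((τ - 1) • bas 0)

theorem stretch_apply (τ : ℝ) (x : V7) (i : Fin 7) :
    stretch τ x i = (if i = 0 then τ else 1) * x i := by
  change x i + x 0 * ((τ - 1) * bas 0 i) = _
  rw [bas_apply]
  split_ifs with h
  · rw [h]; ring
  · ring

theorem stretch_stretch {τ τ' : ℝ} (h : τ * τ' = 1) (x : V7) : stretch τ (stretch τ' x) = x := by
  ext i
  rw [stretch_apply, stretch_apply, ← mul_assoc]
  split_ifs <;> simp [h]

/-- The scaling of the first coordinate, as an equivalence. -/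
def stretchEquiv {τ : ℝ} (h : τ ≠ 0) : V7 ≃L[ℝ] V7 :=
  ContinuousLinearEquiv.equivOfInverse (stretch τ) (stretch τ⁻¹)
    (stretch_stretch (inv_mul_cancel₀ h)) (stretch_stretch (mul_inv_cancel₀ h))

theorem isotropicForm_eq {f₁ f₂ τ θ : ℝ} :
    isotropicForm proj7 (f₁ ^ 2 * τ) (f₂ ^ 2 * τ) (f₁ * f₂ ^ 2 * Real.cos θ)
      (f₁ * f₂ ^ 2 * Real.sin θ) =
      (modelForm θ).compContinuousLinearMap ((scaleMap f₁ f₂).comp (stretch τ)) := by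
  refine ext_three fun x y z => ?_
  rw [comp_three_apply, isotropicForm_apply, modelForm_apply]
  simp only [ContinuousLinearMap.comp_apply, scaleMap_apply, stretch_apply, Matrix.cons_val,
    if_true, one_ne_zero, if_false, Fin.reduceEq]
  ring

theorem modelForm_comp_scaleMap (f₁ f₂ θ : ℝ) :
    (modelForm θ).compContinuousLinearMap (scaleMap f₁ f₂) = isotropicForm proj7 (f₁ ^ 2) (f₂ ^ 2)
      (f₁ * f₂ ^ 2 * Real.cos θ) (f₁ * f₂ ^ 2 * Real.sin θ) := by
  have h1 := isotropicForm_eq (f₁ := f₁) (f₂ := f₂) (τ := 1) (θ := θ)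
  have h2 : stretch 1 = ContinuousLinearMap.id ℝ V7 := by
    ext x i
    rw [stretch_apply]; simp
  rw [h2, ContinuousLinearMap.comp_id, mul_one, mul_one] at h1
  exact h1.symm

/-- Nondegeneracy excludes p = q = 0, c = 0 and c < 0 by exhibiting, in each case, independent
vectors with vanishing cross product. The form is then the model form in a frame with dt rescaled by
a factor τ, and the unit length of the zeroth vector gives τ = 1, which is a c² = p² + q². -/
theorem isotropicForm_conditions {a c p q : ℝ} (hG : IsG2Form (isotropicForm proj7 a c p q))
    (ha : 0 < a) (h0 : g2Metric (isotropicForm proj7 a c p q) (bas 0) (bas 0) = 1) :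
    0 < c ∧ a * c ^ 2 = p ^ 2 + q ^ 2 := by
  have hr : 0 < p ^ 2 + q ^ 2 := by
    by_contra! hle
    have n1 := sq_nonneg p
    have n2 := sq_nonneg q
    have hp : p = 0 := (pow_eq_zero_iff two_ne_zero).1 (by linarith)
    have hq : q = 0 := (pow_eq_zero_iff two_ne_zero).1 (by linarith)
    obtain ⟨z, hz⟩ := exists_ne_zero_of_linearIndependent hG (v := bas 1) (w := bas 3)
      (fun a b h => by
        have e1 := congrArg (fun v : V7 => v 1) h
        have e3 := congrArg (fun v : V7 => v 3) h
        simp [bas_apply] at e1 e3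
        exact ⟨e1, e3⟩)
    rw [isotropicForm_apply] at hz
    simp [bas_apply, hp, hq] at hz
  have hc0 : c ≠ 0 := by
    rintro rfl
    obtain ⟨z, hz⟩ := exists_ne_zero_of_linearIndependent hG (v := bas 3) (w := bas 4)
      (fun a b h => by
        have e1 := congrArg (fun v : V7 => v 3) h
        have e3 := congrArg (fun v : V7 => v 4) h
        simp [bas_apply] at e1 e3
        exact ⟨e1, e3⟩)
    rw [isotropicForm_apply] at hz
    simp [bas_apply] at hz
  have hc : 0 < c := by
    by_contra! hle
    have hneg : c < 0 := lt_of_le_of_ne hle hc0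
    -- For c < 0 this y solves y² c (p² + q²) = -a, the condition for the contraction of the form
    -- with the two vectors below to vanish.
    set y := √(-a / (c * (p ^ 2 + q ^ 2))) with hy
    have hy2 : y ^ 2 * (c * (p ^ 2 + q ^ 2)) = -a := by
      have h1 : 0 < -a / (c * (p ^ 2 + q ^ 2)) :=
        div_pos_of_neg_of_neg (by linarith) (mul_neg_of_neg_of_pos hneg hr)
      rw [hy, Real.sq_sqrt h1.le, div_mul_cancel₀ _ (mul_neg_of_neg_of_pos hneg hr).ne]
    obtain ⟨z, hz⟩ := exists_ne_zero_of_linearIndependent hG (v := bas 0 + (-(c * y)) • bas 3)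
      (w := bas 1 + ((y * p) • bas 5 + (y * q) • bas 6)) (fun a b h => by
        have e1 := congrArg (fun v : V7 => v 0) h
        have e3 := congrArg (fun v : V7 => v 1) h
        simp [bas_apply] at e1 e3
        exact ⟨e1, e3⟩)
    refine hz ?_
    rw [isotropicForm_apply]
    simp [bas_apply]
    linear_combination (z 2) * hy2
  refine ⟨hc, ?_⟩
  -- The equations f₁²τ = a, f₂²τ = c and f₁f₂² = √(p² + q²) force τ³ = a c² / (p² + q²).
  set T := a * c ^ 2 / (p ^ 2 + q ^ 2) with hT
  have hT0 : 0 < T := by positivity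
  set τ := T ^ (1 / 3 : ℝ) with hτ
  have hτ0 : 0 < τ := Real.rpow_pos_of_pos hT0 _
  have hτ3 : τ ^ 3 = T := by
    rw [hτ, ← Real.rpow_natCast, ← Real.rpow_mul hT0.le]; norm_num
  have hT' : a * c ^ 2 = τ ^ 3 * (p ^ 2 + q ^ 2) := by rw [hτ3, hT, div_mul_cancel₀ _ hr.ne']
  obtain ⟨θ, hp, hq⟩ := exists_angle_at p q
  set f₁ := √(a / τ) with hf₁
  set f₂ := √(c / τ) with hf₂
  have h1 : 0 < f₁ := by positivity
  have h2 : 0 < f₂ := by positivity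
  have s1 : f₁ ^ 2 * τ = a := by rw [hf₁, Real.sq_sqrt (by positivity), div_mul_cancel₀ _ hτ0.ne']
  have s2 : f₂ ^ 2 * τ = c := by rw [hf₂, Real.sq_sqrt (by positivity), div_mul_cancel₀ _ hτ0.ne']
  have s3 : √(p ^ 2 + q ^ 2) = f₁ * f₂ ^ 2 := by
    rw [Real.sqrt_eq_iff_mul_self_eq (by positivity) (by positivity)]
    have h3 : τ ^ 3 * (f₁ * f₂ ^ 2 * (f₁ * f₂ ^ 2)) = τ ^ 3 * (p ^ 2 + q ^ 2) := by
      rw [← hT', ← s1, ← s2]; ring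
    exact (mul_left_cancel₀ (pow_pos hτ0 3).ne' h3).symm
  have hform : isotropicForm proj7 a c p q =
      (modelForm θ).compContinuousLinearMap ((scaleMap f₁ f₂).comp (stretch τ)) := by
    rw [← isotropicForm_eq, s1, s2, ← s3, hp, hq]
  have hu : IsAdapted (isotropicForm proj7 a c p q)
      ((stretchEquiv hτ0.ne').trans (scaleEquiv h1.ne' h2.ne')) := ⟨θ, hform⟩
  rw [g2Metric_eq hu] at h0
  change inner ℝ (scaleMap f₁ f₂ (stretch τ (bas 0))) (scaleMap f₁ f₂ (stretch τ (bas 0))) = 1 at h0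
  rw [inner_scaleMap] at h0
  simp [stretch_apply, bas_apply] at h0
  have hτ1 : τ = 1 := by nlinarith
  rw [hT', hτ1, one_pow, one_mul]

/-! ### The normal form along a normal curve -/

section NormalForm

variable {M : Type*} [TopologicalSpace M] [ChartedSpace V7 M] [IsManifold 𝓘(ℝ, V7) ∞ M]
  [MulAction Sp2 M] {φ : FormField M 3} {I : Set ℝ} {γ : ℝ → M} {t : ℝ}

theorem exists_equiv_of_ker {T : (ℝ × sp2) →L[ℝ] V7} (hT : Function.Surjective T)
    (hk : ∀ v, coords v = 0 → T v = 0) :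
    ∃ L : V7 ≃L[ℝ] V7, ∀ v, L (coords v) = T v := by
  have h1 (v : ℝ × sp2) : T (frameMapL (coords v)) = T v := by
    rw [← sub_eq_zero, ← map_sub]
    refine hk _ ?_
    rw [map_sub]
    change coords (frameMap (coords v)) - coords v = 0
    rw [coords_frameMap, sub_self]
  have hs : Function.Surjective ((T.comp frameMapL : V7 →L[ℝ] V7) : V7 →ₗ[ℝ] V7) := fun y => by
    obtain ⟨v, rfl⟩ := hT y
    exact ⟨coords v, h1 v⟩
  exact ⟨(LinearEquiv.ofBijective _ ⟨LinearMap.injective_iff_surjective.2 hs,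
    hs⟩).toContinuousLinearEquiv, h1⟩

/-- On the axis of the tube these functions are components of the pull-back of φ under a smooth map,
hence smooth. -/
theorem tubeForm_frame_contDiffOn (hact : IsSmoothAction M) (hφ : IsG2Structure ∞ φ)
    (hinv : IsInvariant φ) (hI : IsOpen I) (hγ : ContMDiffOn 𝓘(ℝ, ℝ) 𝓘(ℝ, V7) ∞ γ I)
    (i j k : Fin 7) :
    ContDiffOn ℝ ∞ (fun t => tubeForm φ γ t ![frame i, frame j, frame k]) I := by
  intro t ht
  have hnear : ∀ᶠ p : V7 in nhds (t • bas 0), p 0 ∈ I := by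
    have hcont : ContinuousAt (fun p : V7 => p 0) (t • bas 0) :=
      (EuclideanSpace.proj 0 : V7 →L[ℝ] ℝ).continuous.continuousAt
    apply hcont.eventually_mem
    rw [smul_bas_zero_apply]; exact hI.mem_nhds ht
  have hG : ∀ᶠ p in nhds (t • bas 0), ContMDiffAt 𝓘(ℝ, V7) 𝓘(ℝ, V7) ∞ (tubeMap γ 1) p :=
    hnear.mono fun p hp => contMDiffAt_tubeMap hact 1 (hγ.contMDiffAt (hI.mem_nhds hp))
  have h1 := hφ.1.contDiffAt_pull (by simp) hG
  have h2 : ContDiffAt ℝ ∞ (fun p => pull φ (tubeMap γ 1) p fun m => bas (![i, j, k] m))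
      (t • bas 0) := contDiffAt_form_apply h1 fun m => contDiffAt_const
  have h3 : ContDiffAt ℝ ∞ (fun s : ℝ => s • bas 0) t :=
    (contDiff_id.smul contDiff_const).contDiffAt
  have h4 := ContDiffAt.comp t h2 h3
  refine (h4.congr_of_eventuallyEq ?_).contDiffWithinAt
  filter_upwards [hI.mem_nhds ht] with s hs
  have h5 : ((s • bas 0 : V7) 0) = s := by rw [smul_bas_zero_apply]
  have h6 := pull_tubeMap hact (isInvariant_iff.1 hinv) 1 (p := s • bas 0) (γ := γ)
    (by rw [h5]; exact hγ.contMDiffAt (hI.mem_nhds hs)) ![i, j, k]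
  rw [tubeField_smul_bas_zero, h5] at h6
  refine Eq.trans ?_ h6.symm
  rw [tubeForm_apply]
  refine congrArg (formAt φ (γ s)) ?_
  ext1 m
  fin_cases m <;> rfl

theorem IsNormalCurve.tubeForm_eq [T2Space M] (hact : IsSmoothAction M) (hφ : IsG2Structure ∞ φ)
    (hinv : IsInvariant φ) (hdim : ∀ x : M, orbitDim x ≤ 6) (hI : IsOpen I) (hI' : I.OrdConnected)
    (hγ : IsNormalCurve φ I γ) (ht : t ∈ I) (hK : isoAlg (γ t) = subK) :
    (tubeForm φ γ t).compContinuousLinearMap frameMapL = isotropicForm proj7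
      (tubeForm φ γ t ![frame 1, frame 2, frame 0]) (tubeForm φ γ t ![frame 3, frame 4, frame 0])
      (tubeForm φ γ t ![frame 2, frame 4, frame 6]) (tubeForm φ γ t ![frame 1, frame 3, frame 5]) ∧
    tubeForm φ γ t = ((tubeForm φ γ t).compContinuousLinearMap
      frameMapL).compContinuousLinearMap coords := by
  refine ⟨isotropic_components fun X hX u v w =>
    hγ.derivation_tubeForm hact hφ hinv hdim hI hI' ht (hK ▸ hX) u v w, eq_comp_coords ?_⟩
  intro X hX v w
  rw [tubeForm_apply, tubeD_isoAlg hact hI hγ ht (hK ▸ hX), ← curryThree_apply, map_zero]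
  rfl

theorem IsNormalCurve.exists_tube_equiv (hact : IsSmoothAction M) (hφ : IsG2Structure ∞ φ)
    (hI : IsOpen I) (hγ : IsNormalCurve φ I γ) (ht : t ∈ I) (hK : isoAlg (γ t) = subK) :
    ∃ L : V7 ≃L[ℝ] V7, ∀ v, L (coords v) = tubeD γ t v := by
  refine exists_equiv_of_ker (hγ.tubeD_surjective hact hφ.2 hI ht) fun v hv => ?_
  obtain ⟨h1, h2⟩ := coords_eq_zero_iff.1 hv
  have e : v = (0, v.2) := Prod.ext h1 rfl
  rw [e]
  exact tubeD_isoAlg hact hI hγ ht (hK ▸ h2)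

/-- A normal curve whose isotropy algebra is that of `K` is in normal form, provided that the first
component of the structure is positive. -/
theorem IsNormalCurve.exists_normalForm [T2Space M] (hact : IsSmoothAction M)
    (hφ : IsG2Structure ∞ φ) (hinv : IsInvariant φ) (hdim : ∀ x : M, orbitDim x ≤ 6)
    (hI : IsOpen I) (hI' : I.OrdConnected) (hγ : IsNormalCurve φ I γ)
    (hK : ∀ t ∈ I, isoAlg (γ t) = subK)
    (hpos : ∀ t ∈ I, 0 < tubeForm φ γ t ![frame 1, frame 2, frame 0]) :
    ∃ f₁ f₂ θ : ℝ → ℝ, IsNormalForm ∞ φ I γ f₁ f₂ θ := by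
  set a : ℝ → ℝ := fun t => tubeForm φ γ t ![frame 1, frame 2, frame 0]
  set c : ℝ → ℝ := fun t => tubeForm φ γ t ![frame 3, frame 4, frame 0]
  set p : ℝ → ℝ := fun t => tubeForm φ γ t ![frame 2, frame 4, frame 6]
  set q : ℝ → ℝ := fun t => tubeForm φ γ t ![frame 1, frame 3, frame 5]
  have hform (t : ℝ) (ht : t ∈ I) : (tubeForm φ γ t).compContinuousLinearMap frameMapL =
      isotropicForm proj7 (a t) (c t) (p t) (q t) :=
    (hγ.tubeForm_eq hact hφ hinv hdim hI hI' ht (hK t ht)).1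
  have hmetric (t : ℝ) (ht : t ∈ I) : IsG2Form (isotropicForm proj7 (a t) (c t) (p t) (q t)) ∧
      ∀ v w, g2Metric (formAt φ (γ t)) (tubeD γ t v) (tubeD γ t w) =
        g2Metric (isotropicForm proj7 (a t) (c t) (p t) (q t)) (coords v) (coords w) := by
    obtain ⟨L, hL⟩ := hγ.exists_tube_equiv hact hφ hI ht (hK t ht)
    have h1 : (formAt φ (γ t)).compContinuousLinearMap (L : V7 →L[ℝ] V7) =
        isotropicForm proj7 (a t) (c t) (p t) (q t) := by
      rw [← hform t ht]
      refine ext_three fun x y z => ?_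
      have h2 (x : V7) : L x = tubeD γ t (frameMapL x) := by
        rw [← hL]
        change L x = L (coords (frameMap x))
        rw [coords_frameMap]
      rw [comp_three_apply, comp_three_apply, tubeForm_apply]
      simp only [ContinuousLinearEquiv.coe_coe, h2]
    have hG : IsG2Form (formAt φ (γ t)) := hφ.2 (γ t)
    rw [← h1]
    refine ⟨(g2Metric_comp hG L 0 0).1, fun v w => ?_⟩
    rw [(g2Metric_comp hG L _ _).2, hL, hL]
  have hcond (t : ℝ) (ht : t ∈ I) : 0 < c t ∧ a t * c t ^ 2 = p t ^ 2 + q t ^ 2 := by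
    obtain ⟨h1, h2⟩ := hmetric t ht
    refine isotropicForm_conditions h1 (hpos t ht) ?_
    have h3 : coords ((1, 0) : ℝ × sp2) = bas 0 := coords_frame 0
    rw [← h3, ← h2, tubeD_apply hact (hγ.contMDiffAt hI ht), one_smul, map_zero, add_zero]
    exact hγ.unit ht
  have hsm (i j k : Fin 7) := tubeForm_frame_contDiffOn hact hφ hinv hI hγ.1 i j k
  have hsa : ContDiffOn ℝ ∞ (fun t => √(a t)) I := (hsm 1 2 0).sqrt fun t ht => (hpos t ht).ne'
  have hsc : ContDiffOn ℝ ∞ (fun t => √(c t)) I := (hsm 3 4 0).sqrt fun t ht => (hcond t ht).1.ne'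
  have hne (t : ℝ) (ht : t ∈ I) : √(a t) * √(c t) ^ 2 ≠ 0 := by
    have h1 := hpos t ht
    have h2 := (hcond t ht).1
    have h3 : 0 < √(a t) := Real.sqrt_pos.2 h1
    have h4 : 0 < √(c t) := Real.sqrt_pos.2 h2
    positivity
  have hsr : ContDiffOn ℝ ∞ (fun t => √(a t) * √(c t) ^ 2) I := hsa.mul (hsc.pow 2)
  -- With f₁ = √a and f₂ = √c, the equation a c² = p² + q² says that (p, q) / (f₁f₂²) lies on the
  -- unit circle.
  obtain ⟨θ, hθ, hcs⟩ := exists_angle hI hI' (Or.inr rfl) ((hsm 2 4 6).div hsr hne)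
    ((hsm 1 3 5).div hsr hne) (fun t ht => by
      have h1 := (hcond t ht).2
      have h2 := hne t ht
      have h3 : (√(a t) * √(c t) ^ 2) ^ 2 = p t ^ 2 + q t ^ 2 := by
        rw [← h1, mul_pow, Real.sq_sqrt (hpos t ht).le, Real.sq_sqrt (hcond t ht).1.le]
      change (p t / (√(a t) * √(c t) ^ 2)) ^ 2 + (q t / (√(a t) * √(c t) ^ 2)) ^ 2 = 1
      rw [div_pow, div_pow, ← add_div, h3, div_self]
      rw [← h3]; exact pow_ne_zero 2 h2)
  have heq (t : ℝ) (ht : t ∈ I) : isotropicForm proj7 (a t) (c t) (p t) (q t) =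
      (modelForm (θ t)).compContinuousLinearMap (scaleMap √(a t) √(c t)) := by
    rw [modelForm_comp_scaleMap, (hcs t ht).1, (hcs t ht).2, Real.sq_sqrt (hpos t ht).le,
      Real.sq_sqrt (hcond t ht).1.le]
    have h3 := hne t ht
    rw [Real.sq_sqrt (hcond t ht).1.le] at h3
    congr 1
    · change p t = √(a t) * c t * (p t / (√(a t) * √(c t) ^ 2))
      rw [Real.sq_sqrt (hcond t ht).1.le, mul_div_cancel₀ _ h3]
    · change q t = √(a t) * c t * (q t / (√(a t) * √(c t) ^ 2))
      rw [Real.sq_sqrt (hcond t ht).1.le, mul_div_cancel₀ _ h3]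
  have hne₁ (t : ℝ) (ht : t ∈ I) : √(a t) ≠ 0 := (Real.sqrt_pos.2 (hpos t ht)).ne'
  have hne₂ (t : ℝ) (ht : t ∈ I) : √(c t) ≠ 0 := (Real.sqrt_pos.2 (hcond t ht).1).ne'
  refine ⟨fun t => √(a t), fun t => √(c t), θ, hγ.1, hsa, hsc, hθ, hne₁, hne₂, fun t ht v w => ?_,
    fun t ht => ?_⟩
  · refine ((hmetric t ht).2 v w).trans ?_
    have hu : IsAdapted (isotropicForm proj7 (a t) (c t) (p t) (q t))
      (scaleEquiv (hne₁ t ht) (hne₂ t ht)) := ⟨θ t, heq t ht⟩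
    rw [g2Metric_eq hu]
    exact inner_scaleMap _ _ _ _
  · rw [← modelForm_comp_scaleMap_coords, ← heq t ht, ← hform t ht]
    exact (hγ.tubeForm_eq hact hφ hinv hdim hI hI' ht (hK t ht)).2

end NormalForm

/-! ### Normal forms up to the action of the group -/

/-- The element `diag (1, j)` of `Sp(2)`. -/
def conjSp : Sp2 := ⟨!![1, 0; 0, quat 0 0 1 0], by
  rw [Unitary.mem_iff]
  constructor <;> ext i j <;> fin_cases i <;> fin_cases j <;>
    simp [Matrix.mul_apply, Fin.sum_univ_two, Matrix.star_apply]⟩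

theorem Ad_conjSp (a₁ a₂ a₃ d₁ d₂ d₃ b₀ b₁ b₂ b₃ : ℝ) :
    Ad conjSp (spOf a₁ a₂ a₃ d₁ d₂ d₃ b₀ b₁ b₂ b₃) =
      spOf a₁ a₂ a₃ (-d₁) d₂ (-d₃) (-b₂) b₃ b₀ (-b₁) := by
  apply toMat_injective
  rw [toMat_Ad, toMat_spOf, toMat_spOf]
  ext i j <;> fin_cases i <;> fin_cases j <;>
    simp [conjSp, Matrix.mul_apply, Fin.sum_univ_two, Matrix.star_apply]

section NormalForm

variable {M : Type*} [TopologicalSpace M] [ChartedSpace V7 M] [IsManifold 𝓘(ℝ, V7) ∞ M]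
  [MulAction Sp2 M] {φ : FormField M 3} {I : Set ℝ} {γ : ℝ → M} {t : ℝ}

/-- Conjugation by diag (1, j) fixes E₁ and reverses E₂, so moving the curve by its inverse changes
the sign of the first component. Together with `subK_map_conjSp` this allows that component to be
made positive. -/
theorem tubeForm_conjSp (hact : IsSmoothAction M) (hinv : IsInvariant φ)
    (hγ : ContMDiffAt 𝓘(ℝ, ℝ) 𝓘(ℝ, V7) ∞ γ t) :
    tubeForm φ (fun t => conjSp⁻¹ • γ t) t ![frame 1, frame 2, frame 0] =
      -tubeForm φ γ t ![frame 1, frame 2, frame 0] := by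
  have h (i : Fin 7) : tubeD (fun t => conjSp⁻¹ • γ t) t (frame i) =
      dAct conjSp⁻¹ (γ t) (tubeD γ t (if i = 0 then 1 else 0, Ad conjSp (spFrame i))) := by
    rw [frame, tubeD_smul hact _ hγ, inv_inv]
  have e0 : (((if (0 : Fin 7) = 0 then 1 else 0 : ℝ), Ad conjSp (spFrame 0)) : ℝ × sp2) =
      frame 0 := by
    rw [frame]
    change _ = ((_, (0 : sp2)) : ℝ × sp2)
    rw [← map_zero (Ad conjSp)]; rfl
  have e1 : (((if (1 : Fin 7) = 0 then 1 else 0 : ℝ), Ad conjSp (spFrame 1)) : ℝ × sp2) =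
      frame 1 := by
    have h1 : spFrame 1 = spOf 0 0 0 0 (1 / 2) 0 0 0 0 0 := rfl
    rw [frame, h1, Ad_conjSp]
    simp only [neg_zero]
  have e2 : (((if (2 : Fin 7) = 0 then 1 else 0 : ℝ), Ad conjSp (spFrame 2)) : ℝ × sp2) =
      -frame 2 := by
    have h1 : spFrame 2 = spOf 0 0 0 0 0 (-1 / 2) 0 0 0 0 := rfl
    rw [frame, h1, Ad_conjSp]
    refine Prod.ext (by simp) ?_
    change _ = -spOf 0 0 0 0 0 (-1 / 2) 0 0 0 0
    rw [← neg_one_smul ℝ (spOf 0 0 0 0 0 (-1 / 2) 0 0 0 0), smul_spOf]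
    congr 1 <;> norm_num
  rw [tubeForm_apply, h, h, h, e0, e1, e2]
  refine (formAt_smul_apply hinv _ _ _ _ _).trans ?_
  rw [tubeForm_apply, map_neg, three_swap_left, ← curryThree_apply, map_neg, three_swap_left]
  rfl

theorem subK_map_conjSp : subK.map (AdEquiv conjSp⁻¹ : sp2 →ₗ[ℝ] sp2) = subK := by
  ext X
  rw [mem_map_AdEquiv, inv_inv]
  obtain ⟨a₁, a₂, a₃, d₁, d₂, d₃, b₀, b₁, b₂, b₃, rfl⟩ := exists_spOf X
  rw [Ad_conjSp, spOf_mem_subK, spOf_mem_subK]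
  simp only [neg_eq_zero]
  tauto

/-- Every normal curve is, up to the action of the group, in normal form. -/
theorem IsNormalCurve.exists_smul_normalForm [T2Space M] (hact : IsSmoothAction M)
    (hφ : IsG2Structure ∞ φ) (hinv : IsInvariant φ) (hdim : ∀ x : M, orbitDim x ≤ 6)
    (hI : IsOpen I) (hI' : I.OrdConnected) (hγ : IsNormalCurve φ I γ) :
    ∃ (b : Sp2) (f₁ f₂ θ : ℝ → ℝ), IsNormalForm ∞ φ I (fun t => b • γ t) f₁ f₂ θ := by
  obtain ⟨b, hb⟩ := hγ.exists_isoAlg_eq hact hφ hinv hdim hI hI'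
  have hbγ := hγ.smul hact hφ.2 hinv hI b
  set c : ℝ → M := fun t => b • γ t with hc
  set a : ℝ → ℝ := fun t => tubeForm φ c t ![frame 1, frame 2, frame 0] with ha
  have hcont : ContinuousOn a I :=
    (tubeForm_frame_contDiffOn hact hφ hinv hI hbγ.1 1 2 0).continuousOn
  -- If the component vanished, the contraction of φ with the images of E₁ and E₂ would be zero,
  -- against nondegeneracy.
  have hne : ∀ t ∈ I, a t ≠ 0 := by
    intro t ht h0
    obtain ⟨L, hL⟩ := hbγ.exists_tube_equiv hact hφ hI ht (hb t ht)
    obtain ⟨h1, h2⟩ := hbγ.tubeForm_eq hact hφ hinv hdim hI hI' ht (hb t ht)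
    have hG : IsG2Form (formAt φ (c t)) := hφ.2 (c t)
    obtain ⟨z, hz⟩ := exists_ne_zero_of_linearIndependent hG (v := tubeD c t (frame 1))
      (w := tubeD c t (frame 2)) (fun r s h => by
        have h4 : L (r • bas 1 + s • bas 2) = 0 := by
          rw [map_add, map_smul, map_smul, ← coords_frame 1, ← coords_frame 2, hL, hL]
          exact h
        have h3 := (map_eq_zero_iff L L.injective).1 h4
        have e1 := congrArg (fun v : V7 => v 1) h3
        have e2 := congrArg (fun v : V7 => v 2) h3
        simp [bas_apply] at e1 e2
        exact ⟨e1, e2⟩)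
    obtain ⟨w, rfl⟩ := hbγ.tubeD_surjective hact hφ.2 hI ht z
    rw [← tubeForm_apply, h2, comp_three_apply, h1, coords_frame, coords_frame,
      isotropicForm_apply] at hz
    have h0' : tubeForm φ c t ![frame 1, frame 2, frame 0] = 0 := h0
    rw [h0'] at hz
    simp [bas_apply] at hz
  -- The component is continuous without zeros on an interval, so one group element corrects the
  -- sign along the whole curve.
  rcases hI'.isPreconnected.mapsTo_Ioi_or_Iio hcont hne with h | h
  · obtain ⟨f₁, f₂, θ, hf⟩ := hbγ.exists_normalForm hact hφ hinv hdim hI hI' hb h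
    exact ⟨b, f₁, f₂, θ, hf⟩
  · obtain ⟨f₁, f₂, θ, hf⟩ := (hbγ.smul hact hφ.2 hinv hI conjSp⁻¹).exists_normalForm hact hφ hinv
      hdim hI hI' (fun t ht => by rw [isoAlg_smul hact, hb t ht, subK_map_conjSp]) (fun t ht => by
        rw [tubeForm_conjSp hact hinv (hbγ.contMDiffAt hI ht)]
        exact neg_pos.2 (h ht))
    refine ⟨conjSp⁻¹ * b, f₁, f₂, θ, ?_⟩
    simp only [mul_smul]
    exact hf

end NormalForm

/-! ### Invariance under `K` -/

section Isotropy

theorem sq_add_sq_of_isInK {k : Sp2} (hk : IsInK k) {q z : ℍ[ℝ]}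
    (hq : (k : Matrix (Fin 2) (Fin 2) ℍ[ℝ]) 0 0 = q)
    (hz : (k : Matrix (Fin 2) (Fin 2) ℍ[ℝ]) 1 1 = z) :
    q.re ^ 2 + q.imI ^ 2 + q.imJ ^ 2 + q.imK ^ 2 = 1 ∧ z.re ^ 2 + z.imI ^ 2 = 1 := by
  obtain ⟨h01, h10, hj, hk'⟩ := hk
  have hu := (Unitary.mem_iff.1 k.2).1
  have h0 := congrArg (fun A : Matrix (Fin 2) (Fin 2) ℍ[ℝ] => (A 0 0).re) hu
  have h1 := congrArg (fun A : Matrix (Fin 2) (Fin 2) ℍ[ℝ] => (A 1 1).re) hu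
  rw [hz] at hj hk'
  simp [Matrix.mul_apply, Fin.sum_univ_two, Matrix.star_apply, h01, h10, hq, hz, hj, hk'] at h0 h1
  exact ⟨by linarith, by linarith⟩

theorem coords_apply_quat (v : ℝ × sp2) : coords v = WithLp.toLp 2
    ![v.1, 2 * (toMat v.2 1 1).imJ, -2 * (toMat v.2 1 1).imK, 2 * √2 * (toMat v.2 1 0).re,
      2 * √2 * (toMat v.2 1 0).imI, 2 * √2 * (toMat v.2 1 0).imJ,
      2 * √2 * (toMat v.2 1 0).imK] := by
  ext i
  fin_cases i <;> rfl

/-- The first of three two-forms on `ℝ⁴`. -/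
def kappa₁ (x y : V7) : ℝ := (x 3 * y 4 - x 4 * y 3) + (x 5 * y 6 - x 6 * y 5)

/-- The second of three two-forms on `ℝ⁴`. -/
def kappa₂ (x y : V7) : ℝ := (x 4 * y 6 - x 6 * y 4) - (x 3 * y 5 - x 5 * y 3)

/-- The third of three two-forms on `ℝ⁴`. -/
def kappa₃ (x y : V7) : ℝ := (x 4 * y 5 - x 5 * y 4) + (x 3 * y 6 - x 6 * y 3)

/-- The contribution of the first three coordinates of `z` to the isotropic form. -/
def isotropicPart (a c p q : ℝ) (x y z : V7) : ℝ :=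
  (a * (x 1 * y 2 - x 2 * y 1) + c * kappa₁ x y) * z 0 +
    p * (z 2 * kappa₂ x y - z 1 * kappa₃ x y) - q * (z 2 * kappa₃ x y + z 1 * kappa₂ x y)

theorem isotropicForm_eq_sum (a c p q : ℝ) (x y z : V7) :
    isotropicForm proj7 a c p q ![x, y, z] =
      isotropicPart a c p q x y z + isotropicPart a c p q y z x + isotropicPart a c p q z x y := by
  rw [isotropicForm_apply]
  simp only [isotropicPart, kappa₁, kappa₂, kappa₃]
  ring

/-- The action of `diag (q, z)` on the tangent space of the tube. -/
def rot (q0 q1 q2 q3 z0 z1 : ℝ) (x : V7) : V7 := WithLp.toLp 2 ![x 0,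
  (z0 ^ 2 - z1 ^ 2) * x 1 + 2 * z0 * z1 * x 2,
  -(2 * z0 * z1) * x 1 + (z0 ^ 2 - z1 ^ 2) * x 2,
  (z0 * x 3 - z1 * x 4) * q0 + (z0 * x 4 + z1 * x 3) * q1
    + (z0 * x 5 - z1 * x 6) * q2 + (z0 * x 6 + z1 * x 5) * q3,
  -(z0 * x 3 - z1 * x 4) * q1 + (z0 * x 4 + z1 * x 3) * q0
    - (z0 * x 5 - z1 * x 6) * q3 + (z0 * x 6 + z1 * x 5) * q2,
  -(z0 * x 3 - z1 * x 4) * q2 + (z0 * x 4 + z1 * x 3) * q3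
    + (z0 * x 5 - z1 * x 6) * q0 - (z0 * x 6 + z1 * x 5) * q1,
  -(z0 * x 3 - z1 * x 4) * q3 - (z0 * x 4 + z1 * x 3) * q2
    + (z0 * x 5 - z1 * x 6) * q1 + (z0 * x 6 + z1 * x 5) * q0]

section Rot

variable {q0 q1 q2 q3 z0 z1 : ℝ} (x y z : V7)

theorem rot_apply (q0 q1 q2 q3 z0 z1 : ℝ) (x : V7) (i : Fin 7) :
    rot q0 q1 q2 q3 z0 z1 x i = ![x 0,
  (z0 ^ 2 - z1 ^ 2) * x 1 + 2 * z0 * z1 * x 2,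
  -(2 * z0 * z1) * x 1 + (z0 ^ 2 - z1 ^ 2) * x 2,
  (z0 * x 3 - z1 * x 4) * q0 + (z0 * x 4 + z1 * x 3) * q1
    + (z0 * x 5 - z1 * x 6) * q2 + (z0 * x 6 + z1 * x 5) * q3,
  -(z0 * x 3 - z1 * x 4) * q1 + (z0 * x 4 + z1 * x 3) * q0
    - (z0 * x 5 - z1 * x 6) * q3 + (z0 * x 6 + z1 * x 5) * q2,
  -(z0 * x 3 - z1 * x 4) * q2 + (z0 * x 4 + z1 * x 3) * q3
    + (z0 * x 5 - z1 * x 6) * q0 - (z0 * x 6 + z1 * x 5) * q1,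
  -(z0 * x 3 - z1 * x 4) * q3 - (z0 * x 4 + z1 * x 3) * q2
    + (z0 * x 5 - z1 * x 6) * q1 + (z0 * x 6 + z1 * x 5) * q0] i := rfl

theorem kappa₁_rot : kappa₁ (rot q0 q1 q2 q3 z0 z1 x) (rot q0 q1 q2 q3 z0 z1 y) =
    (q0 ^ 2 + q1 ^ 2 + q2 ^ 2 + q3 ^ 2) * (z0 ^ 2 + z1 ^ 2) * kappa₁ x y := by
  simp only [kappa₁, rot_apply, Matrix.cons_val]
  ring

theorem kappa₂_rot : kappa₂ (rot q0 q1 q2 q3 z0 z1 x) (rot q0 q1 q2 q3 z0 z1 y) =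
    (q0 ^ 2 + q1 ^ 2 + q2 ^ 2 + q3 ^ 2) *
      ((z0 ^ 2 - z1 ^ 2) * kappa₂ x y + 2 * z0 * z1 * kappa₃ x y) := by
  simp only [kappa₂, kappa₃, rot_apply, Matrix.cons_val]
  ring

theorem kappa₃_rot : kappa₃ (rot q0 q1 q2 q3 z0 z1 x) (rot q0 q1 q2 q3 z0 z1 y) =
    (q0 ^ 2 + q1 ^ 2 + q2 ^ 2 + q3 ^ 2) *
      (-(2 * z0 * z1) * kappa₂ x y + (z0 ^ 2 - z1 ^ 2) * kappa₃ x y) := by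
  simp only [kappa₂, kappa₃, rot_apply, Matrix.cons_val]
  ring

/-- The form κ₁ is invariant, and (κ₂, κ₃) rotates by the same angle, twice that of z, as the
coordinates numbered 1 and 2. The terms with p and q are the determinant and the inner product of
these two planar vectors. -/
theorem isotropicPart_rot (hq : q0 ^ 2 + q1 ^ 2 + q2 ^ 2 + q3 ^ 2 = 1) (hz : z0 ^ 2 + z1 ^ 2 = 1)
    (a c p q : ℝ) : isotropicPart a c p q (rot q0 q1 q2 q3 z0 z1 x) (rot q0 q1 q2 q3 z0 z1 y)
      (rot q0 q1 q2 q3 z0 z1 z) = isotropicPart a c p q x y z := by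
  have h4 : (z0 ^ 2 - z1 ^ 2) ^ 2 + (2 * z0 * z1) ^ 2 = 1 := by
    linear_combination (z0 ^ 2 + z1 ^ 2 + 1) * hz
  rw [isotropicPart, kappa₁_rot, kappa₂_rot, kappa₃_rot, hq, hz, isotropicPart]
  simp only [rot_apply, Matrix.cons_val, one_mul]
  generalize z0 ^ 2 - z1 ^ 2 = C at *
  generalize 2 * z0 * z1 = S at *
  linear_combination (a * (x 1 * y 2 - x 2 * y 1) * z 0 +
    p * (z 2 * kappa₂ x y - z 1 * kappa₃ x y) - q * (z 2 * kappa₃ x y + z 1 * kappa₂ x y)) * h4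

end Rot

theorem coords_Ad {k : Sp2} (hk : IsInK k) {q z : ℍ[ℝ]}
    (hq : (k : Matrix (Fin 2) (Fin 2) ℍ[ℝ]) 0 0 = q)
    (hz : (k : Matrix (Fin 2) (Fin 2) ℍ[ℝ]) 1 1 = z) (v : ℝ × sp2) :
    coords (v.1, Ad k v.2) = rot q.re q.imI q.imJ q.imK z.re z.imI (coords v) := by
  obtain ⟨h01, h10, hj, hk'⟩ := hk
  rw [hz] at hj hk'
  obtain ⟨τ, X⟩ := v
  obtain ⟨a₁, a₂, a₃, d₁, d₂, d₃, b₀, b₁, b₂, b₃, rfl⟩ := exists_spOf X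
  rw [coords_apply_quat, coords_apply_quat, toMat_Ad, toMat_spOf]
  ext i
  fin_cases i <;>
    simp [rot, Matrix.mul_apply, Fin.sum_univ_two, Matrix.star_apply, h01, h10, hq, hz, hj, hk'] <;>
    ring

theorem isotropicForm_Ad {k : Sp2} (hk : IsInK k) (a c p q : ℝ) (u v w : ℝ × sp2) :
    isotropicForm proj7 a c p q ![coords (u.1, Ad k u.2), coords (v.1, Ad k v.2),
      coords (w.1, Ad k w.2)] = isotropicForm proj7 a c p q ![coords u, coords v, coords w] := by
  obtain ⟨h₁, h₂⟩ := sq_add_sq_of_isInK hk rfl rfl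
  rw [coords_Ad hk rfl rfl u, coords_Ad hk rfl rfl v, coords_Ad hk rfl rfl w,
    isotropicForm_eq_sum, isotropicForm_eq_sum, isotropicPart_rot _ _ _ h₁ h₂,
    isotropicPart_rot _ _ _ h₁ h₂, isotropicPart_rot _ _ _ h₁ h₂]

/-- The exponential commutes with diag (0, i), since X does, and the centralizer of diag (0, i) in
Sp(2) is K: off-diagonal entries vanish and the last entry commutes with i. -/
theorem isInK_expSp {X : sp2} (hX : X ∈ subK) : IsInK (expSp X) := by
  obtain ⟨a₁, a₂, a₃, d₁, d₂, d₃, b₀, b₁, b₂, b₃, rfl⟩ := exists_spOf X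
  obtain ⟨rfl, rfl, rfl, rfl, rfl, rfl⟩ := spOf_mem_subK.1 hX
  have h := Ad_expSp_eq (Z := spOf a₁ a₂ a₃ d₁ 0 0 0 0 0 0) (A := torus 0 1) (by
    rw [torus, bracket_spOf, ← spOf_zero]; congr 1 <;> ring) 1
  rw [one_smul, Ad_eq_iff, torus, toMat_spOf] at h
  generalize expSp (spOf a₁ a₂ a₃ d₁ 0 0 0 0 0 0) = g at *
  have h01 := congrFun (congrFun h 0) 1
  have h10 := congrFun (congrFun h 1) 0
  have h11 := congrFun (congrFun h 1) 1
  simp [Matrix.mul_apply, Fin.sum_univ_two] at h01 h10 h11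
  have e : quat 0 0 0 0 = 0 := rfl
  have e' : quat (-0) 0 0 0 = 0 := by rw [neg_zero]; rfl
  simp only [e, zero_mul, mul_zero, zero_add, add_zero] at h01 h10
  have hne : quat 0 1 0 0 ≠ 0 := fun h => one_ne_zero (congrArg QuaternionAlgebra.imI h)
  refine ⟨(mul_eq_zero.1 h01).resolve_right hne, (mul_eq_zero.1 h10.symm).resolve_left hne, ?_, ?_⟩
  · have := congrArg QuaternionAlgebra.imK h11
    simp at this
    linarith
  · have := congrArg QuaternionAlgebra.imJ h11
    simp at this
    linarith

end Isotropy

/-! ### Invariant structures on a tube -/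

section Tube

variable {M : Type*} [TopologicalSpace M] [ChartedSpace V7 M] [IsManifold 𝓘(ℝ, V7) ∞ M]
  [MulAction Sp2 M] {I : Set ℝ} {γ : ℝ → M} {t : ℝ}

theorem IsTube.contMDiffAt (h : IsTube I γ) (hI : IsOpen I) (ht : t ∈ I) :
    ContMDiffAt 𝓘(ℝ, ℝ) 𝓘(ℝ, V7) ∞ γ t :=
  h.curve.contMDiffAt (hI.mem_nhds ht)

theorem IsTube.infAct_eq_zero (h : IsTube I γ) (hact : IsSmoothAction M) (ht : t ∈ I) {X : sp2}
    (hX : X ∈ subK) : infAct (γ t) X = 0 := by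
  have h1 := hasVelocity_orbit hact (γ t) X
  have h2 : (fun s : ℝ => expSp (s • X) • γ t) = fun _ => γ t := by
    funext s
    exact (h.stabilizer t ht _).2 (isInK_expSp (subK.smul_mem s hX))
  rw [h2] at h1
  refine h1.unique ?_
  have h3 : HasMFDerivAt 𝓘(ℝ, ℝ) 𝓘(ℝ, V7) (fun _ : ℝ => γ t) 0
    (0 : ℝ →L[ℝ] TangentSpace 𝓘(ℝ, V7) (γ t)) := hasMFDerivAt_const (γ t) (0 : ℝ)
  have e : (ContinuousLinearMap.toSpanSingleton ℝ (0 : V7) : ℝ →L[ℝ] V7) = 0 := by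
    ext; simp
  rw [HasVelocity, e]
  exact h3

theorem IsTube.dAct_tubeD (h : IsTube I γ) (hact : IsSmoothAction M) (hI : IsOpen I) (ht : t ∈ I)
    {k : Sp2} (hk : IsInK k) (v : ℝ × sp2) :
    dAct k (γ t) (tubeD γ t v) = tubeD γ t (v.1, Ad k v.2) := by
  have hγ := h.contMDiffAt hI ht
  have h1 : dAct k (γ t) (vel γ t) = vel γ t := by
    refine HasVelocity.unique (((hasVelocity_vel hγ).act hact k).congr ?_) (hasVelocity_vel hγ)
    filter_upwards [hI.mem_nhds ht] with s hs
    exact ((h.stabilizer s hs k).2 hk).symm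
  obtain ⟨τ, X⟩ := v
  rw [tubeD_apply hact hγ, tubeD_apply hact hγ, map_add, map_smul, h1,
    infAct_Ad_of_smul_eq hact ((h.stabilizer t ht k).2 hk)]

theorem IsTube.exists_equiv (h : IsTube I γ) (hact : IsSmoothAction M) (hI : IsOpen I)
    (ht : t ∈ I) : ∃ L : V7 ≃L[ℝ] V7, ∀ v, L (coords v) = tubeD γ t v := by
  refine exists_equiv_of_ker (h.submersion t ht) fun v hv => ?_
  obtain ⟨h1, h2⟩ := coords_eq_zero_iff.1 hv
  have e : v = (0, v.2) := Prod.ext h1 rfl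
  rw [e, tubeD_apply hact (h.contMDiffAt hI ht), zero_smul, zero_add, h.infAct_eq_zero hact ht h2]

/-- A family of forms that are invariant under `K` extends to the tube. -/
theorem IsTube.exists_formField (h : IsTube I γ) (hact : IsSmoothAction M) (hI : IsOpen I) {n : ℕ}
    (Ξ : ℝ → V7 [⋀^Fin n]→L[ℝ] ℝ) (hΞ : ∀ t ∈ I, ∀ k, IsInK k → ∀ v : Fin n → ℝ × sp2,
      Ξ t (fun i => coords ((v i).1, Ad k (v i).2)) = Ξ t fun i => coords (v i)) :
    ∃ η : FormField M n, ∀ t ∈ I, ∀ a x, a • γ t = x → ∀ v : Fin n → ℝ × sp2,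
      formAt η x (fun i => dAct a (γ t) (tubeD γ t (v i))) = Ξ t fun i => coords (v i) := by
  -- An arbitrary representation x = A(x) • γ(T(x)) is chosen at each point, with no regularity. The
  -- form at x is transported from γ(T(x)).
  choose T hT A hA using h.surjective
  choose L hL using fun x => h.exists_equiv hact hI (hT x)
  refine ⟨fun x => (Ξ (T x)).compContinuousLinearMap (((L x).symm : V7 →L[ℝ] V7).comp
    (dAct (A x)⁻¹ x)), fun t ht a x hx v => ?_⟩
  have hk : ((A x)⁻¹ * a) • γ t = γ (T x) := by
    rw [mul_smul, hx, inv_smul_eq_iff, hA]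
  have htT : t = T x := h.injective t ht (T x) (hT x) _ hk
  -- Any other representation of x has the same parameter and differs by an element of K, to which Ξ
  -- is insensitive.
  have hK : IsInK ((A x)⁻¹ * a) := (h.stabilizer t ht _).1 (hk.trans (by rw [← htT]))
  have e (w : ℝ × sp2) : (L x).symm (dAct (A x)⁻¹ x (dAct a (γ t) (tubeD γ t w))) =
      coords (w.1, Ad ((A x)⁻¹ * a) w.2) := by
    rw [ContinuousLinearEquiv.symm_apply_eq, hL, ← htT, ← h.dAct_tubeD hact hI ht hK,
      dAct_mul hact, hx]
    rfl
  change Ξ (T x) (fun i => (L x).symm (dAct (A x)⁻¹ x (dAct a (γ t) (tubeD γ t (v i))))) = _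
  simp only [e]
  rw [← htT]
  exact hΞ t ht _ hK v


end Tube

/-! ### Regularity and closedness of invariant forms on a tube -/

section Tube

variable {M : Type*} [TopologicalSpace M] [ChartedSpace V7 M] [IsManifold 𝓘(ℝ, V7) ∞ M]
  [MulAction Sp2 M] {I : Set ℝ} {γ : ℝ → M} {t : ℝ}

theorem tendsto_coord_zero (t : ℝ) : Filter.Tendsto (fun p : V7 => p 0) (nhds (t • bas 0)) (nhds t) := by
  have hcont : ContinuousAt (fun p : V7 => p 0) (t • bas 0) :=
    (EuclideanSpace.proj 0 : V7 →L[ℝ] ℝ).continuous.continuousAt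
  have := hcont.tendsto
  rwa [smul_bas_zero_apply] at this

theorem IsTube.eventually_contMDiffAt (h : IsTube I γ) (hact : IsSmoothAction M) (hI : IsOpen I)
    (ht : t ∈ I) (a : Sp2) :
    ∀ᶠ p in nhds (t • bas 0), ContMDiffAt 𝓘(ℝ, V7) 𝓘(ℝ, V7) ∞ (tubeMap γ a) p :=
  ((tendsto_coord_zero t).eventually_mem (hI.mem_nhds ht)).mono
    fun _ hp => contMDiffAt_tubeMap hact a (h.contMDiffAt hI hp)

theorem IsTube.deriv7_injective (h : IsTube I γ) (hact : IsSmoothAction M) (hI : IsOpen I)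
    (ht : t ∈ I) (a : Sp2) : Function.Injective (deriv7 (tubeMap γ a) (t • bas 0)) := by
  obtain ⟨L, hL⟩ := h.exists_equiv hact hI ht
  have h0 : (t • bas 0 : V7) 0 = t := smul_bas_zero_apply t
  have e (x : V7) : deriv7 (tubeMap γ a) (t • bas 0) x = dActEquiv hact a (γ t) (L x) := by
    have h1 (i : Fin 7) : deriv7 (tubeMap γ a) (t • bas 0) (bas i) =
        dActEquiv hact a (γ t) (L (bas i)) := by
      rw [deriv7_tubeMap hact a (by rw [h0]; exact h.contMDiffAt hI ht), groupCoord_smul_bas_zero,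
        mul_one, h0, tubeField_smul_bas_zero, ← coords_frame, hL]
      rfl
    conv_lhs => rw [← sum_smul_bas x]
    conv_rhs => rw [← sum_smul_bas x]
    simp only [map_sum, map_smul, h1]
  intro x y hxy
  rw [e, e] at hxy
  exact L.injective ((dActEquiv hact a (γ t)).injective hxy)

/-- Every point of M lies on the axis of one of the maps `tubeMap γ a`, so regularity and closedness
need to be checked at axis points only. -/
theorem IsTube.exists_chart_point (h : IsTube I γ) {e : OpenPartialHomeomorph M V7} {y : V7}
    (hy : y ∈ e.target) : ∃ t ∈ I, ∃ a : Sp2, tubeMap γ a (t • bas 0) ∈ e.source ∧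
      e (tubeMap γ a (t • bas 0)) = y := by
  obtain ⟨t, ht, a, hx⟩ := h.surjective (e.symm y)
  have e1 : tubeMap γ a (t • bas 0) = e.symm y := by
    rw [tubeMap, groupCoord_smul_bas_zero, mul_one, smul_bas_zero_apply, hx]
  refine ⟨t, ht, a, ?_, ?_⟩
  · rw [e1]; exact e.map_target hy
  · rw [e1]; exact e.right_inv hy

section Forms

variable {n : ℕ} {η : FormField M n} {Ξ : ℝ → V7 [⋀^Fin n]→L[ℝ] ℝ}

theorem IsTube.pull_eq (h : IsTube I γ) (hact : IsSmoothAction M) (hI : IsOpen I)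
    (hη : ∀ (a : Sp2) (x : M), (formAt η (a • x)).compContinuousLinearMap (dAct a x) = formAt η x)
    (hv : ∀ t ∈ I, ∀ v : Fin n → ℝ × sp2, formAt η (γ t) (fun i => tubeD γ t (v i)) =
      Ξ t fun i => coords (v i)) (ht : t ∈ I) (a : Sp2) :
    ∀ᶠ p in nhds (t • bas 0), ∀ g : Fin n → Fin 7, pull η (tubeMap γ a) p (fun i => bas (g i)) =
      Ξ (p 0) fun i => coords (tubeField p (g i)) := by
  filter_upwards [(tendsto_coord_zero t).eventually_mem (hI.mem_nhds ht)] with p hp g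
  exact (pull_tubeMap (η := η) hact hη a (h.contMDiffAt hI hp) g).trans (hv _ hp _)

theorem IsTube.contDiffAt_pull (h : IsTube I γ) (hact : IsSmoothAction M) (hI : IsOpen I)
    {r : WithTop ℕ∞} (hr : r ≤ ∞)
    (hη : ∀ (a : Sp2) (x : M), (formAt η (a • x)).compContinuousLinearMap (dAct a x) = formAt η x)
    (hΞ : ContDiffOn ℝ r Ξ I)
    (hv : ∀ t ∈ I, ∀ v : Fin n → ℝ × sp2, formAt η (γ t) (fun i => tubeD γ t (v i)) =
      Ξ t fun i => coords (v i)) (ht : t ∈ I) (a : Sp2) :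
    ContDiffAt ℝ r (pull η (tubeMap γ a)) (t • bas 0) := by
  refine contDiffAt_form fun g => ContDiffAt.congr_of_eventuallyEq ?_
    ((h.pull_eq hact hI hη hv ht a).mono fun p hp => hp g)
  have h1 : ContDiffAt ℝ r (fun p : V7 => Ξ (p 0)) (t • bas 0) := by
    refine ContDiffAt.comp (g := Ξ) (f := fun p : V7 => p 0) _ ?_
      (EuclideanSpace.proj 0 : V7 →L[ℝ] ℝ).contDiff.contDiffAt
    rw [smul_bas_zero_apply]
    exact hΞ.contDiffAt (hI.mem_nhds ht)
  exact contDiffAt_form_apply h1 (w := fun i p => coords (tubeField p (g i)))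
    fun i => coords.contDiff.contDiffAt.comp _ ((contDiff_tubeField (g i)).contDiffAt.of_le hr)

theorem IsTube.isOfClass (h : IsTube I γ) (hact : IsSmoothAction M) (hI : IsOpen I)
    {r : WithTop ℕ∞} (hr : r + 1 ≤ ∞)
    (hη : ∀ (a : Sp2) (x : M), (formAt η (a • x)).compContinuousLinearMap (dAct a x) = formAt η x)
    (hΞ : ContDiffOn ℝ r Ξ I)
    (hv : ∀ t ∈ I, ∀ v : Fin n → ℝ × sp2, formAt η (γ t) (fun i => tubeD γ t (v i)) =
      Ξ t fun i => coords (v i)) : η.IsOfClass r := by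
  intro e he y hy
  obtain ⟨t, ht, a, hs, rfl⟩ := h.exists_chart_point hy
  exact (contDiffAt_inChart_of_pull hr he hs (h.eventually_contMDiffAt hact hI ht a)
    (h.deriv7_injective hact hI ht a)
    (h.contDiffAt_pull hact hI (le_self_add.trans hr) hη hΞ hv ht a)).contDiffWithinAt

end Forms

theorem contDiffOn_isotropicForm {r : WithTop ℕ∞} {f₁ f₂ θ : ℝ → ℝ} (h₁ : ContDiffOn ℝ r f₁ I)
    (h₂ : ContDiffOn ℝ r f₂ I) (hθ : ContDiffOn ℝ r θ I) :
    ContDiffOn ℝ r (fun t => isotropicForm proj7 (f₁ t ^ 2) (f₂ t ^ 2)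
      (f₁ t * f₂ t ^ 2 * Real.cos (θ t)) (f₁ t * f₂ t ^ 2 * Real.sin (θ t))) I := by
  have hc := Real.contDiff_cos.comp_contDiffOn hθ
  have hs := Real.contDiff_sin.comp_contDiffOn hθ
  exact ((((h₁.pow 2).smul contDiffOn_const).add ((h₂.pow 2).smul contDiffOn_const)).add
    (((h₁.mul (h₂.pow 2)).mul hc).smul contDiffOn_const)).add
    (((h₁.mul (h₂.pow 2)).mul hs).smul contDiffOn_const)

theorem contDiffOn_fourForm {r : WithTop ℕ∞} {c : ℝ → Fin 4 → ℝ}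
    (hc : ∀ i, ContDiffOn ℝ r (fun t => c t i) I) : ContDiffOn ℝ r (fun t => fourForm (c t)) I :=
  ((((hc 0).smul contDiffOn_const).add ((hc 1).smul contDiffOn_const)).add
    ((hc 2).smul contDiffOn_const)).sub ((hc 3).smul contDiffOn_const)

/-- On a tube, a solution of the conservation laws defines a cosymplectic structure. -/
theorem IsTube.exists_structure (h : IsTube I γ) (hact : IsSmoothAction M) (hI : IsOpen I)
    {r : WithTop ℕ∞} (hr₁ : 1 ≤ r) (hr : r + 1 ≤ ∞) {f₁ f₂ θ : ℝ → ℝ} (h₁ : ContDiffOn ℝ r f₁ I)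
    (h₂ : ContDiffOn ℝ r f₂ I) (hθ : ContDiffOn ℝ r θ I) (hne₁ : ∀ t ∈ I, f₁ t ≠ 0)
    (hne₂ : ∀ t ∈ I, f₂ t ≠ 0)
    (hd₁ : ∀ t ∈ I, HasDerivAt (fun t => f₁ t ^ 2 * f₂ t ^ 2)
      (2 * (f₁ t * f₂ t ^ 2 * Real.cos (θ t))) t)
    (hd₂ : ∀ t ∈ I, HasDerivAt (fun t => f₂ t ^ 4)
      (2 * (f₁ t * f₂ t ^ 2 * Real.cos (θ t))) t) :
    ∃ φ : FormField M 3, IsG2Structure r φ ∧ IsInvariant φ ∧ IsCosymplectic φ ∧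
      IsNormalForm r φ I γ f₁ f₂ θ := by
  set Ξ : ℝ → V7 [⋀^Fin 3]→L[ℝ] ℝ := fun t => isotropicForm proj7 (f₁ t ^ 2) (f₂ t ^ 2)
    (f₁ t * f₂ t ^ 2 * Real.cos (θ t)) (f₁ t * f₂ t ^ 2 * Real.sin (θ t)) with hΞ
  obtain ⟨φ, hφ⟩ := h.exists_formField hact hI Ξ fun t _ k hk v => by
    have e (w : Fin 3 → V7) : w = ![w 0, w 1, w 2] := by ext i : 1; fin_cases i <;> rfl
    rw [e fun i => coords _, e fun i => coords (v i)]
    exact isotropicForm_Ad hk _ _ _ _ _ _ _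
  have hv (t : ℝ) (ht : t ∈ I) (v : Fin 3 → ℝ × sp2) :
      formAt φ (γ t) (fun i => tubeD γ t (v i)) = Ξ t fun i => coords (v i) := by
    have := hφ t ht 1 _ (one_smul _ _) v
    rwa [dAct_one] at this
  have hL (t : ℝ) (ht : t ∈ I) : ∃ u : V7 ≃L[ℝ] V7,
      formAt φ (γ t) = (modelForm (θ t)).compContinuousLinearMap (u : V7 →L[ℝ] V7) ∧
      ∀ v, u (tubeD γ t v) = scaleMap (f₁ t) (f₂ t) (coords v) := by
    obtain ⟨L, hL⟩ := h.exists_equiv hact hI ht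
    have h1 (v : ℝ × sp2) : L.symm (tubeD γ t v) = coords v := by
      rw [← hL, ContinuousLinearEquiv.symm_apply_apply]
    have h2 (v : ℝ × sp2) : L.symm.trans (scaleEquiv (hne₁ t ht) (hne₂ t ht)) (tubeD γ t v) =
        scaleMap (f₁ t) (f₂ t) (coords v) := by
      rw [ContinuousLinearEquiv.trans_apply, h1]
      rfl
    refine ⟨_, ?_, h2⟩
    ext w
    choose v hw using fun i => h.submersion t ht (w i)
    obtain rfl : (fun i => tubeD γ t (v i)) = w := funext hw
    rw [hv t ht, hΞ]
    beta_reduce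
    rw [← modelForm_comp_scaleMap]
    exact congrArg (modelForm (θ t)) (funext fun i => (h2 (v i)).symm)
  have hinv : IsInvariant φ := by
    refine isInvariant_iff.2 fun b x => ?_
    obtain ⟨t, ht, a, rfl⟩ := h.surjective x
    change (formAt φ (b • a • γ t)).compContinuousLinearMap (dAct b (a • γ t)) = formAt φ (a • γ t)
    ext w
    -- Every tangent vector at a • γ(t) comes from the tube, so invariance can be tested on vectors
    -- for which φ is known.
    choose v hw using fun i => h.submersion t ht (dAct a⁻¹ (a • γ t) (w i))
    have hw' (i : Fin 3) : w i = dAct a (γ t) (tubeD γ t (v i)) := by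
      rw [← dAct_dAct_inv hact a (γ t) (w i)]
      exact congrArg (dAct a (γ t)) (hw i).symm
    obtain rfl : w = fun i => dAct a (γ t) (tubeD γ t (v i)) := funext hw'
    rw [hφ t ht a _ rfl v, ← hφ t ht (b * a) _ (mul_smul _ _ _) v, dAct_mul hact]
    rfl
  have hG (x : M) : IsG2Form (E := V7) (formAt φ x) := by
    obtain ⟨t, ht, a, rfl⟩ := h.surjective x
    obtain ⟨u, hu, -⟩ := hL t ht
    refine ⟨(dActEquiv hact a (γ t)).symm.trans u, θ t, ?_⟩
    have h1 : (formAt φ (a • γ t)).compContinuousLinearMap (dAct a (γ t)) = formAt φ (γ t) :=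
      hinv a (γ t)
    rw [hu] at h1
    ext w
    have h2 := congrArg (fun κ => κ fun i => (dActEquiv hact a (γ t)).symm (w i)) h1
    have h3 (i : Fin 3) : dAct a (γ t) ((dActEquiv hact a (γ t)).symm (w i)) = w i :=
      (dActEquiv hact a (γ t)).apply_symm_apply (w i)
    refine Eq.trans ?_ h2
    exact congrArg (formAt φ (a • γ t)) (funext fun i => (h3 i).symm)
  have hN : IsNormalForm r φ I γ f₁ f₂ θ := by
    refine ⟨h.curve, h₁, h₂, hθ, hne₁, hne₂, fun t ht v w => ?_, fun t ht => ?_⟩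
    · obtain ⟨u, hu, huT⟩ := hL t ht
      have h1 : g2Metric (formAt φ (γ t)) (tubeD γ t v) (tubeD γ t w) = _ := g2Metric_eq ⟨_, hu⟩ _ _
      refine h1.trans ?_
      rw [huT, huT]
      exact inner_scaleMap _ _ _ _
    · rw [← modelForm_comp_scaleMap_coords, modelForm_comp_scaleMap]
      ext v
      exact hv t ht v
  have hclass : φ.IsOfClass r := h.isOfClass hact hI hr hinv (contDiffOn_isotropicForm h₁ h₂ hθ) hv
  -- The dual is assembled pointwise from unrelated adapted frames. Its invariance and its
  -- components along γ follow from the uniqueness of the dual, and its regularity from those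
  -- components.
  choose u Θ hu using hG
  set ψ : FormField M 4 := fun x => (starForm (Θ x)).compContinuousLinearMap (u x : V7 →L[ℝ] V7)
    with hψ
  have hdual (x : M) : IsG2Dual (φ x) (ψ x) := (isG2Dual_iff (hu x)).2 rfl
  have hψinv (a : Sp2) (x : M) :
      (formAt ψ (a • x)).compContinuousLinearMap (dAct a x) = formAt ψ x :=
    dual_invariant hact hinv hdual a x
  have hψv (t : ℝ) (ht : t ∈ I) (v : Fin 4 → ℝ × sp2) :
      formAt ψ (γ t) (fun i => tubeD γ t (v i)) =
        fourForm (starCoeff (f₁ t) (f₂ t) (θ t)) fun i => coords (v i) :=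
    hN.dual_apply (fun x => ⟨u x, Θ x, hu x⟩) hdual ht v
  have hc := Real.contDiff_cos.comp_contDiffOn hθ
  have hs := Real.contDiff_sin.comp_contDiffOn hθ
  have hΨ : ContDiffOn ℝ 1 (fun t => fourForm (starCoeff (f₁ t) (f₂ t) (θ t))) I := by
    refine (contDiffOn_fourForm (r := r) fun i => ?_).of_le hr₁
    fin_cases i
    · exact (h₁.pow 2).mul (h₂.pow 2)
    · exact h₂.pow 4
    · exact (h₁.mul (h₂.pow 2)).mul hs
    · exact (h₁.mul (h₂.pow 2)).mul hc
  refine ⟨φ, ⟨hclass, fun x => ⟨u x, Θ x, hu x⟩⟩, hinv, ⟨ψ, hdual,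
    h.isOfClass hact hI (by norm_cast) hψinv hΨ hψv, ?_⟩, hN⟩
  intro e he y hy
  obtain ⟨t, ht, a, hs, rfl⟩ := h.exists_chart_point hy
  have hp := h.contDiffAt_pull hact hI (by exact_mod_cast le_top) hψinv hΨ hψv ht a
  refine extDeriv_inChart_of_pull he hs (h.eventually_contMDiffAt hact hI ht a)
    (h.deriv7_injective hact hI ht a) hp ?_
  have hr0 : r ≠ 0 := by rintro rfl; simp at hr₁
  refine extDeriv_tube_eq_zero (hp.differentiableAt (by simp))
    (hasDerivAt_starCoeff ((h₁.contDiffAt (hI.mem_nhds ht)).differentiableAt hr0)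
      ((h₂.contDiffAt (hI.mem_nhds ht)).differentiableAt hr0)
      ((hθ.contDiffAt (hI.mem_nhds ht)).differentiableAt hr0))
    (h.pull_eq hact hI hψinv hψv ht a) ?_ ?_
  · exact (hd₁ t ht).deriv
  · exact (hd₂ t ht).deriv

end Tube

/-! ### Square roots of class `C¹` -/

section SquareRoot

open Filter Topology

variable {I U N : Set ℝ} {f f' f'' : ℝ → ℝ} {a : ℝ}

/-- One application of l'Hôpital's rule reduces this to the difference quotient of f' at a. -/
theorem tendsto_div_sq (hI : IsOpen I) (ha : a ∈ I) (h₁ : ∀ t ∈ I, HasDerivAt f (f' t) t)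
    (h₂ : ∀ t ∈ I, HasDerivAt f' (f'' t) t) (h0 : f a = 0) (h0' : f' a = 0) :
    Tendsto (fun t => f t / (t - a) ^ 2) (𝓝[≠] a) (𝓝 (f'' a / 2)) := by
  have hne : ∀ᶠ t in 𝓝[≠] a, t ∈ I := nhdsWithin_le_nhds (hI.mem_nhds ha)
  refine HasDerivAt.lhopital_zero_nhdsNE (f' := f') (g' := fun t => 2 * (t - a))
    (hne.mono fun t ht => h₁ t ht) (Eventually.of_forall fun t => ?_) ?_ ?_ ?_ ?_
  · exact (((hasDerivAt_id t).sub_const a).fun_pow 2).congr_deriv (by simp)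
  · filter_upwards [self_mem_nhdsWithin] with t ht
    exact mul_ne_zero two_ne_zero (sub_ne_zero.2 ht)
  · have := (h₁ a ha).continuousAt.tendsto
    rw [h0] at this
    exact this.mono_left nhdsWithin_le_nhds
  · have : Tendsto (fun t : ℝ => (t - a) ^ 2) (𝓝 a) (𝓝 ((a - a) ^ 2)) :=
      ((continuous_id.sub continuous_const).pow 2).tendsto a
    rw [sub_self, zero_pow two_ne_zero] at this
    exact this.mono_left nhdsWithin_le_nhds
  · have := ((hasDerivAt_iff_tendsto_slope.1 (h₂ a ha)).div_const 2)
    refine this.congr fun t => ?_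
    rw [slope_def_field, h0', sub_zero, div_div, mul_comm]

/-- Glaeser's inequality. -/
theorem eventually_sq_deriv_le (hI : IsOpen I) (ha : a ∈ I) (h₁ : ∀ t ∈ I, HasDerivAt f (f' t) t)
    (h₂ : ∀ t ∈ I, HasDerivAt f' (f'' t) t) (h₃ : ContinuousOn f'' I) (hf : ∀ t ∈ I, 0 ≤ f t)
    (h0' : f' a = 0) (h0'' : f'' a = 0) {ε : ℝ} (hε : 0 < ε) :
    ∀ᶠ t in 𝓝 a, f' t ^ 2 ≤ 4 * ε * f t ∧ |f'' t| ≤ ε := by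
  have hc : ∀ᶠ t in 𝓝 a, |f'' t| < ε := by
    have h4 : ContinuousAt (fun t => |f'' t|) a := (h₃.continuousAt (hI.mem_nhds ha)).abs
    refine h4.eventually_lt continuousAt_const ?_
    rwa [h0'', abs_zero]
  obtain ⟨δ, hδ, hball⟩ := Metric.eventually_nhds_iff_ball.1 (hc.and (hI.mem_nhds ha))
  -- Half the radius leaves room for the point t + h below, where |h| ≤ |t - a| / 2.
  refine Metric.eventually_nhds_iff_ball.2 ⟨δ / 2, by positivity, fun t ht => ?_⟩
  have htI := hball t (Metric.ball_subset_ball (by linarith) ht)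
  refine ⟨?_, htI.1.le⟩
  have hf' (x y : ℝ) (hx : x ∈ Metric.ball a δ) (hy : y ∈ Metric.ball a δ) :
      |f' y - f' x| ≤ ε * |y - x| :=
    (convex_ball a δ).norm_image_sub_le_of_norm_hasDerivWithin_le (f' := f'')
      (fun u hu => (h₂ u (hball u hu).2).hasDerivWithinAt) (fun u hu => (hball u hu).1.le) hx hy
  have hta : |t - a| < δ / 2 := ht
  have h4 : |f' t| ≤ ε * |t - a| := by
    have := hf' a t (Metric.mem_ball_self hδ) (Metric.ball_subset_ball (by linarith) ht)
    rwa [h0', sub_zero] at this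
  -- The minimum of the parabola f(t) + f'(t)h + εh², which lies above f(t + h) ≥ 0; its value f(t)
  -- - f'(t)² / (4ε) is therefore nonnegative.
  set h := -f' t / (2 * ε) with hh
  have hh' : |h| ≤ |t - a| / 2 := by
    rw [hh, abs_div, abs_neg, abs_of_pos (by positivity : 0 < 2 * ε), div_le_iff₀ (by positivity)]
    linarith
  have hsub : uIcc t (t + h) ⊆ Metric.ball a δ := by
    intro u hu
    have h5 : |u - t| ≤ |h| := by
      have := abs_sub_left_of_mem_uIcc hu
      simpa using this
    have h6 : |u - a| ≤ |u - t| + |t - a| := abs_sub_le u t a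
    change |u - a| < δ
    linarith
  have h7 : |(f (t + h) - f' t * (t + h)) - (f t - f' t * t)| ≤ ε * |h| * |t + h - t| :=
    (convex_uIcc t (t + h)).norm_image_sub_le_of_norm_hasDerivWithin_le
      (f := fun u => f u - f' t * u) (f' := fun u => f' u - f' t)
      (fun u hu => by
        have := (h₁ u (hball u (hsub hu)).2).sub ((hasDerivAt_id u).const_mul (f' t))
        rw [mul_one] at this
        exact this.hasDerivWithinAt)
      (fun u hu => by
        refine (hf' t u (hsub left_mem_uIcc) (hsub hu)).trans ?_
        have := abs_sub_left_of_mem_uIcc hu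
        rw [add_sub_cancel_left] at this
        exact mul_le_mul_of_nonneg_left this hε.le)
      left_mem_uIcc right_mem_uIcc
  have h8 := (abs_le.1 h7).2
  have h9 := hf (t + h) (hball _ (hsub right_mem_uIcc)).2
  have e : t + h - t = h := by ring
  rw [e, mul_assoc, abs_mul_abs_self] at h8
  have e2 : f' t = -(2 * ε * h) := by rw [hh]; field_simp
  have h10 : f' t * h = -(2 * ε * h ^ 2) := by rw [e2]; ring
  have h11 : f' t ^ 2 = 4 * ε * (ε * h ^ 2) := by rw [e2]; ring
  rw [h11]
  refine mul_le_mul_of_nonneg_left ?_ (by positivity)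
  have e3 : f' t * (t + h) = f' t * t + f' t * h := by ring
  have e4 : ε * (h * h) = ε * h ^ 2 := by ring
  linarith

theorem ncard_inter_Ioc_add (hfin : ∀ x y, Icc x y ⊆ U → (N ∩ Icc x y).Finite) {x y z : ℝ}
    (hxy : x ≤ y) (hyz : y ≤ z) (hU : Icc x z ⊆ U) :
    (N ∩ Ioc x z).ncard = (N ∩ Ioc x y).ncard + (N ∩ Ioc y z).ncard := by
  have hf := hfin x z hU
  rw [← Ioc_union_Ioc_eq_Ioc hxy hyz, inter_union_distrib_left]
  refine ncard_union_eq ?_ (hf.subset ?_) (hf.subset ?_)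
  · refine disjoint_left.2 fun u hu hu' => ?_
    exact absurd hu.2.2 (not_le.2 hu'.2.1)
  · exact inter_subset_inter_right _ fun u hu => ⟨hu.1.le, hu.2.trans hyz⟩
  · exact inter_subset_inter_right _ fun u hu => ⟨hxy.trans hu.1.le, hu.2⟩

open Classical in
/-- A base point of the connected component of a point in `U`. -/
def basePoint (U : Set ℝ) (t : ℝ) : ℝ := if h : t ∈ U then ordConnectedProj U ⟨t, h⟩ else t

/-- The parity of the number of points of `N` between a point and its base point. -/
def parity (U N : Set ℝ) (t : ℝ) : ℝ := (-1) ^ (N ∩ uIoc (basePoint U t) t).ncard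

theorem parity_sq (U N : Set ℝ) (t : ℝ) : parity U N t ^ 2 = 1 := by
  rw [parity, ← pow_mul, mul_comm, pow_mul]; simp

/-- The parity changes by the number of points of N in (t, t']. Intervals open on the left make the
counts additive, and they assign the sign at a point of N to its right-hand side. -/
theorem parity_eq (hfin : ∀ x y, Icc x y ⊆ U → (N ∩ Icc x y).Finite) {t t' : ℝ} (h : t ≤ t')
    (hU : Icc t t' ⊆ U) : parity U N t' = parity U N t * (-1) ^ (N ∩ Ioc t t').ncard := by
  have ht : t ∈ U := hU (left_mem_Icc.2 h)
  have ht' : t' ∈ U := hU (right_mem_Icc.2 h)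
  have e : basePoint U t = basePoint U t' := by
    rw [basePoint, basePoint, dif_pos ht, dif_pos ht', ordConnectedProj_eq, uIcc_of_le h]
    exact hU
  have hb : uIcc t (basePoint U t) ⊆ U := by
    rw [basePoint, dif_pos ht]
    exact ordConnectedProj_mem_ordConnectedComponent U ⟨t, ht⟩
  rw [parity, parity, ← e]
  set b := basePoint U t
  have key (m n : ℕ) : (-1 : ℝ) ^ m = (-1) ^ n * (-1) ^ (n + m) := by
    rw [pow_add, ← mul_assoc, ← pow_add, ← two_mul, pow_mul]; simp
  rcases le_total b t with h1 | h1
  · have hU' : Icc b t' ⊆ U := by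
      rw [uIcc_of_ge h1] at hb
      exact fun u hu => (le_total u t).elim (fun h2 => hb ⟨hu.1, h2⟩) fun h2 => hU ⟨h2, hu.2⟩
    rw [uIoc_of_le h1, uIoc_of_le (h1.trans h), ncard_inter_Ioc_add hfin h1 h hU', pow_add]
  · rw [uIcc_of_le h1] at hb
    rcases le_total b t' with h2 | h2
    · rw [uIoc_of_ge h1, uIoc_of_le h2, ncard_inter_Ioc_add hfin h1 h2 hU]
      exact key _ _
    · rw [uIoc_of_ge h1, uIoc_of_ge h2, ncard_inter_Ioc_add hfin h h2 hb, add_comm, key _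
        (N ∩ Ioc t t').ncard, mul_comm, add_comm]

end SquareRoot

section SquareRoot

open Filter Topology

variable {I : Set ℝ} {f f' f'' : ℝ → ℝ} {a : ℝ}

/-- A zero with f'' ≠ 0 is isolated, because f / (t - a)² tends to f''(a) / 2 ≠ 0. So the set where
f or f'' does not vanish is open, and the zeros are discrete in it. -/
theorem exists_ball_nondegenerate (hI : IsOpen I) (h₁ : ∀ t ∈ I, HasDerivAt f (f' t) t)
    (h₂ : ∀ t ∈ I, HasDerivAt f' (f'' t) t) (h₃ : ContinuousOn f'' I) (hf : ∀ t ∈ I, 0 ≤ f t)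
    (ha : a ∈ I) (hU : f a ≠ 0 ∨ f'' a ≠ 0) :
    ∃ δ > 0, ∀ t ∈ Metric.ball a δ, (t ∈ I ∧ (f t ≠ 0 ∨ f'' t ≠ 0)) ∧ (t ≠ a → f t ≠ 0) := by
  have hI' := hI.mem_nhds ha
  refine Metric.eventually_nhds_iff_ball.1 ?_
  by_cases h0 : f a = 0
  · have h0' : f' a = 0 := IsLocalMin.hasDerivAt_eq_zero
      (Filter.mem_of_superset hI' fun t ht => by rw [mem_setOf_eq, h0]; exact hf t ht) (h₁ a ha)
    have h4 : ∀ᶠ t in 𝓝 a, f'' t ≠ 0 :=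
      (h₃.continuousAt hI').eventually_ne (hU.resolve_left (not_not.2 h0))
    have h5 : ∀ᶠ t in 𝓝[≠] a, f t / (t - a) ^ 2 ≠ 0 :=
      (tendsto_div_sq hI ha h₁ h₂ h0 h0').eventually_ne
        (div_ne_zero (hU.resolve_left (not_not.2 h0)) two_ne_zero)
    filter_upwards [hI', h4, eventually_nhdsWithin_iff.1 h5] with t h6 h7 h8
    exact ⟨⟨h6, Or.inr h7⟩, fun hne h9 => h8 hne (by rw [h9, zero_div])⟩
  · filter_upwards [hI', (h₁ a ha).continuousAt.eventually_ne h0] with t h6 h7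
    exact ⟨⟨h6, Or.inl h7⟩, fun _ => h7⟩

/-- A nonnegative function of class `C²` is the square of a function of class `C¹`. -/
theorem exists_contDiffOn_one_sq (hI : IsOpen I) (h₁ : ∀ t ∈ I, HasDerivAt f (f' t) t)
    (h₂ : ∀ t ∈ I, HasDerivAt f' (f'' t) t) (h₃ : ContinuousOn f'' I) (hf : ∀ t ∈ I, 0 ≤ f t) :
    ∃ s : ℝ → ℝ, ContDiffOn ℝ 1 s I ∧ ∀ t ∈ I, s t ^ 2 = f t := by
  classical
  set U : Set ℝ := {t | t ∈ I ∧ (f t ≠ 0 ∨ f'' t ≠ 0)} with hU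
  set N : Set ℝ := {t | f t = 0} with hN
  have hball (a : ℝ) (ha : a ∈ U) : ∃ δ > 0, ∀ t ∈ Metric.ball a δ, t ∈ U ∧ (t ≠ a → f t ≠ 0) :=
    exists_ball_nondegenerate hI h₁ h₂ h₃ hf ha.1 ha.2
  have hcont (a : ℝ) (ha : a ∈ I) : ContinuousAt f a := (h₁ a ha).continuousAt
  have hmin (a : ℝ) (ha : a ∈ I) (h0 : f a = 0) : f' a = 0 := IsLocalMin.hasDerivAt_eq_zero
    (Filter.mem_of_superset (hI.mem_nhds ha) fun t ht => by
      rw [mem_setOf_eq, h0]; exact hf t ht) (h₁ a ha)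
  have hfin (x y : ℝ) (hxy : Icc x y ⊆ U) : (N ∩ Icc x y).Finite := by
    by_contra hinf
    obtain ⟨a, ha, hacc⟩ := Set.Infinite.exists_accPt_of_subset_isCompact hinf isCompact_Icc
      inter_subset_right
    obtain ⟨δ, hδ, hb⟩ := hball a (hxy ha)
    obtain ⟨t, ⟨ht, ht'⟩, hne⟩ := accPt_iff_nhds.1 hacc _ (Metric.ball_mem_nhds a hδ)
    exact (hb t ht).2 hne ht'.1
  -- The sign of the root: it switches at every nondegenerate zero. At points outside U both f and
  -- f'' vanish, and the choice of sign there does not matter.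
  set σ := parity U N with hσ
  have hnear (a : ℝ) (ha : a ∈ U) : ∀ᶠ t in 𝓝 a, (f a ≠ 0 → σ t = σ a) ∧
      (f a = 0 → σ t * |t - a| = σ a * (t - a)) := by
    obtain ⟨δ, hδ, hb⟩ := hball a ha
    filter_upwards [Metric.ball_mem_nhds a hδ] with t ht
    have hconv : uIcc a t ⊆ Metric.ball a δ := by
      rw [← segment_eq_uIcc]
      exact (convex_ball a δ).segment_subset (Metric.mem_ball_self hδ) ht
    rcases le_total a t with h | h
    · rw [uIcc_of_le h] at hconv
      have h4 := parity_eq hfin h fun u hu => (hb u (hconv hu)).1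
      have h5 : N ∩ Ioc a t = ∅ := by
        refine eq_empty_of_forall_notMem fun u hu => ?_
        exact (hb u (hconv ⟨hu.2.1.le, hu.2.2⟩)).2 hu.2.1.ne' hu.1
      rw [h5, ncard_empty, pow_zero, mul_one] at h4
      refine ⟨fun _ => h4, fun _ => ?_⟩
      rw [abs_of_nonneg (sub_nonneg.2 h)]
      exact congrArg (· * (t - a)) h4
    · rw [uIcc_of_ge h] at hconv
      have h4 := parity_eq hfin h fun u hu => (hb u (hconv hu)).1
      refine ⟨fun h0 => ?_, fun h0 => ?_⟩
      · have h5 : N ∩ Ioc t a = ∅ := by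
          refine eq_empty_of_forall_notMem fun u hu => ?_
          rcases hu.2.2.lt_or_eq with h6 | h6
          · exact (hb u (hconv ⟨hu.2.1.le, hu.2.2⟩)).2 h6.ne hu.1
          · exact h0 (h6 ▸ hu.1)
        rw [h5, ncard_empty, pow_zero, mul_one] at h4
        exact h4.symm
      · rcases h.lt_or_eq with h' | h'
        · have h5 : N ∩ Ioc t a = {a} := by
            ext u
            refine ⟨fun hu => ?_, fun hu => ?_⟩
            · rcases hu.2.2.lt_or_eq with h6 | h6
              · exact absurd hu.1 ((hb u (hconv ⟨hu.2.1.le, hu.2.2⟩)).2 h6.ne)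
              · exact h6
            · rw [mem_singleton_iff] at hu
              rw [hu]
              exact ⟨h0, h', le_rfl⟩
          rw [h5, ncard_singleton, pow_one] at h4
          rw [abs_of_nonpos (sub_nonpos.2 h)]
          have h6 : σ a = σ t * -1 := h4
          rw [h6]; ring
        · rw [h']; simp
  -- The candidate derivative of σ√f: the formula for a square root off the zeros, σ√(f''/2) at
  -- nondegenerate zeros, and 0 at the others.
  set d : ℝ → ℝ := fun t => if f t = 0 then (if f'' t = 0 then 0 else σ t * √(f'' t / 2)) else
    σ t * (f' t / (2 * √(f t))) with hd
  have hσabs (t : ℝ) : |σ t| = 1 := by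
    have := parity_sq U N t
    rw [← sq_abs] at this
    exact (pow_eq_one_iff_of_nonneg (abs_nonneg _) two_ne_zero).1 this
  have key (a : ℝ) (ha : a ∈ I) : HasDerivAt (fun t => σ t * √(f t)) (d a) a ∧ ContinuousAt d a := by
    by_cases h0 : f a = 0
    · have hq := tendsto_div_sq hI ha h₁ h₂ h0 (hmin a ha h0)
      have hsq (t : ℝ) : √(f t / (t - a) ^ 2) = √(f t) / |t - a| := by
        rw [Real.sqrt_div' _ (sq_nonneg _), Real.sqrt_sq_eq_abs]
      have hr : Tendsto (fun t => √(f t) / |t - a|) (𝓝[≠] a) (𝓝 √(f'' a / 2)) := by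
        simp only [← hsq]
        exact (Real.continuous_sqrt.tendsto _).comp hq
      -- At a degenerate zero √f / |t - a| tends to 0, so the derivative is 0 whatever the signs;
      -- Glaeser's inequality makes f' / (2√f) tend to 0, which is the continuity of the derivative.
      by_cases h2 : f'' a = 0
      · have hda : d a = 0 := by simp only [hd, h0, h2, if_true]
        rw [hda]
        constructor
        · rw [hasDerivAt_iff_tendsto_slope]
          rw [h2, zero_div, Real.sqrt_zero] at hr
          refine squeeze_zero_norm (fun t => ?_) hr
          rw [slope_def_field, h0, Real.sqrt_zero, mul_zero, sub_zero, Real.norm_eq_abs, abs_div,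
            abs_mul, hσabs, one_mul, abs_of_nonneg (Real.sqrt_nonneg _)]
        · rw [ContinuousAt, hda, Metric.tendsto_nhds]
          intro ε hε
          filter_upwards [hI.mem_nhds ha, eventually_sq_deriv_le hI ha h₁ h₂ h₃ hf (hmin a ha h0) h2
            (pow_pos (half_pos hε) 2)] with t htI ⟨h4, h5⟩
          rw [Real.dist_eq, sub_zero]
          refine lt_of_le_of_lt ?_ (half_lt_self hε)
          simp only [hd]
          split_ifs with h6 h7
          · rw [abs_zero]; positivity
          · rw [abs_mul, hσabs, one_mul, abs_of_nonneg (Real.sqrt_nonneg _)]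
            refine Real.sqrt_le_iff.2 ⟨by positivity, ?_⟩
            have := le_abs_self (f'' t)
            have := sq_nonneg (ε / 2)
            linarith
          · have h8 : 0 < √(f t) := Real.sqrt_pos.2 (lt_of_le_of_ne (hf t htI) (Ne.symm h6))
            rw [abs_mul, hσabs, one_mul, abs_div, abs_of_pos (by positivity : 0 < 2 * √(f t)),
              div_le_iff₀ (by positivity)]
            refine abs_le_of_sq_le_sq ?_ (by positivity)
            rw [mul_pow, mul_pow, Real.sq_sqrt (hf t htI)]
            linarith
      · have haU : a ∈ U := ⟨ha, Or.inr h2⟩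
        have hda : d a = σ a * √(f'' a / 2) := by simp only [hd, h0, h2, if_true, if_false]
        obtain ⟨δ, hδ, hb⟩ := hball a haU
        have hpos : 0 < √(f'' a / 2) := by
          refine Real.sqrt_pos.2 (lt_of_le_of_ne ?_ (Ne.symm (div_ne_zero h2 two_ne_zero)))
          refine ge_of_tendsto hq ?_
          filter_upwards [nhdsWithin_le_nhds (hI.mem_nhds ha)] with t ht
          exact div_nonneg (hf t ht) (sq_nonneg _)
        -- Near a nondegenerate zero the switch of σ turns √f, which behaves like a multiple of |t -
        -- a|, into a function behaving like a multiple of t - a.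
        have hev : ∀ᶠ t in 𝓝[≠] a, t ≠ a ∧ f t ≠ 0 ∧ 0 ≤ f t ∧ σ t * |t - a| = σ a * (t - a) := by
          filter_upwards [nhdsWithin_le_nhds (hnear a haU), self_mem_nhdsWithin,
            nhdsWithin_le_nhds (Metric.ball_mem_nhds a hδ)] with t h4 h5 h6
          exact ⟨h5, (hb t h6).2 h5, hf t (hb t h6).1.1, h4.2 h0⟩
        rw [hda]
        constructor
        · rw [hasDerivAt_iff_tendsto_slope]
          refine (hr.const_mul (σ a)).congr' ?_
          filter_upwards [hev] with t ⟨h4, h5, h6, h7⟩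
          have h8 : t - a ≠ 0 := sub_ne_zero.2 h4
          have h9 : |t - a| ≠ 0 := abs_ne_zero.2 h8
          rw [slope_def_field, h0, Real.sqrt_zero, mul_zero, sub_zero]
          field_simp
          linear_combination -h7
        · rw [continuousAt_iff_punctured_nhds, hda]
          have h4 := ((hasDerivAt_iff_tendsto_slope.1 (h₂ a ha)).div (hr.const_mul 2)
            (by positivity)).const_mul (σ a)
          have e : f'' a / (2 * √(f'' a / 2)) = √(f'' a / 2) := by
            rw [div_eq_iff (by positivity)]
            have := Real.mul_self_sqrt (Real.sqrt_pos.1 hpos).le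
            linarith
          rw [e] at h4
          refine h4.congr' ?_
          filter_upwards [hev] with t ⟨h4, h5, h6, h7⟩
          have h8 : t - a ≠ 0 := sub_ne_zero.2 h4
          have h9 : |t - a| ≠ 0 := abs_ne_zero.2 h8
          have h10 : √(f t) ≠ 0 := (Real.sqrt_pos.2 (lt_of_le_of_ne h6 (Ne.symm h5))).ne'
          simp only [hd, h5, if_false]
          rw [Pi.div_apply, slope_def_field, hmin a ha h0, sub_zero]
          have h11 : |t - a| * |t - a| = (t - a) * (t - a) := abs_mul_abs_self _
          field_simp
          have h12 : σ a * |t - a| * |t - a| = σ t * |t - a| * (t - a) := by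
            rw [h7, mul_assoc, h11]; ring
          have h13 : σ a * |t - a| = σ t * (t - a) := by
            have := mul_right_cancel₀ h9 (h12.trans (by ring : _ = σ t * (t - a) * |t - a|))
            exact this
          linear_combination f' t * h13
    · have haU : a ∈ U := ⟨ha, Or.inl h0⟩
      have hpos : 0 < √(f a) := Real.sqrt_pos.2 (lt_of_le_of_ne (hf a ha) (Ne.symm h0))
      have h4 : σ =ᶠ[𝓝 a] fun _ => σ a := (hnear a haU).mono fun t ht => ht.1 h0
      have hda : d a = σ a * (f' a / (2 * √(f a))) := by simp only [hd, h0, if_false]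
      constructor
      · rw [hda]
        refine (((h₁ a ha).sqrt h0).const_mul (σ a)).congr_of_eventuallyEq ?_
        filter_upwards [h4] with t ht
        rw [ht]
      · have h5 : ContinuousAt (fun t => σ a * (f' t / (2 * √(f t)))) a :=
          continuousAt_const.mul ((h₂ a ha).continuousAt.div
            (continuousAt_const.mul (hcont a ha).sqrt) (by positivity))
        refine h5.congr ?_
        filter_upwards [h4, (hcont a ha).eventually_ne h0] with t ht ht'
        simp only [hd, ht', if_false]
        rw [ht]
  refine ⟨fun t => σ t * √(f t), ?_, fun t ht => ?_⟩
  · have h4 : DifferentiableOn ℝ (fun t => σ t * √(f t)) I := fun t ht =>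
      (key t ht).1.differentiableAt.differentiableWithinAt
    have h5 : (1 : WithTop ℕ∞) = 0 + 1 := by norm_num
    rw [h5, contDiffOn_succ_iff_deriv_of_isOpen hI]
    refine ⟨h4, by simp, contDiffOn_zero.2 fun t ht => ?_⟩
    refine ((key t ht).2.congr ?_).continuousWithinAt
    filter_upwards [hI.mem_nhds ht] with u hu
    exact (key u hu).1.deriv.symm
  · rw [mul_pow, Real.sq_sqrt (hf t ht), hσ, parity_sq, one_mul]

end SquareRoot

/-! ### Solutions of the conservation laws -/

section Relations

variable {I : Set ℝ} {f₁ f₂ : ℝ → ℝ} {ν : ℝ}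

/-- The cosine of the angle of a structure with the relations of the first kind. -/
theorem Relations₁.exists_cos (h : Relations₁ ν I f₁ f₂) (hI : IsOpen I)
    (h₁ : ContDiffOn ℝ ∞ f₁ I) (h₂ : ContDiffOn ℝ ∞ f₂ I) (hne₁ : ∀ t ∈ I, f₁ t ≠ 0) :
    ∃ c m : ℝ → ℝ, ContDiffOn ℝ ∞ c I ∧ ContDiffOn ℝ ∞ m I ∧ ∀ t ∈ I, 0 ≤ 1 - c t ^ 2 ∧
      m t ^ 2 * (bound₁ ν (f₁ t) ^ 2 - deriv f₁ t ^ 2) = 1 - c t ^ 2 ∧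
      HasDerivAt (fun t => f₁ t ^ 2 * f₂ t ^ 2) (2 * (f₁ t * f₂ t ^ 2 * c t)) t ∧
      HasDerivAt (fun t => f₂ t ^ 4) (2 * (f₁ t * f₂ t ^ 2 * c t)) t := by
  set R : ℝ → ℝ := fun t => √(f₁ t ^ 4 + 4 * ν ^ 2) with hR
  have hpos (t : ℝ) (ht : t ∈ I) : 0 < f₁ t ^ 4 + 4 * ν ^ 2 := by
    have := hne₁ t ht; positivity
  have hRpos (t : ℝ) (ht : t ∈ I) : 0 < R t := Real.sqrt_pos.2 (hpos t ht)
  have hRsq (t : ℝ) (ht : t ∈ I) : R t ^ 2 = f₁ t ^ 4 + 4 * ν ^ 2 := Real.sq_sqrt (hpos t ht).le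
  have hRs : ContDiffOn ℝ ∞ R I :=
    ((h₁.pow 4).add contDiffOn_const).sqrt fun t ht => (hpos t ht).ne'
  have hm : ContDiffOn ℝ ∞ (fun t => (f₁ t ^ 2 + R t) / R t) I :=
    ((h₁.pow 2).add hRs).div hRs fun t ht => (hRpos t ht).ne'
  -- m is the reciprocal of the bound and c = m f₁', so 1 - c² = m² (bound² - f₁'²).
  refine ⟨fun t => deriv f₁ t * ((f₁ t ^ 2 + R t) / R t), _,
    (h₁.deriv_of_isOpen hI (by exact_mod_cast le_top)).mul hm, hm, fun t ht => ?_⟩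
  have hb : bound₁ ν (f₁ t) = R t / (f₁ t ^ 2 + R t) := rfl
  have hR0 := hRpos t ht
  have hx0 : 0 < f₁ t ^ 2 + R t := by positivity
  have e1 : ((f₁ t ^ 2 + R t) / R t) ^ 2 * (bound₁ ν (f₁ t) ^ 2 - deriv f₁ t ^ 2) =
      1 - (deriv f₁ t * ((f₁ t ^ 2 + R t) / R t)) ^ 2 := by
    rw [hb]; field_simp
  have hsq : deriv f₁ t ^ 2 ≤ bound₁ ν (f₁ t) ^ 2 := by
    rw [← sq_abs]; exact pow_le_pow_left₀ (abs_nonneg _) (h t ht).2 2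
  -- The algebraic relation, freed of its root, is the conservation law f₂⁴ - f₁²f₂² = ν². Its
  -- derivative expresses f₂' by f₁', which yields both differential equations.
  have hid (t : ℝ) (ht : t ∈ I) : f₁ t ^ 2 * f₂ t ^ 2 = f₂ t ^ 4 - ν ^ 2 := by
    have h3 : 2 * f₂ t ^ 2 = f₁ t ^ 2 + R t := (h t ht).1
    linear_combination (-(1 / 4) * (2 * f₂ t ^ 2 - f₁ t ^ 2 + R t)) * h3 - (1 / 4) * hRsq t ht
  have d₁ : HasDerivAt f₁ (deriv f₁ t) t :=
    ((h₁.contDiffAt (hI.mem_nhds ht)).differentiableAt (by simp)).hasDerivAt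
  have d₂ : HasDerivAt f₂ (deriv f₂ t) t :=
    ((h₂.contDiffAt (hI.mem_nhds ht)).differentiableAt (by simp)).hasDerivAt
  have hev : (fun t => f₁ t ^ 2 * f₂ t ^ 2) =ᶠ[nhds t] fun t => f₂ t ^ 4 - ν ^ 2 := by
    filter_upwards [hI.mem_nhds ht] with u hu using hid u hu
  have d3 := (d₂.fun_pow 4)
  have d4 := ((d₁.fun_pow 2).mul (d₂.fun_pow 2)).unique ((d3.sub_const _).congr_of_eventuallyEq hev)
  have h3 : 2 * f₂ t ^ 2 = f₁ t ^ 2 + R t := (h t ht).1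
  have e2 : (4 : ℕ) * f₂ t ^ (4 - 1) * deriv f₂ t =
      2 * (f₁ t * f₂ t ^ 2 * (deriv f₁ t * ((f₁ t ^ 2 + R t) / R t))) := by
    rw [← h3]
    push_cast at d4 ⊢
    norm_num at d4 ⊢
    field_simp
    linear_combination (-2 * f₂ t ^ 2) * d4 - 4 * f₂ t ^ 3 * deriv f₂ t * h3
  have d5 := d3.congr_deriv e2
  exact ⟨by rw [← e1]; exact mul_nonneg (sq_nonneg _) (sub_nonneg.2 hsq), e1,
    (d5.sub_const _).congr_of_eventuallyEq hev, d5⟩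

/-- The cosine of the angle of a structure with the relations of the second kind. -/
theorem Relations₂.exists_cos (h : Relations₂ ν I f₁ f₂) (hI : IsOpen I)
    (h₁ : ContDiffOn ℝ ∞ f₁ I) (h₂ : ContDiffOn ℝ ∞ f₂ I) (hne₁ : ∀ t ∈ I, f₁ t ≠ 0)
    (hne₂ : ∀ t ∈ I, f₂ t ≠ 0) :
    ∃ c m : ℝ → ℝ, ContDiffOn ℝ ∞ c I ∧ ContDiffOn ℝ ∞ m I ∧ ∀ t ∈ I, 0 ≤ 1 - c t ^ 2 ∧
      m t ^ 2 * (bound₂ ν (f₂ t) ^ 2 - deriv f₂ t ^ 2) = 1 - c t ^ 2 ∧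
      HasDerivAt (fun t => f₁ t ^ 2 * f₂ t ^ 2) (2 * (f₁ t * f₂ t ^ 2 * c t)) t ∧
      HasDerivAt (fun t => f₂ t ^ 4) (2 * (f₁ t * f₂ t ^ 2 * c t)) t := by
  have hm : ContDiffOn ℝ ∞ (fun t => 2 * f₂ t / f₁ t) I :=
    (contDiffOn_const.mul h₂).div h₁ hne₁
  -- The relation gives f₁²f₂² = f₂⁴ + ν², so the bound is |f₁| / (2|f₂|), and m = 2f₂ / f₁ is its
  -- reciprocal up to sign; again c = m f₂'.
  refine ⟨fun t => deriv f₂ t * (2 * f₂ t / f₁ t), _,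
    (h₂.deriv_of_isOpen hI (by exact_mod_cast le_top)).mul hm, hm, fun t ht => ?_⟩
  have n₁ := hne₁ t ht
  have n₂ := hne₂ t ht
  have hid (t : ℝ) (ht : t ∈ I) : f₁ t ^ 2 * f₂ t ^ 2 = f₂ t ^ 4 + ν ^ 2 := by
    have := hne₂ t ht
    rw [(h t ht).1]; field_simp
  have hb : bound₂ ν (f₂ t) ^ 2 = (f₂ t ^ 4 + ν ^ 2) / (2 * f₂ t ^ 2) ^ 2 := by
    rw [bound₂, div_pow, Real.sq_sqrt (by positivity)]
  have e1 : (2 * f₂ t / f₁ t) ^ 2 * (bound₂ ν (f₂ t) ^ 2 - deriv f₂ t ^ 2) =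
      1 - (deriv f₂ t * (2 * f₂ t / f₁ t)) ^ 2 := by
    rw [hb, ← hid t ht]; field_simp
  have hsq : deriv f₂ t ^ 2 ≤ bound₂ ν (f₂ t) ^ 2 := by
    rw [← sq_abs]; exact pow_le_pow_left₀ (abs_nonneg _) (h t ht).2 2
  have d₂ : HasDerivAt f₂ (deriv f₂ t) t :=
    ((h₂.contDiffAt (hI.mem_nhds ht)).differentiableAt (by simp)).hasDerivAt
  have hev : (fun t => f₁ t ^ 2 * f₂ t ^ 2) =ᶠ[nhds t] fun t => f₂ t ^ 4 + ν ^ 2 := by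
    filter_upwards [hI.mem_nhds ht] with u hu using hid u hu
  have d5 : HasDerivAt (fun t => f₂ t ^ 4)
      (2 * (f₁ t * f₂ t ^ 2 * (deriv f₂ t * (2 * f₂ t / f₁ t)))) t :=
    (d₂.fun_pow 4).congr_deriv (by push_cast; field_simp; ring)
  exact ⟨by rw [← e1]; exact mul_nonneg (sq_nonneg _) (sub_nonneg.2 hsq), e1,
    (d5.add_const _).congr_of_eventuallyEq hev, d5⟩

variable {M : Type*} [TopologicalSpace M] [ChartedSpace V7 M] [IsManifold 𝓘(ℝ, V7) ∞ M]
  [MulAction Sp2 M] {γ : ℝ → M} {c : ℝ → ℝ}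

/-- The functions c and s serve as cos θ and sin θ. Everything but s is smooth, so the class of the
structure is decided by the choice of the root of 1 - c². -/
theorem IsTube.exists_structure_of_sin (h : IsTube I γ) (hact : IsSmoothAction M) (hI : IsOpen I)
    (hI' : I.OrdConnected) {r : WithTop ℕ∞} (hr : r = 1 ∨ r = ∞) (h₁ : ContDiffOn ℝ ∞ f₁ I)
    (h₂ : ContDiffOn ℝ ∞ f₂ I) (hne₁ : ∀ t ∈ I, f₁ t ≠ 0) (hne₂ : ∀ t ∈ I, f₂ t ≠ 0)
    (hc : ContDiffOn ℝ ∞ c I)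
    (hd : ∀ t ∈ I, HasDerivAt (fun t => f₁ t ^ 2 * f₂ t ^ 2) (2 * (f₁ t * f₂ t ^ 2 * c t)) t ∧
      HasDerivAt (fun t => f₂ t ^ 4) (2 * (f₁ t * f₂ t ^ 2 * c t)) t)
    {s : ℝ → ℝ} (hs : ContDiffOn ℝ r s I) (hsc : ∀ t ∈ I, s t ^ 2 = 1 - c t ^ 2) :
    ∃ (φ : FormField M 3) (θ : ℝ → ℝ), IsG2Structure r φ ∧ IsInvariant φ ∧ IsCosymplectic φ ∧
      IsNormalForm r φ I γ f₁ f₂ θ := by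
  have hle : r ≤ ∞ := by rcases hr with rfl | rfl <;> exact_mod_cast le_top
  obtain ⟨θ, hθ, hcs⟩ := exists_angle hI hI' hr (hc.of_le hle) hs
    (fun t ht => by rw [hsc t ht]; ring)
  obtain ⟨φ, hφ⟩ := h.exists_structure hact hI (r := r)
    (by rcases hr with rfl | rfl <;> [exact le_rfl; exact_mod_cast le_top])
    (by rcases hr with rfl | rfl <;> norm_cast)
    (h₁.of_le hle) (h₂.of_le hle) hθ hne₁ hne₂
    (fun t ht => by rw [(hcs t ht).1]; exact (hd t ht).1)
    (fun t ht => by rw [(hcs t ht).1]; exact (hd t ht).2)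
  exact ⟨φ, θ, hφ⟩

theorem exists_contDiffOn_one_sq_of_smooth (hI : IsOpen I) {f : ℝ → ℝ} (hf : ContDiffOn ℝ ∞ f I)
    (h0 : ∀ t ∈ I, 0 ≤ f t) : ∃ s : ℝ → ℝ, ContDiffOn ℝ 1 s I ∧ ∀ t ∈ I, s t ^ 2 = f t := by
  have h1 : ContDiffOn ℝ ∞ (deriv f) I := hf.deriv_of_isOpen hI (by exact_mod_cast le_top)
  have h2 : ContDiffOn ℝ ∞ (deriv (deriv f)) I := h1.deriv_of_isOpen hI (by exact_mod_cast le_top)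
  exact exists_contDiffOn_one_sq hI
    (fun t ht => ((hf.contDiffAt (hI.mem_nhds ht)).differentiableAt (by simp)).hasDerivAt)
    (fun t ht => ((h1.contDiffAt (hI.mem_nhds ht)).differentiableAt (by simp)).hasDerivAt)
    h2.continuousOn h0

end Relations

end G2Coho

end

/-! ### The theorem -/

open G2Coho in
theorem theorem6p2 {M : Type*} [TopologicalSpace M] [T2Space M] [SecondCountableTopology M]
    [ChartedSpace V7 M] [IsManifold 𝓘(ℝ, V7) ∞ M] [MulAction Sp2 M] (hact : IsSmoothAction M) :
    -- every invariant cosymplectic structure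
    (∀ φ : FormField M 3, IsG2Structure ∞ φ → IsInvariant φ → IsCohomogeneityOne M →
      IsCosymplectic φ →
        -- there is an orthogonal unit-speed curve through every point of a six-dimensional orbit
        (∀ p : M, orbitDim p = 6 → ∃ (I : Set ℝ) (γ : ℝ → M) (t₀ : ℝ), IsOpen I ∧ I.OrdConnected ∧
          t₀ ∈ I ∧ γ t₀ = p ∧ IsNormalCurve φ I γ) ∧
        -- along each such curve, moved by an element of the group, the structure is in normal form
        (∀ (I : Set ℝ) (γ : ℝ → M), IsOpen I → I.OrdConnected → IsNormalCurve φ I γ →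
          ∃ (b : Sp2) (f₁ f₂ θ : ℝ → ℝ), IsNormalForm ∞ φ I (fun t => b • γ t) f₁ f₂ θ) ∧
        -- the functions in any normal form satisfy the relations
        (∀ (I : Set ℝ) (γ : ℝ → M) (f₁ f₂ θ : ℝ → ℝ), IsOpen I → I.OrdConnected →
          IsNormalForm ∞ φ I γ f₁ f₂ θ →
            (∃ s : SignType, ∀ t ∈ I, SignType.sign (f₁ t ^ 2 - f₂ t ^ 2) = s) ∧
            ((∀ t ∈ I, f₁ t ^ 2 ≤ f₂ t ^ 2) → ∃ ν : ℝ, 0 ≤ ν ∧ Relations₁ ν I f₁ f₂) ∧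
            ((∀ t ∈ I, f₂ t ^ 2 ≤ f₁ t ^ 2) → ∃ ν : ℝ, 0 ≤ ν ∧ Relations₂ ν I f₁ f₂))) ∧
    -- the converse, when `M` is `I × Sp(2)/K`
    (∀ (I : Set ℝ) (γ : ℝ → M) (f₁ f₂ : ℝ → ℝ) (ν : ℝ), IsOpen I → I.OrdConnected → IsTube I γ →
      ContDiffOn ℝ ∞ f₁ I → ContDiffOn ℝ ∞ f₂ I → (∀ t ∈ I, f₁ t ≠ 0) → (∀ t ∈ I, f₂ t ≠ 0) →
      0 ≤ ν → (Relations₁ ν I f₁ f₂ ∨ Relations₂ ν I f₁ f₂) →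
        -- in general, the structure is of class `C¹`
        (∃ (φ : FormField M 3) (θ : ℝ → ℝ), IsG2Structure 1 φ ∧ IsInvariant φ ∧
          IsCosymplectic φ ∧ IsNormalForm 1 φ I γ f₁ f₂ θ) ∧
        -- it is smooth if the defect in the inequality is the square of a smooth function
        ((∃ s : ℝ → ℝ, ContDiffOn ℝ ∞ s I ∧
            ((Relations₁ ν I f₁ f₂ ∧ ∀ t ∈ I, s t ^ 2 = bound₁ ν (f₁ t) ^ 2 - deriv f₁ t ^ 2) ∨
              (Relations₂ ν I f₁ f₂ ∧ ∀ t ∈ I, s t ^ 2 = bound₂ ν (f₂ t) ^ 2 - deriv f₂ t ^ 2))) →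
          ∃ (φ : FormField M 3) (θ : ℝ → ℝ), IsG2Structure ∞ φ ∧ IsInvariant φ ∧
            IsCosymplectic φ ∧ IsNormalForm ∞ φ I γ f₁ f₂ θ)) := by
  refine ⟨fun φ hφ hinv hcoh hcos => ⟨fun p hp => ?_, fun I γ hI hI' hγ => ?_,
    fun I γ f₁ f₂ θ hI hI' h => ?_⟩, ?_⟩
  · exact exists_normal_curve hact hφ hcoh.1 hp
  · exact hγ.exists_smul_normalForm hact hφ hinv hcoh.1 hI hI'
  · have hd := fun t (ht : t ∈ I) => h.hasDerivAt hact hI hφ.2 hinv hcos ht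
    exact relations_of_hasDerivAt hI hI'
      (fun t ht => (h.class_f₁.contDiffAt (hI.mem_nhds ht)).differentiableAt (by simp))
      (fun t ht => (h.class_f₂.contDiffAt (hI.mem_nhds ht)).differentiableAt (by simp))
      h.f₁_ne h.f₂_ne (fun t ht => (hd t ht).1) (fun t ht => (hd t ht).2)
  · intro I γ f₁ f₂ ν hI hI' h h₁ h₂ hne₁ hne₂ _ hrel
    refine ⟨?_, ?_⟩
    · obtain ⟨c, hc, h0, hd⟩ : ∃ c : ℝ → ℝ, ContDiffOn ℝ ∞ c I ∧ (∀ t ∈ I, 0 ≤ 1 - c t ^ 2) ∧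
          ∀ t ∈ I, HasDerivAt (fun t => f₁ t ^ 2 * f₂ t ^ 2) (2 * (f₁ t * f₂ t ^ 2 * c t)) t ∧
            HasDerivAt (fun t => f₂ t ^ 4) (2 * (f₁ t * f₂ t ^ 2 * c t)) t := by
        rcases hrel with hrel | hrel
        · obtain ⟨c, m, hc, -, hcm⟩ := hrel.exists_cos hI h₁ h₂ hne₁
          exact ⟨c, hc, fun t ht => (hcm t ht).1, fun t ht => (hcm t ht).2.2⟩
        · obtain ⟨c, m, hc, -, hcm⟩ := hrel.exists_cos hI h₁ h₂ hne₁ hne₂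
          exact ⟨c, hc, fun t ht => (hcm t ht).1, fun t ht => (hcm t ht).2.2⟩
      -- The only loss of regularity: 1 - c² is smooth and nonnegative, but the root provided for it
      -- is merely of class C¹.
      obtain ⟨s, hs, hsc⟩ := exists_contDiffOn_one_sq_of_smooth hI (contDiffOn_const.sub (hc.pow 2)) h0
      exact h.exists_structure_of_sin hact hI hI' (Or.inl rfl) h₁ h₂ hne₁ hne₂ hc hd hs hsc
    · rintro ⟨s, hs, ⟨hrel, hsd⟩ | ⟨hrel, hsd⟩⟩
      · obtain ⟨c, m, hc, hm, hcm⟩ := hrel.exists_cos hI h₁ h₂ hne₁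
        -- Here sin θ = m s, which is smooth, because 1 - c² is m² times the defect s² of the
        -- inequality.
        refine h.exists_structure_of_sin hact hI hI' (Or.inr rfl) h₁ h₂ hne₁ hne₂ hc
          (fun t ht => (hcm t ht).2.2) (hm.mul hs) fun t ht => ?_
        rw [mul_pow, hsd t ht, (hcm t ht).2.1]
      · obtain ⟨c, m, hc, hm, hcm⟩ := hrel.exists_cos hI h₁ h₂ hne₁ hne₂
        refine h.exists_structure_of_sin hact hI hI' (Or.inr rfl) h₁ h₂ hne₁ hne₂ hc
          (fun t ht => (hcm t ht).2.2) (hm.mul hs) fun t ht => ?_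
        rw [mul_pow, hsd t ht, (hcm t ht).2.1]
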